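/- \textbf{Setting.} Let $d\ge 1$ and let $\mu$ be a unitary representation of $\mathbb{Z}_2=\{0,1\}$ on $\mathbb{C}^d$, with $\mathrm{Tr}\,\mu_0=d$ and $\chi:=\mathrm{Tr}\,\mu_1\in\mathbb{Z}$. On the periodic chain of $\ell$ sites, with Hilbert space $(\mathbb{C}^d)^{\otimes \ell}$, let $U_g=\prod_i\mu_{g,i}$ and $U_{g,I}=\prod_{i\in I}\mu_{g,i}$ for an interval $I$. A QCA with spreading length $\xi$ is a unitary $U$ such that $U^\dagger OU$ is supported on $[i-\xi,i+\xi]$ whenever $O$ is supported on the site $i$; it is symmetric if it commutes with $U_0$ and $U_1$. A symmetric circuit with gate size $r$ is a product of two layers, each of them a product of unitary gates that commute with the global symmetry and are supported on disjoint intervals of at most $r$ sites. QCA $U,U'$ are strongly equivalent (with $k$ ancillas per site and gate size $r$) if $U'\otimes 1=W(U\otimes 1)$, where $1$ acts on $k$ ancillas added to every site, each carrying the representation $\mu$, and $W$ is a symmetric circuit with gate size $r$ on the enlarged chain. \textbf{Invariants.} For spaces of operators put $\eta(\mathcal V,\mathcal W)=\bigl(\sum_{a,b}|\mathrm{tr}(O_a^\dagger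 O_b)|^2\bigr)^{1/2}$, where $\mathrm{tr}$ is the normalized trace and $O_a$, $O_b$ run over bases of $\mathcal V$, $\mathcal W$ that are orthonormal for $\mathrm{tr}(X^\dagger Y)$. The GNVW index is $\pi_0(U)=\eta(U^\dagger\mathcal AU,\mathcal B)/\eta(\mathcal A,U^\dagger\mathcal BU)$, where $\mathcal A,\mathcal B$ are the operator algebras of adjacent intervals $A,B$ ($A$ to the left of $B$) of at least $2\xi$ sites each, with at least $4\xi$ sites outside $A\cup B$. If $\chi\ne0$ and $U$ is symmetric, take an interval $I$ of $2n$ sites, $n\ge\xi$, with at least $4\xi$ sites outside $I$, and write $U^\dagger U_{g,I}U=L_g\otimes R_g$ with unitary representations $L,R$ of $\mathbb{Z}_2$ supported respectively to the left and to the right of the midpoint of $I$, within distance $\xi$ of $I$. Put $\pi_1(U)=\pi_0(U)\,|\mathrm{Tr}R_1/\mathrm{Tr}U_{1,R}|$, where $U_{1,R}$ is the restriction of $U_1$ to the right half of $I$ and both traces are over the same Hilbert space. \textbf{System.} Say that $(\pi_0,\pi_1)$, with $\pi_0,\pi_1>0$ real, solves the system if there are nonnegative integers $N_1,N_2,\alpha_0,\alpha_1,\beta_0,\beta_1$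 with $$d^{N_1}\pi_0=\alpha_0+\alpha_1,\quad \frac{d^{N_2}}{\pi_0}=\beta_0+\beta_1,\quad \chi^{N_1}\pi_1=\alpha_0-\alpha_1,\quad \frac{\chi^{N_2}}{\pi_1}=\beta_0-\beta_1 .$$ \textbf{Theorem.} (1) Let $\chi\neq0$, and let $S$ be the set of all pairs that solve the system. (a) For every symmetric QCA with spreading length $\xi$ on a chain with $\ell\ge 8\xi$, the invariants $(\pi_0,\pi_1)$ are well defined (a restriction $L,R$ exists for every admissible interval, and the values depend on no choice), and they lie in $S$. (b) For every element of $S$ there is $\xi$ such that, for all $\ell\ge8\xi$, it is the pair of invariants of a symmetric QCA with spreading length $\xi$ on the chain of $\ell$ sites. (c) The invariants are complete for strong equivalence. For all $\xi,r$ there is $\ell_0$ such that, for $\ell\ge\ell_0$, any two symmetric QCA with spreading length $\xi$ that are strongly equivalent with gate size $r$ (and any number of ancillas) have the same invariants. For every $\xi$ there are $r,k,\ell_0$ such that, for $\ell\ge\ell_0$, any two symmetric QCA with spreading length $\xi$ and the same invariants are strongly equivalent with $k$ ancillas per site and gate size $r$. (d) The composition of two symmetric QCA with spreading length $\xi$ is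 a symmetric QCA with spreading length $2\xi$, and for $\ell\ge16\xi$ its invariants are the products of theirs. (e) Let $p$ and $q$ be the numbers of distinct prime factors of $d$ and of $|\chi|$. If $|\chi|<d$, then $S$ is, under componentwise multiplication, a group isomorphic to $\mathbb{Z}^p\times\mathbb{Z}^q=\mathbb{Z}^{p+q}$. If $|\chi|=d$ (that is, $\mu_1=\pm1$), then $\pi_1=\pi_0$ for all elements of $S$, and $S\cong\mathbb{Z}^p$. By (a)--(d), this is the group of strong-equivalence classes. (2) Let $\chi=0$. Then (a)--(d) hold with $\pi_0$ alone in place of $(\pi_0,\pi_1)$ and with $S=\{\pi_0>0:(\pi_0,1)\text{ solves the system}\}$, and $S\cong\mathbb{Z}^p$. -/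

import Mathlib

open scoped Matrix Kronecker

noncomputable section

namespace SymQCA

/-! ### Operators and the overlap of operator spaces -/

/-- Operators on a finite-dimensional Hilbert space with orthonormal basis indexed by `X`. -/
abbrev Op (X : Type) := Matrix X X ℂ

/-- The normalized trace, `ntr 1 = 1`. -/
def ntr {X : Type} [Fintype X] (O : Op X) : ℂ := O.trace / (Fintype.card X : ℂ)

/-- `f` is an orthonormal basis of the space of operators `V`, for the inner product
`⟨O, O'⟩ = ntr (Oᴴ O')`. -/
structure IsOrthonormalOpBasis {X : Type} [Fintype X] (V : Submodule ℂ (Op X)) {n : ℕ}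
    (f : Fin n → Op X) : Prop where
  orthonormal : ∀ a b, ntr ((f a)ᴴ * f b) = if a = b then 1 else 0
  span_eq : Submodule.span ℂ (Set.range f) = V

/-- Operators identified with vectors of the Euclidean space of their entries (only used to show
that orthonormal bases exist). -/
def entries (X : Type) : Op X ≃ₗ[ℂ] EuclideanSpace ℂ (X × X) :=
  ((Matrix.ofLinearEquiv ℂ).symm.trans (LinearEquiv.curry ℂ ℂ X X).symm).trans
    (WithLp.linearEquiv 2 ℂ (X × X → ℂ)).symm

theorem trace_eq_inner {X : Type} [Fintype X] (O O' : Op X) :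
    (Oᴴ * O').trace = inner ℂ (entries X O) (entries X O') := by
  simp only [PiLp.inner_apply, Fintype.sum_prod_type, Matrix.trace, Matrix.diag,
    Matrix.mul_apply, Matrix.conjTranspose_apply]
  rw [Finset.sum_comm]
  refine Finset.sum_congr rfl fun i _ => Finset.sum_congr rfl fun j _ => ?_
  simp [entries, mul_comm]

theorem exists_orthonormalOpBasis {X : Type} [Fintype X] (V : Submodule ℂ (Op X)) :
    ∃ (n : ℕ) (f : Fin n → Op X), IsOrthonormalOpBasis V f := by
  rcases isEmpty_or_nonempty X with hX | hX
  · refine ⟨0, Fin.elim0, ⟨fun a => a.elim0, ?_⟩⟩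
    exact Subsingleton.elim _ _
  · let W := V.map (entries X).toLinearMap
    let b := stdOrthonormalBasis ℂ W
    let s : ℂ := ((Real.sqrt (Fintype.card X) : ℝ) : ℂ)
    have hD : (Fintype.card X : ℂ) ≠ 0 := by exact_mod_cast Fintype.card_ne_zero
    have hs2 : s * s = (Fintype.card X : ℂ) := by
      simp only [s]
      rw [← Complex.ofReal_mul, Real.mul_self_sqrt (Nat.cast_nonneg _), Complex.ofReal_natCast]
    have hs : s ≠ 0 := fun h => hD (by rw [← hs2, h, zero_mul])
    refine ⟨_, fun i => s • (entries X).symm (b i : EuclideanSpace ℂ (X × X)), ⟨?_, ?_⟩⟩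
    · intro a c
      have h := orthonormal_iff_ite.1 b.orthonormal a c
      rw [Submodule.coe_inner] at h
      rw [ntr, trace_eq_inner, map_smul, map_smul, LinearEquiv.apply_symm_apply,
        LinearEquiv.apply_symm_apply, inner_smul_left, inner_smul_right, h]
      have : (starRingEnd ℂ) s = s := Complex.conj_ofReal _
      rw [this, ← mul_assoc, hs2]
      split_ifs <;> simp [hD]
    · have h1 : Submodule.span ℂ (Set.range fun i => (b i : EuclideanSpace ℂ (X × X))) = W := by
        have := b.toBasis.span_eq
        have h2 := congrArg (Submodule.map W.subtype) this
        rw [Submodule.map_span, ← Set.range_comp, Submodule.map_top, Submodule.range_subtype] at h2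
        convert h2 using 3
        ext i
        simp
      have h3 : (Set.range fun i => s • (entries X).symm (b i : EuclideanSpace ℂ (X × X)))
          = (s • (entries X).symm.toLinearMap) ''
            (Set.range fun i => (b i : EuclideanSpace ℂ (X × X))) := by
        rw [← Set.range_comp]; rfl
      rw [h3, ← Submodule.map_span, h1, Submodule.map_smul _ _ _ hs]
      ext O
      simp [W]

/-- The number of elements of a chosen orthonormal basis of `V`. -/
def onbSize {X : Type} [Fintype X] (V : Submodule ℂ (Op X)) : ℕ :=
  (exists_orthonormalOpBasis V).choose

/-- A chosen orthonormal basis of `V`. -/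
def onb {X : Type} [Fintype X] (V : Submodule ℂ (Op X)) : Fin (onbSize V) → Op X :=
  (exists_orthonormalOpBasis V).choose_spec.choose

/-- The overlap `η(V, W) = √(∑ |ntr (O_aᴴ O_b)|²)`, the sum running over orthonormal bases `O_a`
of `V` and `O_b` of `W` (the value does not depend on the bases). -/
def overlap {X : Type} [Fintype X] (V W : Submodule ℂ (Op X)) : ℝ :=
  Real.sqrt (∑ a, ∑ b, ‖ntr ((onb V a)ᴴ * onb W b)‖ ^ 2)

/-- The Heisenberg evolution `O ↦ Uᴴ O U`. -/
def evolve {X : Type} [Fintype X] (U : Op X) : Op X →ₗ[ℂ] Op X where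
  toFun O := Uᴴ * O * U
  map_add' O O' := by rw [mul_add, add_mul]
  map_smul' c O := by simp

/-! ### Operators on a collection `Λ` of sites

The Hilbert space of one site has basis `ι`, so the Hilbert space of all sites has basis
`Λ → ι`. -/

section Sites

variable {Λ : Type} [Fintype Λ] [DecidableEq Λ] {ι : Type} [Fintype ι] [DecidableEq ι]

/-- The tensor product `⨂_i m i` of single-site operators. -/
def tensorOp (m : Λ → Op ι) : Op (Λ → ι) :=
  Matrix.of fun s t => ∏ i, m i (s i) (t i)

/-- The operator `m` on every site of `S`, the identity on all other sites. -/
def onSites (S : Finset Λ) (m : Op ι) : Op (Λ → ι) :=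
  tensorOp fun i => if i ∈ S then m else 1

/-- The operator `B ⊗ 1`, where `B` acts on the sites of `S` and `1` on the other sites. -/
def embed (S : Finset Λ) : Op (S → ι) →ₗ[ℂ] Op (Λ → ι) where
  toFun B := Matrix.of fun s t =>
    if ∀ i, i ∉ S → s i = t i then B (fun i => s i) (fun i => t i) else 0
  map_add' B C := by
    ext s t
    simp only [Matrix.of_apply, Matrix.add_apply]
    split_ifs <;> simp
  map_smul' c B := by
    ext s t
    simp only [Matrix.of_apply, Matrix.smul_apply, RingHom.id_apply]
    split_ifs <;> simp

/-- The algebra of the operators supported on `S`. -/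
def supported (S : Finset Λ) : Submodule ℂ (Op (Λ → ι)) := LinearMap.range (embed S)

/-- The index `η(Uᴴ 𝒜 U, ℬ) / η(𝒜, Uᴴ ℬ U)`, where `𝒜` and `ℬ` are the algebras of operators
supported on `A` and on `B`. -/
def gnvw (U : Op (Λ → ι)) (A B : Finset Λ) : ℝ :=
  overlap ((supported A).map (evolve U)) (supported B) /
    overlap (supported A) ((supported B).map (evolve U))

end Sites

/-! ### Quantum cellular automata on a periodic chain

The sites of the periodic chain of length `ℓ` are the elements of `ZMod ℓ`. -/

/-- The interval `{a, a + 1, …, a + n - 1}` of the periodic chain. -/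
def arc {ℓ : ℕ} (a : ZMod ℓ) (n : ℕ) : Finset (ZMod ℓ) :=
  (Finset.range n).image fun j : ℕ => a + (j : ZMod ℓ)

/-- The group `ℤ₂`, written multiplicatively. -/
abbrev Z2 := Multiplicative (ZMod 2)

/-- The nontrivial element of `ℤ₂`. -/
abbrev gen : Z2 := Multiplicative.ofAdd 1

section Chain

variable {ℓ : ℕ} [NeZero ℓ] {ι : Type} [Fintype ι] [DecidableEq ι]

/-- `U` is a QCA on the chain with operator spreading length `ξ`: it is unitary, and it takes
every operator supported on a site `i` to an operator supported on `[i - ξ, i + ξ]`. -/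
structure IsQCA (ξ : ℕ) (U : Op (ZMod ℓ → ι)) : Prop where
  unitary : U ∈ Matrix.unitaryGroup (ZMod ℓ → ι) ℂ
  spread : ∀ (i : ZMod ℓ), ∀ O ∈ supported {i},
    evolve U O ∈ supported (arc (i - (ξ : ZMod ℓ)) (2 * ξ + 1))

/-- `U` commutes with the global symmetry operators `U_g = ∏_i μ_{g,i}`, where `μ` is the on-site
representation. -/
def IsSymmetric (μ : Z2 → Op ι) (U : Op (ZMod ℓ → ι)) : Prop :=
  ∀ g, Commute U (onSites Finset.univ (μ g))

/-- `π₀` is the GNVW index of the QCA `U` with spreading length `ξ`: it is the value of the index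
for all pairs of adjacent intervals of length at least `2ξ` each, `A` to the left of `B`, that
leave enough of the periodic chain free for their outer ends to be far from each other. -/
def HasGNVWIndex (ξ : ℕ) (U : Op (ZMod ℓ → ι)) (π₀ : ℝ) : Prop :=
  ∀ (a : ZMod ℓ) (m n : ℕ), 2 * ξ ≤ m → 2 * ξ ≤ n → m + n + 4 * ξ ≤ ℓ →
    gnvw U (arc a m) (arc (a + (m : ZMod ℓ)) n) = π₀

/-- For the interval `I = arc a (2n)`, with left half `arc a n` and right half `arc (a + n) n`,
one has `Uᴴ U_{g,I} U = L_g ⊗ R_g` for all `g`, where `L` and `R` are unitary representations of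
`ℤ₂` by operators supported to the left and to the right of the midpoint of `I`, at distance at
most `ξ` from `I`. -/
structure IsRestriction (μ : Z2 → Op ι) (ξ : ℕ) (U : Op (ZMod ℓ → ι)) (a : ZMod ℓ) (n : ℕ)
    (L R : Z2 →* Matrix.unitaryGroup (ZMod ℓ → ι) ℂ) : Prop where
  left : ∀ g, (L g : Op (ZMod ℓ → ι)) ∈ supported (arc (a - (ξ : ZMod ℓ)) (ξ + n))
  right : ∀ g, (R g : Op (ZMod ℓ → ι)) ∈ supported (arc (a + (n : ZMod ℓ)) (n + ξ))
  eq : ∀ g, evolve U (onSites (arc a (2 * n)) (μ g)) = (L g : Op (ZMod ℓ → ι)) * R g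

/-- `π₁ = π₀ |Tr R₁ / Tr U_{1,R}|`, for every interval `I` with halves of length at least `ξ`
that leaves enough of the periodic chain free, and every choice of `L` and `R` (of which there is
at least one). Both traces are over the Hilbert space of the whole chain. -/
def HasSPI (μ : Z2 → Op ι) (ξ : ℕ) (U : Op (ZMod ℓ → ι)) (π₀ π₁ : ℝ) : Prop :=
  ∀ (a : ZMod ℓ) (n : ℕ), ξ ≤ n → 2 * n + 4 * ξ ≤ ℓ →
    (∃ L R, IsRestriction μ ξ U a n L R) ∧
    ∀ L R, IsRestriction μ ξ U a n L R →
      π₁ = π₀ * ‖(R gen : Op (ZMod ℓ → ι)).trace /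
        (onSites (arc (a + (n : ZMod ℓ)) n) (μ gen)).trace‖

/-! ### Symmetric circuits and strong equivalence -/

/-- A layer of symmetric unitary gates on disjoint intervals of length at most `r`. -/
def IsSymmetricLayer (μ : Z2 → Op ι) (r : ℕ) (W : Op (ZMod ℓ → ι)) : Prop :=
  ∃ (s : ℕ) (a : Fin s → ZMod ℓ) (w : Fin s → ℕ) (G : Fin s → Op (ZMod ℓ → ι)),
    (∀ j, w j ≤ r) ∧
    (∀ j j', j ≠ j' → Disjoint (arc (a j) (w j)) (arc (a j') (w j'))) ∧
    (∀ j, G j ∈ Matrix.unitaryGroup (ZMod ℓ → ι) ℂ ∧ G j ∈ supported (arc (a j) (w j)) ∧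
      IsSymmetric μ (G j)) ∧
    W = (List.ofFn G).prod

/-- A symmetric finite-depth circuit: two layers of symmetric gates of size at most `r`. -/
def IsSymmetricCircuit (μ : Z2 → Op ι) (r : ℕ) (W : Op (ZMod ℓ → ι)) : Prop :=
  ∃ W₁ W₂, IsSymmetricLayer μ r W₁ ∧ IsSymmetricLayer μ r W₂ ∧ W = W₂ * W₁

/-- The representation `μ ⊗ μ^{⊗ k}` on a site together with `k` ancillas, each of them carrying
the original on-site representation. -/
def ancillaRep (μ : Z2 → Op ι) (k : ℕ) (g : Z2) : Op (ι × (Fin k → ι)) :=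
  μ g ⊗ₖ tensorOp fun _ : Fin k => μ g

/-- `U ⊗ 1`, where `1` acts on `k` ancillas added to every site. -/
def withAncillas (k : ℕ) (U : Op (ZMod ℓ → ι)) : Op (ZMod ℓ → ι × (Fin k → ι)) :=
  Matrix.of fun s t =>
    U (fun i => (s i).1) (fun i => (t i).1) * if ∀ i, (s i).2 = (t i).2 then 1 else 0

/-- `U'` and `U` are strongly equivalent by means of `k` ancillas per site and a symmetric circuit
with gates of size at most `r`: `U' ⊗ 1 = W (U ⊗ 1)`. -/
def StronglyEquivalent (μ : Z2 → Op ι) (r k : ℕ) (U U' : Op (ZMod ℓ → ι)) : Prop :=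
  ∃ W, IsSymmetricCircuit (ancillaRep μ k) r W ∧ withAncillas k U' = W * withAncillas k U

end Chain

/-! ### Classification -/

/-- The quantity `inv` (`inv ℓ ξ U x` says that the QCA `U` with spreading length `ξ` on the chain
of `ℓ` sites has the value `x`) classifies the symmetric QCA up to strong equivalence, with `S` as
the set of its possible values. The length of the chain is large compared to the spreading lengths
`ξ` and the gate sizes `r`, which are bounded uniformly in the length of the chain. -/
structure Classifies {ι : Type} [Fintype ι] [DecidableEq ι] (μ : Z2 → Op ι) {Γ : Type} [Mul Γ]
    (inv : ∀ (ℓ : ℕ) [NeZero ℓ], ℕ → Op (ZMod ℓ → ι) → Γ → Prop) (S : Set Γ) : Prop where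
  /-- Every symmetric QCA has exactly one value, and it lies in `S`. -/
  value : ∀ (ξ ℓ : ℕ) [NeZero ℓ], 8 * ξ ≤ ℓ → ∀ U : Op (ZMod ℓ → ι),
    IsQCA ξ U → IsSymmetric μ U → ∃ x ∈ S, ∀ y, inv ℓ ξ U y ↔ y = x
  /-- Every element of `S` is the value of a symmetric QCA, on all long chains, with a spreading
  length that does not depend on the length of the chain. -/
  realized : ∀ x ∈ S, ∃ ξ : ℕ, ∀ (ℓ : ℕ) [NeZero ℓ], 8 * ξ ≤ ℓ →
    ∃ U : Op (ZMod ℓ → ι), IsQCA ξ U ∧ IsSymmetric μ U ∧ inv ℓ ξ U x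
  /-- Strongly equivalent symmetric QCA have the same value. -/
  invariant : ∀ ξ r : ℕ, ∃ ℓ₀ : ℕ, ∀ (ℓ : ℕ) [NeZero ℓ], ℓ₀ ≤ ℓ →
    ∀ (k : ℕ) (U U' : Op (ZMod ℓ → ι)),
      IsQCA ξ U → IsSymmetric μ U → IsQCA ξ U' → IsSymmetric μ U' →
      StronglyEquivalent μ r k U U' → ∀ x, inv ℓ ξ U x ↔ inv ℓ ξ U' x
  /-- Symmetric QCA with the same value are strongly equivalent. -/
  complete : ∀ ξ : ℕ, ∃ r k ℓ₀ : ℕ, ∀ (ℓ : ℕ) [NeZero ℓ], ℓ₀ ≤ ℓ →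
    ∀ U U' : Op (ZMod ℓ → ι),
      IsQCA ξ U → IsSymmetric μ U → IsQCA ξ U' → IsSymmetric μ U' →
      (∃ x, inv ℓ ξ U x ∧ inv ℓ ξ U' x) → StronglyEquivalent μ r k U U'
  /-- The value is multiplicative under composition. -/
  mul : ∀ (ξ ℓ : ℕ) [NeZero ℓ], 16 * ξ ≤ ℓ → ∀ U V : Op (ZMod ℓ → ι),
    IsQCA ξ U → IsSymmetric μ U → IsQCA ξ V → IsSymmetric μ V →
    ∀ x y, inv ℓ ξ U x → inv ℓ ξ V y →
      IsQCA (2 * ξ) (U * V) ∧ IsSymmetric μ (U * V) ∧ inv ℓ (2 * ξ) (U * V) (x * y)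

/-- The system of equations for `(π₀, π₁)`, with nonnegative integers `N₁, N₂, α₀, α₁, β₀, β₁`. -/
def SolvesSystem (d : ℕ) (χ : ℤ) (π₀ π₁ : ℝ) : Prop :=
  ∃ N₁ N₂ α₀ α₁ β₀ β₁ : ℕ,
    (d : ℝ) ^ N₁ * π₀ = α₀ + α₁ ∧
    (d : ℝ) ^ N₂ / π₀ = β₀ + β₁ ∧
    (χ : ℝ) ^ N₁ * π₁ = (α₀ : ℝ) - α₁ ∧
    (χ : ℝ) ^ N₂ / π₁ = (β₀ : ℝ) - β₁

/-- The pairs of positive reals that solve the system. -/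
def solutions (d : ℕ) (χ : ℤ) : Set (ℝ × ℝ) :=
  {x | 0 < x.1 ∧ 0 < x.2 ∧ SolvesSystem d χ x.1 x.2}

/-- The positive reals `π₀` that solve the system together with `π₁ = 1`. -/
def solutionsGNVW (d : ℕ) (χ : ℤ) : Set ℝ :=
  {x | 0 < x ∧ SolvesSystem d χ x 1}

/-- `S` is, under multiplication, a group isomorphic to `ℤⁿ`. -/
def IsFreeAbelianOfRank {Γ : Type} [Monoid Γ] (S : Set Γ) (n : ℕ) : Prop :=
  ∃ Φ : Multiplicative (Fin n → ℤ) →* Γ, Function.Injective Φ ∧ Set.range Φ = S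

end SymQCA

end

open scoped Matrix Kronecker

noncomputable section

set_option linter.unusedSectionVars false

namespace SymQCA

/-! ### Normalized trace and orthonormal bases of operators -/

section Trace
variable {X : Type} [Fintype X]

/-! Put α(x) = U†xU. Around every cut of the chain the algebra of a window of 2ξ sites is a tensor
product Rt ⊗ Lf. The factor Rt is its intersection with the image under α of the algebra of the
sites just left of the cut, and Lf its intersection with the image of the algebra just right of it
(`splits_cut`). Dually, the image of the algebra of an interval is Lf ⊗ bulk ⊗ Rt, with Lf at its
left end and Rt at its right end (`splits_region_both`). Both facts are instances of one lemma on
algebras that are commutants, `splits_of_commutant`.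

The invariants measure Rt. The global symmetry operator u is fixed by α and normalizes all these
factors. For a factor R normalized by u let `tw u R` be the trace of x ↦ u x u† on R. It is
multiplicative on tensor products and invariant under α; it is the dimension of R if u = 1, and |Tr
v|² if an involution v in R ≅ M_n acts on R as u does. Comparison of the two factorizations shows
that the value on Rt is the same at all cuts (`tw_Rt_const`). Its normalized square root `idx` is
the GNVW index for u = 1 (`overlap_ratio`), and π₁ for u = U₁ if χ ≠ 0 (`exists_restriction`). So
both invariants are treated by the same arguments. They multiply under composition because Rt of a
composite is a tensor product of copies of the two given ones (`splits_Rt_trans`). A circuit layer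
has a cut that no gate crosses, where Rt is the algebra of half a window; hence circuits have index
one and strong equivalence preserves the invariants. The multiplicities of the eigenvalues ±1 of the
involutions in Rt and Lf are, up to order, the integers in the system.

Completeness: W = U'U† has trivial invariants. With one ancilla per site, Rt and Lf have the
dimensions and twisted dimensions of half windows (`balanced_ancilla`; for χ = 0 the ancilla makes
the twisted dimensions vanish). Then a symmetric gate on each window carries the halves of the
window to Rt and Lf (`exists_gate`). The layer of these gates maps the algebra of every cell between
consecutive cuts into its image under α, so W differs from it by a unitary that preserves every
cell, and such a unitary is a product of gates on the cells up to a phase. These gates are symmetric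
if the symmetry operator of each cell has the right image. The possible signs are excluded by traces
if χ ≠ 0, and absorbed into the choice of the gates one cut after the other if χ = 0
(`Balanced.exists_layer`).

Realization: in blocks of N sites the algebra is written as a product of two matrix algebras on
which the symmetry acts diagonally, and the first factors are shifted by one block (`exists_shift`).
A solution of the system prescribes the dimensions and signatures of the two factors; a second shift
corrects the normalization.

Arithmetic: π₀ is a product of integer powers of the primes of d, and π₁ one of the primes of |χ|.
If |χ| < d, every such pair occurs: after multiplication with high powers of d and χ, the only
constraints left on the integers d^K π₀ and |χ|^K π₁ are an inequality and a parity condition, and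
both can be met. If |χ| = d, the inequality forces π₁ = π₀. -/

theorem ntr_add (x y : Op X) : ntr (x + y) = ntr x + ntr y := by
  simp [ntr, Matrix.trace_add, add_div]

theorem ntr_smul (c : ℂ) (x : Op X) : ntr (c • x) = c * ntr x := by
  simp [ntr, Matrix.trace_smul, mul_div_assoc]

/-- The normalized trace as a linear map. -/
def ntrL : Op X →ₗ[ℂ] ℂ where
  toFun := ntr
  map_add' := ntr_add
  map_smul' := ntr_smul

theorem ntrL_apply (x : Op X) : ntrL x = ntr x := rfl

theorem ntr_sum {κ : Type*} (s : Finset κ) (f : κ → Op X) :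
    ntr (∑ a ∈ s, f a) = ∑ a ∈ s, ntr (f a) := map_sum ntrL f s

theorem ntr_zero : ntr (0 : Op X) = 0 := map_zero ntrL

theorem ntr_mul_comm (x y : Op X) : ntr (x * y) = ntr (y * x) := by
  rw [ntr, ntr, Matrix.trace_mul_comm]

theorem ntr_conjTranspose (x : Op X) : ntr xᴴ = star (ntr x) := by
  simp [ntr, Matrix.trace_conjTranspose]

theorem ntr_one [DecidableEq X] [Nonempty X] : ntr (1 : Op X) = 1 := by
  simp [ntr, Matrix.trace_one]

theorem ntr_conjTranspose_mul_self (x : Op X) :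
    ntr (xᴴ * x) = (((∑ i, ∑ j, ‖x j i‖ ^ 2) / Fintype.card X : ℝ) : ℂ) := by
  simp only [ntr, Matrix.trace, Matrix.diag, Matrix.mul_apply, Matrix.conjTranspose_apply]
  push_cast
  congr 1
  refine Finset.sum_congr rfl fun i _ => Finset.sum_congr rfl fun j _ => ?_
  rw [← Complex.conj_mul']; rfl

open scoped ComplexOrder in
theorem eq_zero_of_ntr_conjTranspose_mul_self [Nonempty X] {x : Op X} (h : ntr (xᴴ * x) = 0) :
    x = 0 := by
  rw [ntr, div_eq_zero_iff] at h
  exact Matrix.trace_conjTranspose_mul_self_eq_zero_iff.1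
    (h.resolve_right (by exact_mod_cast Fintype.card_ne_zero))

end Trace

section ONB
variable {X : Type} [Fintype X]

/-- Orthonormal bases of spaces of operators, with an arbitrary finite index type. -/
structure IsONB {κ : Type} [Fintype κ] [DecidableEq κ] (V : Submodule ℂ (Op X))
    (f : κ → Op X) : Prop where
  orthonormal : ∀ a b, ntr ((f a)ᴴ * f b) = if a = b then 1 else 0
  span_eq : Submodule.span ℂ (Set.range f) = V

theorem isONB_onb (V : Submodule ℂ (Op X)) : IsONB V (onb V) :=
  let h := (exists_orthonormalOpBasis V).choose_spec.choose_spec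
  ⟨h.orthonormal, h.span_eq⟩

variable {κ κ' : Type} [Fintype κ] [DecidableEq κ] [Fintype κ'] [DecidableEq κ']
  {V W : Submodule ℂ (Op X)} {f : κ → Op X} {g : κ' → Op X}

theorem IsONB.mem (hf : IsONB V f) (a : κ) : f a ∈ V :=
  hf.span_eq ▸ Submodule.subset_span ⟨a, rfl⟩

theorem IsONB.expand (hf : IsONB V f) {x : Op X} (hx : x ∈ V) :
    x = ∑ a, ntr ((f a)ᴴ * x) • f a := by
  rw [← hf.span_eq, Submodule.mem_span_range_iff_exists_fun] at hx
  obtain ⟨c, rfl⟩ := hx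
  refine Finset.sum_congr rfl fun a _ => ?_
  rw [Finset.mul_sum, ntr_sum]
  congr 1
  simp [ntr_smul, hf.orthonormal]

theorem IsONB.linearIndependent (hf : IsONB V f) : LinearIndependent ℂ f := by
  rw [Fintype.linearIndependent_iff]
  intro c hc a
  have h := congrArg (fun x => ntr ((f a)ᴴ * x)) hc
  simpa [Finset.mul_sum, ntr_sum, ntr_smul, hf.orthonormal, ntr_zero] using h

theorem IsONB.finrank_eq (hf : IsONB V f) : Module.finrank ℂ V = Fintype.card κ := by
  rw [← hf.span_eq, finrank_span_eq_card hf.linearIndependent]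

/-- Sums of a sesquilinear map over an orthonormal basis do not depend on the basis. -/
theorem IsONB.sum_sesq {M : Type*} [AddCommGroup M] [Module ℂ M] (hf : IsONB V f) (hg : IsONB V g)
    (B : Op X →ₗ⋆[ℂ] Op X →ₗ[ℂ] M) : ∑ a, B (f a) (f a) = ∑ b, B (g b) (g b) := by
  have h1 : ∀ a, B (f a) (f a) = ∑ b, ntr ((g b)ᴴ * f a) • B (f a) (g b) := by
    intro a
    have := congrArg (B (f a)) (hg.expand (hf.mem a))
    rw [map_sum] at this
    simpa using this
  have h2 : ∀ b, B (g b) (g b) = ∑ a, star (ntr ((f a)ᴴ * g b)) • B (f a) (g b) := by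
    intro b
    have : B (g b) = ∑ a, star (ntr ((f a)ᴴ * g b)) • B (f a) := by
      conv_lhs => rw [hf.expand (hg.mem b)]
      rw [map_sum]
      simp [LinearMap.map_smulₛₗ]
    conv_lhs => rw [this]
    simp
  simp_rw [h1, h2]
  rw [Finset.sum_comm]
  refine Finset.sum_congr rfl fun b _ => Finset.sum_congr rfl fun a _ => ?_
  rw [← ntr_conjTranspose, Matrix.conjTranspose_mul, Matrix.conjTranspose_conjTranspose]

/-- `s ↦ s x rᴴ` as a sesquilinear map. -/
def sandwich (x : Op X) : Op X →ₗ⋆[ℂ] Op X →ₗ[ℂ] Op X :=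
  LinearMap.mk₂'ₛₗ _ _ (fun r s => s * x * rᴴ)
    (by intros; simp [mul_add]) (by intros; simp)
    (by intros; simp [add_mul]) (by intros; simp)

/-- `s ↦ ntr (rᴴ (u s w))` as a sesquilinear map. -/
def twForm (u w : Op X) : Op X →ₗ⋆[ℂ] Op X →ₗ[ℂ] ℂ :=
  LinearMap.mk₂'ₛₗ _ _ (fun r s => ntr (rᴴ * (u * s * w)))
    (by intros; simp [add_mul, ntr_add]) (by intros; simp [ntr_smul])
    (by intros; simp [mul_add, add_mul, ntr_add]) (by intros; simp [ntr_smul])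

theorem sandwich_apply (x r s : Op X) : sandwich x r s = s * x * rᴴ := rfl
theorem twForm_apply (u w r s : Op X) : twForm u w r s = ntr (rᴴ * (u * s * w)) := rfl

end ONB

/-! ### Factors, Casimir maps and twisted dimensions -/

section Algebras
variable {X : Type} [Fintype X] [DecidableEq X]

/-- The underlying space of operators of a star subalgebra. -/
abbrev sm (R : StarSubalgebra ℂ (Op X)) : Submodule ℂ (Op X) := Subalgebra.toSubmodule R.toSubalgebra

theorem mem_sm {R : StarSubalgebra ℂ (Op X)} {x : Op X} : x ∈ sm R ↔ x ∈ R := Iff.rfl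

/-- A star subalgebra with trivial center. -/
def IsFactor (R : StarSubalgebra ℂ (Op X)) : Prop :=
  ∀ z ∈ R, (∀ r ∈ R, r * z = z * r) → ∃ c : ℂ, z = c • 1

/-- The elements of a chosen orthonormal basis of `R`. -/
abbrev bas (R : StarSubalgebra ℂ (Op X)) : Fin (onbSize (sm R)) → Op X := onb (sm R)

/-- The dimension of `R`. -/
def rdim (R : StarSubalgebra ℂ (Op X)) : ℕ := Module.finrank ℂ (sm R)

theorem isONB_bas (R : StarSubalgebra ℂ (Op X)) : IsONB (sm R) (bas R) := isONB_onb _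

theorem bas_mem (R : StarSubalgebra ℂ (Op X)) (a) : bas R a ∈ R := (isONB_bas R).mem a

theorem conjTranspose_mem {R : StarSubalgebra ℂ (Op X)} {x : Op X} (h : x ∈ R) : xᴴ ∈ R :=
  star_mem h

theorem rdim_eq (R : StarSubalgebra ℂ (Op X)) : rdim R = onbSize (sm R) := by
  rw [rdim, (isONB_bas R).finrank_eq, Fintype.card_fin]

theorem isONB_bas_conjTranspose (R : StarSubalgebra ℂ (Op X)) :
    IsONB (sm R) (fun a => (bas R a)ᴴ) := by
  refine ⟨fun a b => ?_, ?_⟩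
  · rw [Matrix.conjTranspose_conjTranspose, ntr_mul_comm, (isONB_bas R).orthonormal]
    simp [eq_comm]
  · apply le_antisymm
    · rw [Submodule.span_le]
      rintro _ ⟨a, rfl⟩
      exact conjTranspose_mem (bas_mem R a)
    · intro x hx
      have h := congrArg Matrix.conjTranspose ((isONB_bas R).expand (conjTranspose_mem hx))
      rw [Matrix.conjTranspose_conjTranspose, Matrix.conjTranspose_sum] at h
      rw [h]
      refine Submodule.sum_mem _ fun a _ => ?_
      rw [Matrix.conjTranspose_smul]
      exact Submodule.smul_mem _ _ (Submodule.subset_span ⟨a, rfl⟩)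

/-- The Casimir map of `R`. -/
def cas (R : StarSubalgebra ℂ (Op X)) (x : Op X) : Op X := ∑ a, bas R a * x * (bas R a)ᴴ

theorem cas_eq_of_isONB {κ : Type} [Fintype κ] [DecidableEq κ] {R : StarSubalgebra ℂ (Op X)}
    {f : κ → Op X} (hf : IsONB (sm R) f) (x : Op X) : cas R x = ∑ a, f a * x * (f a)ᴴ :=
  (isONB_bas R).sum_sesq hf (sandwich x)

theorem cas_eq' (R : StarSubalgebra ℂ (Op X)) (x : Op X) :
    cas R x = ∑ a, (bas R a)ᴴ * x * bas R a := by
  simpa using cas_eq_of_isONB (isONB_bas_conjTranspose R) x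

variable {R S M : StarSubalgebra ℂ (Op X)}

/-- The matrix of left multiplication by a on R in an orthonormal basis also describes right
multiplication by a on the adjoint basis, so both sides expand into the same double sum. -/
theorem mul_cas {a : Op X} (ha : a ∈ R) (x : Op X) : a * cas R x = cas R x * a := by
  have hB := isONB_bas R
  simp only [cas, Finset.mul_sum, Finset.sum_mul]
  have h1 : ∀ i, a * (bas R i * x * (bas R i)ᴴ)
      = ∑ j, ntr ((bas R j)ᴴ * (a * bas R i)) • (bas R j * x * (bas R i)ᴴ) := by
    intro i
    have := hB.expand (mul_mem ha (bas_mem R i) : a * bas R i ∈ R)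
    rw [← mul_assoc, ← mul_assoc]
    conv_lhs => rw [this]
    simp [Finset.sum_mul]
  have h2 : ∀ j, bas R j * x * (bas R j)ᴴ * a
      = ∑ i, ntr ((bas R j)ᴴ * (a * bas R i)) • (bas R j * x * (bas R i)ᴴ) := by
    intro j
    have := congrArg Matrix.conjTranspose
      (hB.expand (mul_mem (conjTranspose_mem ha) (bas_mem R j) : aᴴ * bas R j ∈ R))
    rw [Matrix.conjTranspose_mul, Matrix.conjTranspose_conjTranspose,
      Matrix.conjTranspose_sum] at this
    rw [mul_assoc, this, Finset.mul_sum]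
    refine Finset.sum_congr rfl fun i _ => ?_
    rw [Matrix.conjTranspose_smul, ← ntr_conjTranspose]
    simp [mul_assoc]
  simp_rw [h1, h2]
  rw [Finset.sum_comm]

theorem cas_mem {x : Op X} (hR : R ≤ M) (hx : x ∈ M) : cas R x ∈ M :=
  sum_mem fun a _ => mul_mem (mul_mem (hR (bas_mem R a)) hx) (conjTranspose_mem (hR (bas_mem R a)))

theorem cas_mul_right {x b : Op X} (hb : ∀ r ∈ R, r * b = b * r) :
    cas R (x * b) = cas R x * b := by
  simp only [cas, Finset.sum_mul]
  refine Finset.sum_congr rfl fun a _ => ?_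
  simp only [mul_assoc]
  rw [hb _ (conjTranspose_mem (bas_mem R a))]

theorem cas_mul_left {x b : Op X} (hb : ∀ r ∈ R, r * b = b * r) :
    cas R (b * x) = b * cas R x := by
  simp only [cas, Finset.mul_sum]
  refine Finset.sum_congr rfl fun a _ => ?_
  simp only [← mul_assoc]
  rw [hb _ (bas_mem R a)]

theorem cas_add (x y : Op X) : cas R (x + y) = cas R x + cas R y := by
  simp [cas, mul_add, add_mul, Finset.sum_add_distrib]

variable [Nonempty X]

theorem ntr_smul_one (c : ℂ) : ntr (c • (1 : Op X)) = c := by rw [ntr_smul, ntr_one, mul_one]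

/-- The Casimir image of an element of R is central in R, hence a scalar; the scalar is read off
from the trace. -/
theorem IsFactor.cas_of_mem (hR : IsFactor R) {x : Op X} (hx : x ∈ R) :
    cas R x = ((rdim R : ℂ) * ntr x) • 1 := by
  obtain ⟨c, hc⟩ := hR _ (cas_mem le_rfl (one_mem R)) fun r hr => mul_cas hr 1
  have hc1 : c = rdim R := by
    have := congrArg ntr hc
    rw [ntr_smul_one, cas_eq', ntr_sum] at this
    simp only [mul_one, (isONB_bas R).orthonormal] at this
    rw [← this]; simp [rdim_eq]
  obtain ⟨e, he⟩ := hR _ (cas_mem le_rfl hx) fun r hr => mul_cas hr x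
  have : e = rdim R * ntr x := by
    have h := congrArg ntr he
    rw [ntr_smul_one, cas, ntr_sum] at h
    rw [← h]
    have : ∀ a, ntr (bas R a * x * (bas R a)ᴴ) = ntr ((bas R a)ᴴ * 1 * bas R a * x) := by
      intro a; rw [ntr_mul_comm]; simp [mul_assoc]
    simp_rw [this]
    rw [← ntr_sum, ← Finset.sum_mul, ← cas_eq', hc, hc1]
    simp [ntr_smul]
  rw [he, this]

theorem IsFactor.cas_one (hR : IsFactor R) : cas R 1 = (rdim R : ℂ) • 1 := by
  rw [hR.cas_of_mem (one_mem R), ntr_one, mul_one]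

theorem IsFactor.cas_of_comm (hR : IsFactor R) {x : Op X} (hx : ∀ r ∈ R, r * x = x * r) :
    cas R x = (rdim R : ℂ) • x := by
  have := cas_mul_left (x := 1) hx
  rw [mul_one] at this
  rw [this, hR.cas_one]; simp

theorem rdim_pos : 0 < rdim R := by
  rw [rdim]
  have : Nontrivial (sm R) := ⟨⟨⟨1, one_mem R⟩, 0, fun h => one_ne_zero (congrArg Subtype.val h)⟩⟩
  exact Module.finrank_pos

theorem rdim_ne : (rdim R : ℂ) ≠ 0 := by exact_mod_cast rdim_pos.ne'

/-- The trace of `cas R a * b` is computed twice: `cas R a` is a scalar, and on the other hand b can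
be moved inside the Casimir sum, which collapses to `cas R 1` by cyclicity of the trace. -/
theorem IsFactor.ntr_mul (hR : IsFactor R) {a b : Op X} (ha : a ∈ R)
    (hb : ∀ r ∈ R, r * b = b * r) : ntr (a * b) = ntr a * ntr b := by
  have h1 : ntr (cas R a * b) = rdim R * (ntr a * ntr b) := by
    rw [hR.cas_of_mem ha]; simp [ntr_smul, mul_assoc]
  have h2 : ntr (cas R a * b) = rdim R * ntr (a * b) := by
    rw [← cas_mul_right hb, cas, ntr_sum]
    have : ∀ i, ntr (bas R i * (a * b) * (bas R i)ᴴ) = ntr ((bas R i)ᴴ * 1 * bas R i * (a * b)) := by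
      intro i; rw [ntr_mul_comm]; simp [mul_assoc]
    simp_rw [this]
    rw [← ntr_sum, ← Finset.sum_mul, ← cas_eq', hR.cas_one]
    simp [ntr_smul]
  exact mul_left_cancel₀ rdim_ne (h2.symm.trans h1)

/-- `M` is generated by its commuting subalgebras `R` and `S`. -/
structure Splits (M R S : StarSubalgebra ℂ (Op X)) : Prop where
  left : R ≤ M
  right : S ≤ M
  comm : ∀ r ∈ R, ∀ s ∈ S, r * s = s * r
  le : ∀ x ∈ M, x ∈ sm R * sm S

omit [Nonempty X] in
theorem Splits.symm (h : Splits M R S) : Splits M S R := by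
  refine ⟨h.right, h.left, fun s hs r hr => (h.comm r hr s hs).symm, fun x hx => ?_⟩
  refine Submodule.mul_induction_on (h.le x hx) (fun r hr s hs => ?_) fun x y hx hy => add_mem hx hy
  rw [h.comm r hr s hs]
  exact Submodule.mul_mem_mul hs hr

omit [Nonempty X] in
theorem comm_of_mem_mul {y : Op X} (hR : ∀ r ∈ R, r * y = y * r) (hS : ∀ s ∈ S, s * y = y * s)
    {x : Op X} (hx : x ∈ sm R * sm S) : x * y = y * x := by
  refine Submodule.mul_induction_on hx (fun r hr s hs => ?_) fun x x' h h' => ?_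
  · rw [mul_assoc, hS s hs, ← mul_assoc, hR r hr, mul_assoc]
  · rw [add_mul, mul_add, h, h']

omit [Nonempty X] in
-- A central element of one tensor factor commutes with the other factor as well, hence is central
-- in the product.
theorem Splits.isFactor_left (h : Splits M R S) (hM : IsFactor M) : IsFactor R := fun z hz hc =>
  hM z (h.left hz) fun _ hx => comm_of_mem_mul hc (fun s hs => (h.comm z hz s hs).symm) (h.le _ hx)

omit [Nonempty X] in
theorem Splits.isFactor_right (h : Splits M R S) (hM : IsFactor M) : IsFactor S :=
  h.symm.isFactor_left hM

/-- An element of the product of commuting factors that commutes with one of them lies in the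
other. -/
theorem mem_right_of_comm (hR : IsFactor R) (hc : ∀ r ∈ R, ∀ s ∈ S, r * s = s * r) {x : Op X}
    (hx : x ∈ sm R * sm S) (h : ∀ r ∈ R, r * x = x * r) : x ∈ S := by
  have h1 : cas R x ∈ S := by
    clear h
    refine Submodule.mul_induction_on hx (fun r hr s hs => ?_) fun x y hx hy => ?_
    · rw [cas_mul_right (fun r hr => hc r hr s hs), hR.cas_of_mem hr]
      simpa using S.smul_mem hs _
    · rw [cas_add]; exact add_mem hx hy
  rw [hR.cas_of_comm h] at h1
  simpa only [smul_smul, inv_mul_cancel₀ (rdim_ne (R := R)), one_smul] using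
    S.smul_mem h1 ((rdim R : ℂ)⁻¹)

theorem mem_left_of_comm (hS : IsFactor S) (hc : ∀ r ∈ R, ∀ s ∈ S, r * s = s * r) {x : Op X}
    (hx : x ∈ sm R * sm S) (h : ∀ s ∈ S, s * x = x * s) : x ∈ R := by
  refine mem_right_of_comm hS (fun s hs r hr => (hc r hr s hs).symm) ?_ h
  clear h
  refine Submodule.mul_induction_on hx (fun r hr s hs => ?_) fun x y hx hy => add_mem hx hy
  rw [hc r hr s hs]
  exact Submodule.mul_mem_mul hs hr

/-- The trace of the superoperator `x ↦ u x uᴴ` on the space `R`. -/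
def tw (u : Op X) (R : StarSubalgebra ℂ (Op X)) : ℂ :=
  ∑ a, ntr ((bas R a)ᴴ * (u * bas R a * uᴴ))

omit [Nonempty X] in
theorem tw_eq_of_isONB {κ : Type} [Fintype κ] [DecidableEq κ] (u : Op X) {f : κ → Op X}
    (hf : IsONB (sm R) f) : tw u R = ∑ a, ntr ((f a)ᴴ * (u * f a * uᴴ)) :=
  (isONB_bas R).sum_sesq hf (twForm u uᴴ)

omit [Nonempty X] in
theorem tw_one : tw 1 R = rdim R := by
  simp [tw, (isONB_bas R).orthonormal, rdim_eq]

/-- Since the trace is multiplicative on commuting factors, products of orthonormal bases are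
orthonormal. This makes dimensions and twisted dimensions multiplicative. -/
theorem isONB_mul (h : Splits M R S) (hR : IsFactor R) :
    IsONB (sm M) (fun p : Fin (onbSize (sm R)) × Fin (onbSize (sm S)) => bas R p.1 * bas S p.2) := by
  refine ⟨?_, ?_⟩
  · rintro ⟨a, b⟩ ⟨a', b'⟩
    have : (bas R a * bas S b)ᴴ * (bas R a' * bas S b')
        = ((bas R a)ᴴ * bas R a') * ((bas S b)ᴴ * bas S b') := by
      rw [Matrix.conjTranspose_mul,
        ← (h.comm _ (conjTranspose_mem (bas_mem R a)) _ (conjTranspose_mem (bas_mem S b))),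
        mul_assoc, mul_assoc]
      congr 1
      rw [← mul_assoc, ← mul_assoc, h.comm _ (bas_mem R a') _ (conjTranspose_mem (bas_mem S b))]
    simp only
    rw [this, hR.ntr_mul (mul_mem (conjTranspose_mem (bas_mem R a)) (bas_mem R a'))
      (fun r hr => h.comm r hr _ (mul_mem (conjTranspose_mem (bas_mem S b)) (bas_mem S b'))),
      (isONB_bas R).orthonormal, (isONB_bas S).orthonormal]
    simp only [Prod.mk.injEq]
    split_ifs <;> simp_all
  · apply le_antisymm
    · rw [Submodule.span_le]
      rintro _ ⟨p, rfl⟩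
      exact (mul_mem (h.left (bas_mem R _)) (h.right (bas_mem S _)) : _ ∈ M)
    · intro x hx
      have := h.le x hx
      rw [← (isONB_bas R).span_eq, ← (isONB_bas S).span_eq, Submodule.span_mul_span] at this
      refine Submodule.span_mono ?_ this
      rintro _ ⟨_, ⟨a, rfl⟩, _, ⟨b, rfl⟩, rfl⟩
      exact ⟨(a, b), rfl⟩

theorem Splits.rdim (h : Splits M R S) (hR : IsFactor R) : rdim M = rdim R * rdim S := by
  rw [SymQCA.rdim, (isONB_mul h hR).finrank_eq, Fintype.card_prod, rdim_eq, rdim_eq]; simp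

/-- `u` is a unitary. -/
abbrev IsU (u : Op X) : Prop := uᴴ * u = 1

/-- conjugation by `u` preserves `R`. -/
def Norm (u : Op X) (R : StarSubalgebra ℂ (Op X)) : Prop := ∀ r ∈ R, u * r * uᴴ ∈ R

theorem Splits.tw (h : Splits M R S) (hR : IsFactor R) {u : Op X} (hu : IsU u)
    (hu1 : Norm u R) (hu2 : Norm u S) : tw u M = tw u R * tw u S := by
  rw [tw_eq_of_isONB u (isONB_mul h hR), SymQCA.tw, SymQCA.tw, Finset.sum_mul_sum,
    Fintype.sum_prod_type]
  refine Finset.sum_congr rfl fun a _ => Finset.sum_congr rfl fun b _ => ?_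
  rw [← hR.ntr_mul (mul_mem (conjTranspose_mem (bas_mem R a)) (hu1 _ (bas_mem R a)))
      (fun r hr => h.comm r hr _
        (mul_mem (conjTranspose_mem (bas_mem S b)) (hu2 _ (bas_mem S b))))]
  congr 1
  have e : u * (bas R a * bas S b) * uᴴ = (u * bas R a * uᴴ) * (u * bas S b * uᴴ) := by
    rw [show (u * bas R a * uᴴ) * (u * bas S b * uᴴ)
      = u * bas R a * (uᴴ * u) * bas S b * uᴴ by simp only [mul_assoc], hu]
    simp only [mul_assoc, mul_one]
  rw [e, Matrix.conjTranspose_mul,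
    ← (h.comm _ (conjTranspose_mem (bas_mem R a)) _ (conjTranspose_mem (bas_mem S b))),
    mul_assoc, mul_assoc (bas R a)ᴴ (u * bas R a * uᴴ)]
  congr 1
  rw [← mul_assoc (bas S b)ᴴ, ← h.comm _ (hu1 _ (bas_mem R a)) _ (conjTranspose_mem (bas_mem S b))]
  exact mul_assoc _ _ _

/-- If conjugation by `u` on the factor `R` is implemented by `v ∈ R`. -/
theorem IsFactor.tw_of_implements (hR : IsFactor R) {u v : Op X} (hv : v ∈ R)
    (h : ∀ r ∈ R, u * r * uᴴ = v * r * vᴴ) : tw u R = rdim R * (ntr v * star (ntr v)) := by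
  have : ∀ a, ntr ((bas R a)ᴴ * (u * bas R a * uᴴ)) = ntr ((bas R a)ᴴ * v * bas R a * vᴴ) := by
    intro a; rw [h _ (bas_mem R a)]; simp only [mul_assoc]
  rw [SymQCA.tw]
  simp_rw [this]
  rw [← ntr_sum, ← Finset.sum_mul, ← cas_eq', hR.cas_of_mem hv]
  simp [ntr_smul, ntr_conjTranspose, mul_assoc]

end Algebras

/-! ### Algebras that factorize along a tensor product -/

section Factorization
variable {X : Type} [Fintype X] [DecidableEq X] [Nonempty X]
  {R S M E₁ E₂ N₁ N₂ : StarSubalgebra ℂ (Op X)}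

theorem cas_mem_right (hR : IsFactor R) (hc : ∀ r ∈ R, ∀ s ∈ S, r * s = s * r) {x : Op X}
    (hx : x ∈ sm R * sm S) : cas R x ∈ S := by
  refine Submodule.mul_induction_on hx (fun r hr s hs => ?_) fun x y hx hy => ?_
  · rw [cas_mul_right (fun r hr => hc r hr s hs), hR.cas_of_mem hr]
    simpa using S.smul_mem hs _
  · rw [cas_add]; exact add_mem hx hy

/-- Expansion of an element of `R E₂` along an orthonormal basis of `R`. -/
theorem expand_left (hE : IsFactor E₁) (hR : R ≤ E₁) (hc : ∀ r ∈ E₁, ∀ s ∈ E₂, r * s = s * r)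
    {x : Op X} (hx : x ∈ sm R * sm E₂) :
    x = ∑ a, bas R a * ((rdim E₁ : ℂ)⁻¹ • cas E₁ ((bas R a)ᴴ * x)) := by
  refine Submodule.mul_induction_on hx (fun r hr s hs => ?_) fun x y hx hy => ?_
  · have h : ∀ a, cas E₁ ((bas R a)ᴴ * (r * s))
        = (rdim E₁ : ℂ) • (ntr ((bas R a)ᴴ * r) • s) := by
      intro a
      rw [← mul_assoc, cas_mul_right (fun r hr => hc r hr s hs),
        hE.cas_of_mem (mul_mem (hR (conjTranspose_mem (bas_mem R a))) (hR hr)), smul_smul,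
        smul_mul_assoc, one_mul]
    simp_rw [h, inv_smul_smul₀ (rdim_ne (R := E₁))]
    conv_lhs => rw [(isONB_bas R).expand hr]
    simp [Finset.sum_mul]
  · conv_lhs => rw [hx, hy]
    rw [← Finset.sum_add_distrib]
    refine Finset.sum_congr rfl fun a _ => ?_
    rw [mul_add, cas_add, smul_add, mul_add]

/-- The factorization theorem: an algebra `M` contained in `E₁ ⊗ E₂` that is the commutant of
algebras commuting with `E₂` and with `E₁` respectively is a product. -/
theorem splits_of_commutant (hE₁ : IsFactor E₁) (hE₂ : IsFactor E₂)
    (hc : ∀ a ∈ E₁, ∀ b ∈ E₂, a * b = b * a) (hM : ∀ x ∈ M, x ∈ sm E₁ * sm E₂)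
    (hMN : ∀ x, (∀ n ∈ N₁, n * x = x * n) → (∀ n ∈ N₂, n * x = x * n) → x ∈ M)
    (hM₁ : ∀ x ∈ M, ∀ n ∈ N₁, n * x = x * n) (hM₂ : ∀ x ∈ M, ∀ n ∈ N₂, n * x = x * n)
    (hN₁ : ∀ n ∈ N₁, ∀ b ∈ E₂, b * n = n * b) (hN₂ : ∀ n ∈ N₂, ∀ a ∈ E₁, a * n = n * a) :
    Splits M (M ⊓ E₁) (M ⊓ E₂) := by
  have hc' : ∀ a ∈ E₂, ∀ b ∈ E₁, a * b = b * a := fun a ha b hb => (hc b hb a ha).symm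
  have swap : ∀ {A B : StarSubalgebra ℂ (Op X)}, (∀ a ∈ A, ∀ b ∈ B, a * b = b * a) →
      ∀ {x}, x ∈ sm A * sm B → x ∈ sm B * sm A := by
    intro A B h x hx
    refine Submodule.mul_induction_on hx (fun r hr s hs => ?_) fun x y hx hy => add_mem hx hy
    rw [h r hr s hs]
    exact Submodule.mul_mem_mul hs hr
  have mulL : ∀ {A B : StarSubalgebra ℂ (Op X)} {b : Op X}, b ∈ A →
      ∀ {x}, x ∈ sm A * sm B → b * x ∈ sm A * sm B := by
    intro A B b hb x hx
    refine Submodule.mul_induction_on hx (fun r hr s hs => ?_) fun x y hx hy => ?_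
    · rw [← mul_assoc]; exact Submodule.mul_mem_mul (mul_mem (s := A) hb hr) hs
    · rw [mul_add]; exact add_mem hx hy
  -- Partial traces of x over E₂ lie in E₁, hence commute with N₂; they commute with N₁ because x
  -- does and N₁ commutes with E₂. So they are again in M.
  have slice₂ : ∀ x ∈ M, ∀ b ∈ E₂, cas E₂ (b * x) ∈ M ⊓ E₁ := by
    intro x hx b hb
    have h1 : cas E₂ (b * x) ∈ E₁ := cas_mem_right hE₂ hc' (mulL hb (swap hc (hM x hx)))
    refine ⟨hMN _ (fun n hn => ?_) fun n hn => (hN₂ n hn _ h1).symm, h1⟩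
    rw [← cas_mul_left (fun r hr => hN₁ n hn r hr), ← cas_mul_right (fun r hr => hN₁ n hn r hr),
      mul_assoc, ← hM₁ x hx n hn, ← mul_assoc, ← mul_assoc, hN₁ n hn b hb]
  have slice₁ : ∀ x ∈ M, ∀ b ∈ E₁, cas E₁ (b * x) ∈ M ⊓ E₂ := by
    intro x hx b hb
    have h1 : cas E₁ (b * x) ∈ E₂ := cas_mem_right hE₁ hc (mulL hb (hM x hx))
    refine ⟨hMN _ (fun n hn => (hN₁ n hn _ h1).symm) fun n hn => ?_, h1⟩
    rw [← cas_mul_left (fun r hr => hN₂ n hn r hr), ← cas_mul_right (fun r hr => hN₂ n hn r hr),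
      mul_assoc, ← hM₂ x hx n hn, ← mul_assoc, ← mul_assoc, hN₂ n hn b hb]
  refine ⟨inf_le_left, inf_le_left, fun r hr s hs => hc r hr.2 s hs.2, fun x hx => ?_⟩
  -- The slices are the coefficients of x along a basis of E₂. A second expansion, along a basis of
  -- M ⊓ E₁, moves the other coefficients into M ⊓ E₂.
  have h1 : x ∈ sm (M ⊓ E₁) * sm E₂ := by
    rw [expand_left hE₂ le_rfl hc' (swap hc (hM x hx))]
    refine Submodule.sum_mem _ fun a _ => ?_
    have h2 : (rdim E₂ : ℂ)⁻¹ • cas E₂ ((bas E₂ a)ᴴ * x) ∈ M ⊓ E₁ :=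
      (M ⊓ E₁).smul_mem (slice₂ x hx _ (conjTranspose_mem (bas_mem E₂ a))) _
    rw [hc' _ (bas_mem E₂ a) _ h2.2]
    exact Submodule.mul_mem_mul h2 (bas_mem E₂ a)
  rw [expand_left hE₁ inf_le_right hc h1]
  refine Submodule.sum_mem _ fun a _ => Submodule.mul_mem_mul (bas_mem _ a) ?_
  exact (M ⊓ E₂).smul_mem (slice₁ x hx _ (conjTranspose_mem (bas_mem _ a).2)) _

end Factorization

/-! ### Overlaps of operator algebras -/

section Overlap
variable {X : Type} [Fintype X] [DecidableEq X] [Nonempty X]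
  {R S : StarSubalgebra ℂ (Op X)} {V V' W W' : Submodule ℂ (Op X)}

/-- The conditional expectation onto the commutant of `R`. -/
def twirl (R : StarSubalgebra ℂ (Op X)) (x : Op X) : Op X := (rdim R : ℂ)⁻¹ • cas R x

theorem mul_twirl {a : Op X} (ha : a ∈ R) (x : Op X) : a * twirl R x = twirl R x * a := by
  simp [twirl, mul_cas ha]

theorem twirl_comm {x b : Op X} (hb : ∀ r ∈ R, r * b = b * r) (hx : b * x = x * b) :
    b * twirl R x = twirl R x * b := by
  simp only [twirl, mul_smul_comm, smul_mul_assoc]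
  rw [← cas_mul_left hb, ← cas_mul_right hb, hx]

/-- Pairing with the commutant does not see the difference between x and its twirl: the twirl is the
orthogonal projection to the commutant. -/
theorem IsFactor.ntr_twirl (hR : IsFactor R) {y : Op X} (hy : ∀ r ∈ R, r * y = y * r) (x : Op X) :
    ntr (y * twirl R x) = ntr (y * x) := by
  have : ∀ a, ntr (bas R a * (y * x) * (bas R a)ᴴ) = ntr ((bas R a)ᴴ * 1 * bas R a * (y * x)) := by
    intro a; rw [ntr_mul_comm]; simp [mul_assoc]
  rw [twirl, mul_smul_comm, ← cas_mul_left hy, ntr_smul, cas, ntr_sum]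
  simp_rw [this]
  rw [← ntr_sum, ← Finset.sum_mul, ← cas_eq', hR.cas_one]
  rw [smul_mul_assoc, one_mul, ntr_smul, inv_mul_cancel_left₀ rdim_ne]

theorem norm_ntr_comm (x y : Op X) : ‖ntr (xᴴ * y)‖ = ‖ntr (yᴴ * x)‖ := by
  rw [← norm_star, ← ntr_conjTranspose, Matrix.conjTranspose_mul, Matrix.conjTranspose_conjTranspose]

theorem overlap_comm : overlap V W = overlap W V := by
  rw [overlap, overlap, Finset.sum_comm]
  simp_rw [norm_ntr_comm]

theorem overlap_nonneg : 0 ≤ overlap V W := Real.sqrt_nonneg _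

/-- The sum of the squared coefficients of the orthogonal projection of `w` to `V`. -/
theorem sum_norm_sq_eq {w x : Op X} (hx : x ∈ V)
    (h : ∀ v ∈ V, ntr (vᴴ * w) = ntr (vᴴ * x)) :
    ∑ a, (‖ntr ((onb V a)ᴴ * w)‖ ^ 2 : ℂ) = ntr (xᴴ * w) := by
  have h1 : ntr (xᴴ * w) = ∑ a, star (ntr ((onb V a)ᴴ * x)) * ntr ((onb V a)ᴴ * w) := by
    conv_lhs => rw [(isONB_onb V).expand hx]
    simp [Matrix.conjTranspose_sum, Finset.sum_mul, ntr_sum, ntr_smul]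
  rw [h1]
  refine Finset.sum_congr rfl fun a _ => ?_
  rw [h _ ((isONB_onb V).mem a), ← Complex.conj_mul']; rfl

/-- The squared overlap is the sum of the squared norms of the projections to V of an orthonormal
basis of W. It is unchanged if V shrinks to a subspace that still contains these projections. -/
theorem overlap_eq_of_proj (hV : V' ≤ V)
    (h : ∀ w ∈ W, ∃ x ∈ V', ∀ v ∈ V, ntr (vᴴ * w) = ntr (vᴴ * x)) :
    overlap V W = overlap V' W := by
  rw [overlap_comm, overlap_comm (V := V'), overlap, overlap]
  congr 1
  refine Finset.sum_congr rfl fun b _ => ?_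
  obtain ⟨x, hx, h2⟩ := h _ ((isONB_onb W).mem b)
  have e1 := sum_norm_sq_eq (hV hx) h2
  have e2 := sum_norm_sq_eq hx fun v hv => h2 v (hV hv)
  simp_rw [norm_ntr_comm (onb W b)]
  exact_mod_cast e1.trans e2.symm

theorem overlap_sq : ((overlap V W ^ 2 : ℝ) : ℂ)
    = ∑ b, ∑ a, (‖ntr ((onb V a)ᴴ * onb W b)‖ ^ 2 : ℂ) := by
  rw [overlap, Real.sq_sqrt (by positivity), Finset.sum_comm]
  push_cast; rfl

/-- The overlap with the commutant of a factor. -/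
theorem IsFactor.overlap_sq_commutant (hR : IsFactor R) {R' : StarSubalgebra ℂ (Op X)}
    (hR' : ∀ x, x ∈ R' ↔ ∀ r ∈ R, r * x = x * r) :
    (rdim R : ℂ) * ((overlap (sm R') (sm S) ^ 2 : ℝ) : ℂ)
      = ∑ b, ∑ a, ntr ((bas S b)ᴴ * (bas R a * bas S b * (bas R a)ᴴ)) := by
  rw [overlap_sq, Finset.mul_sum]
  refine Finset.sum_congr rfl fun b _ => ?_
  have ht : twirl R (bas S b) ∈ R' := (hR' _).2 fun r hr => mul_twirl hr _
  rw [sum_norm_sq_eq (V := sm R') (w := onb (sm S) b) (x := twirl R (bas S b)) ht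
    (fun v hv => (hR.ntr_twirl ((hR' _).1 (conjTranspose_mem hv)) _).symm)]
  have h1 : ntr ((twirl R (bas S b))ᴴ * onb (sm S) b) = star (ntr ((bas S b)ᴴ * twirl R (bas S b))) := by
    rw [← ntr_conjTranspose, Matrix.conjTranspose_mul, Matrix.conjTranspose_conjTranspose]
  have h2 : ntr ((twirl R (bas S b))ᴴ * twirl R (bas S b)) = ntr ((twirl R (bas S b))ᴴ * bas S b) :=
    hR.ntr_twirl ((hR' _).1 (conjTranspose_mem ht)) _
  have h3 : star (ntr ((twirl R (bas S b))ᴴ * bas S b)) = ntr ((twirl R (bas S b))ᴴ * bas S b) := by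
    rw [← h2, ← ntr_conjTranspose, Matrix.conjTranspose_mul, Matrix.conjTranspose_conjTranspose]
  rw [← h3, h1, star_star, ← ntr_sum, ← Finset.mul_sum, twirl, mul_smul_comm, ntr_smul, ← mul_assoc,
    mul_inv_cancel₀ rdim_ne, one_mul, cas]

/-- `η(R', S)² dim R = η(S', R)² dim S`. -/
theorem IsFactor.overlap_commutant (hR : IsFactor R) (hS : IsFactor S)
    {R' S' : StarSubalgebra ℂ (Op X)}
    (hR' : ∀ x, x ∈ R' ↔ ∀ r ∈ R, r * x = x * r) (hS' : ∀ x, x ∈ S' ↔ ∀ r ∈ S, r * x = x * r) :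
    (rdim R : ℝ) * overlap (sm R') (sm S) ^ 2 = rdim S * overlap (sm S') (sm R) ^ 2 := by
  have h1 := hR.overlap_sq_commutant (S := S) hR'
  have h2 := hS.overlap_sq_commutant (S := R) hS'
  have h3 := congrArg star h1
  rw [Finset.sum_comm] at h2
  rw [star_sum] at h3
  simp_rw [star_sum, ← ntr_conjTranspose] at h3
  -- Both squared overlaps, multiplied by dimensions, are double sums over the two bases; up to a
  -- cyclic permutation under the trace the summands are complex conjugates of each other.
  have h4 : ∀ b a, ntr (((bas S b)ᴴ * (bas R a * bas S b * (bas R a)ᴴ))ᴴ)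
      = ntr ((bas R a)ᴴ * (bas S b * bas R a * (bas S b)ᴴ)) := by
    intro b a
    have e : ((bas S b)ᴴ * (bas R a * bas S b * (bas R a)ᴴ))ᴴ
        = (bas R a * (bas S b)ᴴ) * ((bas R a)ᴴ * bas S b) := by
      simp only [Matrix.conjTranspose_mul, Matrix.conjTranspose_conjTranspose, mul_assoc]
    rw [e, ntr_mul_comm]
    simp only [mul_assoc]
  simp_rw [h4] at h3
  rw [← h2] at h3
  have h5 : star ((rdim R : ℂ) * ((overlap (sm R') (sm S) ^ 2 : ℝ) : ℂ))
      = (((rdim R : ℝ) * overlap (sm R') (sm S) ^ 2 : ℝ) : ℂ) := by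
    push_cast
    simp [← Complex.ofReal_pow]
  rw [h5] at h3
  exact_mod_cast h3

end Overlap

/-! ### Matrix units and inner automorphisms of factors -/

section MatrixUnits
variable {X : Type} [Fintype X] [DecidableEq X]

/-- A system of matrix units. -/
structure IsMU {I : Type} [Fintype I] [DecidableEq I] (E : I → I → Op X) : Prop where
  mul : ∀ i j k l, E i j * E k l = if j = k then E i l else 0
  star : ∀ i j, (E i j)ᴴ = E j i
  one : ∑ i, E i i = 1

/-- A system of matrix units spanning the algebra `R`. -/
structure IsMUOf {I : Type} [Fintype I] [DecidableEq I] (R : StarSubalgebra ℂ (Op X))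
    (E : I → I → Op X) : Prop extends IsMU E where
  span_eq : Submodule.span ℂ (Set.range fun p : I × I => E p.1 p.2) = sm R

variable {R S M : StarSubalgebra ℂ (Op X)}

/-- There is a minimal nonzero left ideal. -/
theorem exists_minimal_leftIdeal [Nonempty X] (R : StarSubalgebra ℂ (Op X)) :
    ∃ L : Submodule ℂ (Op X), L ≤ sm R ∧ L ≠ ⊥ ∧ (∀ r ∈ R, ∀ x ∈ L, r * x ∈ L) ∧
      ∀ L' : Submodule ℂ (Op X), L' ≤ L → L' ≠ ⊥ → (∀ r ∈ R, ∀ x ∈ L', r * x ∈ L') → L' = L := by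
  have hne : sm R ≠ ⊥ := fun h => by
    have : (1 : Op X) ∈ (⊥ : Submodule ℂ (Op X)) := h ▸ (one_mem R : (1 : Op X) ∈ R)
    exact one_ne_zero ((Submodule.mem_bot ℂ).1 this)
  obtain ⟨L, ⟨h1, h2, h3⟩, h4⟩ := WellFounded.has_min
    (wellFounded_lt (α := Submodule ℂ (Op X)))
    {L | L ≤ sm R ∧ L ≠ ⊥ ∧ ∀ r ∈ R, ∀ x ∈ L, r * x ∈ L}
    ⟨sm R, le_rfl, hne, fun r hr x hx => mul_mem (s := R) hr hx⟩
  refine ⟨L, h1, h2, h3, fun L' hL h0 h => ?_⟩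
  by_contra hne
  exact h4 L' ⟨hL.trans h1, h0, h⟩ (lt_of_le_of_ne hL hne)

/-- Schur's lemma for right multiplication on a minimal left ideal. -/
theorem schur_mul_right {L : Submodule ℂ (Op X)} (h0 : L ≠ ⊥)
    (hl : ∀ r ∈ R, ∀ x ∈ L, r * x ∈ L)
    (hm : ∀ L' : Submodule ℂ (Op X), L' ≤ L → L' ≠ ⊥ → (∀ r ∈ R, ∀ x ∈ L', r * x ∈ L') → L' = L)
    {w : Op X} (hw : ∀ z ∈ L, z * w ∈ L) : ∃ c : ℂ, ∀ z ∈ L, z * w = c • z := by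
  have : Nontrivial L := Submodule.nontrivial_iff_ne_bot.2 h0
  let f : L →ₗ[ℂ] L := (LinearMap.mulRight ℂ w).restrict hw
  obtain ⟨c, hc⟩ := Module.End.exists_eigenvalue f
  obtain ⟨v, hv⟩ := hc.exists_hasEigenvector
  let L' : Submodule ℂ (Op X) := L ⊓ LinearMap.ker (LinearMap.mulRight ℂ w - c • LinearMap.id)
  have hL' : ∀ z, z ∈ L' ↔ z ∈ L ∧ z * w = c • z := by
    intro z
    simp [L', Submodule.mem_inf, LinearMap.mem_ker, sub_eq_zero]
  have hv1 : (v : Op X) * w = c • (v : Op X) := by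
    have := hv.apply_eq_smul
    exact congrArg Subtype.val this
  have h : L' = L := by
    refine hm L' inf_le_left ?_ ?_
    · intro h
      have h2 : (v : Op X) ∈ L' := (hL' _).2 ⟨v.2, hv1⟩
      rw [h, Submodule.mem_bot] at h2
      exact hv.2 (Subtype.ext h2)
    · intro r hr x hx
      rw [hL'] at hx ⊢
      exact ⟨hl r hr x hx.1, by rw [mul_assoc, hx.2, mul_smul_comm]⟩
  exact ⟨c, fun z hz => ((hL' z).1 (h ▸ hz)).2⟩

/-- A factor is spanned by a system of matrix units. -/
theorem IsFactor.exists_isMUOf [Nonempty X] (hR : IsFactor R) :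
    ∃ (n : ℕ) (E : Fin n → Fin n → Op X), IsMUOf R E := by
  obtain ⟨L, hLR, h0, hl, hm⟩ := exists_minimal_leftIdeal R
  -- Right multiplication by x†y maps L to L, since z x† lies in R and L is a left ideal. It
  -- commutes with left multiplication by R, so it is a scalar by Schur's lemma.
  have hx : ∀ x ∈ L, ∀ y ∈ L, ∃ c : ℂ, ∀ z ∈ L, z * (xᴴ * y) = c • z := fun x hx y hy =>
    schur_mul_right h0 hl hm fun z hz => by
      rw [← mul_assoc]
      exact hl _ (mul_mem (hLR hz : z ∈ R) (conjTranspose_mem (hLR hx))) y hy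
  obtain ⟨x₀, hx₀, hx₀'⟩ := Submodule.exists_mem_ne_zero_of_ne_bot h0
  have hpos : ∀ w : Op X, w ≠ 0 → ∃ t : ℝ, 0 < t ∧ ntr (wᴴ * w) = t := by
    intro w hw
    refine ⟨_, lt_of_le_of_ne ?_ (fun h => hw ?_), ntr_conjTranspose_mul_self w⟩
    · positivity
    · apply eq_zero_of_ntr_conjTranspose_mul_self
      rw [ntr_conjTranspose_mul_self, ← h]; rfl
  obtain ⟨t, ht, ht'⟩ := hpos x₀ hx₀'
  obtain ⟨c₀, hc₀⟩ := hx x₀ hx₀ x₀ hx₀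
  have hw : x₀ᴴ * x₀ ≠ 0 := fun h => by
    have := hc₀ x₀ hx₀
    rw [h] at ht'
    rw [ntr_zero] at ht'
    exact ht.ne' (by exact_mod_cast ht'.symm)
  obtain ⟨t', ht1, ht1'⟩ := hpos _ hw
  have hc₀' : c₀ = ((t' / t : ℝ) : ℂ) := by
    have h := congrArg (fun z => ntr (x₀ᴴ * z)) (hc₀ x₀ hx₀)
    simp only [mul_smul_comm, ntr_smul, ht'] at h
    rw [Matrix.conjTranspose_mul, Matrix.conjTranspose_conjTranspose, mul_assoc, h] at ht1'
    push_cast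
    rw [eq_div_iff (by exact_mod_cast ht.ne')]
    exact ht1'
  -- the scalars are proportional to the inner product
  set κ : ℝ := t' / t / t with hκ
  have hκ0 : 0 < κ := by positivity
  have key : ∀ x ∈ L, ∀ y ∈ L, ∀ z ∈ L, z * (xᴴ * y) = ((κ : ℂ) * ntr (xᴴ * y)) • z := by
    intro x hxL y hy z hz
    obtain ⟨c, hc⟩ := hx x hxL y hy
    rw [hc z hz]
    congr 1
    have h1 := congrArg (fun z => ntr (x₀ᴴ * z)) (hc x₀ hx₀)
    simp only [mul_smul_comm, ntr_smul, ht'] at h1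
    have h2 : ntr (x₀ᴴ * (x₀ * (xᴴ * y))) = c₀ * ntr (xᴴ * y) := by
      rw [← mul_assoc, ntr_mul_comm, mul_assoc, hc₀ y hy, mul_smul_comm, ntr_smul]
    rw [h2, hc₀'] at h1
    have ht0 : (t : ℂ) ≠ 0 := by exact_mod_cast ht.ne'
    rw [hκ]
    push_cast at h1 ⊢
    field_simp at h1 ⊢
    linear_combination -h1
  -- a normalized basis of `L`
  set q : ℂ := (((Real.sqrt κ)⁻¹ : ℝ) : ℂ) with hq
  have hqs : star q = q := Complex.conj_ofReal _
  have hqq : q * q * κ = 1 := by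
    rw [hq, ← Complex.ofReal_mul, ← Complex.ofReal_mul, ← Complex.ofReal_one]
    congr 1
    have := Real.mul_self_sqrt hκ0.le
    have h := (Real.sqrt_pos.2 hκ0).ne'
    field_simp
    rw [sq, this]
  have hq0 : q ≠ 0 := fun h => by simp [h] at hqq
  let e : Fin (onbSize L) → Op X := fun i => q • onb L i
  have hB := isONB_onb L
  have he : ∀ i, e i ∈ L := fun i => L.smul_mem _ (hB.mem i)
  have hee : ∀ z ∈ L, ∀ i j, z * ((e i)ᴴ * e j) = if i = j then z else 0 := by
    intro z hz i j
    rw [key _ (he i) _ (he j) z hz]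
    simp only [e, Matrix.conjTranspose_smul, hqs, smul_mul_smul_comm, ntr_smul, hB.orthonormal]
    split_ifs
    · rw [mul_one, mul_comm, hqq, one_smul]
    · simp
  have hmul : ∀ i j k l, (e i * (e j)ᴴ) * (e k * (e l)ᴴ) = if j = k then e i * (e l)ᴴ else 0 := by
    intro i j k l
    rw [show e i * (e j)ᴴ * (e k * (e l)ᴴ) = e i * ((e j)ᴴ * e k) * (e l)ᴴ by simp only [mul_assoc],
      hee _ (he i)]
    split_ifs <;> simp
  -- This sum acts on L as the identity from the left. Hence z₀ y z₀ = y z₀ for y in R, and by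
  -- taking adjoints z₀ is central. As R is a factor, z₀ is a scalar, and it is 1 because it fixes a
  -- nonzero vector of L. Thus the matrix units e_i e_j† add up to the identity.
  set z₀ := ∑ i, e i * (e i)ᴴ with hz₀
  have hLe : ∀ w ∈ L, ∃ c : Fin (onbSize L) → ℂ, w = ∑ i, c i • e i := by
    intro w hw
    refine ⟨fun i => q⁻¹ * ntr ((onb L i)ᴴ * w), ?_⟩
    conv_lhs => rw [hB.expand hw]
    refine Finset.sum_congr rfl fun i _ => ?_
    simp only [e, smul_smul]
    rw [mul_comm q⁻¹, inv_mul_cancel_right₀ hq0]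
  have hz₀L : ∀ w ∈ L, z₀ * w = w := by
    intro w hw
    obtain ⟨c, rfl⟩ := hLe w hw
    rw [Finset.mul_sum]
    refine Finset.sum_congr rfl fun j _ => ?_
    rw [mul_smul_comm, hz₀, Finset.sum_mul]
    congr 1
    simp_rw [mul_assoc, hee _ (he _)]
    simp
  have hz₀star : z₀ᴴ = z₀ := by
    simp [hz₀, Matrix.conjTranspose_sum, Matrix.conjTranspose_mul]
  have h1 : ∀ y ∈ R, z₀ * (y * z₀) = y * z₀ := by
    intro y hy
    have : y * z₀ = ∑ i, (y * e i) * (e i)ᴴ := by simp only [hz₀, Finset.mul_sum, mul_assoc]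
    rw [this, Finset.mul_sum]
    refine Finset.sum_congr rfl fun i _ => ?_
    rw [← mul_assoc, hz₀L _ (hl y hy _ (he i))]
  have h2 : ∀ y ∈ R, y * z₀ = z₀ * y := by
    intro y hy
    have h := congrArg Matrix.conjTranspose (h1 _ (conjTranspose_mem hy))
    simp only [Matrix.conjTranspose_mul, hz₀star, Matrix.conjTranspose_conjTranspose] at h
    rw [← h1 y hy, ← h, mul_assoc]
  have hER : ∀ i j, e i * (e j)ᴴ ∈ R := fun i j =>
    mul_mem (hLR (he i) : _ ∈ R) (conjTranspose_mem (hLR (he j)))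
  obtain ⟨c, hc⟩ := hR z₀ (sum_mem fun i _ => hER i i) h2
  have hz1 : z₀ = 1 := by
    have h := hz₀L x₀ hx₀
    rw [hc, smul_mul_assoc, one_mul] at h
    have : (c - 1) • x₀ = 0 := by rw [sub_smul, h, one_smul, sub_self]
    rcases smul_eq_zero.1 this with h | h
    · rw [hc, sub_eq_zero.1 h, one_smul]
    · exact absurd h hx₀'
  refine ⟨_, fun i j => e i * (e j)ᴴ, ⟨hmul, fun i j => ?_, hz1⟩, le_antisymm ?_ ?_⟩
  · simp [Matrix.conjTranspose_mul]
  · rw [Submodule.span_le]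
    rintro _ ⟨p, rfl⟩
    exact hER _ _
  · intro y hy
    rw [← mul_one y, ← hz1, hz₀, Finset.mul_sum]
    refine Submodule.sum_mem _ fun i _ => ?_
    obtain ⟨c, hc⟩ := hLe _ (hl y hy _ (he i))
    rw [← mul_assoc, hc, Finset.sum_mul]
    refine Submodule.sum_mem _ fun j _ => ?_
    rw [smul_mul_assoc]
    exact Submodule.smul_mem _ _ (Submodule.subset_span ⟨(j, i), rfl⟩)

variable {I J : Type} [Fintype I] [DecidableEq I] [Fintype J] [DecidableEq J]
  {E F : I → I → Op X}

theorem IsMUOf.mem (h : IsMUOf R E) (i j : I) : E i j ∈ R :=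
  (h.span_eq ▸ Submodule.subset_span ⟨(i, j), rfl⟩ : E i j ∈ sm R)

theorem IsMU.nonempty [Nonempty X] (h : IsMU E) : Nonempty I := by
  by_contra h0
  rw [not_nonempty_iff] at h0
  have := h.one
  rw [Finset.univ_eq_empty, Finset.sum_empty] at this
  exact one_ne_zero this.symm

theorem IsMU.card_ne [Nonempty X] (h : IsMU E) : (Fintype.card I : ℂ) ≠ 0 := by
  have := h.nonempty
  exact_mod_cast Fintype.card_ne_zero

theorem IsMU.ntr [Nonempty X] (h : IsMU E) (i j : I) :
    ntr (E i j) = if i = j then (Fintype.card I : ℂ)⁻¹ else 0 := by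
  by_cases hij : i = j
  · subst hij
    have h1 : ∀ k, SymQCA.ntr (E k k) = SymQCA.ntr (E i i) := by
      intro k
      have h2 : E k k = E k i * E i k := by rw [h.mul]; simp
      rw [h2, ntr_mul_comm, h.mul]; simp
    have h3 := congrArg SymQCA.ntr h.one
    rw [ntr_sum, ntr_one] at h3
    simp_rw [h1] at h3
    rw [if_pos rfl]
    refine eq_inv_of_mul_eq_one_right ?_
    simpa using h3
  · rw [if_neg hij]
    have h2 : E i j = E i i * E i j := by rw [h.mul]; simp
    rw [h2, ntr_mul_comm, h.mul, if_neg (Ne.symm hij), ntr_zero]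

theorem IsMUOf.comm (h : IsMUOf R E) {y : Op X} (hy : ∀ i j, E i j * y = y * E i j) :
    ∀ r ∈ R, r * y = y * r := by
  intro r hr
  have hr' : r ∈ Submodule.span ℂ (Set.range fun p : I × I => E p.1 p.2) := h.span_eq ▸ hr
  clear hr
  induction hr' using Submodule.span_induction with
  | mem x hx => obtain ⟨⟨i, j⟩, rfl⟩ := hx; exact hy i j
  | zero => simp
  | add x y hx hy h1 h2 => rw [add_mul, mul_add, h1, h2]
  | smul c x hx h1 => rw [smul_mul_assoc, mul_smul_comm, h1]

/-- Normalization of an operator `G` with scalar `Gᴴ G`. -/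
theorem exists_smul_isU [Nonempty X] {G : Op X} (hG : G ≠ 0) {c : ℂ} (h : Gᴴ * G = c • 1) :
    ∃ s : ℂ, s ≠ 0 ∧ IsU (s • G) := by
  have h1 := ntr_conjTranspose_mul_self G
  set t : ℝ := (∑ i, ∑ j, ‖G j i‖ ^ 2) / Fintype.card X
  rw [h, ntr_smul_one] at h1
  have ht0 : 0 ≤ t := by positivity
  have ht : 0 < t := by
    refine lt_of_le_of_ne ht0 fun h0 => hG ?_
    apply eq_zero_of_ntr_conjTranspose_mul_self
    rw [h, ntr_smul_one, h1, ← h0]; rfl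
  refine ⟨(((Real.sqrt t)⁻¹ : ℝ) : ℂ), ?_, ?_⟩
  · exact_mod_cast (inv_pos.2 (Real.sqrt_pos.2 ht)).ne'
  · rw [IsU, Matrix.conjTranspose_smul, smul_mul_smul_comm, h, h1, smul_smul]
    have : star ((((Real.sqrt t)⁻¹ : ℝ) : ℂ)) = (((Real.sqrt t)⁻¹ : ℝ) : ℂ) := Complex.conj_ofReal _
    rw [this, ← Complex.ofReal_mul, ← Complex.ofReal_mul]
    have h2 : (Real.sqrt t)⁻¹ * (Real.sqrt t)⁻¹ * t = 1 := by
      have := Real.mul_self_sqrt ht0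
      have h := (Real.sqrt_pos.2 ht).ne'
      field_simp
      rw [sq, this]
    rw [h2]; simp

/-- Two systems of matrix units spanning the same factor are unitarily equivalent in it. -/
theorem exists_intertwiner [Nonempty X] (hR : IsFactor R) (hE : IsMU E) (hER : ∀ i j, E i j ∈ R)
    (hF : IsMUOf R F) : ∃ G ∈ R, IsU G ∧ ∀ i j, G * F i j = E i j * G := by
  obtain ⟨o⟩ := hF.nonempty
  have h1 : ∃ k, E o o * F k o ≠ 0 := by
    by_contra hcon
    push Not at hcon
    have h2 : E o o = 0 := by
      rw [← mul_one (E o o), ← hF.one, Finset.mul_sum]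
      refine Finset.sum_eq_zero fun k _ => ?_
      have : F k k = F k o * F o k := by rw [hF.mul]; simp
      rw [this, ← mul_assoc, hcon, zero_mul]
    have := hE.ntr o o
    rw [h2, ntr_zero, if_pos rfl] at this
    exact inv_ne_zero hE.card_ne this.symm
  obtain ⟨k, hk⟩ := h1
  -- Any sum of E_{ao} T F_{oa} over a intertwines F with E. The choice T = F_{ko} makes it nonzero,
  -- because E_{oo} F_{ko} ≠ 0. Then G₀†G₀ commutes with R and is a scalar, which can be normalized.
  set G₀ : Op X := ∑ a, E a o * F k o * F o a with hG₀
  have hint : ∀ i j, G₀ * F i j = E i j * G₀ := by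
    intro i j
    rw [hG₀, Finset.sum_mul, Finset.mul_sum]
    rw [Finset.sum_eq_single i, Finset.sum_eq_single j]
    · simp only [mul_assoc, hF.mul]
      simp only [← mul_assoc, hE.mul]
      simp only [mul_assoc, hF.mul, if_true]
    · intro b _ hb
      rw [← mul_assoc, ← mul_assoc, hE.mul, if_neg (Ne.symm hb)]; simp
    · simp
    · intro b _ hb
      rw [mul_assoc, hF.mul, if_neg hb]; simp
    · simp
  have hG₀R : G₀ ∈ R := sum_mem fun a _ => mul_mem (mul_mem (hER _ _) (hF.mem _ _)) (hF.mem _ _)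
  have hcomm : ∀ r ∈ R, r * (G₀ᴴ * G₀) = G₀ᴴ * G₀ * r := by
    refine hF.comm fun i j => ?_
    have := congrArg Matrix.conjTranspose (hint j i)
    rw [Matrix.conjTranspose_mul, Matrix.conjTranspose_mul, hF.star, hE.star] at this
    rw [← mul_assoc, this, mul_assoc, mul_assoc, hint]
  obtain ⟨c, hc⟩ := hR _ (mul_mem (conjTranspose_mem hG₀R) hG₀R) hcomm
  have hne : G₀ ≠ 0 := fun h => hk <| by
    have h2 : E o o * G₀ * F o o = E o o * F k o := by
      rw [hG₀, Finset.mul_sum, Finset.sum_mul, Finset.sum_eq_single o]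
      · simp only [← mul_assoc, hE.mul]
        simp only [mul_assoc, hF.mul, if_true]
      · intro b _ hb
        rw [← mul_assoc, ← mul_assoc, hE.mul, if_neg (Ne.symm hb)]; simp
      · simp
    rw [← h2, h]; simp
  obtain ⟨s, hs, hU⟩ := exists_smul_isU hne hc
  exact ⟨s • G₀, R.smul_mem hG₀R _, hU, fun i j => by rw [smul_mul_assoc, hint, mul_smul_comm]⟩

theorem IsMUOf.card_sq [Nonempty X] (h : IsMUOf R E) : rdim R = Fintype.card I ^ 2 := by
  have hlin : LinearIndependent ℂ fun p : I × I => E p.1 p.2 := by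
    rw [Fintype.linearIndependent_iff]
    intro c hc p
    have h1 := congrArg (fun x => SymQCA.ntr (E p.2 p.1 * x)) hc
    simp only [Finset.mul_sum, mul_smul_comm, ntr_sum, ntr_smul, h.mul, mul_zero, ntr_zero] at h1
    rw [Finset.sum_eq_single p] at h1
    · simp only [if_true, h.ntr] at h1
      exact (mul_eq_zero.1 h1).resolve_right (inv_ne_zero h.card_ne)
    · rintro ⟨a, b⟩ _ hb
      by_cases h2 : p.1 = a
      · rw [if_pos h2, h.ntr, if_neg, mul_zero]
        rintro rfl
        exact hb (Prod.ext h2.symm rfl)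
      · rw [if_neg h2, ntr_zero, mul_zero]
    · simp
  rw [rdim, ← h.span_eq, finrank_span_eq_card hlin, Fintype.card_prod, sq]

/-- Conjugation by a unitary on a factor is implemented by a unitary of the factor. -/
theorem IsFactor.exists_implements [Nonempty X] (hR : IsFactor R) {u : Op X} (hu : IsU u)
    (hn : Norm u R) : ∃ v ∈ R, IsU v ∧ ∀ r ∈ R, v * r = u * r * uᴴ * v := by
  obtain ⟨n, E, hE⟩ := hR.exists_isMUOf
  have hu' : u * uᴴ = 1 := mul_eq_one_comm.1 hu
  have hE' : IsMU fun i j => u * E i j * uᴴ := by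
    refine ⟨fun i j k l => ?_, fun i j => ?_, ?_⟩
    · rw [show u * E i j * uᴴ * (u * E k l * uᴴ) = u * (E i j * (uᴴ * u) * E k l) * uᴴ by
        simp only [mul_assoc], hu, mul_one, hE.mul]
      split_ifs <;> simp
    · simp only [Matrix.conjTranspose_mul, Matrix.conjTranspose_conjTranspose, hE.star, mul_assoc]
    · rw [← Finset.sum_mul, ← Finset.mul_sum, hE.one, mul_one, hu']
  obtain ⟨v, hv, hvU, h⟩ := exists_intertwiner hR hE' (fun i j => hn _ (hE.mem i j)) hE
  refine ⟨v, hv, hvU, fun r hr => ?_⟩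
  have h1 : uᴴ * v * r = r * (uᴴ * v) := by
    refine (hE.comm (fun i j => ?_) r hr).symm
    rw [mul_assoc, h]
    simp only [← mul_assoc]
    rw [hu, one_mul]
  rw [mul_assoc, mul_assoc, ← mul_assoc r, mul_assoc r, ← h1, ← mul_assoc, ← mul_assoc, hu', one_mul]

/-- Conjugation by a hermitian unitary on a factor is implemented by a hermitian unitary. -/
theorem IsFactor.exists_implements_involution [Nonempty X] (hR : IsFactor R) {u : Op X}
    (hu : u * u = 1) (hus : uᴴ = u) (hn : Norm u R) :
    ∃ v ∈ R, v * v = 1 ∧ vᴴ = v ∧ ∀ r ∈ R, v * r = u * r * u * v := by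
  obtain ⟨v, hv, hvU, h⟩ := hR.exists_implements (by rw [IsU, hus, hu]) hn
  rw [hus] at h
  -- Conjugation by u is its own inverse, so v² is central, a scalar of modulus one. Division of v
  -- by a square root of it gives an involution, and a unitary involution is hermitian.
  have hc : ∀ r ∈ R, r * (v * v) = v * v * r := by
    intro r hr
    have h1 : u * r * u ∈ R := by have := hn r hr; rwa [hus] at this
    have e : u * (u * r * u) * u = (u * u) * r * (u * u) := by simp only [mul_assoc]
    rw [mul_assoc v v r, h r hr, ← mul_assoc v, h _ h1, e, hu, one_mul, mul_one, mul_assoc]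
  obtain ⟨c, hc⟩ := hR _ (mul_mem hv hv) hc
  have hc1 : star c * c = 1 := by
    have h1 : (v * v)ᴴ * (v * v) = 1 := by
      rw [Matrix.conjTranspose_mul, show vᴴ * vᴴ * (v * v) = vᴴ * (vᴴ * v) * v by
        simp only [mul_assoc], hvU, mul_one, hvU]
    rw [hc, Matrix.conjTranspose_smul, smul_mul_smul_comm, Matrix.conjTranspose_one, mul_one] at h1
    have := congrArg SymQCA.ntr h1
    rwa [ntr_smul_one, ntr_one] at this
  obtain ⟨s, rfl⟩ := IsAlgClosed.exists_eq_mul_self c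
  have hs1 : star s * s = 1 := by
    have h1 : star s * s = ((‖s‖ ^ 2 : ℝ) : ℂ) := by rw [Complex.ofReal_pow, ← Complex.conj_mul']; rfl
    rw [star_mul', show star s * star s * (s * s) = (star s * s) * (star s * s) by ring, h1] at hc1
    have h2 : (‖s‖ ^ 2) * (‖s‖ ^ 2) = 1 := by exact_mod_cast hc1
    have h3 : ‖s‖ ^ 2 = 1 := by nlinarith [sq_nonneg ‖s‖]
    rw [h1, h3]; rfl
  have hs0 : s ≠ 0 := right_ne_zero_of_mul_eq_one hs1
  have hw1 : (s⁻¹ • v) * (s⁻¹ • v) = 1 := by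
    rw [smul_mul_smul_comm, hc, smul_smul]
    field_simp
    simp
  have hw2 : (s⁻¹ • v)ᴴ * (s⁻¹ • v) = 1 := by
    rw [Matrix.conjTranspose_smul, smul_mul_smul_comm, hvU, star_inv₀, ← mul_inv, hs1]; simp
  refine ⟨s⁻¹ • v, R.smul_mem hv _, hw1, ?_, fun r hr => ?_⟩
  · rw [← mul_one (s⁻¹ • v)ᴴ, ← hw1, ← mul_assoc, hw2, one_mul]
  · rw [smul_mul_assoc, h r hr, mul_smul_comm]

/-- The operator with matrix `M` with respect to a system of matrix units. -/
def toOp (E : I → I → Op X) : Matrix I I ℂ →ₗ[ℂ] Op X where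
  toFun M := ∑ i, ∑ j, M i j • E i j
  map_add' M N := by simp [add_smul, Finset.sum_add_distrib]
  map_smul' c M := by simp [mul_smul, Finset.smul_sum]

theorem toOp_apply (M : Matrix I I ℂ) : toOp E M = ∑ i, ∑ j, M i j • E i j := rfl

theorem toOp_single (i j : I) : toOp E (Matrix.single i j 1) = E i j := by
  rw [toOp_apply, Finset.sum_eq_single i, Finset.sum_eq_single j]
  · simp
  · intro b _ hb; simp [Matrix.single, hb.symm]
  · simp
  · intro b _ hb; simp [Matrix.single, hb.symm]
  · simp

theorem toOp_diagonal (s : I → ℂ) : toOp E (Matrix.diagonal s) = ∑ i, s i • E i i := by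
  rw [toOp_apply]
  refine Finset.sum_congr rfl fun i _ => ?_
  rw [Finset.sum_eq_single i]
  · simp
  · intro b _ hb; simp [Matrix.diagonal_apply_ne _ hb.symm]
  · simp

theorem IsMU.toOp_mul (h : IsMU E) (M N : Matrix I I ℂ) : toOp E (M * N) = toOp E M * toOp E N := by
  have : ∀ i j k l, (M i j • E i j) * (N k l • E k l)
      = if j = k then (M i j * N k l) • E i l else 0 := by
    intro i j k l
    rw [smul_mul_smul_comm, h.mul]; split_ifs <;> simp
  have h1 : ∀ i j, M i j • E i j * toOp E N = ∑ l, (M i j * N j l) • E i l := by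
    intro i j
    rw [toOp_apply, Finset.mul_sum, Finset.sum_eq_single j]
    · rw [Finset.mul_sum]; simp only [this, if_true]
    · intro k _ hk
      rw [Finset.mul_sum]; simp only [this, if_neg hk.symm, Finset.sum_const_zero]
    · simp
  rw [toOp_apply (M * N), toOp_apply M, Finset.sum_mul]
  refine Finset.sum_congr rfl fun i _ => ?_
  rw [Finset.sum_mul]
  simp_rw [h1, Matrix.mul_apply, Finset.sum_smul]
  rw [Finset.sum_comm]

theorem IsMU.toOp_conjTranspose (h : IsMU E) (M : Matrix I I ℂ) : toOp E Mᴴ = (toOp E M)ᴴ := by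
  simp only [toOp_apply, Matrix.conjTranspose_sum, Matrix.conjTranspose_smul, h.star,
    Matrix.conjTranspose_apply]
  rw [Finset.sum_comm]

theorem IsMU.toOp_one (h : IsMU E) : toOp E 1 = 1 := by
  rw [← Matrix.diagonal_one, toOp_diagonal]; simpa using h.one

theorem IsMUOf.exists_toOp (h : IsMUOf R E) {x : Op X} (hx : x ∈ R) : ∃ M, x = toOp E M := by
  have : sm R ≤ LinearMap.range (toOp E) := by
    rw [← h.span_eq, Submodule.span_le]
    rintro _ ⟨p, rfl⟩
    exact ⟨_, toOp_single _ _⟩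
  obtain ⟨M, hM⟩ := this hx
  exact ⟨M, hM.symm⟩

theorem IsMU.toOp_injective [Nonempty X] (h : IsMU E) : Function.Injective (toOp E) := by
  rw [← LinearMap.ker_eq_bot, LinearMap.ker_eq_bot']
  intro M hM
  ext k l
  have h1 := congrArg (fun x => SymQCA.ntr (E l k * x)) hM
  simp only [toOp_apply, Finset.mul_sum, mul_smul_comm, ntr_sum, ntr_smul, h.mul, mul_zero,
    ntr_zero] at h1
  rw [Finset.sum_eq_single k, Finset.sum_eq_single l] at h1
  · simpa [h.ntr, h.card_ne] using h1
  · intro b _ hb; simp [h.ntr, hb.symm]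
  · simp
  · intro b _ hb; simp [hb.symm, ntr_zero]
  · simp

/-- A hermitian involution in a factor is diagonal with respect to suitable matrix units. -/
theorem IsFactor.exists_diagonal [Nonempty X] (hR : IsFactor R) {v : Op X} (hv : v ∈ R)
    (hvv : v * v = 1) (hvs : vᴴ = v) : ∃ (n : ℕ) (E : Fin n → Fin n → Op X) (s : Fin n → ℤˣ),
      IsMUOf R E ∧ v = ∑ i, ((s i : ℤ) : ℂ) • E i i := by
  obtain ⟨n, E, hE⟩ := hR.exists_isMUOf
  obtain ⟨H, rfl⟩ := hE.exists_toOp hv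
  have hH : H.IsHermitian := hE.toOp_injective (by rw [hE.toOp_conjTranspose, hvs])
  have hHH : H * H = 1 := hE.toOp_injective (by rw [hE.toOp_mul, hvv, hE.toOp_one])
  -- The matrix of v is diagonalized by the spectral theorem. Its eigenvalues square to one, and the
  -- matrix units are conjugated by the unitary of eigenvectors.
  set T : Matrix (Fin n) (Fin n) ℂ := (hH.eigenvectorUnitary : Matrix (Fin n) (Fin n) ℂ) with hT
  have hT1 : Tᴴ * T = 1 := Matrix.mem_unitaryGroup_iff'.1 hH.eigenvectorUnitary.2
  have hT2 : T * Tᴴ = 1 := Matrix.mem_unitaryGroup_iff.1 hH.eigenvectorUnitary.2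
  have hspec : H = T * Matrix.diagonal (fun i => (hH.eigenvalues i : ℂ)) * Tᴴ := by
    have := hH.spectral_theorem
    rw [Unitary.conjStarAlgAut_apply] at this
    exact this
  have hsq : ∀ i, hH.eigenvalues i * hH.eigenvalues i = 1 := by
    intro i
    have h1 : Matrix.diagonal (fun i => (hH.eigenvalues i : ℂ)) = Tᴴ * H * T := by
      conv_rhs => rw [hspec]
      simp only [← mul_assoc]
      rw [hT1, one_mul, mul_assoc, hT1, mul_one]
    have h2 : Matrix.diagonal (fun i => (hH.eigenvalues i : ℂ))
        * Matrix.diagonal (fun i => (hH.eigenvalues i : ℂ)) = 1 := by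
      rw [h1, show Tᴴ * H * T * (Tᴴ * H * T) = Tᴴ * H * (T * Tᴴ) * H * T by simp only [mul_assoc],
        hT2, mul_one, mul_assoc Tᴴ, hHH, mul_one, hT1]
    have h3 := congrFun (congrFun h2 i) i
    rw [Matrix.diagonal_mul_diagonal, Matrix.diagonal_apply_eq, Matrix.one_apply_eq] at h3
    exact_mod_cast h3
  have hs : ∀ i, ∃ s : ℤˣ, ((s : ℤ) : ℂ) = hH.eigenvalues i := by
    intro i
    rcases mul_self_eq_one_iff.1 (hsq i) with h | h
    · exact ⟨1, by simp [h]⟩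
    · exact ⟨-1, by simp [h]⟩
  choose s hs using hs
  refine ⟨n, fun a b => toOp E (T * Matrix.single a b 1 * Tᴴ), s,
    ⟨⟨fun i j k l => ?_, fun i j => ?_, ?_⟩, le_antisymm ?_ ?_⟩, ?_⟩
  · rw [← hE.toOp_mul, show T * Matrix.single i j 1 * Tᴴ * (T * Matrix.single k l 1 * Tᴴ)
      = T * (Matrix.single i j 1 * (Tᴴ * T) * Matrix.single k l 1) * Tᴴ by simp only [mul_assoc],
      hT1, mul_one]
    by_cases hjk : j = k
    · subst hjk; simp
    · rw [if_neg hjk, Matrix.single_mul_single_of_ne _ _ _ _ hjk]; simp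
  · rw [← hE.toOp_conjTranspose]
    congr 1
    simp [Matrix.conjTranspose_mul, mul_assoc, Matrix.conjTranspose_single]
  · rw [← map_sum, ← Finset.sum_mul, ← Finset.mul_sum]
    have : ∑ i : Fin n, Matrix.single i i (1 : ℂ) = 1 := by
      ext a b
      rw [Matrix.sum_apply]
      by_cases h : a = b
      · subst h
        rw [Finset.sum_eq_single a] <;> simp +contextual [Matrix.single]
      · rw [Matrix.one_apply_ne h]
        refine Finset.sum_eq_zero fun i _ => ?_
        simp only [Matrix.single, Matrix.of_apply, ite_eq_right_iff]
        rintro ⟨rfl, rfl⟩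
        exact absurd rfl h
    rw [this, mul_one, hT2, hE.toOp_one]
  · rw [Submodule.span_le]
    rintro _ ⟨p, rfl⟩
    change toOp E _ ∈ R
    rw [toOp_apply]
    exact sum_mem fun i _ => sum_mem fun j _ => R.smul_mem (hE.mem i j) _
  · intro x hx
    obtain ⟨M, rfl⟩ := hE.exists_toOp hx
    have h1 : M = ∑ a, ∑ b, (Tᴴ * M * T) a b • (T * Matrix.single a b 1 * Tᴴ) := by
      have h2 : Tᴴ * M * T = ∑ a, ∑ b, (Tᴴ * M * T) a b • Matrix.single a b (1 : ℂ) := by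
        conv_lhs => rw [Matrix.matrix_eq_sum_single (Tᴴ * M * T)]
        simp
      have h3 : M = T * (Tᴴ * M * T) * Tᴴ := by
        simp only [← mul_assoc]
        rw [hT2, one_mul, mul_assoc, hT2, mul_one]
      conv_lhs => rw [h3, h2]
      simp only [Finset.mul_sum, Finset.sum_mul, mul_smul_comm, smul_mul_assoc]
    rw [h1, map_sum]
    refine Submodule.sum_mem _ fun a _ => ?_
    rw [map_sum]
    refine Submodule.sum_mem _ fun b _ => ?_
    rw [map_smul]
    exact Submodule.smul_mem _ _ (Submodule.subset_span ⟨(a, b), rfl⟩)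
  · conv_lhs => rw [hspec]
    simp_rw [hs, ← map_smul, ← map_sum]
    congr 1
    rw [← toOp_diagonal (E := fun i j => T * Matrix.single i j 1 * Tᴴ)]
    have h2 : Matrix.diagonal (fun i => (hH.eigenvalues i : ℂ))
        = ∑ a, (hH.eigenvalues a : ℂ) • Matrix.single a a (1 : ℂ) := by
      rw [← toOp_diagonal (X := Fin n) (E := fun i j => Matrix.single i j (1 : ℂ)), toOp_apply]
      conv_lhs => rw [Matrix.matrix_eq_sum_single (Matrix.diagonal _)]
      simp
    rw [toOp_diagonal]
    conv_lhs => rw [h2]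
    simp only [Finset.mul_sum, Finset.sum_mul, mul_smul_comm, smul_mul_assoc]

/-- The sum and the number of the signs determine how many of them are 1 and how many are -1, so the
fibres of s and t have equal sizes and can be matched. -/
theorem exists_equiv_of_sum_eq (s : I → ℤˣ) (t : J → ℤˣ) (hc : Fintype.card I = Fintype.card J)
    (hs : ∑ i, (s i : ℤ) = ∑ j, (t j : ℤ)) : ∃ e : I ≃ J, ∀ i, t (e i) = s i := by
  have key : ∀ {K : Type} [Fintype K] [DecidableEq K] (s : K → ℤˣ),
      ∑ i, (s i : ℤ) = 2 * Fintype.card {i // s i = 1} - Fintype.card K := by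
    intro K _ _ s
    have h1 : ∀ i, (s i : ℤ) = 2 * (if s i = 1 then 1 else 0) - 1 := by
      intro i
      rcases Int.units_eq_one_or (s i) with h | h <;> simp [h]
    simp_rw [h1]
    rw [Finset.sum_sub_distrib, ← Finset.mul_sum, Finset.sum_boole, Fintype.card_subtype]
    simp
  have key' : ∀ {K : Type} [Fintype K] [DecidableEq K] (s : K → ℤˣ),
      Fintype.card {i // s i = 1} + Fintype.card {i // s i = -1} = Fintype.card K := by
    intro K _ _ s
    have h1 := Fintype.card_subtype_compl (fun i => s i = 1)
    have h2 := Fintype.card_subtype_le (fun i => s i = 1)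
    have h3 : Fintype.card {i // s i = -1} = Fintype.card {i // ¬ s i = 1} := by
      refine Fintype.card_congr (Equiv.subtypeEquivRight fun i => ?_)
      rcases Int.units_eq_one_or (s i) with h | h <;> simp [h]
    omega
  rw [key s, key t] at hs
  have hs' := key' s
  have ht' := key' t
  have h : ∀ u : ℤˣ, Nonempty ({i // s i = u} ≃ {j // t j = u}) := by
    intro u
    rw [← Fintype.card_eq]
    rcases Int.units_eq_one_or u with rfl | rfl <;> omega
  let e := fun u => (h u).some
  exact ⟨Equiv.ofFiberEquiv (fun u => e u), fun i => Equiv.ofFiberEquiv_map _ _⟩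

end MatrixUnits

/-! ### Unitaries between two factorizations of a factor -/

section Gates
variable {X : Type} [Fintype X] [DecidableEq X]
  {I J : Type} [Fintype I] [DecidableEq I] [Fintype J] [DecidableEq J]
  {R S M R₁ R₂ S₁ S₂ : StarSubalgebra ℂ (Op X)}

theorem IsMU.prod {E : I → I → Op X} {F : J → J → Op X} (hE : IsMU E) (hF : IsMU F)
    (hc : ∀ i i' j j', E i i' * F j j' = F j j' * E i i') :
    IsMU fun p q : I × J => E p.1 q.1 * F p.2 q.2 := by
  refine ⟨?_, ?_, ?_⟩
  · rintro ⟨i, i'⟩ ⟨j, j'⟩ ⟨k, k'⟩ ⟨l, l'⟩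
    simp only
    rw [show E i j * F i' j' * (E k l * F k' l') = E i j * (F i' j' * E k l) * F k' l' by
      simp only [mul_assoc], ← hc, show E i j * (E k l * F i' j') * F k' l'
      = (E i j * E k l) * (F i' j' * F k' l') by simp only [mul_assoc], hE.mul, hF.mul]
    by_cases h1 : j = k <;> by_cases h2 : j' = k' <;> simp [h1, h2]
  · rintro ⟨i, i'⟩ ⟨j, j'⟩
    simp only [Matrix.conjTranspose_mul, hE.star, hF.star, hc]
  · rw [Fintype.sum_prod_type]
    simp only [← Finset.mul_sum, hF.one, mul_one, hE.one]

theorem IsMUOf.prod {E : I → I → Op X} {F : J → J → Op X} (h : Splits M R S) (hE : IsMUOf R E)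
    (hF : IsMUOf S F) : IsMUOf M fun p q : I × J => E p.1 q.1 * F p.2 q.2 := by
  refine ⟨hE.toIsMU.prod hF.toIsMU fun i i' j j' => h.comm _ (hE.mem _ _) _ (hF.mem _ _),
    le_antisymm ?_ fun x hx => ?_⟩
  · rw [Submodule.span_le]
    rintro _ ⟨p, rfl⟩
    exact (mul_mem (h.left (hE.mem _ _)) (h.right (hF.mem _ _)) : _ ∈ M)
  · have := h.le x hx
    rw [← hE.span_eq, ← hF.span_eq, Submodule.span_mul_span] at this
    refine Submodule.span_mono ?_ this
    rintro _ ⟨_, ⟨a, rfl⟩, _, ⟨b, rfl⟩, rfl⟩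
    exact ⟨((a.1, b.1), (a.2, b.2)), rfl⟩

theorem IsMU.reindex {E : I → I → Op X} (hE : IsMU E) (e : J ≃ I) :
    IsMU fun i j => E (e i) (e j) :=
  ⟨fun i j k l => by simp [hE.mul], fun i j => hE.star _ _,
    by rw [← hE.one]; exact e.sum_comp fun i => E i i⟩

theorem IsMUOf.reindex {E : I → I → Op X} (hE : IsMUOf R E) (e : J ≃ I) :
    IsMUOf R fun i j => E (e i) (e j) := by
  refine ⟨hE.toIsMU.reindex e, ?_⟩
  rw [← hE.span_eq]
  congr 1
  exact (e.prodCongr e).surjective.range_comp fun p : I × I => E p.1 p.2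

theorem IsMU.ntr_diagonal [Nonempty X] {E : I → I → Op X} (hE : IsMU E) (s : I → ℤˣ) :
    SymQCA.ntr (∑ i, ((s i : ℤ) : ℂ) • E i i) = ((∑ i, (s i : ℤ) : ℤ) : ℂ) / Fintype.card I := by
  simp only [ntr_sum, ntr_smul, hE.ntr, if_true, ← Finset.sum_mul, div_eq_mul_inv]
  push_cast; rfl

theorem conj_mem_of_intertwiner {E F : I → I → Op X} (hE : IsMUOf R E) (hF : IsMUOf S F) {G : Op X}
    (hU : G * Gᴴ = 1) (h : ∀ i j, G * F i j = E i j * G) {x : Op X} (hx : x ∈ S) :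
    G * x * Gᴴ ∈ R := by
  obtain ⟨M, rfl⟩ := hF.exists_toOp hx
  simp only [toOp_apply, Finset.mul_sum, Finset.sum_mul]
  refine sum_mem fun i _ => sum_mem fun j _ => ?_
  rw [mul_smul_comm, h, smul_mul_assoc, mul_assoc, hU, mul_one]
  exact R.smul_mem (hE.mem i j) _

/-- Two factorizations of a factor with the same dimensions are unitarily equivalent; the
equivalence can be chosen to intertwine given hermitian involutions of equal traces. -/
theorem exists_gate [Nonempty X] (hM : IsFactor M) (h : Splits M R₁ R₂) (h' : Splits M S₁ S₂)
    {r₁ r₂ s₁ s₂ : Op X}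
    (hr₁ : r₁ ∈ R₁ ∧ r₁ * r₁ = 1 ∧ r₁ᴴ = r₁) (hr₂ : r₂ ∈ R₂ ∧ r₂ * r₂ = 1 ∧ r₂ᴴ = r₂)
    (hs₁ : s₁ ∈ S₁ ∧ s₁ * s₁ = 1 ∧ s₁ᴴ = s₁) (hs₂ : s₂ ∈ S₂ ∧ s₂ * s₂ = 1 ∧ s₂ᴴ = s₂)
    (hd₁ : rdim R₁ = rdim S₁) (hd₂ : rdim R₂ = rdim S₂)
    (ht₁ : ntr r₁ = ntr s₁) (ht₂ : ntr r₂ = ntr s₂) :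
    ∃ G ∈ M, IsU G ∧ (∀ x ∈ S₁, G * x * Gᴴ ∈ R₁) ∧ (∀ x ∈ S₂, G * x * Gᴴ ∈ R₂) ∧
      G * s₁ = r₁ * G ∧ G * s₂ = r₂ * G := by
  -- Both involutions are diagonalized. Equal dimensions and equal traces mean equal multiplicities
  -- of the eigenvalues, so the units of S can be reindexed until the signs agree.
  have key : ∀ {R S : StarSubalgebra ℂ (Op X)} {r s : Op X}, IsFactor R → IsFactor S →
      (r ∈ R ∧ r * r = 1 ∧ rᴴ = r) → (s ∈ S ∧ s * s = 1 ∧ sᴴ = s) → rdim R = rdim S →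
      ntr r = ntr s → ∃ (n : ℕ) (E F : Fin n → Fin n → Op X) (a : Fin n → ℤˣ),
        IsMUOf R E ∧ IsMUOf S F ∧ r = ∑ i, ((a i : ℤ) : ℂ) • E i i ∧
        s = ∑ i, ((a i : ℤ) : ℂ) • F i i := by
    intro R S r s hR hS hr hs hd ht
    obtain ⟨n, E, a, hE, rfl⟩ := hR.exists_diagonal hr.1 hr.2.1 hr.2.2
    obtain ⟨m, F, b, hF, rfl⟩ := hS.exists_diagonal hs.1 hs.2.1 hs.2.2
    have hnm : n = m := by
      rw [hE.card_sq, hF.card_sq, Fintype.card_fin, Fintype.card_fin] at hd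
      exact Nat.pow_left_injective (n := 2) (by norm_num) hd
    subst hnm
    rw [hE.ntr_diagonal, hF.ntr_diagonal, div_left_inj' hE.card_ne] at ht
    obtain ⟨e, he⟩ := exists_equiv_of_sum_eq a b rfl (by exact_mod_cast ht)
    refine ⟨n, E, fun i j => F (e i) (e j), a, hE, hF.reindex e, rfl, ?_⟩
    rw [← e.sum_comp]
    simp [he]
  obtain ⟨n, E, F, a, hE, hF, rfl, rfl⟩ := key (h.isFactor_left hM) (h'.isFactor_left hM)
    hr₁ hs₁ hd₁ ht₁
  obtain ⟨m, E', F', a', hE', hF', rfl, rfl⟩ := key (h.isFactor_right hM) (h'.isFactor_right hM)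
    hr₂ hs₂ hd₂ ht₂
  have hEE := hE.prod h hE'
  have hFF := hF.prod h' hF'
  obtain ⟨G, hG, hU, hi⟩ := exists_intertwiner hM hEE.toIsMU hEE.mem hFF
  -- G intertwines products of units; a unit of one factor is the sum of its products with the
  -- diagonal units of the other.
  have h1 : ∀ i j, G * F i j = E i j * G := by
    intro i j
    have : ∀ (E : Fin n → Fin n → Op X) {E' : Fin m → Fin m → Op X}, IsMU E' →
        E i j = ∑ k, E i j * E' k k := fun E _ h => by rw [← Finset.mul_sum, h.one, mul_one]
    rw [this F hF'.toIsMU, this E hE'.toIsMU, Finset.mul_sum, Finset.sum_mul]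
    exact Finset.sum_congr rfl fun k _ => hi (i, k) (j, k)
  have h2 : ∀ i j, G * F' i j = E' i j * G := by
    intro i j
    have : ∀ {E : Fin n → Fin n → Op X} (E' : Fin m → Fin m → Op X), IsMU E →
        E' i j = ∑ k, E k k * E' i j := fun E' h => by rw [← Finset.sum_mul, h.one, one_mul]
    rw [this F' hF.toIsMU, this E' hE.toIsMU, Finset.mul_sum, Finset.sum_mul]
    exact Finset.sum_congr rfl fun k _ => hi (k, i) (k, j)
  have hU' : G * Gᴴ = 1 := mul_eq_one_comm.1 hU
  refine ⟨G, hG, hU, fun x hx => conj_mem_of_intertwiner hE hF hU' h1 hx,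
    fun x hx => conj_mem_of_intertwiner hE' hF' hU' h2 hx, ?_, ?_⟩
  · simp only [Finset.mul_sum, Finset.sum_mul, mul_smul_comm, smul_mul_assoc, h1]
  · simp only [Finset.mul_sum, Finset.sum_mul, mul_smul_comm, smul_mul_assoc, h2]

end Gates

/-! ### The algebras of operators supported on sets of sites -/

section Net
variable {Λ : Type} [Fintype Λ] [DecidableEq Λ] {ι : Type} [Fintype ι] [DecidableEq ι]

/-- The matrix unit `|p⟩⟨q| ⊗ 1` on the sites of `S`. -/
def munit (S : Finset Λ) (p q : Λ → ι) : Op (Λ → ι) :=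
  Matrix.of fun a b => if (∀ i ∈ S, a i = p i) ∧ (∀ i ∈ S, b i = q i) ∧ ∀ i, i ∉ S → a i = b i
    then 1 else 0

theorem munit_mul_apply (S : Finset Λ) (p q : Λ → ι) (x : Op (Λ → ι)) (a b : Λ → ι) :
    (munit S p q * x) a b = if ∀ i ∈ S, a i = p i then x (S.piecewise q a) b else 0 := by
  rw [Matrix.mul_apply, Finset.sum_eq_single (S.piecewise q a)]
  · have h1 : ∀ i ∈ S, S.piecewise q a i = q i := fun i hi => Finset.piecewise_eq_of_mem _ _ _ hi
    have h2 : ∀ i, i ∉ S → a i = S.piecewise q a i :=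
      fun i hi => (Finset.piecewise_eq_of_notMem _ _ _ hi).symm
    simp only [munit, Matrix.of_apply]
    by_cases h : ∀ i ∈ S, a i = p i
    · rw [if_pos ⟨h, h1, h2⟩, if_pos h, one_mul]
    · rw [if_neg (fun h' => h h'.1), if_neg h, zero_mul]
  · intro c _ hc
    simp only [munit, Matrix.of_apply]
    rw [if_neg, zero_mul]
    rintro ⟨-, h1, h2⟩
    apply hc
    ext i
    by_cases hi : i ∈ S
    · rw [Finset.piecewise_eq_of_mem _ _ _ hi, h1 i hi]
    · rw [Finset.piecewise_eq_of_notMem _ _ _ hi, h2 i hi]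
  · simp

theorem munit_conjTranspose (S : Finset Λ) (p q : Λ → ι) : (munit S p q)ᴴ = munit S q p := by
  ext a b
  simp only [munit, Matrix.conjTranspose_apply, Matrix.of_apply]
  rw [apply_ite star, star_one, star_zero]
  refine if_congr ⟨fun h => ⟨h.2.1, h.1, fun i hi => (h.2.2 i hi).symm⟩,
    fun h => ⟨h.2.1, h.1, fun i hi => (h.2.2 i hi).symm⟩⟩ rfl rfl

theorem mul_munit_apply (S : Finset Λ) (p q : Λ → ι) (x : Op (Λ → ι)) (a b : Λ → ι) :
    (x * munit S p q) a b = if ∀ i ∈ S, b i = q i then x a (S.piecewise p b) else 0 := by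
  have h := congrFun (congrFun (Matrix.conjTranspose_mul (munit S q p) xᴴ) a) b
  rw [Matrix.conjTranspose_conjTranspose, munit_conjTranspose, Matrix.conjTranspose_apply,
    munit_mul_apply] at h
  rw [← h]
  split_ifs <;> simp

theorem munit_union {S T : Finset Λ} (h : Disjoint S T) (p q : Λ → ι) :
    munit (S ∪ T) p q = munit S p q * munit T p q := by
  ext a b
  rw [munit_mul_apply]
  simp only [munit, Matrix.of_apply, ← ite_and]
  refine if_congr ⟨fun ⟨h1, h2, h3⟩ => ⟨fun i hi => h1 i (Finset.mem_union_left _ hi), ?_⟩,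
    fun ⟨h1, h2, h3, h4⟩ => ⟨?_, ?_, ?_⟩⟩ rfl rfl
  · refine ⟨fun i hi => ?_, fun i hi => h2 i (Finset.mem_union_right _ hi), fun i hi => ?_⟩
    · rw [Finset.piecewise_eq_of_notMem _ _ _ (Finset.disjoint_right.1 h hi)]
      exact h1 i (Finset.mem_union_right _ hi)
    · by_cases hS : i ∈ S
      · rw [Finset.piecewise_eq_of_mem _ _ _ hS, h2 i (Finset.mem_union_left _ hS)]
      · rw [Finset.piecewise_eq_of_notMem _ _ _ hS]
        exact h3 i (by simp [hS, hi])
  · intro i hi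
    rcases Finset.mem_union.1 hi with hi | hi
    · exact h1 i hi
    · have := h2 i hi
      rwa [Finset.piecewise_eq_of_notMem _ _ _ (Finset.disjoint_right.1 h hi)] at this
  · intro i hi
    rcases Finset.mem_union.1 hi with hi | hi
    · have := h4 i (Finset.disjoint_left.1 h hi)
      rw [Finset.piecewise_eq_of_mem _ _ _ hi] at this
      exact this.symm
    · exact h3 i hi
  · intro i hi
    simp only [Finset.mem_union, not_or] at hi
    have := h4 i hi.2
    rwa [Finset.piecewise_eq_of_notMem _ _ _ hi.1] at this

/-- The star subalgebra of the operators supported on `S`. -/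
def net (S : Finset Λ) : StarSubalgebra ℂ (Op (Λ → ι)) :=
  StarSubalgebra.centralizer ℂ (Set.range fun p : (Λ → ι) × (Λ → ι) => munit Sᶜ p.1 p.2)

theorem mem_net {S : Finset Λ} {x : Op (Λ → ι)} :
    x ∈ net S ↔ ∀ p q, munit Sᶜ p q * x = x * munit Sᶜ p q := by
  rw [net, StarSubalgebra.mem_centralizer_iff]
  constructor
  · intro h p q
    exact (h _ ⟨(p, q), rfl⟩).1
  · rintro h _ ⟨p, rfl⟩
    refine ⟨h _ _, ?_⟩
    rw [Matrix.star_eq_conjTranspose, munit_conjTranspose]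
    exact h _ _

theorem munit_mul_embed_comm {S T : Finset Λ} (hST : S ⊆ T) (p q : Λ → ι) (B : Op (S → ι)) :
    munit Tᶜ p q * embed S B = embed S B * munit Tᶜ p q := by
  ext a b
  rw [munit_mul_apply, mul_munit_apply]
  simp only [embed, LinearMap.coe_mk, AddHom.coe_mk, Matrix.of_apply, ← ite_and]
  have e : ∀ q a : Λ → ι, (fun i : S => Tᶜ.piecewise q a i) = fun i : S => a i := by
    intro q a
    ext i; rw [Finset.piecewise_eq_of_notMem]; simpa using hST i.2
  rw [e, e]
  refine if_congr ?_ rfl rfl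
  have f : ∀ (q a : Λ → ι) (i : Λ), i ∉ T → Tᶜ.piecewise q a i = q i := fun q a i hi =>
    Finset.piecewise_eq_of_mem _ _ _ (by simpa using hi)
  have g : ∀ (q a : Λ → ι) (i : Λ), i ∈ T → Tᶜ.piecewise q a i = a i := fun q a i hi =>
    Finset.piecewise_eq_of_notMem _ _ _ (by simpa using hi)
  constructor
  · rintro ⟨h1, h2⟩
    refine ⟨fun i hi => ?_, fun i hi => ?_⟩
    · rw [Finset.mem_compl] at hi
      rw [← h2 i fun h => hi (hST h), f _ _ i hi]
    · by_cases hT : i ∈ T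
      · rw [g _ _ i hT, ← h2 i hi, g _ _ i hT]
      · rw [f _ _ i hT, h1 i (by simpa using hT)]
  · rintro ⟨h1, h2⟩
    refine ⟨fun i hi => ?_, fun i hi => ?_⟩
    · rw [Finset.mem_compl] at hi
      rw [h2 i fun h => hi (hST h), f _ _ i hi]
    · by_cases hT : i ∈ T
      · rw [g _ _ i hT, h2 i hi, g _ _ i hT]
      · rw [f _ _ i hT, h1 i (by simpa using hT)]

/-- The description as a commutant makes `net S` a star subalgebra from the start; the description
by `embed` is the one used in the statement of the theorem. -/
theorem mem_net_iff [Nonempty ι] {S : Finset Λ} {x : Op (Λ → ι)} : x ∈ net S ↔ x ∈ supported S := by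
  rw [mem_net]
  constructor
  · intro h
    obtain ⟨o⟩ := ‹Nonempty ι›
    let ext : (S → ι) → Λ → ι := fun s i => if h : i ∈ S then s ⟨i, h⟩ else o
    refine ⟨Matrix.of fun s t => x (ext s) (ext t), ?_⟩
    ext a b
    -- Commutation with the unit |o⟩⟨a| outside S: the entry x a b vanishes unless a and b agree
    -- outside S, and otherwise equals the entry in which both are replaced by o there.
    have h1 := congrFun (congrFun (h (fun _ => o) a) (Sᶜ.piecewise (fun _ => o) a)) b
    rw [munit_mul_apply, mul_munit_apply, if_pos, Finset.piecewise_idem_right,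
      Finset.piecewise_same] at h1
    · rw [h1]
      have hext : ∀ a : Λ → ι, ext (fun i => a i) = Sᶜ.piecewise (fun _ => o) a := by
        intro a
        ext i
        by_cases hi : i ∈ S
        · simp [ext, hi]
        · simp [ext, hi]
      simp only [embed, LinearMap.coe_mk, AddHom.coe_mk, Matrix.of_apply, Finset.mem_compl, hext]
      exact if_congr ⟨fun h i hi => (h i hi).symm, fun h i hi => (h i hi).symm⟩ rfl rfl
    · intro i hi
      rw [Finset.piecewise_eq_of_mem _ _ _ hi]
  · rintro ⟨B, rfl⟩ p q
    exact munit_mul_embed_comm subset_rfl p q B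

theorem sm_net [Nonempty ι] (S : Finset Λ) : sm (net (ι := ι) S) = supported S :=
  Submodule.ext fun _ => mem_net_iff

theorem munit_mem [Nonempty ι] (S : Finset Λ) (p q : Λ → ι) : munit S p q ∈ net S := by
  rw [mem_net_iff]
  refine ⟨Matrix.single (fun i => p i) (fun i => q i) 1, ?_⟩
  ext a b
  simp only [embed, LinearMap.coe_mk, AddHom.coe_mk, Matrix.of_apply, munit, Matrix.single,
    ← ite_and]
  refine if_congr ⟨fun ⟨h1, h2, h3⟩ => ⟨fun i hi => (congrFun h2 ⟨i, hi⟩).symm,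
    fun i hi => (congrFun h3 ⟨i, hi⟩).symm, h1⟩, fun ⟨h1, h2, h3⟩ => ⟨h3, ?_, ?_⟩⟩ rfl rfl
  · ext i; exact (h1 i i.2).symm
  · ext i; exact (h2 i i.2).symm

theorem sm_net_eq_span [Nonempty ι] (S : Finset Λ) : sm (net (ι := ι) S)
    = Submodule.span ℂ (Set.range fun p : (Λ → ι) × (Λ → ι) => munit S p.1 p.2) := by
  apply le_antisymm
  · rw [sm_net]
    rintro _ ⟨B, rfl⟩
    obtain ⟨o⟩ := ‹Nonempty ι›
    let ext : (S → ι) → Λ → ι := fun s i => if h : i ∈ S then s ⟨i, h⟩ else o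
    rw [Matrix.matrix_eq_sum_single B, map_sum]
    refine Submodule.sum_mem _ fun s _ => ?_
    rw [map_sum]
    refine Submodule.sum_mem _ fun t _ => ?_
    have : Matrix.single s t (B s t) = B s t • Matrix.single s t (1 : ℂ) := by simp
    rw [this, map_smul]
    refine Submodule.smul_mem _ _ (Submodule.subset_span ⟨(ext s, ext t), ?_⟩)
    ext a b
    simp only [embed, LinearMap.coe_mk, AddHom.coe_mk, Matrix.of_apply, munit, Matrix.single,
      ← ite_and]
    refine if_congr ⟨fun ⟨h1, h2, h3⟩ => ⟨h3, ?_, ?_⟩, fun ⟨h1, h2, h3⟩ =>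
      ⟨fun i hi => ?_, fun i hi => ?_, h1⟩⟩ rfl rfl
    · ext i; rw [h1 i i.2]; simp [ext]
    · ext i; rw [h2 i i.2]; simp [ext]
    · rw [← congrFun h2 ⟨i, hi⟩]; simp [ext, hi]
    · rw [← congrFun h3 ⟨i, hi⟩]; simp [ext, hi]
  · rw [Submodule.span_le]
    rintro _ ⟨p, rfl⟩
    exact munit_mem (ι := ι) S p.1 p.2

variable [Nonempty ι]

theorem net_induction {S : Finset Λ} {P : Op (Λ → ι) → Prop} (h : ∀ p q, P (munit S p q))
    (h0 : P 0) (ha : ∀ x y, P x → P y → P (x + y)) (hs : ∀ (c : ℂ) x, P x → P (c • x))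
    {x : Op (Λ → ι)} (hx : x ∈ net S) : P x := by
  have hx' : x ∈ Submodule.span ℂ
      (Set.range fun p : (Λ → ι) × (Λ → ι) => munit S p.1 p.2) := by
    rw [← sm_net_eq_span]; exact hx
  clear hx
  induction hx' using Submodule.span_induction with
  | mem x hx => obtain ⟨p, rfl⟩ := hx; exact h _ _
  | zero => exact h0
  | add x y _ _ h1 h2 => exact ha _ _ h1 h2
  | smul c x _ h1 => exact hs c x h1

/-- The commutant of the operators supported on `S`. -/
theorem mem_net_compl {S : Finset Λ} {y : Op (Λ → ι)} :
    y ∈ net Sᶜ ↔ ∀ x ∈ net S, x * y = y * x := by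
  constructor
  · intro hy x hx
    rw [mem_net] at hy
    simp only [compl_compl] at hy
    refine net_induction (P := fun x => x * y = y * x) hy (by simp)
      (fun a b ha hb => by rw [add_mul, mul_add, ha, hb])
      (fun c a ha => by rw [smul_mul_assoc, mul_smul_comm, ha]) hx
  · intro h
    rw [mem_net]
    intro p q
    rw [compl_compl]
    exact h _ (munit_mem S p q)

theorem mem_net_iff_comm {S : Finset Λ} {y : Op (Λ → ι)} :
    y ∈ net S ↔ ∀ x ∈ net Sᶜ, x * y = y * x := by
  rw [← mem_net_compl, compl_compl]

theorem net_mono {S T : Finset Λ} (h : S ⊆ T) : net (ι := ι) S ≤ net T := by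
  intro x hx
  obtain ⟨B, rfl⟩ := mem_net_iff.1 hx
  exact mem_net.2 fun p q => munit_mul_embed_comm h p q B

theorem net_comm {S T : Finset Λ} (h : Disjoint S T) {x y : Op (Λ → ι)} (hx : x ∈ net S)
    (hy : y ∈ net T) : x * y = y * x :=
  mem_net_compl.1 (net_mono (Finset.subset_compl_iff_disjoint_left.2 h) hy) x hx

theorem mem_net_union {S T : Finset Λ} (h : Disjoint S T) {x : Op (Λ → ι)} (hx : x ∈ net (S ∪ T)) :
    x ∈ sm (net (ι := ι) S) * sm (net T) := by
  refine net_induction (P := fun x => x ∈ sm (net (ι := ι) S) * sm (net T)) (fun p q => ?_)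
    (zero_mem _) (fun _ _ => add_mem) (fun c _ h => Submodule.smul_mem _ c h) hx
  rw [munit_union h]
  exact Submodule.mul_mem_mul (munit_mem S p q) (munit_mem T p q)

theorem splits_net {S T U : Finset Λ} (h : Disjoint S T) (hU : U = S ∪ T) :
    Splits (net (ι := ι) U) (net S) (net T) := by
  subst hU
  exact ⟨net_mono Finset.subset_union_left, net_mono Finset.subset_union_right,
    fun r hr s hs => net_comm h hr hs, fun x hx => mem_net_union h hx⟩

/-- The algebra of S ∪ T is generated by those of the disjoint sets S and T \ S. -/
theorem mem_net_of_comm_union {S T : Finset Λ} {x : Op (Λ → ι)}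
    (hS : ∀ y ∈ net S, y * x = x * y) (hT : ∀ y ∈ net T, y * x = x * y) :
    x ∈ net (S ∪ T)ᶜ := by
  rw [mem_net_compl]
  intro y hy
  have hd : Disjoint S (T \ S) := Finset.disjoint_sdiff
  rw [← Finset.union_sdiff_self_eq_union] at hy
  exact comm_of_mem_mul hS (fun y hy => hT y (net_mono Finset.sdiff_subset hy)) (mem_net_union hd hy)

theorem net_inf (S T : Finset Λ) : net (ι := ι) S ⊓ net T = net (S ∩ T) := by
  apply le_antisymm
  · rintro x ⟨hS, hT⟩
    have := mem_net_of_comm_union (S := Sᶜ) (T := Tᶜ) (mem_net_iff_comm.1 hS) (mem_net_iff_comm.1 hT)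
    rwa [← Finset.compl_inter, compl_compl] at this
  · exact le_inf (net_mono Finset.inter_subset_left) (net_mono Finset.inter_subset_right)

theorem mem_net_univ (x : Op (Λ → ι)) : x ∈ net Finset.univ := by
  rw [mem_net]
  intro p q
  have : munit (Finset.univᶜ : Finset Λ) p q = 1 := by
    ext a b
    simp [munit, Matrix.one_apply, funext_iff]
  rw [this, one_mul, mul_one]

theorem exists_smul_of_mem_net_empty {x : Op (Λ → ι)} (hx : x ∈ net (∅ : Finset Λ)) :
    ∃ c : ℂ, x = c • 1 := by
  refine net_induction (P := fun x => ∃ c : ℂ, x = c • 1) (fun p q => ⟨1, ?_⟩) ⟨0, by simp⟩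
    (fun x y ⟨a, ha⟩ ⟨b, hb⟩ => ⟨a + b, by rw [ha, hb, add_smul]⟩)
    (fun c x ⟨a, ha⟩ => ⟨c * a, by rw [ha, smul_smul]⟩) hx
  ext a b
  simp [munit, Matrix.one_apply, funext_iff]

theorem isFactor_net (S : Finset Λ) : IsFactor (net (ι := ι) S) := by
  intro z hz hc
  have h : z ∈ net S ⊓ net Sᶜ := ⟨hz, mem_net_compl.2 hc⟩
  rw [net_inf, Finset.inter_compl] at h
  exact exists_smul_of_mem_net_empty h

theorem rdim_net (S : Finset Λ) : rdim (net (ι := ι) S) = Fintype.card ι ^ (2 * S.card) := by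
  have hinj : Function.Injective (embed (ι := ι) S) := by
    intro B C h
    obtain ⟨o⟩ := ‹Nonempty ι›
    let ext : (S → ι) → Λ → ι := fun s i => if h : i ∈ S then s ⟨i, h⟩ else o
    ext s t
    have h1 := congrFun (congrFun h (ext s)) (ext t)
    have e : ∀ s, (fun i : S => ext s i) = s := fun s => by ext i; simp [ext]
    simp only [embed, LinearMap.coe_mk, AddHom.coe_mk, Matrix.of_apply, e] at h1
    rwa [if_pos, if_pos] at h1 <;> intro i hi <;> simp [ext, hi]
  rw [rdim, sm_net, supported, LinearMap.finrank_range_of_inj hinj, Module.finrank_matrix]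
  simp [pow_mul, sq, mul_comm 2, ← mul_pow]

/-- Operators on single sites generate the algebra of S. This is how the single-site condition in
the definition of spreading is extended to intervals. -/
theorem net_biUnion_induction {S : Finset Λ} {A : StarSubalgebra ℂ (Op (Λ → ι))}
    (h : ∀ i ∈ S, net {i} ≤ A) : net S ≤ A := by
  induction S using Finset.induction_on with
  | empty =>
    intro x hx
    obtain ⟨c, rfl⟩ := exists_smul_of_mem_net_empty hx
    exact A.smul_mem (one_mem A) c
  | insert i S hi ih =>
    intro x hx
    rw [Finset.insert_eq] at hx
    refine Submodule.mul_induction_on (mem_net_union (Finset.disjoint_singleton_left.2 hi) hx)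
      (fun r hr s hs => mul_mem (h i (Finset.mem_insert_self _ _) hr)
        (ih (fun j hj => h j (Finset.mem_insert_of_mem hj)) hs)) fun _ _ => add_mem

/-! ### The symmetry operators -/

theorem tensorOp_mul (m n : Λ → Op ι) : tensorOp m * tensorOp n = tensorOp fun i => m i * n i := by
  ext a b
  simp only [tensorOp, Matrix.mul_apply, Matrix.of_apply, ← Finset.prod_mul_distrib]
  exact (Fintype.prod_sum fun i c => m i (a i) c * n i c (b i)).symm

theorem tensorOp_one : tensorOp (fun _ : Λ => (1 : Op ι)) = 1 := by
  ext a b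
  simp only [tensorOp, Matrix.of_apply, Matrix.one_apply]
  rw [Finset.prod_ite_zero]
  simp [funext_iff]

theorem tensorOp_conjTranspose (m : Λ → Op ι) : (tensorOp m)ᴴ = tensorOp fun i => (m i)ᴴ := by
  ext a b
  simp [tensorOp, Matrix.conjTranspose_apply]

theorem tensorOp_trace (m : Λ → Op ι) : (tensorOp m).trace = ∏ i, (m i).trace := by
  simp only [Matrix.trace, tensorOp, Matrix.diag, Matrix.of_apply]
  exact (Fintype.prod_sum fun i c => m i c c).symm

theorem onSites_mul_self {m : Op ι} (hm : m * m = 1) (S : Finset Λ) :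
    onSites S m * onSites S m = 1 := by
  rw [onSites, tensorOp_mul, ← tensorOp_one]
  congr 1; ext i : 1
  split_ifs <;> simp [hm]

theorem onSites_conjTranspose {m : Op ι} (hm : mᴴ = m) (S : Finset Λ) :
    (onSites S m)ᴴ = onSites S m := by
  rw [onSites, tensorOp_conjTranspose]
  congr 1; ext i : 1
  split_ifs <;> simp [hm]

theorem onSites_one (S : Finset Λ) : onSites S (1 : Op ι) = 1 := by
  rw [onSites, ← tensorOp_one]; simp

theorem onSites_empty (m : Op ι) : onSites (∅ : Finset Λ) m = 1 := by
  rw [onSites, ← tensorOp_one]; simp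

theorem onSites_union {S T U : Finset Λ} (h : Disjoint S T) (hU : U = S ∪ T) (m : Op ι) :
    onSites U m = onSites S m * onSites T m := by
  subst hU
  rw [onSites, onSites, onSites, tensorOp_mul]
  congr 1; ext i : 1
  by_cases hS : i ∈ S
  · simp [hS, Finset.disjoint_left.1 h hS]
  · simp [hS]

theorem onSites_mem (S : Finset Λ) (m : Op ι) : onSites S m ∈ net S := by
  rw [mem_net_iff]
  refine ⟨tensorOp fun _ => m, ?_⟩
  ext a b
  simp only [embed, LinearMap.coe_mk, AddHom.coe_mk, Matrix.of_apply, onSites, tensorOp]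
  have : ∀ i, (if i ∈ S then m else 1) (a i) (b i)
      = if i ∈ S then m (a i) (b i) else if a i = b i then 1 else 0 := by
    intro i; split_ifs <;> simp_all [Matrix.one_apply]
  simp_rw [this]
  rw [← Finset.prod_mul_prod_compl S, Finset.prod_congr rfl fun i hi => if_pos hi,
    Finset.prod_congr rfl (s₁ := Sᶜ) fun i hi => if_neg (by simpa using hi),
    Finset.prod_ite_zero, Finset.prod_coe_sort S (fun i => m (a i) (b i))]
  simp

theorem ntr_onSites (S : Finset Λ) (m : Op ι) :
    ntr (onSites S m) = (m.trace / Fintype.card ι) ^ S.card := by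
  have hd : (Fintype.card ι : ℂ) ≠ 0 := by exact_mod_cast Fintype.card_ne_zero
  rw [ntr, onSites, tensorOp_trace, Fintype.card_fun, ← Finset.prod_mul_prod_compl S,
    Finset.prod_congr rfl (fun i hi => congrArg Matrix.trace (if_pos hi)),
    Finset.prod_congr rfl (s₁ := Sᶜ) (fun i hi => congrArg Matrix.trace (if_neg (by simpa using hi))),
    Finset.prod_const, Finset.prod_const, Matrix.trace_one, div_pow,
    ← Finset.card_add_card_compl S, Nat.cast_pow, pow_add]
  field_simp

/-- The part of the global symmetry operator outside S commutes with x and cancels against itself,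
so on `net S` the global symmetry is implemented by an element of `net S`. -/
theorem onSites_conj {m : Op ι} (hm : m * m = 1) (S : Finset Λ) {x : Op (Λ → ι)} (hx : x ∈ net S) :
    onSites Finset.univ m * x * onSites Finset.univ m = onSites S m * x * onSites S m := by
  have h1 : onSites Finset.univ m = onSites S m * onSites Sᶜ m :=
    onSites_union disjoint_compl_right (by simp) m
  have h2 : onSites Sᶜ m * onSites S m = onSites S m * onSites Sᶜ m :=
    (net_comm disjoint_compl_right (onSites_mem S m) (onSites_mem Sᶜ m)).symm
  have h3 : x * onSites Sᶜ m = onSites Sᶜ m * x :=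
    net_comm disjoint_compl_right hx (onSites_mem Sᶜ m)
  rw [h1, show onSites S m * onSites Sᶜ m * x * (onSites S m * onSites Sᶜ m)
    = onSites S m * (onSites Sᶜ m * x) * (onSites S m * onSites Sᶜ m) by simp only [mul_assoc],
    ← h3, ← h2, show onSites S m * (x * onSites Sᶜ m) * (onSites Sᶜ m * onSites S m)
    = onSites S m * x * (onSites Sᶜ m * onSites Sᶜ m) * onSites S m by simp only [mul_assoc],
    onSites_mul_self hm, mul_one]

theorem tw_net {m : Op ι} (hm : m * m = 1) (hms : mᴴ = m) (S : Finset Λ) :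
    tw (onSites Finset.univ m) (net (ι := ι) S) = (m.trace * star m.trace) ^ S.card := by
  have hd : (Fintype.card ι : ℂ) ≠ 0 := by exact_mod_cast Fintype.card_ne_zero
  rw [(isFactor_net S).tw_of_implements (onSites_mem S m), rdim_net, ntr_onSites, ← ntr_onSites]
  · rw [ntr_onSites, star_pow, star_div₀, star_natCast, ← mul_pow, Nat.cast_pow, pow_mul, ← mul_pow]
    congr 1
    field_simp
  · intro r hr
    rw [onSites_conjTranspose hms, onSites_conjTranspose hms]
    exact onSites_conj hm S hr

end Net

/-! ### Automorphisms of the full operator algebra -/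

section Automorphisms
variable {X : Type} [Fintype X] [DecidableEq X]

/-- Automorphisms of the algebra of all operators. -/
abbrev Aut (X : Type) [Fintype X] [DecidableEq X] := Op X ≃⋆ₐ[ℂ] Op X

variable {R S M : StarSubalgebra ℂ (Op X)} (α : Aut X)

theorem aut_conjTranspose (x : Op X) : α xᴴ = (α x)ᴴ := map_star α x

theorem aut_injective : Function.Injective α := EquivLike.injective α

/-- The image of a subalgebra under an automorphism. -/
def img (R : StarSubalgebra ℂ (Op X)) : StarSubalgebra ℂ (Op X) :=
  R.comap (α.symm : Op X →⋆ₐ[ℂ] Op X)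

variable {α}

theorem mem_img {x : Op X} : x ∈ img α R ↔ α.symm x ∈ R := Iff.rfl

theorem apply_mem_img {x : Op X} (hx : x ∈ R) : α x ∈ img α R := by
  rw [mem_img, StarAlgEquiv.symm_apply_apply]; exact hx

theorem apply_mem_img_iff {x : Op X} : α x ∈ img α R ↔ x ∈ R := by
  rw [mem_img, StarAlgEquiv.symm_apply_apply]

theorem exists_of_mem_img {x : Op X} (hx : x ∈ img α R) : ∃ y ∈ R, α y = x :=
  ⟨α.symm x, hx, StarAlgEquiv.apply_symm_apply _ _⟩

theorem img_mono (h : R ≤ S) : img α R ≤ img α S := fun _ hx => h hx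

theorem img_comm (h : ∀ r ∈ R, ∀ s ∈ S, r * s = s * r) :
    ∀ r ∈ img α R, ∀ s ∈ img α S, r * s = s * r := by
  intro r hr s hs
  obtain ⟨r, hr', rfl⟩ := exists_of_mem_img hr
  obtain ⟨s, hs', rfl⟩ := exists_of_mem_img hs
  rw [← map_mul, h r hr' s hs', map_mul]

theorem apply_mem_mul {x : Op X} (hx : x ∈ sm R * sm S) : α x ∈ sm (img α R) * sm (img α S) := by
  refine Submodule.mul_induction_on hx (fun r hr s hs => ?_) fun x y hx hy => ?_
  · rw [map_mul]
    exact Submodule.mul_mem_mul (apply_mem_img (R := R) hr) (apply_mem_img (R := S) hs)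
  · rw [map_add]; exact add_mem hx hy

theorem Splits.img (h : Splits M R S) : Splits (img α M) (img α R) (img α S) := by
  refine ⟨img_mono h.left, img_mono h.right, img_comm h.comm, fun x hx => ?_⟩
  obtain ⟨x, hx', rfl⟩ := exists_of_mem_img hx
  exact apply_mem_mul (h.le x hx')

theorem IsFactor.img (h : IsFactor R) : IsFactor (img α R) := by
  intro z hz hc
  obtain ⟨z, hz', rfl⟩ := exists_of_mem_img hz
  obtain ⟨c, rfl⟩ := h z hz' fun r hr => aut_injective α (by
    rw [map_mul, map_mul]; exact hc _ (apply_mem_img hr))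
  exact ⟨c, by rw [map_smul, map_one]⟩

theorem isFactor_top : IsFactor (⊤ : StarSubalgebra ℂ (Op X)) := by
  intro z _ hc
  obtain ⟨c, hc⟩ := Matrix.mem_range_scalar_of_commute_single
    (fun i j _ => hc (Matrix.single i j 1) StarSubalgebra.mem_top)
  exact ⟨c, by rw [← hc, Matrix.smul_one_eq_diagonal]; rfl⟩

/-- Matrix units of the full algebra are mapped to matrix units with the same index set, and traces
of matrix units depend only on the size of the index set. -/
theorem ntr_aut [Nonempty X] (x : Op X) : ntr (α x) = ntr x := by
  obtain ⟨n, E, hE⟩ := (isFactor_top (X := X)).exists_isMUOf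
  obtain ⟨M, rfl⟩ := hE.exists_toOp (x := x) StarSubalgebra.mem_top
  have hE' : IsMU fun i j => α (E i j) := by
    refine ⟨fun i j k l => ?_, fun i j => ?_, ?_⟩
    · rw [← map_mul, hE.mul]; split_ifs <;> simp
    · rw [← aut_conjTranspose, hE.star]
    · rw [← map_sum, hE.one, map_one]
  simp only [toOp_apply, map_sum, map_smul, ntr_sum, ntr_smul, hE.ntr]
  simp only [hE'.ntr]

theorem isONB_img [Nonempty X] : IsONB (sm (img α R)) fun a => α (bas R a) := by
  refine ⟨fun a b => ?_, le_antisymm ?_ fun x hx => ?_⟩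
  · rw [← aut_conjTranspose, ← map_mul, ntr_aut, (isONB_bas R).orthonormal]
  · rw [Submodule.span_le]
    rintro _ ⟨a, rfl⟩
    exact apply_mem_img (bas_mem R a)
  · obtain ⟨x, hx', rfl⟩ := exists_of_mem_img hx
    rw [(isONB_bas R).expand hx', map_sum]
    refine Submodule.sum_mem _ fun a _ => ?_
    rw [map_smul]
    exact Submodule.smul_mem _ _ (Submodule.subset_span ⟨a, rfl⟩)

theorem tw_img [Nonempty X] {u : Op X} (hu : α u = u) : tw u (img α R) = tw u R := by
  rw [tw_eq_of_isONB u isONB_img, tw]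
  refine Finset.sum_congr rfl fun a _ => ?_
  conv_lhs => rw [← hu]
  rw [← aut_conjTranspose, ← aut_conjTranspose, ← map_mul, ← map_mul, ← map_mul, ntr_aut]

theorem Norm.img {u : Op X} (hu : α u = u) (h : Norm u R) : Norm u (img α R) := by
  intro x hx
  obtain ⟨x, hx', rfl⟩ := exists_of_mem_img hx
  have : u * α x * uᴴ = α (u * x * uᴴ) := by
    rw [map_mul, map_mul, aut_conjTranspose, hu]
  rw [this]
  exact apply_mem_img (h x hx')

theorem Norm.inf {u : Op X} (h : Norm u R) (h' : Norm u S) : Norm u (R ⊓ S) :=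
  fun x hx => ⟨h x hx.1, h' x hx.2⟩

/-- If `M = A ⊗ B` and `A ≤ C ≤ M`, then `C = A ⊗ (C ⊓ B)`. -/
theorem Splits.of_le [Nonempty X] {A B C : StarSubalgebra ℂ (Op X)} (h : Splits M A B)
    (hM : IsFactor M) (hA : A ≤ C) (hC : C ≤ M) : Splits C A (C ⊓ B) := by
  refine ⟨hA, inf_le_left, fun r hr s hs => h.comm r hr s hs.2, fun x hx => ?_⟩
  have hAf := h.isFactor_left hM
  have hx' := h.le x (hC hx)
  rw [expand_left hAf le_rfl h.comm hx']
  refine Submodule.sum_mem _ fun a _ => Submodule.mul_mem_mul (bas_mem A a) ?_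
  have h1 : (bas A a)ᴴ * x ∈ sm A * sm B := h.le _ (mul_mem
    (h.left (conjTranspose_mem (bas_mem A a))) (hC hx))
  exact (C ⊓ B).smul_mem ⟨cas_mem hA (mul_mem (hA (conjTranspose_mem (bas_mem A a))) hx),
    cas_mem_right hAf h.comm h1⟩ _

/-- The automorphism `x ↦ Uᴴ x U`. -/
def ev (U : Op X) (hU : U ∈ Matrix.unitaryGroup X ℂ) : Aut X :=
  Unitary.conjStarAlgAut ℂ (Op X) (star (⟨U, hU⟩ : unitary (Op X)))

theorem ev_apply {U : Op X} (hU : U ∈ Matrix.unitaryGroup X ℂ) (x : Op X) :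
    ev U hU x = Uᴴ * x * U := by
  rw [ev, Unitary.conjStarAlgAut_star_apply]; rfl

theorem ev_symm_apply {U : Op X} (hU : U ∈ Matrix.unitaryGroup X ℂ) (x : Op X) :
    (ev U hU).symm x = U * x * Uᴴ := by
  rw [ev, Unitary.conjStarAlgAut_symm, star_star, Unitary.conjStarAlgAut_apply]; rfl

end Automorphisms

/-! ### Locality of automorphisms and the resulting factorizations -/

section Maps
variable {Λ : Type} [Fintype Λ] [DecidableEq Λ] {ι : Type} [Fintype ι] [DecidableEq ι] [Nonempty ι]
  {α β : Aut (Λ → ι)} {S T S' T' : Finset Λ}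

/-- `α` maps operators supported on `S` to operators supported on `T`. -/
def Maps (α : Aut (Λ → ι)) (S T : Finset Λ) : Prop := ∀ x ∈ net S, α x ∈ net T

/-- Operators on complements are the commutants: what commutes with the image of `net S` is pulled
back to what commutes with `net S`. -/
theorem Maps.symm (h : Maps α S T) : Maps α.symm Tᶜ Sᶜ := by
  intro y hy
  rw [mem_net_compl] at hy ⊢
  intro x hx
  apply aut_injective α
  rw [map_mul, map_mul, StarAlgEquiv.apply_symm_apply]
  exact hy _ (h x hx)

theorem Maps.mono (h : Maps α S T) (hS : S' ⊆ S) (hT : T ⊆ T') : Maps α S' T' :=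
  fun x hx => net_mono hT (h x (net_mono hS hx))

theorem Maps.img_le (h : Maps α S T) : img α (net S) ≤ net T := by
  intro x hx
  obtain ⟨x, hx', rfl⟩ := exists_of_mem_img hx
  exact h x hx'

theorem Maps.le_img (h : Maps α.symm S T) : net S ≤ img α (net T) := fun x hx => h x hx

theorem mem_img_net_iff {x : Op (Λ → ι)} :
    x ∈ img α (net S) ↔ ∀ y ∈ img α (net Sᶜ), y * x = x * y := by
  rw [mem_img, mem_net_iff_comm]
  constructor
  · intro h y hy
    have := congrArg α (h _ hy)
    simpa using this
  · intro h y hy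
    have := congrArg α.symm (h _ (apply_mem_img hy))
    simpa using this

/-- Factorization of the algebra of a window along the images of two adjacent regions. -/
theorem splits_window {P A B Q₁ Q₂ : Finset Λ} (hAB : Disjoint A B) (hP : Maps α.symm P (A ∪ B))
    (hQ : Q₁ ∪ Q₂ = Pᶜ) (h₁ : Maps α B Q₁ᶜ) (h₂ : Maps α A Q₂ᶜ) :
    Splits (net P) (net P ⊓ img α (net A)) (net P ⊓ img α (net B)) := by
  refine splits_of_commutant (N₁ := net Q₁) (N₂ := net Q₂) (isFactor_net A).img (isFactor_net B).img
    (img_comm fun a ha b hb => net_comm hAB ha hb) ?_ ?_ ?_ ?_ ?_ ?_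
  · intro x hx
    have := apply_mem_mul (α := α) (mem_net_union hAB (hP x hx))
    rwa [StarAlgEquiv.apply_symm_apply] at this
  · intro x h1 h2
    have := mem_net_of_comm_union h1 h2
    rwa [hQ, compl_compl] at this
  · intro x hx n hn
    exact mem_net_iff_comm.1 hx n (net_mono (hQ ▸ Finset.subset_union_left) hn)
  · intro x hx n hn
    exact mem_net_iff_comm.1 hx n (net_mono (hQ ▸ Finset.subset_union_right) hn)
  · intro n hn b hb
    exact (mem_net_compl.1 (h₁.img_le hb) n hn).symm
  · intro n hn b hb
    exact (mem_net_compl.1 (h₂.img_le hb) n hn).symm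

/-- Factorization of the image of the algebra of a region along two adjacent windows. -/
theorem splits_region {I E₁ E₂ J₁ J₂ : Finset Λ} (hE : Disjoint E₁ E₂) (hI : Maps α I (E₁ ∪ E₂))
    (hJ : J₁ ∪ J₂ = Iᶜ) (h₁ : Maps α J₁ E₂ᶜ) (h₂ : Maps α J₂ E₁ᶜ) :
    Splits (img α (net I)) (img α (net I) ⊓ net E₁) (img α (net I) ⊓ net E₂) := by
  refine splits_of_commutant (N₁ := img α (net J₁)) (N₂ := img α (net J₂)) (isFactor_net _)
    (isFactor_net _) (fun a ha b hb => net_comm hE ha hb) ?_ ?_ ?_ ?_ ?_ ?_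
  · intro x hx
    exact mem_net_union hE (hI.img_le hx)
  · intro x h1 h2
    rw [mem_img]
    have := mem_net_of_comm_union (x := α.symm x) (S := J₁) (T := J₂) (fun y hy => by
        simpa using congrArg α.symm (h1 _ (apply_mem_img hy)))
      (fun y hy => by simpa using congrArg α.symm (h2 _ (apply_mem_img hy)))
    rwa [hJ, compl_compl] at this
  · intro x hx n hn
    exact mem_img_net_iff.1 hx n (img_mono (net_mono (hJ ▸ Finset.subset_union_left)) hn)
  · intro x hx n hn
    exact mem_img_net_iff.1 hx n (img_mono (net_mono (hJ ▸ Finset.subset_union_right)) hn)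
  · intro n hn b hb
    exact mem_net_compl.1 (h₁.img_le hn) b hb
  · intro n hn b hb
    exact mem_net_compl.1 (h₂.img_le hn) b hb

end Maps

/-! ### Intervals in coordinates and spreading length -/

section Intervals
variable {ℓ : ℕ} [NeZero ℓ]

/-- The interval of the sites at positions `s, …, e - 1`, counted from the site `b`. -/
def iv (b : ZMod ℓ) (s e : ℕ) : Finset (ZMod ℓ) :=
  Finset.univ.filter fun x => s ≤ (x - b).val ∧ (x - b).val < e

theorem mem_iv {b x : ZMod ℓ} {s e : ℕ} : x ∈ iv b s e ↔ s ≤ (x - b).val ∧ (x - b).val < e := by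
  simp [iv]

theorem arc_eq_iv (b : ZMod ℓ) {s n : ℕ} (h : s + n ≤ ℓ) : arc (b + (s : ZMod ℓ)) n = iv b s (s + n) := by
  ext x
  rw [mem_iv]
  simp only [arc, Finset.mem_image, Finset.mem_range]
  constructor
  · rintro ⟨j, hj, rfl⟩
    have : b + (s : ZMod ℓ) + (j : ZMod ℓ) - b = ((s + j : ℕ) : ZMod ℓ) := by push_cast; ring
    rw [this, ZMod.val_natCast, Nat.mod_eq_of_lt (by omega)]
    omega
  · rintro ⟨h1, h2⟩
    refine ⟨(x - b).val - s, by omega, ?_⟩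
    rw [Nat.cast_sub h1, ZMod.natCast_zmod_val]
    ring

theorem iv_shift (b : ZMod ℓ) {k s e : ℕ} (h : k + e ≤ ℓ) (hs : s ≤ e) :
    iv (b + (k : ZMod ℓ)) s e = iv b (k + s) (k + e) := by
  obtain ⟨n, rfl⟩ := Nat.exists_eq_add_of_le hs
  rw [← arc_eq_iv _ (by omega), ← add_assoc k s n, ← arc_eq_iv _ (by omega)]
  push_cast
  rw [add_assoc]

theorem card_iv (b : ZMod ℓ) {s e : ℕ} (h : e ≤ ℓ) : (iv b s e).card = e - s := by
  by_cases hs : s ≤ e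
  · obtain ⟨n, rfl⟩ := Nat.exists_eq_add_of_le hs
    rw [← arc_eq_iv _ h, arc, Finset.card_image_of_injOn, Finset.card_range]
    · omega
    · intro i hi j hj hij
      simp only [Finset.coe_range, Set.mem_Iio] at hi hj
      have := congrArg ZMod.val (add_left_cancel hij)
      rwa [ZMod.val_natCast, ZMod.val_natCast, Nat.mod_eq_of_lt (by omega),
        Nat.mod_eq_of_lt (by omega)] at this
  · rw [Finset.card_eq_zero.2]
    · omega
    · ext x; rw [mem_iv]; simp; omega

/-- A goal about sets of sites is reduced to a goal about positions. -/
theorem iv_subset {b : ZMod ℓ} {s e s' e' : ℕ} (h : s < e → s' ≤ s ∧ e ≤ e') : iv b s e ⊆ iv b s' e' := by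
  intro x hx
  rw [mem_iv] at hx ⊢
  omega

theorem iv_disjoint {b : ZMod ℓ} {s e s' e' : ℕ} (h : e ≤ s' ∨ e' ≤ s) :
    Disjoint (iv b s e) (iv b s' e') := by
  rw [Finset.disjoint_left]
  intro x hx hx'
  rw [mem_iv] at hx hx'
  omega

theorem iv_union {b : ZMod ℓ} {s m e : ℕ} (h : s ≤ m) (h' : m ≤ e) : iv b s e = iv b s m ∪ iv b m e := by
  ext x
  rw [Finset.mem_union, mem_iv, mem_iv, mem_iv]
  omega

variable {ι : Type} [Fintype ι] [DecidableEq ι] [Nonempty ι] {α β : Aut (ZMod ℓ → ι)} {ξ : ℕ}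

/-- `α` has spreading length `ξ`. -/
def Spreads (ξ : ℕ) (α : Aut (ZMod ℓ → ι)) : Prop :=
  ∀ i : ZMod ℓ, Maps α {i} (arc (i - (ξ : ZMod ℓ)) (2 * ξ + 1))

theorem mem_arc_symm {i j : ZMod ℓ} :
    j ∈ arc (i - (ξ : ZMod ℓ)) (2 * ξ + 1) ↔ i ∈ arc (j - (ξ : ZMod ℓ)) (2 * ξ + 1) := by
  have key : ∀ {i j : ZMod ℓ}, j ∈ arc (i - (ξ : ZMod ℓ)) (2 * ξ + 1) →
      i ∈ arc (j - (ξ : ZMod ℓ)) (2 * ξ + 1) := by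
    intro i j h
    simp only [arc, Finset.mem_image, Finset.mem_range] at h ⊢
    obtain ⟨t, ht, rfl⟩ := h
    refine ⟨2 * ξ - t, by omega, ?_⟩
    rw [Nat.cast_sub (by omega)]
    push_cast
    ring
  exact ⟨key, key⟩

/-- If j is farther than ξ from i, then i is outside the spread of j, so an operator on i commutes
with images of operators on j. Hence its preimage commutes with all operators far from i. -/
theorem Spreads.symm (h : Spreads ξ α) : Spreads ξ α.symm := by
  intro i x hx
  rw [mem_net_iff_comm]
  have : net (arc (i - (ξ : ZMod ℓ)) (2 * ξ + 1))ᶜ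
      ≤ StarSubalgebra.centralizer ℂ {α.symm x} := by
    refine net_biUnion_induction fun j hj y hy => ?_
    have hd : Disjoint (arc (j - (ξ : ZMod ℓ)) (2 * ξ + 1)) {i} := by
      rw [Finset.disjoint_singleton_right, ← mem_arc_symm]
      simpa using hj
    have key : ∀ x ∈ net {i}, α.symm x * y = y * α.symm x := by
      intro x hx
      apply aut_injective α
      rw [map_mul, map_mul, StarAlgEquiv.apply_symm_apply]
      exact (net_comm hd (h j y hy) hx).symm
    rw [StarSubalgebra.mem_centralizer_iff]
    rintro _ rfl
    refine ⟨key x hx, ?_⟩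
    rw [← map_star]
    exact key _ (star_mem hx)
  intro y hy
  exact (((StarSubalgebra.mem_centralizer_iff ℂ).1 (this hy)) _ rfl).1.symm

/-- The bounds on s and e keep the enlarged interval from passing the base point b, so that
positions need no reduction modulo ℓ. -/
theorem Spreads.maps_iv (h : Spreads ξ α) (b : ZMod ℓ) {s e : ℕ} (hs : ξ ≤ s) (he : e + ξ ≤ ℓ) :
    Maps α (iv b s e) (iv b (s - ξ) (e + ξ)) := by
  have h1 : net (iv b s e) ≤ img α.symm (net (iv b (s - ξ) (e + ξ))) := by
    refine net_biUnion_induction fun i hi x hx => ?_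
    rw [mem_img, StarAlgEquiv.symm_symm]
    refine net_mono ?_ (h i x hx)
    rw [mem_iv] at hi
    have h2 : i - (ξ : ZMod ℓ) = b + (((i - b).val - ξ : ℕ) : ZMod ℓ) := by
      rw [Nat.cast_sub (by omega), ZMod.natCast_zmod_val]; ring
    rw [h2, arc_eq_iv _ (by omega)]
    exact iv_subset (by omega)
  intro x hx
  have := h1 hx
  rwa [mem_img, StarAlgEquiv.symm_symm] at this

theorem Spreads.mono {ξ' : ℕ} (h : Spreads ξ α) (hξ : ξ ≤ ξ') : Spreads ξ' α := by
  intro i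
  refine (h i).mono subset_rfl ?_
  intro x hx
  simp only [arc, Finset.mem_image, Finset.mem_range] at hx ⊢
  obtain ⟨t, ht, rfl⟩ := hx
  refine ⟨t + (ξ' - ξ), by omega, ?_⟩
  push_cast [Nat.cast_sub hξ]
  ring

theorem Spreads.trans {ξ' : ℕ} (h : Spreads ξ α) (h' : Spreads ξ' β) :
    Spreads (ξ + ξ') (α.trans β) := by
  intro i x hx
  have h1 : net (arc (i - (ξ : ZMod ℓ)) (2 * ξ + 1))
      ≤ img β.symm (net (arc (i - ((ξ + ξ' : ℕ) : ZMod ℓ)) (2 * (ξ + ξ') + 1))) := by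
    refine net_biUnion_induction fun j hj x hx => ?_
    rw [mem_img, StarAlgEquiv.symm_symm]
    refine net_mono ?_ (h' j x hx)
    intro k hk
    simp only [arc, Finset.mem_image, Finset.mem_range] at hj hk ⊢
    obtain ⟨t, ht, rfl⟩ := hj
    obtain ⟨t', ht', rfl⟩ := hk
    refine ⟨t + t', by omega, ?_⟩
    push_cast
    ring
  have := h1 (h i x hx)
  rwa [mem_img, StarAlgEquiv.symm_symm] at this

end Intervals

/-! ### The two factors at a cut -/

section Cuts
variable {ℓ : ℕ} [NeZero ℓ] {ι : Type} [Fintype ι] [DecidableEq ι] [Nonempty ι]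
  {α β : Aut (ZMod ℓ → ι)} {ξ : ℕ}

/-- The part of the image of the algebra to the right of the cut `c` that is supported near `c`. -/
def Lf (ξ : ℕ) (α : Aut (ZMod ℓ → ι)) (c : ZMod ℓ) : StarSubalgebra ℂ (Op (ZMod ℓ → ι)) :=
  net (arc (c - (ξ : ZMod ℓ)) (2 * ξ)) ⊓ img α (net (arc c (2 * ξ)))

/-- The part of the image of the algebra to the left of the cut `c` that is supported near `c`. -/
def Rt (ξ : ℕ) (α : Aut (ZMod ℓ → ι)) (c : ZMod ℓ) : StarSubalgebra ℂ (Op (ZMod ℓ → ι)) :=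
  net (arc (c - (ξ : ZMod ℓ)) (2 * ξ)) ⊓ img α (net (arc (c - ((2 * ξ : ℕ) : ZMod ℓ)) (2 * ξ)))

theorem arc_sub_eq_iv (b : ZMod ℓ) {s k n : ℕ} (hk : k ≤ s) (h : s - k + n ≤ ℓ) :
    arc (b + (s : ZMod ℓ) - (k : ZMod ℓ)) n = iv b (s - k) (s - k + n) := by
  rw [← arc_eq_iv _ h, Nat.cast_sub hk, add_sub_assoc]

theorem Lf_eq (b : ZMod ℓ) {s : ℕ} (h : ξ ≤ s) (h' : s + 2 * ξ ≤ ℓ) :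
    Lf ξ α (b + (s : ZMod ℓ)) = net (iv b (s - ξ) (s + ξ)) ⊓ img α (net (iv b s (s + 2 * ξ))) := by
  rw [Lf, arc_sub_eq_iv b h (by omega), arc_eq_iv b h', show s - ξ + 2 * ξ = s + ξ by omega]

theorem Rt_eq (b : ZMod ℓ) {s : ℕ} (h : 2 * ξ ≤ s) (h' : s + ξ ≤ ℓ) :
    Rt ξ α (b + (s : ZMod ℓ)) = net (iv b (s - ξ) (s + ξ)) ⊓ img α (net (iv b (s - 2 * ξ) s)) := by
  rw [Rt, arc_sub_eq_iv b (by omega) (by omega), arc_sub_eq_iv b h (by omega),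
    show s - ξ + 2 * ξ = s + ξ by omega, show s - 2 * ξ + 2 * ξ = s by omega]

/-- The preimage of the window lies in the 2ξ sites on the left and the 2ξ sites on the right of the
cut. The complement of the window consists of a part Q₁ not reached by images from the right and a
part Q₂ not reached by images from the left, so the factorization along the images applies. -/
theorem splits_cut (hα : Spreads ξ α) (b : ZMod ℓ) {s : ℕ} (h : 3 * ξ ≤ s) (h' : s + 3 * ξ ≤ ℓ) :
    Splits (net (iv b (s - ξ) (s + ξ))) (Rt ξ α (b + (s : ZMod ℓ))) (Lf ξ α (b + (s : ZMod ℓ))) := by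
  rw [Lf_eq b (by omega) (by omega), Rt_eq b (by omega) (by omega)]
  refine splits_window (Q₁ := (iv b (s - ξ) (s + 3 * ξ))ᶜ) (Q₂ := iv b (s + ξ) (s + 3 * ξ))
    (iv_disjoint (by omega)) ?_ ?_ ?_ ?_
  · rw [← iv_union (by omega) (by omega)]
    exact (hα.symm.maps_iv b (by omega) (by omega)).mono subset_rfl (iv_subset (by omega))
  · ext x
    simp only [Finset.mem_union, Finset.mem_compl, mem_iv]
    omega
  · rw [compl_compl]
    exact (hα.maps_iv b (by omega) (by omega)).mono subset_rfl (iv_subset (by omega))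
  · refine (hα.maps_iv b (s := s - 2 * ξ) (e := s) (by omega) (by omega)).mono subset_rfl ?_
    intro x
    simp only [Finset.mem_compl, mem_iv]
    omega

/-- An operator in the window around s has its preimage within 2ξ of s. So only the first 2ξ sites
of the interval matter, and the end of the image of a long interval does not depend on its length.
-/
theorem region_inf_left (hα : Spreads ξ α) (b : ZMod ℓ) {s e : ℕ} (h : 2 * ξ ≤ s)
    (h₁ : s + 2 * ξ ≤ e) (h₂ : e ≤ ℓ) :
    img α (net (iv b s e)) ⊓ net (iv b (s - ξ) (s + ξ)) = Lf ξ α (b + (s : ZMod ℓ)) := by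
  rw [Lf_eq b (by omega) (by omega), inf_comm]
  apply le_antisymm
  · rintro x ⟨h1, h2⟩
    refine ⟨h1, ?_⟩
    have h3 := hα.symm.maps_iv b (by omega) (by omega) x h1
    have h4 : α.symm x ∈ net _ ⊓ net _ := ⟨h3, h2⟩
    rw [net_inf] at h4
    change α.symm x ∈ net _
    refine net_mono ?_ h4
    intro x
    simp only [Finset.mem_inter, mem_iv]
    omega
  · exact inf_le_inf le_rfl (img_mono (net_mono (iv_subset (by omega))))

theorem region_inf_right (hα : Spreads ξ α) (b : ZMod ℓ) {s e : ℕ} 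
    (h₁ : s + 2 * ξ ≤ e) (h₂ : e + 2 * ξ ≤ ℓ) :
    img α (net (iv b s e)) ⊓ net (iv b (e - ξ) (e + ξ)) = Rt ξ α (b + (e : ZMod ℓ)) := by
  rw [Rt_eq b (by omega) (by omega), inf_comm]
  apply le_antisymm
  · rintro x ⟨h1, h2⟩
    refine ⟨h1, ?_⟩
    have h3 := hα.symm.maps_iv b (by omega) (by omega) x h1
    have h4 : α.symm x ∈ net _ ⊓ net _ := ⟨h3, h2⟩
    rw [net_inf] at h4
    change α.symm x ∈ net _
    refine net_mono ?_ h4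
    intro x
    simp only [Finset.mem_inter, mem_iv]
    omega
  · exact inf_le_inf le_rfl (img_mono (net_mono (iv_subset (by omega))))

theorem splits_region_left (hα : Spreads ξ α) (b : ZMod ℓ) {s e : ℕ} (h : 3 * ξ ≤ s)
    (h₁ : s + 2 * ξ ≤ e) (h₂ : e + ξ ≤ ℓ) :
    Splits (img α (net (iv b s e))) (Lf ξ α (b + (s : ZMod ℓ)))
      (img α (net (iv b s e)) ⊓ net (iv b (s + ξ) (e + ξ))) := by
  rw [← region_inf_left hα b (s := s) (e := e) (by omega) h₁ (by omega)]
  refine splits_region (J₁ := iv b (s - 2 * ξ) s) (J₂ := (iv b (s - 2 * ξ) e)ᶜ)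
    (iv_disjoint (by omega)) ?_ ?_ ?_ ?_
  · rw [← iv_union (by omega) (by omega)]
    exact hα.maps_iv b (by omega) (by omega)
  · ext x
    simp only [Finset.mem_union, Finset.mem_compl, mem_iv]
    omega
  · refine (hα.maps_iv b (s := s - 2 * ξ) (e := s) (by omega) (by omega)).mono subset_rfl ?_
    intro x
    simp only [Finset.mem_compl, mem_iv]
    omega
  · have := (hα.symm.maps_iv b (s := s - ξ) (e := s + ξ) (by omega) (by omega)).symm
    rw [StarAlgEquiv.symm_symm] at this
    exact this.mono (Finset.compl_subset_compl.2 (iv_subset (by omega))) subset_rfl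

theorem splits_region_right (hα : Spreads ξ α) (b : ZMod ℓ) {s e : ℕ} (h : ξ ≤ s)
    (h₁ : s + 2 * ξ ≤ e) (h₂ : e + 3 * ξ ≤ ℓ) :
    Splits (img α (net (iv b s e))) (img α (net (iv b s e)) ⊓ net (iv b (s - ξ) (e - ξ)))
      (Rt ξ α (b + (e : ZMod ℓ))) := by
  rw [← region_inf_right hα b (s := s) (e := e) h₁ (by omega)]
  refine splits_region (J₂ := iv b e (e + 2 * ξ)) (J₁ := (iv b s (e + 2 * ξ))ᶜ)
    (iv_disjoint (by omega)) ?_ ?_ ?_ ?_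
  · rw [← iv_union (by omega) (by omega)]
    exact hα.maps_iv b (by omega) (by omega)
  · ext x
    simp only [Finset.mem_union, Finset.mem_compl, mem_iv]
    omega
  · have := (hα.symm.maps_iv b (s := e - ξ) (e := e + ξ) (by omega) (by omega)).symm
    rw [StarAlgEquiv.symm_symm] at this
    exact this.mono (Finset.compl_subset_compl.2 (iv_subset (by omega))) subset_rfl
  · refine (hα.maps_iv b (s := e) (e := e + 2 * ξ) (by omega) (by omega)).mono subset_rfl ?_
    intro x
    simp only [Finset.mem_compl, mem_iv]
    omega

/-- The image of the algebra of an interval consists of a part near the left end, the algebra of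
the middle, and a part near the right end. -/
theorem splits_region_both (hα : Spreads ξ α) (b : ZMod ℓ) {s e : ℕ} (h : 3 * ξ ≤ s)
    (h₁ : s + 2 * ξ ≤ e) (h₂ : e + ξ ≤ ℓ) : ∃ K : StarSubalgebra ℂ (Op (ZMod ℓ → ι)),
    Splits (img α (net (iv b s e))) K (Rt ξ α (b + (e : ZMod ℓ))) ∧
      Splits K (Lf ξ α (b + (s : ZMod ℓ))) (net (iv b (s + ξ) (e - ξ))) := by
  have hl := splits_region_left hα b h h₁ h₂
  -- At the right end 3ξ further sites are required before the base point is reached again; moving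
  -- the base point by 2ξ to the right provides them.
  have hr := splits_region_right hα (b + ((2 * ξ : ℕ) : ZMod ℓ)) (s := s - 2 * ξ) (e := e - 2 * ξ)
    (by omega) (by omega) (by omega)
  have hs : ∀ s e : ℕ, 2 * ξ ≤ s → s ≤ e → e ≤ ℓ →
      iv (b + ((2 * ξ : ℕ) : ZMod ℓ)) (s - 2 * ξ) (e - 2 * ξ) = iv b s e := by
    intro s e h1 h2 h3
    rw [iv_shift b (by omega) (by omega), show 2 * ξ + (s - 2 * ξ) = s by omega,
      show 2 * ξ + (e - 2 * ξ) = e by omega]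
  rw [hs s e (by omega) (by omega) (by omega), show s - 2 * ξ - ξ = s - ξ - 2 * ξ by omega,
    show e - 2 * ξ - ξ = e - ξ - 2 * ξ by omega, hs _ _ (by omega) (by omega) (by omega), add_assoc,
    ← Nat.cast_add, show 2 * ξ + (e - 2 * ξ) = e by omega] at hr
  refine ⟨_, hr, ?_⟩
  have h3 := hl.of_le (C := img α (net (iv b s e)) ⊓ net (iv b (s - ξ) (e - ξ)))
    (isFactor_net _).img (le_inf hl.left ?_) inf_le_left
  · have h4 : img α (net (iv b s e)) ⊓ net (iv b (s - ξ) (e - ξ)) ⊓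
        (img α (net (iv b s e)) ⊓ net (iv b (s + ξ) (e + ξ))) = net (iv b (s + ξ) (e - ξ)) := by
      apply le_antisymm
      · rintro x ⟨⟨-, h5⟩, -, h6⟩
        have : x ∈ net _ ⊓ net _ := ⟨h5, h6⟩
        rw [net_inf] at this
        refine net_mono ?_ this
        intro x
        simp only [Finset.mem_inter, mem_iv]
        omega
      · intro x hx
        have h5 : x ∈ img α (net (iv b s e)) := by
          by_cases hne : s + ξ < e - ξ
          · exact net_mono (iv_subset (by omega)) (hα.symm.maps_iv b (by omega) (by omega) x hx)
          · have hempty : iv b (s + ξ) (e - ξ) = ∅ := by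
              ext x; simp only [mem_iv, Finset.notMem_empty, iff_false]; omega
            rw [hempty] at hx
            obtain ⟨c, rfl⟩ := exists_smul_of_mem_net_empty hx
            exact StarSubalgebra.smul_mem _ (one_mem _) c
        exact ⟨⟨h5, net_mono (iv_subset (by omega)) hx⟩, h5, net_mono (iv_subset (by omega)) hx⟩
    rwa [h4] at h3
  · rw [Lf_eq b (by omega) (by omega)]
    exact inf_le_left.trans (net_mono (iv_subset (by omega)))

end Cuts

/-! ### Twisted dimensions at the cuts -/

section Weights
variable {ℓ : ℕ} [NeZero ℓ] {ι : Type} [Fintype ι] [DecidableEq ι] [Nonempty ι]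
  {α β : Aut (ZMod ℓ → ι)} {ξ : ℕ} {m : Op ι}

/-- The symmetry operator of the whole chain. -/
abbrev sym (ℓ : ℕ) [NeZero ℓ] (m : Op ι) : Op (ZMod ℓ → ι) := onSites Finset.univ m

/-- The squared modulus of the trace of `m`. -/
def kap (m : Op ι) : ℂ := m.trace * star m.trace

theorem isU_onSites {Λ : Type} [Fintype Λ] [DecidableEq Λ] (hm : m * m = 1) (hms : mᴴ = m)
    (S : Finset Λ) : IsU (onSites S m) := by
  rw [IsU, onSites_conjTranspose hms, onSites_mul_self hm]

theorem norm_net {Λ : Type} [Fintype Λ] [DecidableEq Λ] (hm : m * m = 1) (hms : mᴴ = m)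
    (S : Finset Λ) : Norm (onSites Finset.univ m) (net (ι := ι) S) := by
  intro x hx
  rw [onSites_conjTranspose hms, onSites_conj hm S hx]
  exact mul_mem (mul_mem (onSites_mem S m) hx) (onSites_mem S m)

theorem norm_Lf (hm : m * m = 1) (hms : mᴴ = m) (hu : α (sym ℓ m) = sym ℓ m) (c : ZMod ℓ) :
    Norm (sym ℓ m) (Lf ξ α c) :=
  (norm_net hm hms _).inf ((norm_net hm hms _).img hu)

theorem norm_Rt (hm : m * m = 1) (hms : mᴴ = m) (hu : α (sym ℓ m) = sym ℓ m) (c : ZMod ℓ) :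
    Norm (sym ℓ m) (Rt ξ α c) :=
  (norm_net hm hms _).inf ((norm_net hm hms _).img hu)

theorem splits_cut' (hα : Spreads ξ α) (h : 6 * ξ ≤ ℓ) (c : ZMod ℓ) :
    Splits (net (arc (c - (ξ : ZMod ℓ)) (2 * ξ))) (Rt ξ α c) (Lf ξ α c) := by
  have := splits_cut hα (c - ((3 * ξ : ℕ) : ZMod ℓ)) (s := 3 * ξ) le_rfl (by omega)
  rw [sub_add_cancel] at this
  convert this using 2
  rw [← show 3 * ξ - ξ + 2 * ξ = 3 * ξ + ξ by omega, ← arc_eq_iv _ (by omega),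
    show 3 * ξ - ξ = 2 * ξ by omega]
  push_cast
  congr 1
  ring

theorem isFactor_Lf (hα : Spreads ξ α) (h : 6 * ξ ≤ ℓ) (c : ZMod ℓ) : IsFactor (Lf ξ α c) :=
  (splits_cut' hα h c).isFactor_right (isFactor_net _)

theorem isFactor_Rt (hα : Spreads ξ α) (h : 6 * ξ ≤ ℓ) (c : ZMod ℓ) : IsFactor (Rt ξ α c) :=
  (splits_cut' hα h c).isFactor_left (isFactor_net _)

theorem card_arc (a : ZMod ℓ) {n : ℕ} (h : n ≤ ℓ) : (arc a n).card = n := by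
  have := arc_eq_iv a (s := 0) (n := n) (by omega)
  rw [Nat.cast_zero, add_zero] at this
  rw [this, card_iv _ (by omega)]
  omega

theorem tw_cut (hα : Spreads ξ α) (h : 6 * ξ ≤ ℓ) (hm : m * m = 1) (hms : mᴴ = m)
    (hu : α (sym ℓ m) = sym ℓ m) (c : ZMod ℓ) :
    tw (sym ℓ m) (Rt ξ α c) * tw (sym ℓ m) (Lf ξ α c) = kap m ^ (2 * ξ) := by
  rw [← (splits_cut' hα h c).tw (isFactor_Rt hα h c) (isU_onSites hm hms _) (norm_Rt hm hms hu c)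
    (norm_Lf hm hms hu c), tw_net hm hms, card_arc _ (by omega), kap]

theorem tw_region (hα : Spreads ξ α) (hm : m * m = 1) (hms : mᴴ = m)
    (hu : α (sym ℓ m) = sym ℓ m) (b : ZMod ℓ) {s e : ℕ} (h : 3 * ξ ≤ s)
    (h₁ : s + 2 * ξ ≤ e) (h₂ : e + ξ ≤ ℓ) :
    tw (sym ℓ m) (Lf ξ α (b + (s : ZMod ℓ))) * kap m ^ (e - s - 2 * ξ) *
      tw (sym ℓ m) (Rt ξ α (b + (e : ZMod ℓ))) = kap m ^ (e - s) := by
  obtain ⟨K, h1, h2⟩ := splits_region_both hα b h h₁ h₂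
  have hM : IsFactor (img α (net (ι := ι) (iv b s e))) := (isFactor_net _).img
  have hK := h1.isFactor_left hM
  have hKu : Norm (sym ℓ m) K := by
    intro x hx
    refine Submodule.mul_induction_on (h2.le x hx) (fun r hr s hs => ?_) fun x y hx hy => ?_
    · have : sym ℓ m * (r * s) * (sym ℓ m)ᴴ
          = (sym ℓ m * r * (sym ℓ m)ᴴ) * (sym ℓ m * s * (sym ℓ m)ᴴ) := by
        rw [show sym ℓ m * r * (sym ℓ m)ᴴ * (sym ℓ m * s * (sym ℓ m)ᴴ)
          = sym ℓ m * r * ((sym ℓ m)ᴴ * sym ℓ m) * s * (sym ℓ m)ᴴ by simp only [mul_assoc],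
          isU_onSites hm hms]
        simp only [mul_assoc, mul_one]
      rw [this]
      exact mul_mem (h2.left (norm_Lf hm hms hu _ r hr)) (h2.right (norm_net hm hms _ s hs))
    · rw [mul_add, add_mul]; exact add_mem hx hy
  have e1 := h1.tw hK (isU_onSites hm hms Finset.univ) hKu (norm_Rt hm hms hu _)
  have e2 := h2.tw (h2.isFactor_left hK) (isU_onSites hm hms Finset.univ) (norm_Lf hm hms hu _)
    (norm_net hm hms _)
  rw [tw_img hu, tw_net hm hms, card_iv _ (by omega), e2, tw_net hm hms, card_iv _ (by omega)] at e1
  rw [kap, e1]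
  congr 3
  omega

/-- Two intervals with a common left end and with right ends at c and c + 1 are compared. Their
images have the same factor at the left end, which cancels because its weight is nonzero by
`tw_cut`; the additional site contributes `kap m` on both sides. -/
theorem tw_Rt_succ (hα : Spreads ξ α) (h : 6 * ξ + 1 ≤ ℓ) (hm : m * m = 1) (hms : mᴴ = m)
    (hu : α (sym ℓ m) = sym ℓ m) (hk : kap m ≠ 0) (c : ZMod ℓ) :
    tw (sym ℓ m) (Rt ξ α (c + 1)) = tw (sym ℓ m) (Rt ξ α c) := by
  have h1 := tw_region hα hm hms hu (c - ((5 * ξ : ℕ) : ZMod ℓ)) (s := 3 * ξ) (e := 5 * ξ) le_rfl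
    (by omega) (by omega)
  have h2 := tw_region hα hm hms hu (c - ((5 * ξ : ℕ) : ZMod ℓ)) (s := 3 * ξ) (e := 5 * ξ + 1) le_rfl
    (by omega) (by omega)
  have h3 := tw_cut hα (by omega) hm hms hu (c - ((5 * ξ : ℕ) : ZMod ℓ) + ((3 * ξ : ℕ) : ZMod ℓ))
  have hL : tw (sym ℓ m) (Lf ξ α (c - ((5 * ξ : ℕ) : ZMod ℓ) + ((3 * ξ : ℕ) : ZMod ℓ))) ≠ 0 :=
    right_ne_zero_of_mul (h3.trans_ne (pow_ne_zero _ hk))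
  rw [sub_add_cancel, show 5 * ξ - 3 * ξ - 2 * ξ = 0 by omega, pow_zero, mul_one] at h1
  rw [Nat.cast_add, ← add_assoc, sub_add_cancel, Nat.cast_one,
    show 5 * ξ + 1 - 3 * ξ - 2 * ξ = 1 by omega, pow_one,
    show 5 * ξ + 1 - 3 * ξ = (5 * ξ - 3 * ξ) + 1 by omega, pow_succ, ← h1] at h2
  have h4 : tw (sym ℓ m) (Lf ξ α (c - ((5 * ξ : ℕ) : ZMod ℓ) + ((3 * ξ : ℕ) : ZMod ℓ))) * kap m ≠ 0 :=
    mul_ne_zero hL hk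
  exact mul_left_cancel₀ h4 (by rw [h2]; ring)

/-- The weight of the algebra near a cut does not depend on the cut. -/
theorem tw_Rt_const (hα : Spreads ξ α) (h : 6 * ξ + 1 ≤ ℓ) (hm : m * m = 1) (hms : mᴴ = m)
    (hu : α (sym ℓ m) = sym ℓ m) (hk : kap m ≠ 0) (c c' : ZMod ℓ) :
    tw (sym ℓ m) (Rt ξ α c) = tw (sym ℓ m) (Rt ξ α c') := by
  have key : ∀ n : ℕ, tw (sym ℓ m) (Rt ξ α (c' + (n : ZMod ℓ))) = tw (sym ℓ m) (Rt ξ α c') := by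
    intro n
    induction n with
    | zero => simp
    | succ n ih => rw [Nat.cast_succ, ← add_assoc, tw_Rt_succ hα h hm hms hu hk, ih]
  have := key (c - c').val
  rwa [ZMod.natCast_zmod_val, add_sub_cancel] at this

end Weights

/-! ### The GNVW index as a dimension at a cut -/

section OverlapNet
variable {Λ : Type} [Fintype Λ] [DecidableEq Λ] {ι : Type} [Fintype ι] [DecidableEq ι] [Nonempty ι]

/-- The projection to `net B` is the twirl over the complement of B. It does not enlarge the
support, so elements supported on T are projected into `net (B ∩ T)`. -/
theorem overlap_net_inter {B T : Finset Λ} {W : Submodule ℂ (Op (Λ → ι))} (hW : W ≤ sm (net T)) :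
    overlap (sm (net B)) W = overlap (sm (net (B ∩ T))) W := by
  refine overlap_eq_of_proj (net_mono Finset.inter_subset_left) fun w hw =>
    ⟨twirl (net Bᶜ) w, ?_, fun v hv => ?_⟩
  · have h1 := mem_net_of_comm_union (S := Bᶜ) (T := Tᶜ \ Bᶜ) (x := twirl (net Bᶜ) w)
      (fun y hy => mul_twirl hy w) fun y hy => by
        refine twirl_comm (fun r hr => net_comm Finset.disjoint_sdiff hr hy) ?_
        exact mem_net_iff_comm.1 (hW hw) y (net_mono Finset.sdiff_subset hy)
    rwa [Finset.union_sdiff_self_eq_union, ← Finset.compl_inter, compl_compl] at h1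
  · refine ((isFactor_net _).ntr_twirl (fun r hr => ?_) _).symm
    exact mem_net_iff_comm.1 (conjTranspose_mem (R := net B) hv) r hr

theorem overlap_ne_zero {X : Type} [Fintype X] [DecidableEq X] [Nonempty X]
    (R S : StarSubalgebra ℂ (Op X)) : overlap (sm R) (sm S) ≠ 0 := by
  intro h
  have h1 := overlap_sq (V := sm R) (W := sm S)
  rw [h] at h1
  have h2 : ∑ b, ∑ a, ‖ntr ((bas R a)ᴴ * bas S b)‖ ^ 2 = 0 := by
    have : ((0 ^ 2 : ℝ) : ℂ) = 0 := by norm_num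
    rw [this] at h1
    exact_mod_cast h1.symm
  have h3 : ∀ b a, ntr ((bas R a)ᴴ * bas S b) = 0 := by
    intro b a
    have h4 := (Finset.sum_eq_zero_iff_of_nonneg (fun b _ => Finset.sum_nonneg fun a _ =>
      sq_nonneg _)).1 h2 b (Finset.mem_univ _)
    have h5 := (Finset.sum_eq_zero_iff_of_nonneg (fun a _ => sq_nonneg _)).1 h4 a (Finset.mem_univ _)
    simpa using h5
  have hR := (isONB_bas R).expand (one_mem R : (1 : Op X) ∈ R)
  have hS := (isONB_bas S).expand (one_mem S : (1 : Op X) ∈ S)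
  have h6 : ntr ((1 : Op X)ᴴ * 1) = 0 := by
    rw [hR]
    conv_lhs => enter [1, 2]; rw [← hR, hS]
    simp [Matrix.conjTranspose_sum, Finset.sum_mul, Finset.mul_sum, ntr_sum, ntr_smul, h3]
  rw [Matrix.conjTranspose_one, one_mul, ntr_one] at h6
  exact one_ne_zero h6

end OverlapNet

section Index
variable {ℓ : ℕ} [NeZero ℓ] {ι : Type} [Fintype ι] [DecidableEq ι] [Nonempty ι]
  {α β : Aut (ZMod ℓ → ι)} {ξ : ℕ} {m : Op ι}

theorem map_evolve_supported {Λ : Type} [Fintype Λ] [DecidableEq Λ] {U : Op (Λ → ι)}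
    (hU : U ∈ Matrix.unitaryGroup (Λ → ι) ℂ) (S : Finset Λ) :
    (supported S).map (evolve U) = sm (img (ev U hU) (net S)) := by
  ext x
  rw [Submodule.mem_map]
  constructor
  · rintro ⟨y, hy, rfl⟩
    have := apply_mem_img (α := ev U hU) (mem_net_iff.2 hy)
    rw [ev_apply] at this
    exact this
  · intro hx
    obtain ⟨y, hy, rfl⟩ := exists_of_mem_img (mem_sm.1 hx)
    exact ⟨y, mem_net_iff.1 hy, (ev_apply hU y).symm⟩

/-- The ratio of overlaps in terms of the dimension of the algebra near the cut. -/
theorem overlap_ratio (hα : Spreads ξ α) (b : ZMod ℓ) {s e t : ℕ} (hs : ξ ≤ s) (h : s + 2 * ξ ≤ e)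
    (h' : e + 2 * ξ ≤ t) (h₁ : t + ξ ≤ ℓ) (h₂ : 3 * ξ ≤ e) (h₃ : e + 3 * ξ ≤ ℓ) :
    overlap (sm (img α (net (iv b s e)))) (sm (net (iv b e t))) /
      overlap (sm (net (iv b s e))) (sm (img α (net (iv b e t))))
      = Real.sqrt (rdim (Rt ξ α (b + (e : ZMod ℓ)))) / (Fintype.card ι : ℝ) ^ ξ := by
  set R := Rt ξ α (b + (e : ZMod ℓ)) with hR
  set L := Lf ξ α (b + (e : ZMod ℓ)) with hL
  have hcut := splits_cut hα b h₂ h₃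
  rw [← hR, ← hL] at hcut
  have hRf : IsFactor R := hcut.isFactor_left (isFactor_net _)
  have hRP : R ≤ net (iv b (e - ξ) (e + ξ)) := hcut.left
  have hA : img α (net (iv b s e)) ≤ net (iv b (s - ξ) (e + ξ)) :=
    (hα.maps_iv b hs (by omega)).img_le
  have hB : img α (net (iv b e t)) ≤ net (iv b (e - ξ) (t + ξ)) :=
    (hα.maps_iv b (by omega) h₁).img_le
  -- the overlap of the image of the left interval with the right interval
  have hPB : iv b e t ∩ iv b (s - ξ) (e + ξ) = iv b e (e + ξ) := by
    ext x; simp only [Finset.mem_inter, mem_iv]; omega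
  have a1 : overlap (sm (img α (net (iv b s e)))) (sm (net (iv b e t)))
      = overlap (sm (img α (net (iv b s e)))) (sm (net (iv b e (e + ξ)))) := by
    rw [overlap_comm, overlap_net_inter (T := iv b (s - ξ) (e + ξ)) hA, hPB, overlap_comm]
  -- The projection of an operator on [e, e + ξ) to the image of the left interval commutes with the
  -- left tensor factor of that image, which is supported away from it. Hence it lies in the right
  -- tensor factor R.
  have a2 : overlap (sm (img α (net (iv b s e)))) (sm (net (iv b e (e + ξ))))
      = overlap (sm R) (sm (net (iv b e (e + ξ)))) := by
    have hsp := splits_region_right hα b hs h h₃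
    have hf : IsFactor (img α (net (ι := ι) (iv b s e)ᶜ)) := (isFactor_net _).img
    refine overlap_eq_of_proj hsp.right fun w hw =>
      ⟨twirl (img α (net (iv b s e)ᶜ)) w, ?_, fun v hv => ?_⟩
    · have h1 : twirl (img α (net (iv b s e)ᶜ)) w ∈ img α (net (iv b s e)) :=
        mem_img_net_iff.2 fun y hy => mul_twirl hy w
      refine mem_right_of_comm (hsp.isFactor_left (isFactor_net _).img) hsp.comm (hsp.le _ h1)
        fun r hr => twirl_comm (fun y hy => mem_img_net_iff.1 hr.1 y hy) ?_
      exact net_comm (iv_disjoint (by omega)) hr.2 hw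
    · exact (hf.ntr_twirl (fun r hr => mem_img_net_iff.1 (conjTranspose_mem hv) r hr) _).symm
  have a3 : overlap (sm R) (sm (net (iv b e (e + ξ))))
      = overlap (sm (net (iv b (e - ξ) e)ᶜ)) (sm R) := by
    rw [overlap_net_inter (T := iv b (e - ξ) (e + ξ)) hRP, overlap_comm]
    congr 3
    ext x; simp only [Finset.mem_inter, Finset.mem_compl, mem_iv]; omega
  -- the overlap of the left interval with the image of the right interval
  have b1 : overlap (sm (net (iv b s e))) (sm (img α (net (iv b e t))))
      = overlap (sm (img α (net (iv b e t)))) (sm (net (iv b (e - ξ) e))) := by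
    rw [overlap_net_inter (T := iv b (e - ξ) (t + ξ)) hB, overlap_comm]
    congr 3
    ext x; simp only [Finset.mem_inter, mem_iv]; omega
  have b2 : overlap (sm (img α (net (iv b e t)))) (sm (net (iv b (e - ξ) e)))
      = overlap (sm L) (sm (net (iv b (e - ξ) e))) := by
    have hsp := splits_region_left hα b h₂ h' h₁
    have hf : IsFactor (img α (net (ι := ι) (iv b e t)ᶜ)) := (isFactor_net _).img
    refine overlap_eq_of_proj hsp.left fun w hw =>
      ⟨twirl (img α (net (iv b e t)ᶜ)) w, ?_, fun v hv => ?_⟩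
    · have h1 : twirl (img α (net (iv b e t)ᶜ)) w ∈ img α (net (iv b e t)) :=
        mem_img_net_iff.2 fun y hy => mul_twirl hy w
      refine mem_left_of_comm (hsp.isFactor_right (isFactor_net _).img) hsp.comm (hsp.le _ h1)
        fun r hr => twirl_comm (fun y hy => mem_img_net_iff.1 hr.1 y hy) ?_
      exact net_comm (iv_disjoint (by omega)) hr.2 hw
    · exact (hf.ntr_twirl (fun r hr => mem_img_net_iff.1 (conjTranspose_mem hv) r hr) _).symm
  -- Within the window L is the commutant of R. Replacing L by the full commutant R' does not change
  -- the overlap with operators in the window, and makes the duality of `IsFactor.overlap_commutant`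
  -- applicable to R and to the left half of the window.
  set R' : StarSubalgebra ℂ (Op (ZMod ℓ → ι)) := StarSubalgebra.centralizer ℂ (R : Set _) with hR'
  have hR'm : ∀ x, x ∈ R' ↔ ∀ r ∈ R, r * x = x * r := by
    intro x
    rw [hR', StarSubalgebra.mem_centralizer_iff]
    exact ⟨fun h r hr => (h r hr).1, fun h r hr => ⟨h r hr, h _ (star_mem hr)⟩⟩
  have b3 : overlap (sm R') (sm (net (iv b (e - ξ) e)))
      = overlap (sm L) (sm (net (iv b (e - ξ) e))) := by
    refine overlap_eq_of_proj (fun x hx => (hR'm x).2 fun r hr => hcut.comm r hr x hx) fun w hw =>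
      ⟨twirl R w, ?_, fun v hv => ?_⟩
    · have h1 : ∀ r ∈ R, r * twirl R w = twirl R w * r := fun r hr => mul_twirl hr w
      refine mem_right_of_comm hRf hcut.comm (hcut.le _ ?_) h1
      rw [mem_net_iff_comm]
      intro y hy
      refine twirl_comm (fun r hr => (mem_net_compl.1 hy r (hRP hr))) ?_
      exact (mem_net_compl.1 hy w (net_mono (iv_subset (by omega)) hw)).symm
    · exact (hRf.ntr_twirl (fun r hr => (hR'm _).1 (conjTranspose_mem hv) r hr) _).symm
  have key := hRf.overlap_commutant (isFactor_net (ι := ι) (iv b (e - ξ) e)) hR'm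
    (S' := net (iv b (e - ξ) e)ᶜ) fun x => mem_net_compl
  rw [rdim_net, card_iv _ (by omega), show e - (e - ξ) = ξ by omega] at key
  rw [a1, a2, a3, b1, b2, ← b3]
  set x := overlap (sm (net (ι := ι) (iv b (e - ξ) e)ᶜ)) (sm R) with hx
  set y := overlap (sm R') (sm (net (ι := ι) (iv b (e - ξ) e))) with hy
  have hx0 : 0 ≤ x := overlap_nonneg
  have hy0 : 0 < y := lt_of_le_of_ne overlap_nonneg (overlap_ne_zero _ _).symm
  have hd : (0 : ℝ) < (Fintype.card ι : ℝ) ^ ξ := by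
    have : (0 : ℝ) < Fintype.card ι := by exact_mod_cast Fintype.card_pos
    positivity
  rw [div_eq_div_iff hy0.ne' hd.ne']
  rw [← sq_eq_sq₀ (by positivity) (by positivity), mul_pow, mul_pow, Real.sq_sqrt (by positivity), key]
  push_cast
  ring

variable {U : Op (ZMod ℓ → ι)}

theorem gnvw_eq (hU : U ∈ Matrix.unitaryGroup (ZMod ℓ → ι) ℂ) (hα : Spreads ξ (ev U hU)) (a : ZMod ℓ)
    {k n : ℕ} (hk : 2 * ξ ≤ k) (hn : 2 * ξ ≤ n) (h : k + n + 4 * ξ ≤ ℓ) :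
    gnvw U (arc a k) (arc (a + (k : ZMod ℓ)) n)
      = Real.sqrt (rdim (Rt ξ (ev U hU) (a + (k : ZMod ℓ)))) / (Fintype.card ι : ℝ) ^ ξ := by
  have ha : a = (a - ((2 * ξ : ℕ) : ZMod ℓ)) + ((2 * ξ : ℕ) : ZMod ℓ) := by ring
  have ha' : a + (k : ZMod ℓ) = (a - ((2 * ξ : ℕ) : ZMod ℓ)) + ((2 * ξ + k : ℕ) : ZMod ℓ) := by
    push_cast; ring
  rw [ha']
  conv_lhs => rw [ha]
  rw [arc_eq_iv _ (by omega), arc_eq_iv _ (by omega), gnvw, map_evolve_supported hU,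
    map_evolve_supported hU, ← sm_net, ← sm_net, sub_add_cancel]
  exact overlap_ratio hα _ (by omega) (by omega) (by omega) (by omega) (by omega) (by omega)

end Index

/-! ### Involutions that implement the symmetry on a factor -/

section Impl
variable {X : Type} [Fintype X] [DecidableEq X] {R S M : StarSubalgebra ℂ (Op X)} {u v w : Op X}
  {α : Aut X}

/-- The involution `v` belongs to `R` and acts on `R` by conjugation in the same way as `u`. -/
structure Impl (u : Op X) (R : StarSubalgebra ℂ (Op X)) (v : Op X) : Prop where
  mem : v ∈ R
  sq : v * v = 1
  star : vᴴ = v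
  conj : ∀ r ∈ R, v * r * v = u * r * u

theorem Impl.neg (h : Impl u R v) : Impl u R (-v) :=
  ⟨neg_mem h.mem, by rw [neg_mul_neg, h.sq], by rw [Matrix.conjTranspose_neg, h.star],
    fun r hr => by rw [neg_mul, neg_mul_neg, h.conj r hr]⟩

theorem Impl.mul (hs : Splits M R S) (hu : u * u = 1) (h : Impl u R v) (h' : Impl u S w) :
    Impl u M (v * w) := by
  have hc := hs.comm v h.mem w h'.mem
  refine ⟨mul_mem (hs.left h.mem) (hs.right h'.mem), ?_, ?_, fun x hx => ?_⟩
  · rw [mul_assoc, ← mul_assoc w, ← hc, mul_assoc v, h'.sq, mul_one, h.sq]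
  · rw [Matrix.conjTranspose_mul, h.star, h'.star, hc]
  · refine Submodule.mul_induction_on (hs.le x hx) (fun r hr s hs' => ?_) fun x y hx hy => ?_
    · have h1 := hs.comm r hr w h'.mem
      have h2 := hs.comm v h.mem _ (mul_mem hs' h'.mem)
      calc v * w * (r * s) * (v * w) = v * (w * r) * s * (v * w) := by simp only [mul_assoc]
        _ = v * r * (w * (s * (w * v))) := by rw [← h1, hc]; simp only [mul_assoc]
        _ = v * r * (w * ((s * w) * v)) := by simp only [mul_assoc]
        _ = v * r * (w * v * (s * w)) := by rw [← h2]; simp only [mul_assoc]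
        _ = (v * r * v) * (w * s * w) := by rw [← hc]; simp only [mul_assoc]
        _ = u * r * (u * u) * s * u := by rw [h.conj r hr, h'.conj s hs']; simp only [mul_assoc]
        _ = u * (r * s) * u := by rw [hu, mul_one]; simp only [mul_assoc]
    · simp only [mul_add, add_mul, hx, hy]

theorem Impl.img (hα : α u = u) (h : Impl u R v) : Impl u (img α R) (α v) := by
  refine ⟨apply_mem_img h.mem, by rw [← map_mul, h.sq, map_one], by
    rw [← aut_conjTranspose, h.star], fun x hx => ?_⟩
  obtain ⟨r, hr, rfl⟩ := exists_of_mem_img hx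
  rw [← map_mul, ← map_mul, h.conj r hr, map_mul, map_mul, hα]

variable [Nonempty X]

theorem IsFactor.exists_impl (hR : IsFactor R) (hu : u * u = 1) (hus : uᴴ = u) (hn : Norm u R) :
    ∃ v, Impl u R v := by
  obtain ⟨v, hv, h1, h2, h3⟩ := hR.exists_implements_involution hu hus hn
  exact ⟨v, hv, h1, h2, fun r hr => by rw [h3 r hr, mul_assoc, h1, mul_one]⟩

/-- The product v w acts trivially on the factor R, so it is a scalar, and its square is one. -/
theorem Impl.unique (hR : IsFactor R) (h : Impl u R v) (h' : Impl u R w) : w = v ∨ w = -v := by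
  obtain ⟨c, hc⟩ := hR (v * w) (mul_mem h.mem h'.mem) fun r hr => by
    have h1 := (h.conj r hr).trans (h'.conj r hr).symm
    calc r * (v * w) = v * v * r * v * w := by rw [h.sq, one_mul, mul_assoc]
      _ = v * (v * r * v) * w := by simp only [mul_assoc]
      _ = v * w * r := by rw [h1]; simp only [mul_assoc, h'.sq, mul_one]
  have hw : w = c • v := by
    rw [← one_mul w, ← h.sq, mul_assoc, hc, mul_smul_comm, mul_one]
  have hcc : c * c = 1 := by
    have := h'.sq
    rw [hw, smul_mul_smul_comm, h.sq] at this
    have := congrArg ntr this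
    rwa [ntr_smul_one, ntr_one] at this
  rcases mul_self_eq_one_iff.1 hcc with rfl | rfl
  · left; rw [hw, one_smul]
  · right; rw [hw, neg_smul, one_smul]

theorem Impl.tw (hR : IsFactor R) (hus : uᴴ = u) (h : Impl u R v) :
    tw u R = ((rdim R * ‖ntr v‖ ^ 2 : ℝ) : ℂ) := by
  rw [hR.tw_of_implements h.mem fun r hr => by rw [hus, h.star, h.conj r hr]]
  push_cast
  rw [← Complex.mul_conj']
  rfl

end Impl

section Chain
variable {ℓ : ℕ} [NeZero ℓ] {ι : Type} [Fintype ι] [DecidableEq ι] [Nonempty ι]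
  {α β : Aut (ZMod ℓ → ι)} {ξ : ℕ} {m : Op ι}

theorem impl_net {Λ : Type} [Fintype Λ] [DecidableEq Λ] (hm : m * m = 1) (hms : mᴴ = m)
    (S : Finset Λ) : Impl (onSites Finset.univ m) (net S) (onSites S m) :=
  ⟨onSites_mem S m, onSites_mul_self hm S, onSites_conjTranspose hms S,
    fun _ hr => (onSites_conj hm S hr).symm⟩

theorem sym_sq (hm : m * m = 1) : sym ℓ m * sym ℓ m = 1 := onSites_mul_self hm _

/-- The image of the symmetry operator of an interval differs from the symmetry operator of a
smaller interval by involutions near the ends. -/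
theorem exists_boundary (hα : Spreads ξ α) (hm : m * m = 1) (hms : mᴴ = m)
    (hu : α (sym ℓ m) = sym ℓ m) (b : ZMod ℓ) {s e : ℕ} (h : 3 * ξ ≤ s)
    (h₁ : s + 2 * ξ ≤ e) (h₂ : e + ξ ≤ ℓ) :
    ∃ v v', Impl (sym ℓ m) (Lf ξ α (b + (s : ZMod ℓ))) v ∧
      Impl (sym ℓ m) (Rt ξ α (b + (e : ZMod ℓ))) v' ∧
      α (onSites (iv b s e) m) = v * onSites (iv b (s + ξ) (e - ξ)) m * v' := by
  obtain ⟨K, h1, h2⟩ := splits_region_both hα b h h₁ h₂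
  have hM : IsFactor (img α (net (ι := ι) (iv b s e))) := (isFactor_net _).img
  have hK := h1.isFactor_left hM
  obtain ⟨v, hv⟩ := (h2.isFactor_left hK).exists_impl (sym_sq hm)
    (onSites_conjTranspose hms _) (norm_Lf hm hms hu _)
  obtain ⟨v', hv'⟩ := (h1.isFactor_right hM).exists_impl (sym_sq hm)
    (onSites_conjTranspose hms _) (norm_Rt hm hms hu _)
  have h3 := (hv.mul h2 (sym_sq hm) (impl_net hm hms _)).mul h1 (sym_sq hm) hv'
  -- Both operators implement the symmetry on the image of the interval, so they agree up to a sign,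
  -- which is absorbed into the left involution.
  rcases h3.unique hM ((impl_net hm hms _).img hu) with h4 | h4
  · exact ⟨v, v', hv, hv', h4⟩
  · exact ⟨-v, v', hv.neg, hv', by rw [h4]; simp only [neg_mul]⟩

/-- The normalized square root of the weight of the algebra near a cut. For `m = 1` it is the GNVW
index. -/
def idx (m : Op ι) (ξ : ℕ) (α : Aut (ZMod ℓ → ι)) : ℝ :=
  Real.sqrt ‖tw (sym ℓ m) (Rt ξ α 0)‖ / ‖m.trace‖ ^ ξ

theorem sym_one : sym ℓ (1 : Op ι) = 1 := onSites_one _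

theorem kap_ne_zero (h : m.trace ≠ 0) : kap m ≠ 0 := mul_ne_zero h (star_ne_zero.2 h)

theorem trace_one_ne_zero : (1 : Op ι).trace ≠ 0 := by
  rw [Matrix.trace_one]; exact_mod_cast Fintype.card_ne_zero

theorem idx_eq (hα : Spreads ξ α) (h : 6 * ξ + 1 ≤ ℓ) (hm : m * m = 1) (hms : mᴴ = m)
    (hu : α (sym ℓ m) = sym ℓ m) (hk : m.trace ≠ 0) (c : ZMod ℓ) :
    idx m ξ α = Real.sqrt ‖tw (sym ℓ m) (Rt ξ α c)‖ / ‖m.trace‖ ^ ξ := by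
  rw [idx, tw_Rt_const hα h hm hms hu (kap_ne_zero hk) 0 c]

theorem idx_one_eq (hα : Spreads ξ α) (h : 6 * ξ + 1 ≤ ℓ) (c : ZMod ℓ) :
    idx 1 ξ α = Real.sqrt (rdim (Rt ξ α c)) / (Fintype.card ι : ℝ) ^ ξ := by
  rw [idx_eq hα h (mul_one _) Matrix.conjTranspose_one (by rw [sym_one, map_one])
    trace_one_ne_zero c, sym_one, tw_one, Matrix.trace_one]
  simp

/-- A representation of `ℤ₂` by an involution. -/
def involutionHom {G : Type*} [Group G] (V : G) (hV : V * V = 1) : Z2 →* G :=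
  MonoidHom.mk' (fun g => if g = 1 then 1 else V) fun a b => by
    have key : ∀ g : Z2, g = 1 ∨ g = gen := by decide
    have h1 : gen ≠ 1 := by decide
    have h2 : gen * gen = (1 : Z2) := by decide
    rcases key a with rfl | rfl <;> rcases key b with rfl | rfl <;> simp [h1, h2, hV]

theorem involutionHom_gen {G : Type*} [Group G] (V : G) (hV : V * V = 1) :
    involutionHom V hV gen = V := by
  simp only [involutionHom, MonoidHom.mk'_apply]
  exact if_neg (by decide)

theorem z2_cases (g : Z2) : g = 1 ∨ g = gen := by revert g; decide

end Chain

/-! ### The symmetry index -/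

section SPI
variable {ℓ : ℕ} [NeZero ℓ] {ι : Type} [Fintype ι] [DecidableEq ι] [Nonempty ι]
  {ξ : ℕ} {μ : Z2 → Op ι} {U : Op (ZMod ℓ → ι)}

/-- The hypotheses on the on-site representation. -/
structure IsRep (μ : Z2 → Op ι) : Prop where
  one : μ 1 = 1
  sq : μ gen * μ gen = 1
  star : (μ gen)ᴴ = μ gen

theorem spi_frame (a : ZMod ℓ) {n : ℕ} (h : 2 * n + 4 * ξ ≤ ℓ) :
    arc a (2 * n) = iv (a - ((3 * ξ : ℕ) : ZMod ℓ)) (3 * ξ) (3 * ξ + 2 * n) ∧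
    arc (a - (ξ : ZMod ℓ)) (ξ + n) = iv (a - ((3 * ξ : ℕ) : ZMod ℓ)) (2 * ξ) (3 * ξ + n) ∧
    arc (a + (n : ZMod ℓ)) (n + ξ) = iv (a - ((3 * ξ : ℕ) : ZMod ℓ)) (3 * ξ + n) (4 * ξ + 2 * n) ∧
    arc (a + (n : ZMod ℓ)) n = iv (a - ((3 * ξ : ℕ) : ZMod ℓ)) (3 * ξ + n) (3 * ξ + 2 * n) := by
  refine ⟨?_, ?_, ?_, ?_⟩
  · rw [← arc_eq_iv _ (by omega)]; congr 1; push_cast; ring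
  · rw [show 3 * ξ + n = 2 * ξ + (ξ + n) by omega, ← arc_eq_iv _ (by omega)]
    congr 1; push_cast; ring
  · rw [show 4 * ξ + 2 * n = 3 * ξ + n + (n + ξ) by omega, ← arc_eq_iv _ (by omega)]
    congr 1; push_cast; ring
  · rw [show 3 * ξ + 2 * n = 3 * ξ + n + n by omega, ← arc_eq_iv _ (by omega)]
    congr 1; push_cast; ring

/-- The image of the symmetry operator of an interval factorizes, and the right factor has the
expected trace. -/
theorem exists_restriction (hμ : IsRep μ) (hU : U ∈ Matrix.unitaryGroup (ZMod ℓ → ι) ℂ)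
    (hα : Spreads ξ (ev U hU)) (hu : ev U hU (sym ℓ (μ gen)) = sym ℓ (μ gen))
    (hk : (μ gen).trace ≠ 0) (h6 : 6 * ξ + 1 ≤ ℓ)
    (a : ZMod ℓ) {n : ℕ} (hn : ξ ≤ n) (h : 2 * n + 4 * ξ ≤ ℓ) :
    ∃ L R, IsRestriction μ ξ U a n L R ∧
      idx (μ gen) ξ (ev U hU) = idx 1 ξ (ev U hU) * ‖(R gen : Op (ZMod ℓ → ι)).trace /
        (onSites (arc (a + (n : ZMod ℓ)) n) (μ gen)).trace‖ := by
  obtain ⟨e1, e2, e3, e4⟩ := spi_frame (ξ := ξ) a h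
  obtain ⟨hm1, hm, hms⟩ := hμ
  set m := μ gen with hmdef
  set b := a - ((3 * ξ : ℕ) : ZMod ℓ) with hb
  obtain ⟨v, v', hv, hv', hvv⟩ := exists_boundary hα hm hms hu b (s := 3 * ξ) (e := 3 * ξ + 2 * n)
    le_rfl (by omega) (by omega)
  have hvm : v ∈ net (iv b (2 * ξ) (4 * ξ)) := by
    have := hv.mem
    rw [Lf_eq b (by omega) (by omega)] at this
    exact net_mono (iv_subset (by omega)) this.1
  have hvm' : v' ∈ net (iv b (2 * ξ + 2 * n) (4 * ξ + 2 * n)) := by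
    have := hv'.mem
    rw [Rt_eq b (by omega) (by omega)] at this
    exact net_mono (iv_subset (by omega)) this.1
  -- The symmetry operator of the bulk is cut at the midpoint of I. Its halves together with the
  -- involutions at the two ends give L and R.
  set uL := onSites (iv b (4 * ξ) (3 * ξ + n)) m with huL
  set uR := onSites (iv b (3 * ξ + n) (2 * ξ + 2 * n)) m with huR
  have humid : onSites (iv b (3 * ξ + ξ) (3 * ξ + 2 * n - ξ)) m = uL * uR := by
    rw [huL, huR, ← onSites_union (iv_disjoint (by omega)) (iv_union (by omega) (by omega))]
    congr 2 <;> omega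
  have hLL : ∀ (x : Op (ZMod ℓ → ι)), x * x = 1 → xᴴ = x → x ∈ Matrix.unitaryGroup _ ℂ :=
    fun x h h' => by rw [Matrix.mem_unitaryGroup_iff, Matrix.star_eq_conjTranspose, h', h]
  have key : ∀ x y : Op (ZMod ℓ → ι), x * y = y * x → x * x = 1 → y * y = 1 → xᴴ = x → yᴴ = y →
      (x * y) * (x * y) = 1 ∧ (x * y)ᴴ = x * y := by
    intro x y hc hx hy hxs hys
    refine ⟨?_, by rw [Matrix.conjTranspose_mul, hxs, hys, hc]⟩
    rw [mul_assoc, ← mul_assoc y, ← hc, mul_assoc x, hy, mul_one, hx]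
  have hL := key v uL (net_comm (iv_disjoint (by omega)) hvm (onSites_mem _ _)) hv.sq
    (onSites_mul_self hm _) hv.star (onSites_conjTranspose hms _)
  have hR := key uR v' (net_comm (iv_disjoint (by omega)) (onSites_mem _ _) hvm')
    (onSites_mul_self hm _) hv'.sq (onSites_conjTranspose hms _) hv'.star
  have hLm : v * uL ∈ net (iv b (2 * ξ) (3 * ξ + n)) :=
    mul_mem (net_mono (iv_subset (by omega)) hvm)
      (net_mono (iv_subset (by omega)) (onSites_mem _ _))
  have hRm : uR * v' ∈ net (iv b (3 * ξ + n) (4 * ξ + 2 * n)) :=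
    mul_mem (net_mono (iv_subset (by omega)) (onSites_mem _ _))
      (net_mono (iv_subset (by omega)) hvm')
  refine ⟨involutionHom ⟨_, hLL _ hL.1 hL.2⟩ (Subtype.ext hL.1),
    involutionHom ⟨_, hLL _ hR.1 hR.2⟩ (Subtype.ext hR.1), ⟨fun g => ?_, fun g => ?_, fun g => ?_⟩, ?_⟩
  · rw [e2, ← mem_net_iff]
    rcases z2_cases g with rfl | rfl
    · rw [map_one]; exact one_mem _
    · rw [involutionHom_gen]; exact hLm
  · rw [e3, ← mem_net_iff]
    rcases z2_cases g with rfl | rfl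
    · rw [map_one]; exact one_mem _
    · rw [involutionHom_gen]; exact hRm
  · rcases z2_cases g with rfl | rfl
    · rw [map_one, map_one, hm1, onSites_one]
      change Uᴴ * 1 * U = 1 * 1
      rw [mul_one, mul_one]
      exact Matrix.mem_unitaryGroup_iff'.1 hU
    · rw [involutionHom_gen, involutionHom_gen, e1]
      change Uᴴ * onSites _ m * U = v * uL * (uR * v')
      rw [← ev_apply hU, hvv, humid]
      simp only [mul_assoc]
  · rw [involutionHom_gen]
    change _ = _ * ‖(uR * v').trace / _‖
    have hcard : ((Fintype.card (ZMod ℓ → ι) : ℕ) : ℂ) ≠ 0 := by exact_mod_cast Fintype.card_ne_zero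
    rw [← div_div_div_cancel_right₀ hcard]
    change _ = _ * ‖ntr (uR * v') / ntr (onSites _ m)‖
    have hRf := isFactor_Rt hα (by omega) (b + ((3 * ξ + 2 * n : ℕ) : ZMod ℓ))
    rw [(isFactor_net (iv b (3 * ξ + n) (2 * ξ + 2 * n))).ntr_mul (onSites_mem _ _)
      (fun r hr => net_comm (iv_disjoint (by omega)) hr hvm'), ntr_onSites, ntr_onSites,
      card_arc _ (by omega), card_iv _ (by omega),
      idx_eq hα h6 hm hms hu hk (b + ((3 * ξ + 2 * n : ℕ) : ZMod ℓ)),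
      idx_one_eq hα h6 (b + ((3 * ξ + 2 * n : ℕ) : ZMod ℓ)),
      hv'.tw hRf (onSites_conjTranspose hms _), Complex.norm_real, Real.norm_of_nonneg (by positivity),
      Real.sqrt_mul (by positivity), Real.sqrt_sq (norm_nonneg _)]
    have hk' : ‖m.trace‖ ≠ 0 := norm_ne_zero_iff.2 hk
    have hd : (Fintype.card ι : ℝ) ≠ 0 := by exact_mod_cast Fintype.card_ne_zero
    obtain ⟨k, rfl⟩ := Nat.exists_eq_add_of_le hn
    -- The n - ξ bulk sites in R contribute the factor |χ/d|^(n-ξ), and the involution at the end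
    -- contributes the square root of the ratio of the twisted dimension and the dimension. Division
    -- by |χ/d|^n leaves the quotient of the two indices.
    rw [show 2 * ξ + 2 * (ξ + k) - (3 * ξ + (ξ + k)) = k by omega]
    simp only [norm_div, norm_mul, norm_pow, Complex.norm_natCast, div_pow, pow_add]
    field_simp

/-- For two restrictions L'†L = R'R† is supported on both sides of the midpoint, hence is a scalar
of modulus one. So the absolute value of the trace does not depend on the choice. -/
theorem norm_trace_restriction {a : ZMod ℓ} {n : ℕ} (h : 2 * n + 4 * ξ ≤ ℓ)
    {L R L' R' : Z2 →* Matrix.unitaryGroup (ZMod ℓ → ι) ℂ}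
    (h1 : IsRestriction μ ξ U a n L R) (h2 : IsRestriction μ ξ U a n L' R') (g : Z2) :
    ‖(R g : Op (ZMod ℓ → ι)).trace‖ = ‖(R' g : Op (ZMod ℓ → ι)).trace‖ := by
  obtain ⟨e1, e2, e3, e4⟩ := spi_frame (ξ := ξ) a h
  have hl := h1.left g
  have hr := h1.right g
  have hl' := h2.left g
  have hr' := h2.right g
  have he := (h1.eq g).symm.trans (h2.eq g)
  rw [e2, ← mem_net_iff] at hl hl'
  rw [e3, ← mem_net_iff] at hr hr'
  have uL' : (L' g : Op (ZMod ℓ → ι))ᴴ * L' g = 1 := Matrix.mem_unitaryGroup_iff'.1 (L' g).2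
  have uR : (R g : Op (ZMod ℓ → ι)) * (R g : Op (ZMod ℓ → ι))ᴴ = 1 := Matrix.mem_unitaryGroup_iff.1 (R g).2
  have uR1 : (R g : Op (ZMod ℓ → ι))ᴴ * (R g : Op (ZMod ℓ → ι)) = 1 := Matrix.mem_unitaryGroup_iff'.1 (R g).2
  have uR' : (R' g : Op (ZMod ℓ → ι))ᴴ * (R' g : Op (ZMod ℓ → ι)) = 1 :=
    Matrix.mem_unitaryGroup_iff'.1 (R' g).2
  generalize (R g : Op (ZMod ℓ → ι)) = r at *
  generalize (R' g : Op (ZMod ℓ → ι)) = r' at *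
  generalize (L g : Op (ZMod ℓ → ι)) = l at *
  generalize (L' g : Op (ZMod ℓ → ι)) = l' at *
  have h3 : l'ᴴ * l = r' * rᴴ := by
    calc l'ᴴ * l = l'ᴴ * (l * r) * rᴴ := by rw [mul_assoc, mul_assoc, uR, mul_one]
      _ = r' * rᴴ := by rw [he, ← mul_assoc, uL', one_mul]
  have h4 : r' * rᴴ ∈ net (iv (a - ((3 * ξ : ℕ) : ZMod ℓ)) (2 * ξ) (3 * ξ + n)) ⊓
      net (iv (a - ((3 * ξ : ℕ) : ZMod ℓ)) (3 * ξ + n) (4 * ξ + 2 * n)) :=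
    ⟨h3 ▸ mul_mem (conjTranspose_mem hl') hl, mul_mem hr' (conjTranspose_mem hr)⟩
  rw [net_inf, Finset.disjoint_iff_inter_eq_empty.1 (iv_disjoint (by omega))] at h4
  obtain ⟨c, hc⟩ := exists_smul_of_mem_net_empty h4
  have h5 : r' = c • r := by
    rw [← mul_one r', ← uR1, ← mul_assoc, hc, smul_mul_assoc, one_mul]
  have h6 : ‖c‖ = 1 := by
    rw [h5, Matrix.conjTranspose_smul, smul_mul_smul_comm, uR1] at uR'
    have := congrArg ntr uR'
    rw [ntr_smul_one, ntr_one] at this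
    have h7 := congrArg norm this
    rw [norm_mul, norm_star, norm_one] at h7
    exact (mul_self_eq_one_iff.1 h7).resolve_right (by linarith [norm_nonneg c])
  rw [h5, Matrix.trace_smul, norm_smul, h6, one_mul]

theorem hasSPI_iff (hμ : IsRep μ) (hU : U ∈ Matrix.unitaryGroup (ZMod ℓ → ι) ℂ)
    (hα : Spreads ξ (ev U hU)) (hu : ev U hU (sym ℓ (μ gen)) = sym ℓ (μ gen))
    (hk : (μ gen).trace ≠ 0) (h8 : 8 * ξ ≤ ℓ) {x : ℝ} :
    HasSPI μ ξ U (idx 1 ξ (ev U hU)) x ↔ x = idx (μ gen) ξ (ev U hU) := by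
  have h6 : 6 * ξ + 1 ≤ ℓ := by have := NeZero.pos ℓ; omega
  constructor
  · intro H
    -- The conditions range over admissible intervals, and at least one is needed to pin down the
    -- value; n = ξ is admissible on a chain of 6ξ sites.
    obtain ⟨L, R, h1, h2⟩ := exists_restriction hμ hU hα hu hk h6 0 (n := ξ) le_rfl (by omega)
    rw [(H 0 ξ le_rfl (by omega)).2 L R h1, h2]
  · rintro rfl a n hn h
    obtain ⟨L, R, h1, h2⟩ := exists_restriction hμ hU hα hu hk h6 a hn h
    refine ⟨⟨L, R, h1⟩, fun L' R' h' => ?_⟩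
    rw [h2, norm_div, norm_div, norm_trace_restriction h h1 h']

theorem hasGNVWIndex_iff (hU : U ∈ Matrix.unitaryGroup (ZMod ℓ → ι) ℂ)
    (hα : Spreads ξ (ev U hU)) (h8 : 8 * ξ ≤ ℓ) {x : ℝ} :
    HasGNVWIndex ξ U x ↔ x = idx 1 ξ (ev U hU) := by
  have h6 : 6 * ξ + 1 ≤ ℓ := by have := NeZero.pos ℓ; omega
  constructor
  · intro H
    -- The shortest admissible pair of intervals together with the free sites takes 8ξ sites: this
    -- is the origin of the assumption 8ξ ≤ ℓ.
    rw [← H 0 (2 * ξ) (2 * ξ) le_rfl le_rfl (by omega), gnvw_eq hU hα 0 le_rfl le_rfl (by omega),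
      idx_one_eq hα h6]
  · rintro rfl a k n hk hn h
    rw [gnvw_eq hU hα a hk hn h, idx_one_eq hα h6]

end SPI

/-! ### Multiplicativity under composition -/

section SplitLeft
variable {X : Type} [Fintype X] [DecidableEq X] [Nonempty X] {R S M A B : StarSubalgebra ℂ (Op X)}

/-- Subspaces of two tensor factors whose product exhausts the whole algebra must exhaust each
factor: the partial trace over S maps V W into V and acts on R as a nonzero scalar. -/
theorem Splits.le_of_le_mul (h : Splits M R S) (hM : IsFactor M) {V W : Submodule ℂ (Op X)}
    (hV : V ≤ sm R) (hW : W ≤ sm S) (hle : sm M ≤ V * W) : sm R ≤ V := by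
  intro x hx
  have hS := h.isFactor_right hM
  have h1 : cas S x ∈ V := by
    have hx' : x ∈ V * W := hle (h.left hx)
    clear hx
    refine Submodule.mul_induction_on hx' (fun v hv w hw => ?_) fun x y hx hy => ?_
    · rw [cas_mul_left fun s hs => (h.comm v (hV hv) s hs).symm, hS.cas_of_mem (hW hw),
        mul_smul_comm, mul_one]
      exact Submodule.smul_mem _ _ hv
    · rw [cas_add]; exact add_mem hx hy
  rw [hS.cas_of_comm fun s hs => (h.comm x hx s hs).symm] at h1
  simpa only [smul_smul, inv_mul_cancel₀ (rdim_ne (R := S)), one_smul] using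
    Submodule.smul_mem _ ((SymQCA.rdim S : ℂ)⁻¹) h1

theorem sm_mul_le (hA : A ≤ R) (hB : B ≤ R) : sm A * sm B ≤ sm R :=
  Submodule.mul_le.2 fun _ ha _ hb => (mul_mem (hA ha) (hB hb) : _ ∈ R)

theorem Splits.split_left {C D : StarSubalgebra ℂ (Op X)} (h : Splits M R S) (hM : IsFactor M)
    (hA : A ≤ R) (hB : B ≤ R) (hC : C ≤ S) (hD : D ≤ S) (hc : ∀ a ∈ A, ∀ b ∈ B, a * b = b * a)
    (hle : sm M ≤ (sm A * sm B) * (sm C * sm D)) : Splits R A B :=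
  ⟨hA, hB, hc, h.le_of_le_mul hM (sm_mul_le hA hB) (sm_mul_le hC hD) hle⟩

end SplitLeft

section Mul
variable {ℓ : ℕ} [NeZero ℓ] {ι : Type} [Fintype ι] [DecidableEq ι] [Nonempty ι]
  {α β : Aut (ZMod ℓ → ι)} {ξ : ℕ} {m : Op ι}

/-- The window of 4ξ sites consists of the windows of β at s - ξ and at s + ξ, that is, of four
factors. The two inner ones, Lf at s - ξ and Rt at s + ξ, lie in the image under β of the window of
α at s, which splits into the images of Rt and Lf of α. The pieces so obtained on either side lie in
Rt and in Lf of the composition and together generate the window, hence they exhaust Rt and Lf. -/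
theorem splits_Rt_trans (hα : Spreads ξ α) (hβ : Spreads ξ β) (b : ZMod ℓ) {s : ℕ} (h : 6 * ξ ≤ s)
    (h' : s + 6 * ξ ≤ ℓ) :
    Splits (Rt (2 * ξ) (α.trans β) (b + (s : ZMod ℓ))) (Rt ξ β (b + ((s - ξ : ℕ) : ZMod ℓ)))
      (img β (Rt ξ α (b + (s : ZMod ℓ)))) := by
  have hγ : Spreads (2 * ξ) (α.trans β) := two_mul ξ ▸ hα.trans hβ
  have key : ∀ S T, Maps α.symm T S → img β (net T) ≤ img (α.trans β) (net S) :=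
    fun S T hm x hx => hm _ hx
  have hβr : img β (Rt ξ α (b + (s : ZMod ℓ))) ≤ Rt (2 * ξ) (α.trans β) (b + (s : ZMod ℓ)) := by
    rw [Rt_eq b (by omega) (by omega), Rt_eq b (by omega) (by omega)]
    refine le_inf ((img_mono inf_le_left).trans
      ((hβ.maps_iv b (by omega) (by omega)).img_le.trans (net_mono (iv_subset (by omega))))) ?_
    intro x hx
    exact net_mono (iv_subset (by omega)) hx.2
  have hβl : img β (Lf ξ α (b + (s : ZMod ℓ))) ≤ Lf (2 * ξ) (α.trans β) (b + (s : ZMod ℓ)) := by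
    rw [Lf_eq b (by omega) (by omega), Lf_eq b (by omega) (by omega)]
    refine le_inf ((img_mono inf_le_left).trans
      ((hβ.maps_iv b (by omega) (by omega)).img_le.trans (net_mono (iv_subset (by omega))))) ?_
    intro x hx
    exact net_mono (iv_subset (by omega)) hx.2
  have hr : Rt ξ β (b + ((s - ξ : ℕ) : ZMod ℓ)) ≤ Rt (2 * ξ) (α.trans β) (b + (s : ZMod ℓ)) := by
    rw [Rt_eq b (by omega) (by omega), Rt_eq b (by omega) (by omega)]
    refine le_inf (inf_le_left.trans (net_mono (iv_subset (by omega)))) (inf_le_right.trans ?_)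
    exact key _ _ ((hα.symm.maps_iv b (by omega) (by omega)).mono subset_rfl (iv_subset (by omega)))
  have hl : Lf ξ β (b + ((s + ξ : ℕ) : ZMod ℓ)) ≤ Lf (2 * ξ) (α.trans β) (b + (s : ZMod ℓ)) := by
    rw [Lf_eq b (by omega) (by omega), Lf_eq b (by omega) (by omega)]
    refine le_inf (inf_le_left.trans (net_mono (iv_subset (by omega)))) (inf_le_right.trans ?_)
    exact key _ _ ((hα.symm.maps_iv b (by omega) (by omega)).mono subset_rfl (iv_subset (by omega)))
  have s1 := splits_cut hβ b (s := s - ξ) (by omega) (by omega)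
  have s2 := splits_cut hβ b (s := s + ξ) (by omega) (by omega)
  have s3 : Splits _ _ _ := (splits_cut hα b (s := s) (by omega) (by omega)).img (α := β)
  have i1 : Lf ξ β (b + ((s - ξ : ℕ) : ZMod ℓ)) ≤ img β (net (iv b (s - ξ) (s + ξ))) := by
    rw [Lf_eq b (by omega) (by omega)]
    exact inf_le_right.trans (img_mono (net_mono (iv_subset (by omega))))
  have i2 : Rt ξ β (b + ((s + ξ : ℕ) : ZMod ℓ)) ≤ img β (net (iv b (s - ξ) (s + ξ))) := by
    rw [Rt_eq b (by omega) (by omega)]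
    exact inf_le_right.trans (img_mono (net_mono (iv_subset (by omega))))
  have s0 := splits_cut hγ b (s := s) (by omega) (by omega)
  refine s0.split_left (isFactor_net _) hr hβr hβl hl ?_ ?_
  · intro x hx y hy
    rw [Rt_eq b (by omega) (by omega)] at hx
    rw [Rt_eq b (by omega) (by omega)] at hy
    have hy' : y ∈ img β (net (iv b (s - ξ) (s + ξ))) := hy.1
    refine img_comm (fun r hr s hs => ?_) x hx.2 y hy'
    exact net_comm (iv_disjoint (by omega)) hr hs
  · have j0 : sm (net (ι := ι) (iv b (s - 2 * ξ) (s + 2 * ξ)))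
        ≤ sm (net (iv b (s - ξ - ξ) (s - ξ + ξ))) * sm (net (iv b (s + ξ - ξ) (s + ξ + ξ))) :=
      (splits_net (iv_disjoint (by omega)) (by
        rw [show s - 2 * ξ = s - ξ - ξ by omega, show s - ξ + ξ = s + ξ - ξ by omega,
          show s + 2 * ξ = s + ξ + ξ by omega]
        exact iv_union (by omega) (by omega))).le
    refine (j0.trans (mul_le_mul' s1.le s2.le)).trans ?_
    have j1 := (sm_mul_le i1 i2).trans s3.le
    calc _ = sm (Rt ξ β (b + ((s - ξ : ℕ) : ZMod ℓ))) * (sm (Lf ξ β (b + ((s - ξ : ℕ) : ZMod ℓ))) *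
          sm (Rt ξ β (b + ((s + ξ : ℕ) : ZMod ℓ)))) * sm (Lf ξ β (b + ((s + ξ : ℕ) : ZMod ℓ))) := by
          simp only [mul_assoc]
      _ ≤ sm (Rt ξ β (b + ((s - ξ : ℕ) : ZMod ℓ))) * (sm (img β (Rt ξ α (b + (s : ZMod ℓ)))) *
          sm (img β (Lf ξ α (b + (s : ZMod ℓ))))) * sm (Lf ξ β (b + ((s + ξ : ℕ) : ZMod ℓ))) :=
        mul_le_mul' (mul_le_mul' le_rfl j1) le_rfl
      _ = _ := by simp only [mul_assoc]

/-- A larger spreading length only adds the algebra of the additional sites on the left of the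
window, which the normalization of `idx` cancels. -/
theorem splits_Rt_mono {ξ' : ℕ} (hξ : ξ ≤ ξ') (hα : Spreads ξ α) (b : ZMod ℓ) {s : ℕ}
    (h : 3 * ξ' ≤ s) (h' : s + 3 * ξ' ≤ ℓ) :
    Splits (Rt ξ' α (b + (s : ZMod ℓ))) (net (iv b (s - ξ') (s - ξ))) (Rt ξ α (b + (s : ZMod ℓ))) := by
  have s0 := splits_cut (hα.mono hξ) b (s := s) (by omega) (by omega)
  have s1 := splits_cut hα b (s := s) (by omega) (by omega)
  refine s0.split_left (C := Lf ξ α (b + (s : ZMod ℓ))) (D := net (iv b (s + ξ) (s + ξ')))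
    (isFactor_net _) ?_ ?_ ?_ ?_ ?_ ?_
  · rw [Rt_eq b (by omega) (by omega)]
    refine le_inf (net_mono (iv_subset (by omega))) ?_
    have := (hα.symm.maps_iv b (s := s - ξ') (e := s - ξ) (by omega) (by omega)).le_img
    exact this.trans (img_mono (net_mono (iv_subset (by omega))))
  · rw [Rt_eq b (by omega) (by omega), Rt_eq b (by omega) (by omega)]
    exact inf_le_inf (net_mono (iv_subset (by omega))) (img_mono (net_mono (iv_subset (by omega))))
  · rw [Lf_eq b (by omega) (by omega), Lf_eq b (by omega) (by omega)]
    exact inf_le_inf (net_mono (iv_subset (by omega))) (img_mono (net_mono (iv_subset (by omega))))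
  · rw [Lf_eq b (by omega) (by omega)]
    refine le_inf (net_mono (iv_subset (by omega))) ?_
    have := (hα.symm.maps_iv b (s := s + ξ) (e := s + ξ') (by omega) (by omega)).le_img
    exact this.trans (img_mono (net_mono (iv_subset (by omega))))
  · intro x hx y hy
    exact net_comm (iv_disjoint (by omega)) hx (s1.left hy)
  · have j0 : sm (net (ι := ι) (iv b (s - ξ') (s + ξ')))
        ≤ sm (net (iv b (s - ξ') (s - ξ))) * sm (net (iv b (s - ξ) (s + ξ'))) :=
      (splits_net (iv_disjoint (by omega)) (iv_union (by omega) (by omega))).le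
    have j1 : sm (net (ι := ι) (iv b (s - ξ) (s + ξ')))
        ≤ sm (net (iv b (s - ξ) (s + ξ))) * sm (net (iv b (s + ξ) (s + ξ'))) :=
      (splits_net (iv_disjoint (by omega)) (iv_union (by omega) (by omega))).le
    have j2 : sm (net (ι := ι) (iv b (s - ξ) (s + ξ))) ≤ _ := s1.le
    refine (j0.trans (mul_le_mul' le_rfl
      (j1.trans (mul_le_mul' j2 le_rfl)))).trans ?_
    simp only [mul_assoc, le_refl]

theorem idx_trans (hα : Spreads ξ α) (hβ : Spreads ξ β) (h : 12 * ξ + 1 ≤ ℓ) (hm : m * m = 1)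
    (hms : mᴴ = m) (hu : α (sym ℓ m) = sym ℓ m) (hu' : β (sym ℓ m) = sym ℓ m) (hk : m.trace ≠ 0) :
    idx m (2 * ξ) (α.trans β) = idx m ξ α * idx m ξ β := by
  have hγ : Spreads (2 * ξ) (α.trans β) := two_mul ξ ▸ hα.trans hβ
  have hsp := splits_Rt_trans hα hβ 0 (s := 6 * ξ) le_rfl (by omega)
  rw [idx_eq hγ (by omega) hm hms (by rw [StarAlgEquiv.trans_apply, hu, hu']) hk
      (0 + ((6 * ξ : ℕ) : ZMod ℓ)), idx_eq hα (by omega) hm hms hu hk (0 + ((6 * ξ : ℕ) : ZMod ℓ)),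
    idx_eq hβ (by omega) hm hms hu' hk (0 + ((6 * ξ - ξ : ℕ) : ZMod ℓ)),
    hsp.tw (isFactor_Rt hβ (by omega) _) (isU_onSites hm hms _) (norm_Rt hm hms hu' _)
      ((norm_Rt hm hms hu _).img hu'), tw_img hu', norm_mul, Real.sqrt_mul (norm_nonneg _), two_mul,
    pow_add]
  ring

theorem idx_mono {ξ' : ℕ} (hξ : ξ ≤ ξ') (hα : Spreads ξ α) (h : 6 * ξ' + 1 ≤ ℓ) (hm : m * m = 1)
    (hms : mᴴ = m) (hu : α (sym ℓ m) = sym ℓ m) (hk : m.trace ≠ 0) :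
    idx m ξ' α = idx m ξ α := by
  have hsp := splits_Rt_mono hξ hα 0 (s := 3 * ξ') le_rfl (by omega)
  rw [idx_eq (hα.mono hξ) (by omega) hm hms hu hk (0 + ((3 * ξ' : ℕ) : ZMod ℓ)),
    idx_eq hα (by omega) hm hms hu hk (0 + ((3 * ξ' : ℕ) : ZMod ℓ)),
    hsp.tw (isFactor_net _) (isU_onSites hm hms _) (norm_net hm hms _) (norm_Rt hm hms hu _),
    tw_net hm hms, card_iv _ (by omega), norm_mul, Real.sqrt_mul (norm_nonneg _), norm_pow, norm_mul,
    norm_star, mul_pow, Real.sqrt_mul_self (by positivity)]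
  obtain ⟨k, rfl⟩ := Nat.exists_eq_add_of_le hξ
  rw [show 3 * (ξ + k) - ξ - (3 * (ξ + k) - (ξ + k)) = k by omega, pow_add]
  have : ‖m.trace‖ ≠ 0 := norm_ne_zero_iff.2 hk
  field_simp

end Mul

/-! ### Quantum cellular automata as automorphisms -/

section QCA
variable {ℓ : ℕ} [NeZero ℓ] {ι : Type} [Fintype ι] [DecidableEq ι] [Nonempty ι]
  {ξ : ℕ} {μ : Z2 → Op ι} {U V : Op (ZMod ℓ → ι)}

theorem IsQCA.spreads (h : IsQCA ξ U) : Spreads ξ (ev U h.unitary) := by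
  intro i x hx
  rw [mem_net_iff, ev_apply]
  exact h.spread i x (mem_net_iff.1 hx)

theorem isQCA_iff (hU : U ∈ Matrix.unitaryGroup (ZMod ℓ → ι) ℂ) :
    IsQCA ξ U ↔ Spreads ξ (ev U hU) := by
  refine ⟨fun h => h.spreads, fun h => ⟨hU, fun i x hx => ?_⟩⟩
  have := h i x (mem_net_iff.2 hx)
  rw [mem_net_iff, ev_apply] at this
  exact this

theorem ev_mul {X : Type} [Fintype X] [DecidableEq X] {U V : Op X}
    (hU : U ∈ Matrix.unitaryGroup X ℂ) (hV : V ∈ Matrix.unitaryGroup X ℂ) :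
    ev (U * V) (mul_mem hU hV) = (ev U hU).trans (ev V hV) := by
  ext1 x
  rw [StarAlgEquiv.trans_apply, ev_apply, ev_apply, ev_apply, Matrix.conjTranspose_mul]
  simp only [mul_assoc]

theorem conjTranspose_mem_unitaryGroup {X : Type} [Fintype X] [DecidableEq X] {U : Op X}
    (hU : U ∈ Matrix.unitaryGroup X ℂ) : Uᴴ ∈ Matrix.unitaryGroup X ℂ := Unitary.star_mem hU

theorem ev_conjTranspose {X : Type} [Fintype X] [DecidableEq X] {U : Op X}
    (hU : U ∈ Matrix.unitaryGroup X ℂ) :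
    ev Uᴴ (conjTranspose_mem_unitaryGroup hU) = (ev U hU).symm := by
  ext1 x
  rw [ev_apply, ev_symm_apply, Matrix.conjTranspose_conjTranspose]

theorem IsQCA.mul (hU : IsQCA ξ U) (hV : IsQCA ξ V) : IsQCA (2 * ξ) (U * V) := by
  rw [isQCA_iff (mul_mem hU.unitary hV.unitary), ev_mul hU.unitary hV.unitary, two_mul]
  exact hU.spreads.trans hV.spreads

theorem IsQCA.conjTranspose (hU : IsQCA ξ U) : IsQCA ξ Uᴴ := by
  rw [isQCA_iff (conjTranspose_mem_unitaryGroup hU.unitary), ev_conjTranspose hU.unitary]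
  exact hU.spreads.symm

theorem IsQCA.mono {ξ' : ℕ} (hξ : ξ ≤ ξ') (hU : IsQCA ξ U) : IsQCA ξ' U := by
  rw [isQCA_iff hU.unitary]
  exact hU.spreads.mono hξ

theorem IsSymmetric.mul (hU : IsSymmetric μ U) (hV : IsSymmetric μ V) : IsSymmetric μ (U * V) :=
  fun g => (hU g).mul_left (hV g)

theorem ev_eq_self_iff {X : Type} [Fintype X] [DecidableEq X] {U u : Op X}
    (hU : U ∈ Matrix.unitaryGroup X ℂ) : ev U hU u = u ↔ Commute U u := by
  have h1 : U * Uᴴ = 1 := Matrix.mem_unitaryGroup_iff.1 hU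
  have h2 : Uᴴ * U = 1 := Matrix.mem_unitaryGroup_iff'.1 hU
  rw [ev_apply]
  constructor
  · intro h
    change U * u = u * U
    conv_lhs => rw [← h, mul_assoc, ← mul_assoc, h1, one_mul]
  · intro h
    rw [mul_assoc, ← h.eq, ← mul_assoc, h2, one_mul]

theorem isSymmetric_iff (hμ : IsRep μ) (hU : U ∈ Matrix.unitaryGroup (ZMod ℓ → ι) ℂ) :
    IsSymmetric μ U ↔ ev U hU (sym ℓ (μ gen)) = sym ℓ (μ gen) := by
  rw [ev_eq_self_iff]
  refine ⟨fun h => h gen, fun h g => ?_⟩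
  rcases z2_cases g with rfl | rfl
  · rw [hμ.one, onSites_one]; exact Commute.one_right _
  · exact h

theorem IsSymmetric.conjTranspose (hμ : IsRep μ) (hU : U ∈ Matrix.unitaryGroup (ZMod ℓ → ι) ℂ)
    (h : IsSymmetric μ U) : IsSymmetric μ Uᴴ := by
  rw [isSymmetric_iff hμ (conjTranspose_mem_unitaryGroup hU), ev_conjTranspose hU]
  rw [isSymmetric_iff hμ hU] at h
  conv_lhs => rw [← h]
  exact StarAlgEquiv.symm_apply_apply _ _

end QCA

/-! ### Tensor products of two chains -/

section Tensor
variable {Λ : Type} [Fintype Λ] [DecidableEq Λ] {ι : Type} [Fintype ι] [DecidableEq ι] [Nonempty ι]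
  {κ : Type} [Fintype κ] [DecidableEq κ] [Nonempty κ]

/-- The tensor product of operators on two systems with the same set of sites. -/
def stack (x : Op (Λ → ι)) (y : Op (Λ → κ)) : Op (Λ → ι × κ) :=
  (x ⊗ₖ y).submatrix (Equiv.arrowProdEquivProdArrow Λ (fun _ => ι) fun _ => κ)
    (Equiv.arrowProdEquivProdArrow Λ (fun _ => ι) fun _ => κ)

theorem stack_apply (x : Op (Λ → ι)) (y : Op (Λ → κ)) (s t) : stack x y s t =
    x (fun i => (s i).1) (fun i => (t i).1) * y (fun i => (s i).2) (fun i => (t i).2) := rfl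

theorem stack_mul (x x' : Op (Λ → ι)) (y y' : Op (Λ → κ)) :
    stack x y * stack x' y' = stack (x * x') (y * y') := by
  rw [stack, stack, Matrix.submatrix_mul_equiv, ← Matrix.mul_kronecker_mul, stack]

theorem stack_one : stack (1 : Op (Λ → ι)) (1 : Op (Λ → κ)) = 1 := by
  rw [stack, Matrix.one_kronecker_one, Matrix.submatrix_one_equiv]

theorem stack_conjTranspose (x : Op (Λ → ι)) (y : Op (Λ → κ)) :
    (stack x y)ᴴ = stack xᴴ yᴴ := by
  rw [stack, Matrix.conjTranspose_submatrix, Matrix.conjTranspose_kronecker, stack]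

theorem ntr_stack (x : Op (Λ → ι)) (y : Op (Λ → κ)) : ntr (stack x y) = ntr x * ntr y := by
  have h : (stack x y).trace = x.trace * y.trace := by
    rw [← Matrix.trace_kronecker, Matrix.trace, Matrix.trace]
    exact Equiv.sum_comp _ fun i => (x ⊗ₖ y).diag i
  rw [ntr, h, ntr, ntr, div_mul_div_comm, ← Nat.cast_mul, ← Fintype.card_prod]
  rw [Fintype.card_congr (Equiv.arrowProdEquivProdArrow Λ (fun _ => ι) fun _ => κ)]

/-- The operators of the first system, as operators on both. -/
def stackL : Op (Λ → ι) →⋆ₐ[ℂ] Op (Λ → ι × κ) where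
  toFun x := stack x 1
  map_one' := stack_one
  map_mul' x y := by rw [stack_mul, one_mul]
  map_zero' := by ext; simp [stack_apply]
  map_add' x y := by ext; simp [stack_apply, add_mul]
  commutes' c := by
    ext s t
    rw [Algebra.algebraMap_eq_smul_one, Algebra.algebraMap_eq_smul_one, ← stack_one]
    simp [stack_apply, mul_assoc]
  map_star' x := by
    rw [Matrix.star_eq_conjTranspose, Matrix.star_eq_conjTranspose, stack_conjTranspose,
      Matrix.conjTranspose_one]

/-- The operators of the second system, as operators on both. -/
def stackR : Op (Λ → κ) →⋆ₐ[ℂ] Op (Λ → ι × κ) where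
  toFun y := stack 1 y
  map_one' := stack_one
  map_mul' x y := by rw [stack_mul, one_mul]
  map_zero' := by ext; simp [stack_apply]
  map_add' x y := by ext; simp [stack_apply, mul_add]
  commutes' c := by
    ext s t
    rw [Algebra.algebraMap_eq_smul_one, Algebra.algebraMap_eq_smul_one, ← stack_one]
    simp only [stack_apply, Matrix.smul_apply, smul_eq_mul]
    ring
  map_star' x := by
    rw [Matrix.star_eq_conjTranspose, Matrix.star_eq_conjTranspose, stack_conjTranspose,
      Matrix.conjTranspose_one]

theorem stackL_apply (x : Op (Λ → ι)) : stackL (κ := κ) x = stack x 1 := rfl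
theorem stackR_apply (x : Op (Λ → κ)) : stackR (ι := ι) x = stack 1 x := rfl

theorem stackL_mul_stackR (x : Op (Λ → ι)) (y : Op (Λ → κ)) :
    stackL x * stackR y = stack x y := by
  rw [stackL_apply, stackR_apply, stack_mul, one_mul, mul_one]

theorem stackR_mul_stackL (x : Op (Λ → ι)) (y : Op (Λ → κ)) :
    stackR y * stackL x = stack x y := by
  rw [stackL_apply, stackR_apply, stack_mul, one_mul, mul_one]

theorem stack_munit (S : Finset Λ) (p q : Λ → ι × κ) :
    stack (munit S (fun i => (p i).1) fun i => (q i).1) (munit S (fun i => (p i).2) fun i => (q i).2)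
      = munit S p q := by
  ext a b
  rw [stack_apply]
  simp only [munit, Matrix.of_apply, mul_ite, mul_one, mul_zero, ← ite_and]
  refine if_congr ⟨fun ⟨h, h'⟩ => ⟨fun i hi => Prod.ext (h'.1 i hi) (h.1 i hi),
    fun i hi => Prod.ext (h'.2.1 i hi) (h.2.1 i hi),
    fun i hi => Prod.ext (h'.2.2 i hi) (h.2.2 i hi)⟩, fun h => ⟨⟨fun i hi => by rw [h.1 i hi],
    fun i hi => by rw [h.2.1 i hi], fun i hi => by rw [h.2.2 i hi]⟩, fun i hi => by rw [h.1 i hi],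
    fun i hi => by rw [h.2.1 i hi], fun i hi => by rw [h.2.2 i hi]⟩⟩ rfl rfl

theorem stack_onSites (S : Finset Λ) (a : Op ι) (b : Op κ) :
    stack (onSites S a) (onSites S b) = onSites S (a ⊗ₖ b) := by
  ext s t
  rw [stack_apply]
  simp only [onSites, tensorOp, Matrix.of_apply, ← Finset.prod_mul_distrib]
  refine Finset.prod_congr rfl fun i _ => ?_
  split_ifs
  · rfl
  · rw [← Matrix.one_kronecker_one]; rfl

theorem stackL_mem {S : Finset Λ} {x : Op (Λ → ι)} (hx : x ∈ net S) :
    stackL (κ := κ) x ∈ net S := by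
  rw [mem_net] at hx ⊢
  intro p q
  rw [← stack_munit, stackL_apply, stack_mul, stack_mul, hx, one_mul, mul_one]

theorem stackR_mem {S : Finset Λ} {x : Op (Λ → κ)} (hx : x ∈ net S) :
    stackR (ι := ι) x ∈ net S := by
  rw [mem_net] at hx ⊢
  intro p q
  rw [← stack_munit, stackR_apply, stack_mul, stack_mul, hx, one_mul, mul_one]

theorem map_stackL_comm {R : StarSubalgebra ℂ (Op (Λ → ι))} {S : StarSubalgebra ℂ (Op (Λ → κ))} :
    ∀ a ∈ R.map (stackL (κ := κ)), ∀ b ∈ S.map (stackR (ι := ι)), a * b = b * a := by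
  rintro _ ⟨a, -, rfl⟩ _ ⟨b, -, rfl⟩
  exact (stackL_mul_stackR a b).trans (stackR_mul_stackL a b).symm

/-- Matrix units of the stacked system are products of matrix units of its two parts. -/
theorem splits_stack (S : Finset Λ) : Splits (net (ι := ι × κ) S) ((net S).map stackL)
    ((net S).map stackR) := by
  refine ⟨?_, ?_, map_stackL_comm, fun x hx => ?_⟩
  · rintro _ ⟨x, hx, rfl⟩; exact stackL_mem hx
  · rintro _ ⟨x, hx, rfl⟩; exact stackR_mem hx
  · refine net_induction (fun p q => ?_) (zero_mem _) (fun _ _ => add_mem)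
      (fun c _ h => Submodule.smul_mem _ c h) hx
    rw [← stack_munit, ← stackL_mul_stackR]
    exact Submodule.mul_mem_mul ⟨_, munit_mem _ _ _, rfl⟩ ⟨_, munit_mem _ _ _, rfl⟩

theorem map_mul_map_le {R S M : StarSubalgebra ℂ (Op (Λ → ι))} {κ' : Type} [Fintype κ']
    [DecidableEq κ'] (f : Op (Λ → ι) →⋆ₐ[ℂ] Op κ') (h : Splits M R S) :
    sm (M.map f) ≤ sm (R.map f) * sm (S.map f) := by
  rintro _ ⟨x, hx, rfl⟩
  have hx' := h.le x hx
  change f x ∈ _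
  refine Submodule.mul_induction_on hx' (fun r hr s hs => ?_) fun x y hx hy => ?_
  · rw [map_mul]; exact Submodule.mul_mem_mul ⟨r, hr, rfl⟩ ⟨s, hs, rfl⟩
  · rw [map_add]; exact add_mem hx hy

theorem mul_mul_mul_le {X : Type} [Fintype X] [DecidableEq X] {A B C D : Submodule ℂ (Op X)}
    (h : C * B ≤ B * C) : A * C * (B * D) ≤ A * B * (C * D) := by
  calc A * C * (B * D) = A * (C * B) * D := by simp only [mul_assoc]
    _ ≤ A * (B * C) * D := mul_le_mul' (mul_le_mul' le_rfl h) le_rfl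
    _ = A * B * (C * D) := by simp only [mul_assoc]

theorem isONB_map_stackL (R : StarSubalgebra ℂ (Op (Λ → ι))) :
    IsONB (sm (R.map (stackL (κ := κ)))) fun a => stackL (bas R a) := by
  refine ⟨fun a b => ?_, le_antisymm ?_ ?_⟩
  · rw [stackL_apply, stackL_apply, stack_conjTranspose, stack_mul, ntr_stack,
      (isONB_bas R).orthonormal, Matrix.conjTranspose_one, mul_one, ntr_one, mul_one]
  · rw [Submodule.span_le]
    rintro _ ⟨a, rfl⟩
    exact ⟨_, bas_mem R a, rfl⟩
  · rintro _ ⟨x, hx, rfl⟩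
    change stackL x ∈ _
    rw [(isONB_bas R).expand hx, map_sum]
    refine Submodule.sum_mem _ fun a _ => ?_
    rw [map_smul]
    exact Submodule.smul_mem _ _ (Submodule.subset_span ⟨a, rfl⟩)

theorem isONB_map_stackR (R : StarSubalgebra ℂ (Op (Λ → κ))) :
    IsONB (sm (R.map (stackR (ι := ι)))) fun a => stackR (bas R a) := by
  refine ⟨fun a b => ?_, le_antisymm ?_ ?_⟩
  · rw [stackR_apply, stackR_apply, stack_conjTranspose, stack_mul, ntr_stack,
      (isONB_bas R).orthonormal, Matrix.conjTranspose_one, mul_one, ntr_one, one_mul]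
  · rw [Submodule.span_le]
    rintro _ ⟨a, rfl⟩
    exact ⟨_, bas_mem R a, rfl⟩
  · rintro _ ⟨x, hx, rfl⟩
    change stackR x ∈ _
    rw [(isONB_bas R).expand hx, map_sum]
    refine Submodule.sum_mem _ fun a _ => ?_
    rw [map_smul]
    exact Submodule.smul_mem _ _ (Submodule.subset_span ⟨a, rfl⟩)

theorem tw_map_stackL {u : Op (Λ → ι)} {w : Op (Λ → κ)} (hw : w * wᴴ = 1)
    (R : StarSubalgebra ℂ (Op (Λ → ι))) : tw (stack u w) (R.map stackL) = tw u R := by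
  rw [tw_eq_of_isONB _ (isONB_map_stackL R), tw]
  refine Finset.sum_congr rfl fun a _ => ?_
  rw [stackL_apply, stack_conjTranspose, stack_conjTranspose, stack_mul, stack_mul, stack_mul,
    mul_one, hw, ntr_stack, Matrix.conjTranspose_one, mul_one, ntr_one, mul_one]

theorem tw_map_stackR {u : Op (Λ → ι)} {w : Op (Λ → κ)} (hu : u * uᴴ = 1)
    (R : StarSubalgebra ℂ (Op (Λ → κ))) : tw (stack u w) (R.map stackR) = tw w R := by
  rw [tw_eq_of_isONB _ (isONB_map_stackR R), tw]
  refine Finset.sum_congr rfl fun a _ => ?_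
  rw [stackR_apply, stack_conjTranspose, stack_conjTranspose, stack_mul, stack_mul, stack_mul,
    mul_one, hu, ntr_stack, Matrix.conjTranspose_one, mul_one, ntr_one, one_mul]

theorem Norm.map_stackL {u : Op (Λ → ι)} {w : Op (Λ → κ)} (hw : w * wᴴ = 1)
    {R : StarSubalgebra ℂ (Op (Λ → ι))} (h : Norm u R) : Norm (stack u w) (R.map stackL) := by
  rintro _ ⟨x, hx, rfl⟩
  refine ⟨_, h x hx, ?_⟩
  change stack _ _ = stack _ _ * stack _ _ * _
  rw [stack_conjTranspose, stack_mul, stack_mul, mul_one, hw]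

theorem Norm.map_stackR {u : Op (Λ → ι)} {w : Op (Λ → κ)} (hu : u * uᴴ = 1)
    {R : StarSubalgebra ℂ (Op (Λ → κ))} (h : Norm w R) : Norm (stack u w) (R.map stackR) := by
  rintro _ ⟨x, hx, rfl⟩
  refine ⟨_, h x hx, ?_⟩
  change stack _ _ = stack _ _ * stack _ _ * _
  rw [stack_conjTranspose, stack_mul, stack_mul, mul_one, hu]

end Tensor

/-! ### Invariants of a QCA with ancillas -/

section Ancilla
variable {ℓ : ℕ} [NeZero ℓ] {ι : Type} [Fintype ι] [DecidableEq ι] [Nonempty ι]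
  {κ : Type} [Fintype κ] [DecidableEq κ] [Nonempty κ]
  {α : Aut (ZMod ℓ → ι)} {α' : Aut (ZMod ℓ → ι × κ)} {ξ : ℕ} {m : Op ι} {m' : Op κ}

/-- `α'` acts as `α` on the first system and trivially on the second one. -/
structure Extends (α : Aut (ZMod ℓ → ι)) (α' : Aut (ZMod ℓ → ι × κ)) : Prop where
  left : ∀ x, α' (stackL x) = stackL (α x)
  right : ∀ y, α' (stackR y) = stackR y

theorem Extends.symm (h : Extends α α') : Extends α.symm α'.symm :=
  ⟨fun x => aut_injective α' (by rw [h.left, StarAlgEquiv.apply_symm_apply,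
    StarAlgEquiv.apply_symm_apply]), fun y => aut_injective α' (by
    rw [h.right, StarAlgEquiv.apply_symm_apply])⟩

theorem Extends.spreads (h : Extends α α') (hα : Spreads ξ α) : Spreads ξ α' := by
  intro i x hx
  refine Submodule.mul_induction_on ((splits_stack {i}).le x hx) ?_ ?_
  · rintro _ ⟨x, hx, rfl⟩ _ ⟨y, hy, rfl⟩
    change α' (stackL x * stackR y) ∈ _
    rw [map_mul, h.left, h.right]
    refine mul_mem (stackL_mem (hα i x hx)) (stackR_mem (net_mono ?_ hy))
    rw [Finset.singleton_subset_iff]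
    simp only [arc, Finset.mem_image, Finset.mem_range]
    exact ⟨ξ, by omega, by ring⟩
  · intro x y hx hy
    rw [map_add]; exact add_mem hx hy

theorem Extends.map_img_le (h : Extends α α') (S : Finset (ZMod ℓ)) :
    (img α (net S)).map stackL ≤ img α' (net S) := by
  rintro _ ⟨x, hx, rfl⟩
  change α'.symm (stackL x) ∈ net S
  rw [h.symm.left]
  exact stackL_mem hx

theorem Extends.map_stackR_le (h : Extends α α') (S : Finset (ZMod ℓ)) :
    (net S).map (stackR (ι := ι)) ≤ img α' (net S) := by
  rintro _ ⟨x, hx, rfl⟩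
  change α'.symm (stackR x) ∈ net S
  rw [h.symm.right]
  exact stackR_mem hx

theorem splits_map_stack {M R S : StarSubalgebra ℂ (Op (ZMod ℓ → ι))}
    {N A B : StarSubalgebra ℂ (Op (ZMod ℓ → κ))} {M' R' S' : StarSubalgebra ℂ (Op (ZMod ℓ → ι × κ))}
    (s0 : Splits M' R' S') (hM' : IsFactor M') (s : Splits M' (M.map stackL) (N.map stackR))
    (s1 : Splits M R S) (s2 : Splits N A B) (hR : R.map stackL ≤ R') (hA : A.map stackR ≤ R')
    (hS : S.map stackL ≤ S') (hB : B.map stackR ≤ S') :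
    Splits R' (R.map stackL) (A.map stackR) := by
  refine s0.split_left (C := S.map stackL) (D := B.map stackR) hM' hR hA hS hB map_stackL_comm ?_
  have j0 : sm M' ≤ _ := s.le
  refine (j0.trans (mul_le_mul' (map_mul_map_le stackL s1) (map_mul_map_le stackR s2))).trans ?_
  refine mul_mul_mul_le ?_
  rw [Submodule.mul_le]
  intro x hx y hy
  rw [map_stackL_comm x hx y hy]
  exact Submodule.mul_mem_mul hy hx

/-- The ancillas do not move, so those on the left half of the window belong to Rt and those on the
right half to Lf. Together with the factors of the original chain they generate the window, so
nothing else is contained in Rt and Lf. -/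
theorem Extends.splits_cut (h : Extends α α') (hα : Spreads ξ α) (b : ZMod ℓ) {s : ℕ}
    (hs : 3 * ξ ≤ s) (hs' : s + 3 * ξ ≤ ℓ) :
    Splits (Rt ξ α' (b + (s : ZMod ℓ))) ((Rt ξ α (b + (s : ZMod ℓ))).map stackL)
      ((net (iv b (s - ξ) s)).map stackR) ∧
    Splits (Lf ξ α' (b + (s : ZMod ℓ))) ((Lf ξ α (b + (s : ZMod ℓ))).map stackL)
      ((net (iv b s (s + ξ))).map stackR) := by
  have s0 := SymQCA.splits_cut (h.spreads hα) b (s := s) (by omega) (by omega)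
  have s1 := SymQCA.splits_cut hα b (s := s) (by omega) (by omega)
  have s2 := splits_net (ι := κ) (iv_disjoint (b := b) (s := s - ξ) (e := s) (s' := s) (e' := s + ξ)
    (by omega)) (iv_union (by omega) (by omega))
  have hmap : ∀ (S : Finset (ZMod ℓ)), (net S).map (stackR (ι := ι) (κ := κ)) ≤ net S :=
    fun S => (splits_stack S).right
  have h1 : (Rt ξ α (b + (s : ZMod ℓ))).map stackL ≤ Rt ξ α' (b + (s : ZMod ℓ)) := by
    rw [Rt_eq b (by omega) (by omega), Rt_eq b (by omega) (by omega)]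
    exact le_inf ((StarSubalgebra.map_mono inf_le_left).trans (splits_stack _).left)
      ((StarSubalgebra.map_mono inf_le_right).trans (h.map_img_le _))
  have h2 : (net (iv b (s - ξ) s)).map stackR ≤ Rt ξ α' (b + (s : ZMod ℓ)) := by
    rw [Rt_eq b (by omega) (by omega)]
    exact le_inf ((hmap _).trans (net_mono (iv_subset (by omega))))
      ((h.map_stackR_le _).trans (img_mono (net_mono (iv_subset (by omega)))))
  have h3 : (Lf ξ α (b + (s : ZMod ℓ))).map stackL ≤ Lf ξ α' (b + (s : ZMod ℓ)) := by
    rw [Lf_eq b (by omega) (by omega), Lf_eq b (by omega) (by omega)]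
    exact le_inf ((StarSubalgebra.map_mono inf_le_left).trans (splits_stack _).left)
      ((StarSubalgebra.map_mono inf_le_right).trans (h.map_img_le _))
  have h4 : (net (iv b s (s + ξ))).map stackR ≤ Lf ξ α' (b + (s : ZMod ℓ)) := by
    rw [Lf_eq b (by omega) (by omega)]
    exact le_inf ((hmap _).trans (net_mono (iv_subset (by omega))))
      ((h.map_stackR_le _).trans (img_mono (net_mono (iv_subset (by omega)))))
  exact ⟨splits_map_stack s0 (isFactor_net _) (splits_stack _) s1 s2 h1 h2 h3 h4,
    splits_map_stack s0.symm (isFactor_net _) (splits_stack _) s1.symm s2.symm h3 h4 h1 h2⟩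

theorem Extends.idx (h : Extends α α') (hα : Spreads ξ α) (h6 : 6 * ξ + 1 ≤ ℓ) (hm : m * m = 1)
    (hms : mᴴ = m) (hm' : m' * m' = 1) (hms' : m'ᴴ = m') (hu : α (sym ℓ m) = sym ℓ m)
    (hk : m.trace ≠ 0) (hk' : m'.trace ≠ 0) :
    idx (m ⊗ₖ m') ξ α' = SymQCA.idx m ξ α := by
  have hmm : (m ⊗ₖ m') * (m ⊗ₖ m') = 1 := by
    rw [← Matrix.mul_kronecker_mul, hm, hm', Matrix.one_kronecker_one]
  have hmms : (m ⊗ₖ m')ᴴ = m ⊗ₖ m' := by rw [Matrix.conjTranspose_kronecker, hms, hms']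
  have hsym : sym ℓ (m ⊗ₖ m') = stack (sym ℓ m) (sym ℓ m') := (stack_onSites _ _ _).symm
  have hu' : α' (sym ℓ (m ⊗ₖ m')) = sym ℓ (m ⊗ₖ m') := by
    rw [hsym, ← stackL_mul_stackR, map_mul, h.left, h.right, hu]
  have hkk : (m ⊗ₖ m').trace ≠ 0 := by
    rw [Matrix.trace_kronecker]; exact mul_ne_zero hk hk'
  have hsp := (h.splits_cut hα 0 (s := 3 * ξ) le_rfl (by omega)).1
  have hw : sym ℓ m' * (sym ℓ m')ᴴ = 1 := mul_eq_one_comm.1 (isU_onSites hm' hms' _)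
  have hw1 : sym ℓ m * (sym ℓ m)ᴴ = 1 := mul_eq_one_comm.1 (isU_onSites hm hms _)
  rw [idx_eq (h.spreads hα) (by omega) hmm hmms hu' hkk (0 + ((3 * ξ : ℕ) : ZMod ℓ)),
    idx_eq hα (by omega) hm hms hu hk (0 + ((3 * ξ : ℕ) : ZMod ℓ)),
    hsp.tw (hsp.isFactor_left (isFactor_Rt (h.spreads hα) (by omega) _)) (u := sym ℓ (m ⊗ₖ m'))
      (isU_onSites hmm hmms _) (by rw [hsym]; exact (norm_Rt hm hms hu _).map_stackL hw)
      (by rw [hsym]; exact (norm_net hm' hms' _).map_stackR hw1), hsym, tw_map_stackL hw, tw_map_stackR hw1,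
      tw_net hm' hms', card_iv _ (by omega), show 3 * ξ - (3 * ξ - ξ) = ξ by omega,
      Matrix.trace_kronecker, norm_mul, Real.sqrt_mul (norm_nonneg _), norm_pow, norm_mul, norm_star,
      norm_mul, mul_pow, mul_pow, Real.sqrt_mul_self (by positivity)]
  have h1 : ‖m.trace‖ ≠ 0 := norm_ne_zero_iff.2 hk
  have h2 : ‖m'.trace‖ ≠ 0 := norm_ne_zero_iff.2 hk'
  field_simp

variable {U : Op (ZMod ℓ → ι)} {k : ℕ} {μ : Z2 → Op ι}

theorem withAncillas_eq : withAncillas k U = stackL U := by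
  ext s t
  rw [stackL_apply, stack_apply, withAncillas, Matrix.of_apply, Matrix.one_apply]
  congr 1
  exact if_congr funext_iff.symm rfl rfl

theorem stackL_mem_unitaryGroup (hU : U ∈ Matrix.unitaryGroup (ZMod ℓ → ι) ℂ) :
    stackL (κ := κ) U ∈ Matrix.unitaryGroup (ZMod ℓ → ι × κ) ℂ := by
  rw [Matrix.mem_unitaryGroup_iff, ← map_star, ← map_mul, Matrix.mem_unitaryGroup_iff.1 hU, map_one]

theorem extends_ev (hU : U ∈ Matrix.unitaryGroup (ZMod ℓ → ι) ℂ) :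
    Extends (ev U hU) (ev (stackL (κ := κ) U) (stackL_mem_unitaryGroup hU)) := by
  refine ⟨fun x => ?_, fun y => ?_⟩
  · rw [ev_apply, ev_apply, map_mul, map_mul]
    congr 2
    exact (map_star stackL U).symm
  · rw [ev_apply, mul_assoc, stackR_mul_stackL, ← stackL_mul_stackR, ← mul_assoc]
    have := Matrix.mem_unitaryGroup_iff'.1 (stackL_mem_unitaryGroup (κ := κ) hU)
    rw [Matrix.star_eq_conjTranspose] at this
    rw [this, one_mul]

theorem IsRep.ancillaRep (hμ : IsRep μ) : IsRep (ancillaRep μ k) := by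
  refine ⟨?_, ?_, ?_⟩
  · rw [SymQCA.ancillaRep, hμ.one, tensorOp_one, Matrix.one_kronecker_one]
  · rw [SymQCA.ancillaRep, ← Matrix.mul_kronecker_mul, hμ.sq, tensorOp_mul]
    simp only [hμ.sq]
    rw [tensorOp_one, Matrix.one_kronecker_one]
  · rw [SymQCA.ancillaRep, Matrix.conjTranspose_kronecker, hμ.star, tensorOp_conjTranspose]
    simp only [hμ.star]

end Ancilla

/-! ### Layers of gates -/

section Gates
variable {Λ : Type} [Fintype Λ] [DecidableEq Λ] {ι : Type} [Fintype ι] [DecidableEq ι] [Nonempty ι]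

theorem conj_list_prod_mem {T : Finset Λ} {l : List (Op (Λ → ι))}
    (hl : ∀ G ∈ l, Gᴴ * G = 1 ∧ (G ∈ net T ∨ G ∈ net Tᶜ)) :
    ∀ x ∈ net T, l.prodᴴ * x * l.prod ∈ net T := by
  induction l with
  | nil => intro x hx; simpa using hx
  | cons G l ih =>
    intro x hx
    rw [List.prod_cons, Matrix.conjTranspose_mul, show l.prodᴴ * Gᴴ * x * (G * l.prod)
      = l.prodᴴ * (Gᴴ * x * G) * l.prod by simp only [mul_assoc]]
    refine ih (fun G hG => hl G (List.mem_cons_of_mem _ hG)) _ ?_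
    obtain ⟨h1, h2 | h2⟩ := hl G List.mem_cons_self
    · exact mul_mem (mul_mem (conjTranspose_mem h2) hx) h2
    · rw [mul_assoc, net_comm disjoint_compl_right hx h2, ← mul_assoc, h1, one_mul]
      exact hx

theorem exists_saturation {n : ℕ} {A : Fin n → Finset Λ}
    (hA : ∀ j j', j ≠ j' → Disjoint (A j) (A j')) (S : Finset Λ) :
    ∃ T, S ⊆ T ∧ (∀ j, A j ⊆ T ∨ Disjoint (A j) T) ∧
      ∀ V, S ⊆ V → (∀ j, ¬Disjoint (A j) S → A j ⊆ V) → T ⊆ V := by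
  refine ⟨S ∪ (Finset.univ.filter fun j => ¬Disjoint (A j) S).biUnion A,
    Finset.subset_union_left, fun j => ?_, fun V h1 h2 => ?_⟩
  · by_cases h : Disjoint (A j) S
    · right
      rw [Finset.disjoint_union_right, Finset.disjoint_biUnion_right]
      refine ⟨h, fun i hi => hA j i ?_⟩
      rintro rfl
      exact (Finset.mem_filter.1 hi).2 h
    · left
      exact (Finset.subset_biUnion_of_mem A (Finset.mem_filter.2 ⟨Finset.mem_univ _, h⟩)).trans
        Finset.subset_union_right
  · refine Finset.union_subset h1 (Finset.biUnion_subset.2 fun j hj => ?_)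
    exact h2 j (Finset.mem_filter.1 hj).2

theorem list_ofFn_prod_mem_unitaryGroup {X : Type} [Fintype X] [DecidableEq X] {n : ℕ}
    {G : Fin n → Op X} (hG : ∀ j, G j ∈ Matrix.unitaryGroup X ℂ) :
    (List.ofFn G).prod ∈ Matrix.unitaryGroup X ℂ :=
  Submonoid.list_prod_mem _ fun x hx => by
    obtain ⟨j, rfl⟩ := (List.mem_ofFn' _ _).1 hx; exact hG j

/-- S is enlarged by all gate supports that it meets. As the supports are disjoint, every gate then
acts either inside the enlarged set or outside it, so conjugation by the layer and its inverse
preserve the algebra of this set. -/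
theorem maps_list_prod {n : ℕ} {A : Fin n → Finset Λ} {G : Fin n → Op (Λ → ι)}
    (hG : ∀ j, G j ∈ Matrix.unitaryGroup (Λ → ι) ℂ) (hGA : ∀ j, G j ∈ net (A j))
    (hA : ∀ j j', j ≠ j' → Disjoint (A j) (A j')) {S V : Finset Λ} (hS : S ⊆ V)
    (h : ∀ j, ¬Disjoint (A j) S → A j ⊆ V) :
    Maps (ev _ (list_ofFn_prod_mem_unitaryGroup hG)) S V ∧
      Maps (ev _ (list_ofFn_prod_mem_unitaryGroup hG)).symm S V := by
  obtain ⟨T, h1, h2, h3⟩ := exists_saturation hA S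
  have key : ∀ T, (∀ j, A j ⊆ T ∨ Disjoint (A j) T) →
      Maps (ev _ (list_ofFn_prod_mem_unitaryGroup hG)) T T := by
    intro T hT x hx
    rw [ev_apply]
    refine conj_list_prod_mem (fun g hg => ?_) x hx
    obtain ⟨j, rfl⟩ := (List.mem_ofFn' _ _).1 hg
    refine ⟨Matrix.mem_unitaryGroup_iff'.1 (hG j), ?_⟩
    rcases hT j with h | h
    · exact Or.inl (net_mono h (hGA j))
    · exact Or.inr (net_mono (Finset.subset_compl_iff_disjoint_right.2 h) (hGA j))
  refine ⟨(key T h2).mono h1 (h3 V hS h), ?_⟩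
  have := (key Tᶜ fun j => ?_).symm
  · rw [compl_compl] at this
    exact this.mono h1 (h3 V hS h)
  · rcases h2 j with h | h
    · exact Or.inr (disjoint_compl_right.mono_left h)
    · exact Or.inl (Finset.subset_compl_iff_disjoint_right.2 h)

end Gates

section Layer
variable {ℓ : ℕ} [NeZero ℓ]

theorem mem_arc {a x : ZMod ℓ} {w : ℕ} : x ∈ arc a w ↔ ∃ t < w, a + (t : ZMod ℓ) = x := by
  simp [arc]

theorem val_add_sub {b : ZMod ℓ} {n : ℕ} (h : n < ℓ) : (b + (n : ZMod ℓ) - b).val = n := by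
  rw [add_sub_cancel_left, ZMod.val_natCast, Nat.mod_eq_of_lt h]

theorem exists_start {a b : ZMod ℓ} {w r s e : ℕ} (hw : w ≤ r) (hs : r ≤ s)
    (h : ¬Disjoint (arc a w) (iv b s e)) :
    ∃ A : ℕ, a = b + (A : ZMod ℓ) ∧ A < e ∧ s < A + w := by
  obtain ⟨y, hy, hy'⟩ := Finset.not_disjoint_iff.1 h
  obtain ⟨t, ht, rfl⟩ := mem_arc.1 hy
  rw [mem_iv] at hy'
  refine ⟨(a + (t : ZMod ℓ) - b).val - t, ?_, by omega, by omega⟩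
  rw [Nat.cast_sub (by omega), ZMod.natCast_zmod_val]
  ring

/-- If no gate crosses the cut at position 3r, a gate that meets the last r sites before the cut
ends at the cut at the latest and starts less than r sites before those. -/
theorem arc_subset_left {a b : ZMod ℓ} {w r : ℕ} (hw : w ≤ r) (hℓ : 6 * r ≤ ℓ)
    (hc : b + ((3 * r : ℕ) : ZMod ℓ) ∈ arc a w → a = b + ((3 * r : ℕ) : ZMod ℓ))
    (h : ¬Disjoint (arc a w) (iv b (2 * r) (3 * r))) : arc a w ⊆ iv b r (3 * r) := by
  obtain ⟨A, rfl, h1, h2⟩ := exists_start hw (by omega) h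
  intro z hz
  obtain ⟨t, ht, rfl⟩ := mem_arc.1 hz
  rw [add_assoc, ← Nat.cast_add, mem_iv, val_add_sub (by omega)]
  refine ⟨by omega, ?_⟩
  by_contra hcon
  have h3 := hc (mem_arc.2 ⟨3 * r - A, by omega, by rw [Nat.cast_sub (by omega)]; ring⟩)
  have h4 := congrArg (fun x => (x - b).val) h3
  simp only [val_add_sub (show A < ℓ by omega)] at h4
  rw [val_add_sub (by omega)] at h4
  omega

theorem arc_subset_right {a b : ZMod ℓ} {w r : ℕ} (hw : w ≤ r) (hℓ : 6 * r ≤ ℓ)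
    (hc : b + ((3 * r : ℕ) : ZMod ℓ) ∈ arc a w → a = b + ((3 * r : ℕ) : ZMod ℓ))
    (h : ¬Disjoint (arc a w) (iv b (3 * r) (4 * r))) : arc a w ⊆ iv b (3 * r) (5 * r) := by
  obtain ⟨A, rfl, h1, h2⟩ := exists_start hw (by omega) h
  have h5 : 3 * r ≤ A := by
    by_contra hcon
    have h3 := hc (mem_arc.2 ⟨3 * r - A, by omega, by rw [Nat.cast_sub (by omega)]; ring⟩)
    have h4 := congrArg (fun x => (x - b).val) h3
    simp only [val_add_sub (show A < ℓ by omega)] at h4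
    rw [val_add_sub (by omega)] at h4
    omega
  intro z hz
  obtain ⟨t, ht, rfl⟩ := mem_arc.1 hz
  rw [add_assoc, ← Nat.cast_add, mem_iv, val_add_sub (by omega)]
  omega

variable {ι : Type} [Fintype ι] [DecidableEq ι] [Nonempty ι] {α : Aut (ZMod ℓ → ι)} {r ξ : ℕ}
  {m : Op ι} {μ : Z2 → Op ι} {W : Op (ZMod ℓ → ι)}

/-- If preimages do not cross the cut, the two halves of the window lie in Rt and in Lf; since they
generate the window, they exhaust them. -/
theorem Rt_eq_net (hα : Spreads r α) (b : ZMod ℓ) {s : ℕ} (h : 3 * r ≤ s) (h' : s + 3 * r ≤ ℓ)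
    (h₁ : Maps α.symm (iv b (s - r) s) (iv b (s - 2 * r) s))
    (h₂ : Maps α.symm (iv b s (s + r)) (iv b s (s + 2 * r))) :
    Rt r α (b + (s : ZMod ℓ)) = net (iv b (s - r) s) := by
  have s0 := splits_cut hα b h h'
  have hR : net (iv b (s - r) s) ≤ Rt r α (b + (s : ZMod ℓ)) := by
    rw [Rt_eq b (by omega) (by omega)]
    exact le_inf (net_mono (iv_subset (by omega))) h₁.le_img
  have hL : net (iv b s (s + r)) ≤ Lf r α (b + (s : ZMod ℓ)) := by
    rw [Lf_eq b (by omega) (by omega)]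
    exact le_inf (net_mono (iv_subset (by omega))) h₂.le_img
  exact le_antisymm (s0.le_of_le_mul (isFactor_net _) hR hL
    (splits_net (iv_disjoint (by omega)) (iv_union (by omega) (by omega))).le) hR

theorem IsSymmetricLayer.props (hW : IsSymmetricLayer μ r W) (hℓ : 6 * r + 1 ≤ ℓ) :
    IsQCA r W ∧ IsSymmetric μ W ∧ ∀ hU : W ∈ Matrix.unitaryGroup (ZMod ℓ → ι) ℂ,
      (∀ m : Op ι, m * m = 1 → mᴴ = m → ev W hU (sym ℓ m) = sym ℓ m → m.trace ≠ 0 →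
        idx m r (ev W hU) = 1) := by
  obtain ⟨n, a, w, G, hw, hd, hG, rfl⟩ := hW
  have hGU := fun j => (hG j).1
  have hGA := fun j => mem_net_iff.2 (hG j).2.1
  have hsp : Spreads r (ev _ (list_ofFn_prod_mem_unitaryGroup hGU)) := by
    intro i
    refine (maps_list_prod hGU hGA hd ?_ fun j hj => ?_).1
    · rw [Finset.singleton_subset_iff, mem_arc]
      exact ⟨r, by omega, by ring⟩
    · rw [Finset.disjoint_singleton_right, not_not, mem_arc] at hj
      obtain ⟨t, ht, rfl⟩ := hj
      intro x hx
      obtain ⟨t', ht', rfl⟩ := mem_arc.1 hx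
      have := hw j
      refine mem_arc.2 ⟨r + t' - t, by omega, ?_⟩
      rw [Nat.cast_sub (by omega)]
      push_cast; ring
  refine ⟨(isQCA_iff _).2 hsp, fun g => ?_, fun hU m hm hms hu hk => ?_⟩
  · refine (Commute.list_prod_right _ _ fun x hx => ?_).symm
    obtain ⟨j, rfl⟩ := (List.mem_ofFn' _ _).1 hx
    exact ((hG j).2.2 g).symm
  · obtain ⟨c, hc⟩ : ∃ c : ZMod ℓ, ∀ j, c ∈ arc (a j) (w j) → a j = c := by
      by_cases h : ∃ j, (0 : ZMod ℓ) ∈ arc (a j) (w j)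
      · obtain ⟨j, hj⟩ := h
        refine ⟨a j, fun j' hj' => ?_⟩
        by_contra hcon
        have hne : j ≠ j' := fun h => hcon (by rw [h])
        refine Finset.disjoint_left.1 (hd j j' hne) ?_ hj'
        obtain ⟨t, ht, -⟩ := mem_arc.1 hj
        exact mem_arc.2 ⟨0, by omega, by simp⟩
      · push Not at h
        exact ⟨0, fun j hj => absurd hj (h j)⟩
    obtain ⟨b, rfl⟩ : ∃ b, c = b + ((3 * r : ℕ) : ZMod ℓ) := ⟨c - ((3 * r : ℕ) : ZMod ℓ), by ring⟩
    have h1 : Maps (ev _ hU).symm (iv b (3 * r - r) (3 * r)) (iv b (3 * r - 2 * r) (3 * r)) := by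
      refine (maps_list_prod hGU hGA hd (iv_subset (by omega)) fun j hj => ?_).2
      rw [show 3 * r - r = 2 * r by omega] at hj
      rw [show 3 * r - 2 * r = r by omega]
      exact arc_subset_left (hw j) (by omega) (hc j) hj
    have h2 : Maps (ev _ hU).symm (iv b (3 * r) (3 * r + r)) (iv b (3 * r) (3 * r + 2 * r)) := by
      refine (maps_list_prod hGU hGA hd (iv_subset (by omega)) fun j hj => ?_).2
      rw [show 3 * r + r = 4 * r by omega] at hj
      rw [show 3 * r + 2 * r = 5 * r by omega]
      exact arc_subset_right (hw j) (by omega) (hc j) hj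
    rw [idx_eq hsp (by omega) hm hms hu hk (b + ((3 * r : ℕ) : ZMod ℓ)),
      Rt_eq_net hsp b le_rfl (by omega) h1 h2, tw_net hm hms, card_iv _ (by omega),
      show 3 * r - (3 * r - r) = r by omega, norm_pow, norm_mul, norm_star, mul_pow,
      Real.sqrt_mul_self (by positivity), div_self]
    exact pow_ne_zero _ (norm_ne_zero_iff.2 hk)

/-- Conjugation by `u` for the two symmetries `1` and `μ gen` that give invariants. -/
def IsAdmissible (μ : Z2 → Op ι) (m : Op ι) : Prop := (m = 1 ∨ m = μ gen) ∧ m.trace ≠ 0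

theorem IsAdmissible.sq (hμ : IsRep μ) (h : IsAdmissible μ m) : m * m = 1 := by
  rcases h.1 with rfl | rfl
  · rw [mul_one]
  · exact hμ.sq

theorem IsAdmissible.star (hμ : IsRep μ) (h : IsAdmissible μ m) : mᴴ = m := by
  rcases h.1 with rfl | rfl
  · exact Matrix.conjTranspose_one
  · exact hμ.star

theorem IsAdmissible.fixed (hμ : IsRep μ) (h : IsAdmissible μ m)
    (hU : W ∈ Matrix.unitaryGroup (ZMod ℓ → ι) ℂ) (hs : IsSymmetric μ W) :
    ev W hU (sym ℓ m) = sym ℓ m := by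
  rcases h.1 with rfl | rfl
  · rw [sym_one, map_one]
  · exact (isSymmetric_iff hμ hU).1 hs

theorem IsSymmetricCircuit.props (hμ : IsRep μ) (hW : IsSymmetricCircuit μ r W)
    (hℓ : 12 * r + 1 ≤ ℓ) : IsQCA (2 * r) W ∧ IsSymmetric μ W ∧
      ∀ (hU : W ∈ Matrix.unitaryGroup (ZMod ℓ → ι) ℂ) (m : Op ι), IsAdmissible μ m →
        idx m (2 * r) (ev W hU) = 1 := by
  obtain ⟨W₁, W₂, h₁, h₂, rfl⟩ := hW
  obtain ⟨q₁, s₁, i₁⟩ := h₁.props (by omega)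
  obtain ⟨q₂, s₂, i₂⟩ := h₂.props (by omega)
  refine ⟨q₂.mul q₁, s₂.mul s₁, fun hU m hm => ?_⟩
  rw [ev_mul q₂.unitary q₁.unitary, idx_trans q₂.spreads q₁.spreads hℓ (hm.sq hμ) (hm.star hμ)
    (hm.fixed hμ _ s₂) (hm.fixed hμ _ s₁) hm.2,
    i₁ _ m (hm.sq hμ) (hm.star hμ) (hm.fixed hμ _ s₁) hm.2,
    i₂ _ m (hm.sq hμ) (hm.star hμ) (hm.fixed hμ _ s₂) hm.2, one_mul]

end Layer

/-! ### Invariance under strong equivalence -/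

section Invariance
variable {ℓ : ℕ} [NeZero ℓ] {ι : Type} [Fintype ι] [DecidableEq ι] [Nonempty ι] {r ξ k : ℕ}
  {m : Op ι} {μ : Z2 → Op ι} {U U' : Op (ZMod ℓ → ι)}

theorem IsAdmissible.ancilla (h : IsAdmissible μ m) :
    IsAdmissible (ancillaRep μ k) (m ⊗ₖ tensorOp fun _ : Fin k => m) := by
  refine ⟨?_, ?_⟩
  · rcases h.1 with rfl | rfl
    · left; rw [tensorOp_one, Matrix.one_kronecker_one]
    · right; rfl
  · rw [Matrix.trace_kronecker, tensorOp_trace]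
    exact mul_ne_zero h.2 (Finset.prod_ne_zero_iff.2 fun _ _ => h.2)

theorem IsSymmetric.stackL (h : IsSymmetric μ U) :
    IsSymmetric (ancillaRep μ k) (stackL (κ := Fin k → ι) U) := by
  intro g
  change _ * _ = _ * _
  rw [ancillaRep, ← stack_onSites, stackL_apply, stack_mul, stack_mul, one_mul, mul_one, (h g).eq]

theorem IsAdmissible.idx_stackL (hμ : IsRep μ) (hm : IsAdmissible μ m) (hq : IsQCA ξ U)
    (hs : IsSymmetric μ U) (h6 : 6 * ξ + 1 ≤ ℓ) :
    idx (m ⊗ₖ tensorOp fun _ : Fin k => m) ξ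
      (ev (stackL (κ := Fin k → ι) U) (stackL_mem_unitaryGroup hq.unitary))
      = idx m ξ (ev U hq.unitary) := by
  refine (extends_ev hq.unitary).idx hq.spreads h6 (hm.sq hμ) (hm.star hμ) ?_ ?_
    (hm.fixed hμ _ hs) hm.2 ?_
  · rw [tensorOp_mul]; simp only [hm.sq hμ]; exact tensorOp_one
  · rw [tensorOp_conjTranspose]; simp only [hm.star hμ]
  · rw [tensorOp_trace]; exact Finset.prod_ne_zero_iff.2 fun _ _ => hm.2

theorem IsAdmissible.idx_mono (hμ : IsRep μ) (hm : IsAdmissible μ m) (hq : IsQCA ξ U)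
    (hs : IsSymmetric μ U) {ξ' : ℕ} (hξ : ξ ≤ ξ') (h6 : 6 * ξ' + 1 ≤ ℓ) :
    idx m ξ' (ev U hq.unitary) = idx m ξ (ev U hq.unitary) :=
  SymQCA.idx_mono hξ hq.spreads h6 (hm.sq hμ) (hm.star hμ) (hm.fixed hμ _ hs) hm.2

theorem IsAdmissible.idx_mul (hμ : IsRep μ) (hm : IsAdmissible μ m) (hq : IsQCA ξ U)
    (hs : IsSymmetric μ U) (hq' : IsQCA ξ U') (hs' : IsSymmetric μ U') (h : 12 * ξ + 1 ≤ ℓ) :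
    idx m (2 * ξ) (ev (U * U') (mul_mem hq.unitary hq'.unitary))
      = idx m ξ (ev U hq.unitary) * idx m ξ (ev U' hq'.unitary) := by
  rw [ev_mul hq.unitary hq'.unitary, idx_trans hq.spreads hq'.spreads h (hm.sq hμ) (hm.star hμ)
    (hm.fixed hμ _ hs) (hm.fixed hμ _ hs') hm.2]

theorem IsQCA.stackL (hq : IsQCA ξ U) (κ : Type) [Fintype κ] [DecidableEq κ] [Nonempty κ] :
    IsQCA ξ (stackL (κ := κ) U) :=
  (isQCA_iff (stackL_mem_unitaryGroup hq.unitary)).2 ((extends_ev hq.unitary).spreads hq.spreads)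

/-- The circuit has index one and ancillas do not change the index, so multiplicativity gives the
claim once all spreading lengths have been raised to a common value. The bound on ℓ does not involve
the number of ancillas. -/
theorem StronglyEquivalent.idx_eq (hμ : IsRep μ) (hm : IsAdmissible μ m) (hq : IsQCA ξ U)
    (hs : IsSymmetric μ U) (hq' : IsQCA ξ U') (hs' : IsSymmetric μ U')
    (h : StronglyEquivalent μ r k U U') (hℓ : 12 * (ξ + 2 * r) + 1 ≤ ℓ) :
    idx m ξ (ev U hq.unitary) = idx m ξ (ev U' hq'.unitary) := by
  obtain ⟨W, hW, he⟩ := h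
  obtain ⟨qW, sW, iW⟩ := hW.props hμ.ancillaRep (by omega)
  rw [withAncillas_eq, withAncillas_eq] at he
  have hma := hm.ancilla (k := k)
  have q1 := (hq.stackL (Fin k → ι)).mono (ξ' := ξ + 2 * r) (by omega)
  have q1' := (hq'.stackL (Fin k → ι)).mono (ξ' := 2 * (ξ + 2 * r)) (by omega)
  have qW1 := qW.mono (ξ' := ξ + 2 * r) (by omega)
  have e1 := hma.idx_mul hμ.ancillaRep qW1 sW q1 (hs.stackL) hℓ
  rw [hma.idx_mono hμ.ancillaRep qW sW (ξ' := ξ + 2 * r) (by omega) (by omega), iW _ _ hma, one_mul,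
    hma.idx_mono hμ.ancillaRep (hq.stackL _) (hs.stackL) (ξ' := ξ + 2 * r) (by omega) (by omega),
    hm.idx_stackL hμ hq hs (by omega)] at e1
  rw [← e1, ← hm.idx_stackL (k := k) hμ hq' hs' (by omega),
    ← hma.idx_mono hμ.ancillaRep (hq'.stackL _) (hs'.stackL) (ξ' := 2 * (ξ + 2 * r)) (by omega)
      (by omega)]
  congr 2
  exact he.symm

end Invariance

/-! ### Gates at the cuts of a balanced automorphism -/

section Balanced
variable {ℓ : ℕ} [NeZero ℓ] {ι : Type} [Fintype ι] [DecidableEq ι] [Nonempty ι]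
  {α : Aut (ZMod ℓ → ι)} {ξ : ℕ} {m : Op ι}

/-- The algebras near the cuts have the same weights as the algebras of half of the window. -/
structure Balanced (m : Op ι) (ξ : ℕ) (α : Aut (ZMod ℓ → ι)) : Prop where
  rdim_right : ∀ c, rdim (Rt ξ α c) = Fintype.card ι ^ (2 * ξ)
  rdim_left : ∀ c, rdim (Lf ξ α c) = Fintype.card ι ^ (2 * ξ)
  tw_right : ∀ c, tw (sym ℓ m) (Rt ξ α c) = kap m ^ ξ
  tw_left : ∀ c, tw (sym ℓ m) (Lf ξ α c) = kap m ^ ξ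

theorem Impl.smul {X : Type} [Fintype X] [DecidableEq X] {R : StarSubalgebra ℂ (Op X)} {u v : Op X}
    (h : Impl u R v) {σ : ℂ} (hσ : σ = 1 ∨ σ = -1) : Impl u R (σ • v) := by
  rcases hσ with rfl | rfl
  · rwa [one_smul]
  · rw [neg_smul, one_smul]; exact h.neg

theorem Impl.ntr_eq {X : Type} [Fintype X] [DecidableEq X] [Nonempty X]
    {R : StarSubalgebra ℂ (Op X)} {u v : Op X} (hR : IsFactor R) (hus : uᴴ = u) (h : Impl u R v)
    {a : ℂ} (ha : Star.star a = a) (ht : SymQCA.tw u R = rdim R * (a * Star.star a)) :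
    ntr v = a ∨ ntr v = -a := by
  have h1 : Star.star (ntr v) = ntr v := by rw [← ntr_conjTranspose, h.star]
  rw [hR.tw_of_implements h.mem (v := v) fun r hr => by rw [hus, h.star, h.conj r hr]] at ht
  have h2 := mul_left_cancel₀ rdim_ne ht
  rw [h1, ha] at h2
  exact mul_self_eq_mul_self_iff.1 h2

theorem cut_window (c : ZMod ℓ) (h : 2 * ξ ≤ ℓ) :
    Disjoint (arc (c - (ξ : ZMod ℓ)) ξ) (arc c ξ) ∧
      arc (c - (ξ : ZMod ℓ)) (2 * ξ) = arc (c - (ξ : ZMod ℓ)) ξ ∪ arc c ξ := by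
  have h1 : arc (c - (ξ : ZMod ℓ)) ξ = iv (c - (ξ : ZMod ℓ)) 0 ξ := by
    have := arc_eq_iv (c - (ξ : ZMod ℓ)) (s := 0) (n := ξ) (by omega)
    simpa using this
  have h2 : arc (c - (ξ : ZMod ℓ)) (2 * ξ) = iv (c - (ξ : ZMod ℓ)) 0 (2 * ξ) := by
    have := arc_eq_iv (c - (ξ : ZMod ℓ)) (s := 0) (n := 2 * ξ) (by omega)
    simpa using this
  have h3 : arc c ξ = iv (c - (ξ : ZMod ℓ)) ξ (2 * ξ) := by
    have := arc_eq_iv (c - (ξ : ZMod ℓ)) (s := ξ) (n := ξ) (by omega)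
    rwa [sub_add_cancel, ← two_mul] at this
  rw [h1, h2, h3]
  exact ⟨iv_disjoint (by omega), iv_union (by omega) (by omega)⟩

theorem star_ntr_onSites {Λ : Type} [Fintype Λ] [DecidableEq Λ] (hms : mᴴ = m) (S : Finset Λ) :
    star (ntr (onSites S m)) = ntr (onSites S m) := by
  rw [← ntr_conjTranspose, onSites_conjTranspose hms]

theorem tw_of_balanced {R : StarSubalgebra ℂ (Op (ZMod ℓ → ι))} {S : Finset (ZMod ℓ)}
    (hS : S.card = ξ) (hr : rdim R = Fintype.card ι ^ (2 * ξ))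
    (ht : tw (sym ℓ m) R = kap m ^ ξ) :
    tw (sym ℓ m) R = rdim R * (ntr (onSites S m) * star (ntr (onSites S m))) := by
  rw [ht, hr, ntr_onSites, hS, star_pow, ← mul_pow, star_div₀, kap, pow_mul]
  push_cast
  rw [← mul_pow, star_natCast]
  have hd : (Fintype.card ι : ℂ) ≠ 0 := by exact_mod_cast Fintype.card_ne_zero
  congr 1
  field_simp

/-- The implementing involutions are unique up to sign. The sign of v is fixed by its trace, that of
w by the product v w. If the trace of v is nonzero, the trace of w follows by division; otherwise
both traces of half windows vanish and so does that of w. -/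
theorem Balanced.exists_cut (hb : Balanced m ξ α) (hα : Spreads ξ α) (h6 : 6 * ξ ≤ ℓ)
    (hm : m * m = 1) (hms : mᴴ = m) (hu : α (sym ℓ m) = sym ℓ m) (c : ZMod ℓ) :
    ∃ v w, Impl (sym ℓ m) (Rt ξ α c) v ∧ Impl (sym ℓ m) (Lf ξ α c) w ∧
      v * w = onSites (arc (c - (ξ : ZMod ℓ)) (2 * ξ)) m ∧
      ntr v = ntr (onSites (arc (c - (ξ : ZMod ℓ)) ξ) m) ∧ ntr w = ntr (onSites (arc c ξ) m) := by
  have hR := isFactor_Rt hα h6 c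
  have hL := isFactor_Lf hα h6 c
  obtain ⟨hd, hun⟩ := cut_window c (ξ := ξ) (by omega)
  have hus : (sym ℓ m)ᴴ = sym ℓ m := onSites_conjTranspose hms _
  obtain ⟨v, hv, hvt⟩ : ∃ v, Impl (sym ℓ m) (Rt ξ α c) v ∧
      ntr v = ntr (onSites (arc (c - (ξ : ZMod ℓ)) ξ) m) := by
    obtain ⟨v, hv⟩ := hR.exists_impl (sym_sq hm) hus (norm_Rt hm hms hu c)
    rcases hv.ntr_eq hR hus (star_ntr_onSites hms _) (tw_of_balanced
      (card_arc (c - (ξ : ZMod ℓ)) (by omega)) (hb.rdim_right c) (hb.tw_right c)) with h | h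
    · exact ⟨v, hv, h⟩
    · refine ⟨-v, hv.neg, ?_⟩
      rw [← neg_one_smul ℂ, ntr_smul, h]; ring
  obtain ⟨w, hw, hvw⟩ : ∃ w, Impl (sym ℓ m) (Lf ξ α c) w ∧
      v * w = onSites (arc (c - (ξ : ZMod ℓ)) (2 * ξ)) m := by
    obtain ⟨w, hw⟩ := hL.exists_impl (sym_sq hm) hus (norm_Lf hm hms hu c)
    rcases (hv.mul (splits_cut' hα h6 c) (sym_sq hm) hw).unique (isFactor_net _)
      (impl_net hm hms _) with h | h
    · exact ⟨w, hw, h.symm⟩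
    · exact ⟨-w, hw.neg, by rw [mul_neg, h]⟩
  refine ⟨v, w, hv, hw, hvw, hvt, ?_⟩
  have h1 := congrArg ntr hvw
  rw [hR.ntr_mul hv.mem fun r hr => (splits_cut' hα h6 c).comm r hr w hw.mem,
    onSites_union hd hun, (isFactor_net _).ntr_mul (onSites_mem _ _)
      fun r hr => net_comm hd hr (onSites_mem _ _), hvt] at h1
  by_cases h0 : ntr (onSites (arc (c - (ξ : ZMod ℓ)) ξ) m) = 0
  · have h2 : ntr (onSites (arc c ξ) m) = 0 := by
      rw [← h0, ntr_onSites, ntr_onSites, card_arc _ (by omega), card_arc _ (by omega)]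
    rcases hw.ntr_eq hL hus (star_ntr_onSites hms (arc c ξ)) (tw_of_balanced
      (card_arc c (by omega)) (hb.rdim_left c) (hb.tw_left c)) with h | h
    · exact h
    · rw [h, h2, neg_zero]
  · exact mul_left_cancel₀ h0 h1

theorem Balanced.exists_gate (hb : Balanced m ξ α) (hα : Spreads ξ α) (h6 : 6 * ξ ≤ ℓ)
    {c : ZMod ℓ} {v w : Op (ZMod ℓ → ι)} (hm : m * m = 1) (hms : mᴴ = m)
    (hv : Impl (sym ℓ m) (Rt ξ α c) v) (hw : Impl (sym ℓ m) (Lf ξ α c) w)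
    (hvw : v * w = onSites (arc (c - (ξ : ZMod ℓ)) (2 * ξ)) m)
    (htv : ntr v = ntr (onSites (arc (c - (ξ : ZMod ℓ)) ξ) m))
    (htw : ntr w = ntr (onSites (arc c ξ) m)) :
    ∃ G ∈ net (arc (c - (ξ : ZMod ℓ)) (2 * ξ)), Gᴴ * G = 1 ∧ Commute G (sym ℓ m) ∧
      (∀ x ∈ net (arc (c - (ξ : ZMod ℓ)) ξ), G * x * Gᴴ ∈ Rt ξ α c) ∧
      (∀ x ∈ net (arc c ξ), G * x * Gᴴ ∈ Lf ξ α c) ∧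
      G * onSites (arc (c - (ξ : ZMod ℓ)) ξ) m * Gᴴ = v ∧ G * onSites (arc c ξ) m * Gᴴ = w := by
  obtain ⟨hd, hun⟩ := cut_window c (ξ := ξ) (by omega)
  obtain ⟨G, hG, hU, h1, h2, h3, h4⟩ := SymQCA.exists_gate (isFactor_net _) (splits_cut' hα h6 c)
    (splits_net hd hun) ⟨hv.mem, hv.sq, hv.star⟩ ⟨hw.mem, hw.sq, hw.star⟩
    ⟨onSites_mem _ m, onSites_mul_self hm _, onSites_conjTranspose hms _⟩
    ⟨onSites_mem _ m, onSites_mul_self hm _, onSites_conjTranspose hms _⟩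
    (by rw [hb.rdim_right, rdim_net, card_arc _ (by omega)])
    (by rw [hb.rdim_left, rdim_net, card_arc _ (by omega)]) htv htw
  have hU' : G * Gᴴ = 1 := mul_eq_one_comm.1 hU
  refine ⟨G, hG, hU, ?_, h1, h2, by rw [h3, mul_assoc, hU', mul_one],
    by rw [h4, mul_assoc, hU', mul_one]⟩
  have h5 : G * onSites (arc (c - (ξ : ZMod ℓ)) (2 * ξ)) m
      = onSites (arc (c - (ξ : ZMod ℓ)) (2 * ξ)) m * G := by
    conv_lhs => rw [onSites_union hd hun, ← mul_assoc, h3, mul_assoc, h4, ← mul_assoc, hvw]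
  have h6 : sym ℓ m = onSites (arc (c - (ξ : ZMod ℓ)) (2 * ξ)) m *
      onSites (arc (c - (ξ : ZMod ℓ)) (2 * ξ))ᶜ m :=
    onSites_union disjoint_compl_right (by simp) m
  change G * _ = _ * G
  rw [h6, ← mul_assoc, h5, mul_assoc, mul_assoc, net_comm disjoint_compl_right hG (onSites_mem _ _)]

end Balanced

/-! ### Products of commuting gates -/

section Product
variable {Λ : Type} [Fintype Λ] [DecidableEq Λ] {ι : Type} [Fintype ι] [DecidableEq ι] [Nonempty ι]
  {n : ℕ} {A : Fin n → Finset Λ} {G : Fin n → Op (Λ → ι)}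

theorem list_prod_mem_net_compl (hGA : ∀ j, G j ∈ net (A j)) {B : Finset Λ}
    (hB : ∀ j, Disjoint (A j) B) : (List.ofFn G).prod ∈ net Bᶜ :=
  list_prod_mem fun x hx => by
    obtain ⟨j, rfl⟩ := (List.mem_ofFn' _ _).1 hx
    exact net_mono (Finset.subset_compl_iff_disjoint_right.2 (hB j)) (hGA j)

theorem exists_prod_eq (hGA : ∀ j, G j ∈ net (A j)) (hA : ∀ j j', j ≠ j' → Disjoint (A j) (A j'))
    (j : Fin n) : ∃ R ∈ net (A j)ᶜ, (List.ofFn G).prod = G j * R := by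
  induction n with
  | zero => exact j.elim0
  | succ n ih =>
    rw [List.ofFn_succ, List.prod_cons]
    refine Fin.cases ?_ (fun i => ?_) j
    · exact ⟨_, list_prod_mem_net_compl (fun i => hGA i.succ) fun i =>
        hA _ _ (Fin.succ_ne_zero i), rfl⟩
    · obtain ⟨R, hR, h⟩ := ih (A := fun i => A i.succ) (G := fun i => G i.succ)
        (fun i => hGA i.succ) (fun i i' h => hA _ _ fun h' => h (Fin.succ_injective _ h')) i
      have hd := hA _ _ (Fin.succ_ne_zero i)
      refine ⟨G 0 * R, mul_mem (net_mono (Finset.subset_compl_iff_disjoint_right.2 hd.symm) (hGA 0))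
        hR, ?_⟩
      rw [h, ← mul_assoc, ← mul_assoc, net_comm hd (hGA _) (hGA 0)]

/-- The gate at A j can be pulled to the front; the remaining factor is supported elsewhere and
cancels. -/
theorem list_prod_conj (hG : ∀ j, G j ∈ Matrix.unitaryGroup (Λ → ι) ℂ) (hGA : ∀ j, G j ∈ net (A j))
    (hA : ∀ j j', j ≠ j' → Disjoint (A j) (A j')) (j : Fin n) {y : Op (Λ → ι)}
    (hy : y ∈ net (A j)) :
    (List.ofFn G).prodᴴ * y * (List.ofFn G).prod = (G j)ᴴ * y * G j ∧
      (List.ofFn G).prod * y * (List.ofFn G).prodᴴ = G j * y * (G j)ᴴ := by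
  obtain ⟨R, hR, h⟩ := exists_prod_eq hGA hA j
  have hP := list_ofFn_prod_mem_unitaryGroup hG
  have hG1 : (G j)ᴴ * G j = 1 := Matrix.mem_unitaryGroup_iff'.1 (hG j)
  have hRe : R = (G j)ᴴ * (List.ofFn G).prod := by rw [h, ← mul_assoc, hG1, one_mul]
  have hRU : R ∈ Matrix.unitaryGroup (Λ → ι) ℂ :=
    hRe ▸ mul_mem (conjTranspose_mem_unitaryGroup (hG j)) hP
  have hR1 : Rᴴ * R = 1 := Matrix.mem_unitaryGroup_iff'.1 hRU
  have hR2 : R * Rᴴ = 1 := Matrix.mem_unitaryGroup_iff.1 hRU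
  rw [h, Matrix.conjTranspose_mul]
  constructor
  · rw [show Rᴴ * (G j)ᴴ * y * (G j * R) = Rᴴ * (((G j)ᴴ * y * G j) * R) by simp only [mul_assoc],
      net_comm disjoint_compl_right (mul_mem (mul_mem (conjTranspose_mem (hGA j)) hy) (hGA j)) hR,
      ← mul_assoc, hR1, one_mul]
  · rw [show G j * R * y * (Rᴴ * (G j)ᴴ) = G j * (R * y * Rᴴ) * (G j)ᴴ by simp only [mul_assoc],
      ← net_comm disjoint_compl_right hy hR, mul_assoc y, hR2, mul_one]

theorem list_prod_conj_of_disjoint (hG : ∀ j, G j ∈ Matrix.unitaryGroup (Λ → ι) ℂ)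
    (hGA : ∀ j, G j ∈ net (A j)) {B : Finset Λ}
    (hB : ∀ j, Disjoint (A j) B) {y : Op (Λ → ι)} (hy : y ∈ net B) :
    (List.ofFn G).prodᴴ * y * (List.ofFn G).prod = y := by
  have hP : (List.ofFn G).prodᴴ * (List.ofFn G).prod = 1 :=
    Matrix.mem_unitaryGroup_iff'.1 (list_ofFn_prod_mem_unitaryGroup hG)
  rw [mul_assoc, net_comm disjoint_compl_right hy (list_prod_mem_net_compl hGA hB), ← mul_assoc, hP,
    one_mul]

end Product

/-! ### Positions of the cuts -/

section Positions

/-- The position of the `x`-th cut. -/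
def cutPos (ℓ ζ x : ℕ) : ℕ := if x < ℓ / (2 * ζ) then 2 * ζ * x else ℓ

variable {ℓ ζ : ℕ}

theorem cutPos_zero (h : 2 * ζ ≤ ℓ) (hζ : 1 ≤ ζ) : cutPos ℓ ζ 0 = 0 := by
  rw [cutPos, if_pos (Nat.div_pos h (by omega)), mul_zero]

theorem cutPos_last : cutPos ℓ ζ (ℓ / (2 * ζ)) = ℓ := if_neg (lt_irrefl _)

/-- The last cell absorbs the remainder of ℓ modulo 2ζ, which is why cells have at least 2ζ and at
most 4ζ sites. The position ℓ of the final cut is the site 0 again, so cells and cuts close up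
around the ring. -/
theorem cutPos_succ (hζ : 1 ≤ ζ) {x : ℕ} (hx : x < ℓ / (2 * ζ)) :
    cutPos ℓ ζ x = 2 * ζ * x ∧ cutPos ℓ ζ x + 2 * ζ ≤ cutPos ℓ ζ (x + 1) ∧
      cutPos ℓ ζ (x + 1) ≤ cutPos ℓ ζ x + 4 * ζ ∧ cutPos ℓ ζ (x + 1) ≤ ℓ ∧
      (x + 1 < ℓ / (2 * ζ) → cutPos ℓ ζ (x + 1) = cutPos ℓ ζ x + 2 * ζ) := by
  have h1 : 2 * ζ * (ℓ / (2 * ζ)) ≤ ℓ := Nat.mul_div_le _ _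
  have h2 : ℓ < 2 * ζ * (ℓ / (2 * ζ)) + 2 * ζ := by
    have := Nat.lt_mul_div_succ ℓ (show 0 < 2 * ζ by omega)
    rwa [mul_add, mul_one] at this
  have h3 : 2 * ζ * (x + 1) ≤ 2 * ζ * (ℓ / (2 * ζ)) := Nat.mul_le_mul_left _ hx
  rw [mul_add, mul_one] at h3
  have h4 : cutPos ℓ ζ x = 2 * ζ * x := if_pos hx
  refine ⟨h4, ?_⟩
  rw [h4]
  by_cases h : x + 1 < ℓ / (2 * ζ)
  · rw [cutPos, if_pos h, mul_add, mul_one]; omega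
  · have h5 : x + 1 = ℓ / (2 * ζ) := by omega
    rw [cutPos, if_neg h]
    rw [← h5, mul_add, mul_one] at h2
    omega

theorem exists_cutPos (hζ : 1 ≤ ζ) (h : 2 * ζ ≤ ℓ) {i : ℕ} (hi : i < ℓ) :
    ∃ x < ℓ / (2 * ζ), cutPos ℓ ζ x ≤ i ∧ i < cutPos ℓ ζ (x + 1) := by
  have h0 : 0 < ℓ / (2 * ζ) := Nat.div_pos h (by omega)
  have key : ∀ n, n ≤ ℓ / (2 * ζ) → i < cutPos ℓ ζ n →
      ∃ x < ℓ / (2 * ζ), cutPos ℓ ζ x ≤ i ∧ i < cutPos ℓ ζ (x + 1) := by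
    intro n
    induction n with
    | zero => intro _ h'; rw [cutPos_zero h hζ] at h'; omega
    | succ n ih =>
      intro hn h'
      by_cases hc : cutPos ℓ ζ n ≤ i
      · exact ⟨n, by omega, hc, h'⟩
      · exact ih (by omega) (by omega)
  exact key _ le_rfl (by rw [cutPos_last]; exact hi)

end Positions

/-! ### The layer of gates at the cuts -/

section Gluing
variable {ℓ : ℕ} [NeZero ℓ] {ι : Type} [Fintype ι] [DecidableEq ι] [Nonempty ι]
  {α : Aut (ZMod ℓ → ι)} {ζ : ℕ} {m : Op ι}

/-- The window of the cut `c`. -/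
abbrev window (ζ : ℕ) (c : ZMod ℓ) : Finset (ZMod ℓ) := arc (c - (ζ : ZMod ℓ)) (2 * ζ)

/-- Gates that map the algebras of the halves of the windows to the algebras near the cuts, and the
symmetry operators of these halves to given operators. -/
structure IsGateFamily (α : Aut (ZMod ℓ → ι)) (ζ : ℕ) (m : Op ι) (G v w : ZMod ℓ → Op (ZMod ℓ → ι)) :
    Prop where
  mem : ∀ c, G c ∈ net (window ζ c)
  unitary : ∀ c, (G c)ᴴ * G c = 1
  comm : ∀ c, Commute (G c) (sym ℓ m)
  right : ∀ c, ∀ x ∈ net (arc (c - (ζ : ZMod ℓ)) ζ), G c * x * (G c)ᴴ ∈ Rt ζ α c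
  left : ∀ c, ∀ x ∈ net (arc c ζ), G c * x * (G c)ᴴ ∈ Lf ζ α c
  conj_right : ∀ c, G c * onSites (arc (c - (ζ : ZMod ℓ)) ζ) m * (G c)ᴴ = v c
  conj_left : ∀ c, G c * onSites (arc c ζ) m * (G c)ᴴ = w c

/-- The cut with number `x`. -/
abbrev cut (ℓ ζ x : ℕ) : ZMod ℓ := ((cutPos ℓ ζ x : ℕ) : ZMod ℓ)

/-- The layer of the adjoints of the gates at all cuts. -/
def gateLayer (ζ : ℕ) (G : ZMod ℓ → Op (ZMod ℓ → ι)) : Op (ZMod ℓ → ι) :=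
  (List.ofFn fun j : Fin (ℓ / (2 * ζ)) => (G (cut ℓ ζ j))ᴴ).prod

theorem window_eq_iv {x : ℕ} (hζ : 1 ≤ ζ) (hx : x < ℓ / (2 * ζ)) :
    window ζ (cut ℓ ζ x) = iv (-(ζ : ZMod ℓ)) (2 * ζ * x) (2 * ζ * x + 2 * ζ) := by
  obtain ⟨h1, h2, h3, h4, -⟩ := cutPos_succ hζ hx
  rw [← arc_eq_iv _ (by omega), window, cut, h1]
  congr 1
  ring

theorem window_disjoint (hζ : 1 ≤ ζ) {x y : ℕ} (hx : x < ℓ / (2 * ζ)) (hy : y < ℓ / (2 * ζ))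
    (h : x ≠ y) : Disjoint (window ζ (cut ℓ ζ x)) (window ζ (cut ℓ ζ y)) := by
  rw [window_eq_iv hζ hx, window_eq_iv hζ hy]
  refine iv_disjoint ?_
  rcases lt_or_gt_of_ne h with h | h
  · left
    have := Nat.mul_le_mul_left (2 * ζ) h
    rwa [Nat.succ_eq_add_one, mul_add, mul_one] at this
  · right
    have := Nat.mul_le_mul_left (2 * ζ) h
    rwa [Nat.succ_eq_add_one, mul_add, mul_one] at this

theorem exists_cut_eq (hζ : 1 ≤ ζ) (h : 2 * ζ ≤ ℓ) {x : ℕ} (hx : x ≤ ℓ / (2 * ζ)) :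
    ∃ j : Fin (ℓ / (2 * ζ)), cut ℓ ζ j = cut ℓ ζ x := by
  rcases lt_or_eq_of_le hx with hx | rfl
  · exact ⟨⟨x, hx⟩, rfl⟩
  · refine ⟨⟨0, Nat.div_pos h (by omega)⟩, ?_⟩
    rw [cut, cut, cutPos_last, cutPos_zero h hζ]
    simp

/-- The layer is built from adjoints, so that x ↦ L†xL, which has the form of α, conjugates each
window by G itself. -/
theorem gateLayer_spec {G v w : ZMod ℓ → Op (ZMod ℓ → ι)} (hG : IsGateFamily α ζ m G v w)
    (hζ : 1 ≤ ζ) (h : 2 * ζ ≤ ℓ) :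
    gateLayer ζ G ∈ Matrix.unitaryGroup (ZMod ℓ → ι) ℂ ∧
    (∀ x ≤ ℓ / (2 * ζ), ∀ y ∈ net (window ζ (cut ℓ ζ x)),
      (gateLayer ζ G)ᴴ * y * gateLayer ζ G = G (cut ℓ ζ x) * y * (G (cut ℓ ζ x))ᴴ) ∧
    (∀ x < ℓ / (2 * ζ), ∀ y ∈ net (iv (0 : ZMod ℓ) (cutPos ℓ ζ x + ζ) (cutPos ℓ ζ (x + 1) - ζ)),
      (gateLayer ζ G)ᴴ * y * gateLayer ζ G = y) := by
  have hU : ∀ c, (G c)ᴴ ∈ Matrix.unitaryGroup (ZMod ℓ → ι) ℂ := fun c =>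
    conjTranspose_mem_unitaryGroup (Matrix.mem_unitaryGroup_iff'.2 (hG.unitary c))
  have hm : ∀ c, (G c)ᴴ ∈ net (window ζ c) := fun c => conjTranspose_mem (hG.mem c)
  refine ⟨list_ofFn_prod_mem_unitaryGroup fun j => hU _, fun x hx y hy => ?_, fun x hx y hy => ?_⟩
  · obtain ⟨j, hj⟩ := exists_cut_eq hζ h hx
    rw [← hj] at hy ⊢
    have := (list_prod_conj (A := fun j : Fin (ℓ / (2 * ζ)) => window ζ (cut ℓ ζ j))
      (fun j : Fin (ℓ / (2 * ζ)) => hU (cut ℓ ζ j)) (fun j => hm _)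
      (fun j j' hjj => window_disjoint hζ j.2 j'.2 fun h => hjj (Fin.ext h)) j hy).1
    rw [Matrix.conjTranspose_conjTranspose] at this
    exact this
  · refine list_prod_conj_of_disjoint (A := fun j : Fin (ℓ / (2 * ζ)) => window ζ (cut ℓ ζ j))
      (fun j : Fin (ℓ / (2 * ζ)) => hU (cut ℓ ζ j)) (fun j => hm _) (fun j => ?_) hy
    obtain ⟨h1, h2, h3, h4, h5⟩ := cutPos_succ hζ hx
    rw [window_eq_iv hζ j.2]
    have e : iv (0 : ZMod ℓ) (cutPos ℓ ζ x + ζ) (cutPos ℓ ζ (x + 1) - ζ)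
        = iv (-(ζ : ZMod ℓ)) (cutPos ℓ ζ x + 2 * ζ) (cutPos ℓ ζ (x + 1)) := by
      have := iv_shift (-(ζ : ZMod ℓ)) (k := ζ) (s := cutPos ℓ ζ x + ζ)
        (e := cutPos ℓ ζ (x + 1) - ζ) (by omega) (by omega)
      rw [neg_add_cancel] at this
      rw [this]
      congr 1 <;> omega
    rw [e]
    refine iv_disjoint ?_
    rcases Nat.lt_or_ge x j with hjx | hjx
    · right
      have h6 := h5 (by omega)
      have := Nat.mul_le_mul_left (2 * ζ) hjx
      rw [Nat.succ_eq_add_one, mul_add, mul_one] at this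
      omega
    · left
      have := Nat.mul_le_mul_left (2 * ζ) hjx
      omega

/-- The interval between two consecutive cuts. -/
abbrev cell (ℓ ζ x : ℕ) [NeZero ℓ] : Finset (ZMod ℓ) :=
  iv 0 (cutPos ℓ ζ x) (cutPos ℓ ζ (x + 1))

theorem cell_parts {x : ℕ} (hζ : 1 ≤ ζ) (hx : x < ℓ / (2 * ζ)) :
    arc (cut ℓ ζ x) ζ = iv 0 (cutPos ℓ ζ x) (cutPos ℓ ζ x + ζ) ∧
    arc (cut ℓ ζ (x + 1) - (ζ : ZMod ℓ)) ζ = iv 0 (cutPos ℓ ζ (x + 1) - ζ) (cutPos ℓ ζ (x + 1)) := by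
  obtain ⟨h1, h2, h3, h4, -⟩ := cutPos_succ hζ hx
  constructor
  · rw [← arc_eq_iv _ (by omega), zero_add]
  · have := arc_sub_eq_iv (0 : ZMod ℓ) (s := cutPos ℓ ζ (x + 1)) (k := ζ) (n := ζ) (by omega) (by omega)
    rw [zero_add] at this
    rw [this]
    congr 1
    omega

/-- A cell consists of the right half of the window of its first cut, a middle part, and the left
half of the window of its last cut. They go to Lf, to themselves and to Rt, all of which lie in the
image of the cell under α. -/
theorem gateLayer_cell {G v w : ZMod ℓ → Op (ZMod ℓ → ι)} (hG : IsGateFamily α ζ m G v w)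
    (hα : Spreads ζ α) (hζ : 1 ≤ ζ) (h : 2 * ζ ≤ ℓ) {x : ℕ} (hx : x < ℓ / (2 * ζ)) :
    (∀ y ∈ net (cell ℓ ζ x), (gateLayer ζ G)ᴴ * y * gateLayer ζ G ∈ img α (net (cell ℓ ζ x))) ∧
    (gateLayer ζ G)ᴴ * onSites (cell ℓ ζ x) m * gateLayer ζ G = w (cut ℓ ζ x) *
      onSites (iv 0 (cutPos ℓ ζ x + ζ) (cutPos ℓ ζ (x + 1) - ζ)) m * v (cut ℓ ζ (x + 1)) := by
  obtain ⟨hL, k1, k2⟩ := gateLayer_spec hG hζ h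
  obtain ⟨h1, h2, h3, h4, -⟩ := cutPos_succ hζ hx
  obtain ⟨p1, p2⟩ := cell_parts hζ hx
  have w1 := (cut_window (cut ℓ ζ x) (ξ := ζ) h).2
  have w2 := (cut_window (cut ℓ ζ (x + 1)) (ξ := ζ) h).2
  have i1 : arc (cut ℓ ζ x) ζ ⊆ window ζ (cut ℓ ζ x) := by
    rw [window, w1]; exact Finset.subset_union_right
  have i2 : arc (cut ℓ ζ (x + 1) - (ζ : ZMod ℓ)) ζ ⊆ window ζ (cut ℓ ζ (x + 1)) := by
    rw [window, w2]; exact Finset.subset_union_left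
  have l1 : Lf ζ α (cut ℓ ζ x) ≤ img α (net (cell ℓ ζ x)) := by
    refine inf_le_right.trans (img_mono (net_mono ?_))
    have := arc_eq_iv (0 : ZMod ℓ) (s := cutPos ℓ ζ x) (n := 2 * ζ) (by omega)
    rw [zero_add] at this
    rw [this]
    exact iv_subset (by omega)
  have l2 : Rt ζ α (cut ℓ ζ (x + 1)) ≤ img α (net (cell ℓ ζ x)) := by
    refine inf_le_right.trans (img_mono (net_mono ?_))
    have := arc_sub_eq_iv (0 : ZMod ℓ) (s := cutPos ℓ ζ (x + 1)) (k := 2 * ζ) (n := 2 * ζ) (by omega)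
      (by omega)
    rw [zero_add] at this
    rw [this]
    exact iv_subset (by omega)
  constructor
  · have key : net (cell ℓ ζ x) ≤ img (ev _ hL).symm (img α (net (cell ℓ ζ x))) := by
      refine net_biUnion_induction fun i hi y hy => ?_
      rw [mem_img, StarAlgEquiv.symm_symm, ev_apply]
      rw [mem_iv] at hi
      by_cases c1 : (i - 0).val < cutPos ℓ ζ x + ζ
      · have hy' : y ∈ net (arc (cut ℓ ζ x) ζ) := by
          refine net_mono ?_ hy
          rw [p1, Finset.singleton_subset_iff, mem_iv]
          omega
        rw [k1 x hx.le y (net_mono i1 hy')]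
        exact l1 (hG.left _ y hy')
      · by_cases c2 : (i - 0).val < cutPos ℓ ζ (x + 1) - ζ
        · have hy' : y ∈ net (iv (0 : ZMod ℓ) (cutPos ℓ ζ x + ζ) (cutPos ℓ ζ (x + 1) - ζ)) := by
            refine net_mono ?_ hy
            rw [Finset.singleton_subset_iff, mem_iv]
            omega
          rw [k2 x hx y hy']
          exact net_mono (iv_subset (by omega)) (hα.symm.maps_iv 0 (by omega) (by omega) y hy')
        · have hy' : y ∈ net (arc (cut ℓ ζ (x + 1) - (ζ : ZMod ℓ)) ζ) := by
            refine net_mono ?_ hy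
            rw [p2, Finset.singleton_subset_iff, mem_iv]
            omega
          rw [k1 (x + 1) hx y (net_mono i2 hy')]
          exact l2 (hG.right _ y hy')
    intro y hy
    have := key hy
    rwa [mem_img, StarAlgEquiv.symm_symm, ev_apply] at this
  · have e : onSites (cell ℓ ζ x) m = onSites (arc (cut ℓ ζ x) ζ) m *
        onSites (iv 0 (cutPos ℓ ζ x + ζ) (cutPos ℓ ζ (x + 1) - ζ)) m *
        onSites (arc (cut ℓ ζ (x + 1) - (ζ : ZMod ℓ)) ζ) m := by
      rw [p1, p2, mul_assoc, ← onSites_union (iv_disjoint (by omega))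
        (iv_union (by omega) (by omega)), ← onSites_union (iv_disjoint (by omega))
        (iv_union (by omega) (by omega))]
    rw [← ev_apply hL, e, map_mul, map_mul, ev_apply, ev_apply, ev_apply,
      k1 x hx.le _ (net_mono i1 (onSites_mem _ _)), k1 (x + 1) hx _ (net_mono i2 (onSites_mem _ _)),
      k2 x hx _ (onSites_mem _ _), hG.conj_left, hG.conj_right]

/-- The image of the symmetry operator of a cell, up to a sign. -/
theorem exists_cell_sign (hα : Spreads ζ α) (hm : m * m = 1) (hms : mᴴ = m)
    (hu : α (sym ℓ m) = sym ℓ m) (hζ : 1 ≤ ζ) (h : 8 * ζ ≤ ℓ) {v w : ZMod ℓ → Op (ZMod ℓ → ι)}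
    (hv : ∀ c, Impl (sym ℓ m) (Rt ζ α c) (v c)) (hw : ∀ c, Impl (sym ℓ m) (Lf ζ α c) (w c))
    {x : ℕ} (hx : x < ℓ / (2 * ζ)) : ∃ ε : ℂ, (ε = 1 ∨ ε = -1) ∧
      w (cut ℓ ζ x) * onSites (iv 0 (cutPos ℓ ζ x + ζ) (cutPos ℓ ζ (x + 1) - ζ)) m *
        v (cut ℓ ζ (x + 1)) = ε • α (onSites (cell ℓ ζ x) m) := by
  obtain ⟨h1, h2, h3, h4, -⟩ := cutPos_succ hζ hx
  set s := cutPos ℓ ζ x with hs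
  obtain ⟨n, hn⟩ := Nat.exists_eq_add_of_le (show s ≤ cutPos ℓ ζ (x + 1) by omega)
  set b : ZMod ℓ := cut ℓ ζ x - ((3 * ζ : ℕ) : ZMod ℓ) with hb
  have hbc : b + ((3 * ζ : ℕ) : ZMod ℓ) = cut ℓ ζ x := sub_add_cancel _ _
  obtain ⟨w', v', hw', hv', he⟩ := exists_boundary hα hm hms hu b (s := 3 * ζ) (e := 3 * ζ + n) le_rfl
    (by omega) (by omega)
  have hbc' : b + ((3 * ζ + n : ℕ) : ZMod ℓ) = cut ℓ ζ (x + 1) := by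
    rw [Nat.cast_add, ← add_assoc, hbc, cut, cut, hn, Nat.cast_add]
  rw [hbc] at hw'
  rw [hbc'] at hv'
  have e1 : iv b (3 * ζ) (3 * ζ + n) = cell ℓ ζ x := by
    rw [← arc_eq_iv _ (by omega), hbc, cell, hn, ← arc_eq_iv _ (by omega), zero_add]
  have e2 : iv b (3 * ζ + ζ) (3 * ζ + n - ζ) = iv 0 (s + ζ) (cutPos ℓ ζ (x + 1) - ζ) := by
    rw [show 3 * ζ + n - ζ = 3 * ζ + ζ + (n - 2 * ζ) by omega, ← arc_eq_iv _ (by omega), hn,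
      show s + n - ζ = s + ζ + (n - 2 * ζ) by omega, ← arc_eq_iv _ (by omega), Nat.cast_add,
      ← add_assoc, hbc, zero_add, Nat.cast_add, cut]
  rw [e1, e2] at he
  rw [he]
  have hR := isFactor_Rt hα (by omega) (cut ℓ ζ (x + 1))
  have hL := isFactor_Lf hα (by omega) (cut ℓ ζ x)
  rcases hw'.unique hL (hw (cut ℓ ζ x)) with r1 | r1 <;>
    rcases hv'.unique hR (hv (cut ℓ ζ (x + 1))) with r2 | r2 <;> rw [r1, r2]
  · exact ⟨1, Or.inl rfl, by rw [one_smul]⟩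
  · exact ⟨-1, Or.inr rfl, by rw [neg_smul, one_smul, mul_neg]⟩
  · exact ⟨-1, Or.inr rfl, by rw [neg_smul, one_smul, neg_mul, neg_mul]⟩
  · exact ⟨1, Or.inl rfl, by rw [one_smul]; simp only [neg_mul, mul_neg, neg_neg]⟩

end Gluing

section Gluing
variable {ℓ : ℕ} [NeZero ℓ] {ι : Type} [Fintype ι] [DecidableEq ι] [Nonempty ι]
  {α : Aut (ZMod ℓ → ι)} {ζ : ℕ} {m : Op ι}

/-- A sign may be put on both involutions at a cut without changing their product. The gate also
needs matching traces, so the sign -1 is available only if the trace of m vanishes. -/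
theorem Balanced.exists_gateFamily (hb : Balanced m ζ α) (hα : Spreads ζ α) (hm : m * m = 1)
    (hms : mᴴ = m) (hζ : 1 ≤ ζ) (h : 8 * ζ ≤ ℓ)
    {v w : ZMod ℓ → Op (ZMod ℓ → ι)} (hv : ∀ c, Impl (sym ℓ m) (Rt ζ α c) (v c))
    (hw : ∀ c, Impl (sym ℓ m) (Lf ζ α c) (w c))
    (hvw : ∀ c, v c * w c = onSites (window ζ c) m)
    (htv : ∀ c, ntr (v c) = ntr (onSites (arc (c - (ζ : ZMod ℓ)) ζ) m))
    (htw : ∀ c, ntr (w c) = ntr (onSites (arc c ζ) m))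
    {σ : ZMod ℓ → ℂ} (hσ : ∀ c, σ c = 1 ∨ σ c = -1) (hσ' : ∀ c, σ c = 1 ∨ m.trace = 0) :
    ∃ G, IsGateFamily α ζ m G (fun c => σ c • v c) (fun c => σ c • w c) := by
  have key : ∀ c, ∀ S : Finset (ZMod ℓ), S.card = ζ →
      σ c * ntr (onSites S m) = ntr (onSites S m) := by
    intro c S hS
    rcases hσ' c with h | h
    · rw [h, one_mul]
    · rw [ntr_onSites, hS, h, zero_div, zero_pow (by omega), mul_zero]
  have hG : ∀ c, _ := fun c => hb.exists_gate hα (by omega) (c := c) hm hms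
    ((hv c).smul (hσ c)) ((hw c).smul (hσ c))
    (by
      rw [smul_mul_smul_comm, hvw]
      rcases hσ c with h | h <;> rw [h] <;> norm_num)
    (by rw [ntr_smul, htv, key c _ (card_arc _ (by omega))])
    (by rw [ntr_smul, htw, key c _ (card_arc _ (by omega))])
  choose G h1 h2 h3 h4 h5 h6 h7 using hG
  exact ⟨G, h1, h2, h3, h4, h5, h6, h7⟩

theorem IsGateFamily.commute {G v w : ZMod ℓ → Op (ZMod ℓ → ι)} (hG : IsGateFamily α ζ m G v w)
    (hms : mᴴ = m) : Commute (gateLayer ζ G) (sym ℓ m) := by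
  refine (Commute.list_prod_right _ _ fun x hx => ?_).symm
  obtain ⟨j, rfl⟩ := (List.mem_ofFn' _ _).1 hx
  have := congrArg Matrix.conjTranspose (hG.comm (cut ℓ ζ j)).eq
  rw [Matrix.conjTranspose_mul, Matrix.conjTranspose_mul, onSites_conjTranspose hms] at this
  exact this

/-- The gates can be chosen in such a way that the layer maps the symmetry operators of the cells
to their images under `α`. -/
theorem Balanced.exists_layer (hb : Balanced m ζ α) (hα : Spreads ζ α) (hm : m * m = 1)
    (hms : mᴴ = m) (hu : α (sym ℓ m) = sym ℓ m) (hζ : 1 ≤ ζ) (h : 8 * ζ ≤ ℓ) :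
    ∃ G v w, IsGateFamily α ζ m G v w ∧ ∀ x < ℓ / (2 * ζ),
      (gateLayer ζ G)ᴴ * onSites (cell ℓ ζ x) m * gateLayer ζ G = α (onSites (cell ℓ ζ x) m) := by
  choose v w hv hw hvw htv htw using hb.exists_cut hα (by omega) hm hms hu
  have hε := fun x : Fin (ℓ / (2 * ζ)) => exists_cell_sign hα hm hms hu hζ h hv hw x.2
  choose ε hε1 hε2 using hε
  by_cases hk : m.trace = 0
  · let e : ℕ → ℂ := fun y => if hy : y < ℓ / (2 * ζ) then ε ⟨y, hy⟩ else 1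
    have he1 : ∀ y, e y = 1 ∨ e y = -1 := by
      intro y
      by_cases hy : y < ℓ / (2 * ζ)
      · simp only [e, dif_pos hy]; exact hε1 _
      · simp only [e, dif_neg hy]; exact Or.inl trivial
    have he2 : ∀ n : ℕ, (∏ y ∈ Finset.range n, e y) = 1 ∨ (∏ y ∈ Finset.range n, e y) = -1 := by
      intro n
      induction n with
      | zero => left; simp
      | succ n ih =>
        rw [Finset.prod_range_succ]
        rcases ih with h1 | h1 <;> rcases he1 n with h2 | h2 <;> rw [h1, h2] <;> norm_num
    -- The sign at a cut is the product of the errors of all cells before it. The error of cell x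
    -- becomes σ(x) σ(x+1) e(x), which is one for all cells but possibly the last.
    let σ : ZMod ℓ → ℂ := fun c => ∏ y ∈ Finset.range (c.val / (2 * ζ)), e y
    have hσ : ∀ c, σ c = 1 ∨ σ c = -1 := fun c => he2 _
    have hσx : ∀ x < ℓ / (2 * ζ), σ (cut ℓ ζ x) = ∏ y ∈ Finset.range x, e y := by
      intro x hx
      obtain ⟨h1, h2, h3, h4, -⟩ := cutPos_succ hζ hx
      simp only [σ, cut]
      rw [ZMod.val_natCast, Nat.mod_eq_of_lt (by omega), h1, Nat.mul_div_cancel_left _ (by omega)]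
    obtain ⟨G, hG⟩ := hb.exists_gateFamily hα hm hms hζ h hv hw hvw htv htw hσ fun _ => Or.inr hk
    refine ⟨G, _, _, hG, ?_⟩
    have key : ∀ x < ℓ / (2 * ζ), (gateLayer ζ G)ᴴ * onSites (cell ℓ ζ x) m * gateLayer ζ G
        = (σ (cut ℓ ζ x) * σ (cut ℓ ζ (x + 1)) * e x) • α (onSites (cell ℓ ζ x) m) := by
      intro x hx
      rw [(gateLayer_cell hG hα hζ (by omega) hx).2, smul_mul_assoc, smul_mul_smul_comm,
        hε2 ⟨x, hx⟩, smul_smul]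
      simp only [e, dif_pos hx]
    have sq : ∀ a : ℂ, (a = 1 ∨ a = -1) → a * a = 1 := by
      rintro a (rfl | rfl) <;> norm_num
    have h1 : ∀ x, x + 1 < ℓ / (2 * ζ) →
        (gateLayer ζ G)ᴴ * onSites (cell ℓ ζ x) m * gateLayer ζ G = α (onSites (cell ℓ ζ x) m) := by
      intro x hx
      rw [key x (by omega), hσx x (by omega), hσx (x + 1) hx, Finset.prod_range_succ]
      have h2 := sq _ (he2 x)
      have h3 := sq _ (he1 x)
      rw [show (∏ y ∈ Finset.range x, e y) * ((∏ y ∈ Finset.range x, e y) * e x) * e x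
        = ((∏ y ∈ Finset.range x, e y) * (∏ y ∈ Finset.range x, e y)) * (e x * e x) by ring, h2, h3,
        one_mul, one_smul]
    obtain ⟨hL, -, -⟩ := gateLayer_spec hG hζ (by omega)
    have h2 : ∀ x < ℓ / (2 * ζ), (gateLayer ζ G)ᴴ * onSites (iv 0 0 (cutPos ℓ ζ x)) m * gateLayer ζ G
        = α (onSites (iv 0 0 (cutPos ℓ ζ x)) m) := by
      intro x
      induction x with
      | zero =>
        intro hx
        have : iv (0 : ZMod ℓ) 0 (cutPos ℓ ζ 0) = ∅ := by
          ext i; rw [mem_iv, cutPos_zero (by omega) hζ]; simp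
        rw [this, onSites_empty, map_one, mul_one]
        exact Matrix.mem_unitaryGroup_iff'.1 hL
      | succ x ih =>
        intro hx
        have ih := ih (by omega)
        obtain ⟨h3, h4, -⟩ := cutPos_succ hζ (show x < ℓ / (2 * ζ) by omega)
        have h5 := h1 x hx
        rw [← ev_apply hL] at ih h5 ⊢
        rw [onSites_union (iv_disjoint (s := 0) (e := cutPos ℓ ζ x) (s' := cutPos ℓ ζ x)
          (e' := cutPos ℓ ζ (x + 1)) (by omega)) (iv_union (by omega) (by omega)), map_mul, map_mul,
          ih, h5]
    intro x hx
    by_cases hx1 : x + 1 < ℓ / (2 * ζ)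
    · exact h1 x hx1
    -- Around the ring the sign at the final cut is already fixed as that of the cut 0. The last
    -- cell is correct nevertheless, because the product over all cells is the global symmetry
    -- operator, which both the layer and α preserve.
    · have hxl : x + 1 = ℓ / (2 * ζ) := by omega
      have h3 := h2 x hx
      have h4 := key x hx
      have h5 : sym ℓ m = onSites (iv 0 0 (cutPos ℓ ζ x)) m * onSites (cell ℓ ζ x) m := by
        refine onSites_union (iv_disjoint (by omega)) ?_ m
        obtain ⟨h3, h4, -⟩ := cutPos_succ hζ hx
        rw [← iv_union (by omega) (by omega), hxl, cutPos_last]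
        ext i
        rw [mem_iv]
        simp [ZMod.val_lt]
      have h6 : (gateLayer ζ G)ᴴ * sym ℓ m * gateLayer ζ G = sym ℓ m := by
        rw [← ev_apply hL, ev_eq_self_iff]
        exact hG.commute hms
      rw [← ev_apply hL] at h3 h4 h6 ⊢
      rw [h5, map_mul, h3, h4, mul_smul_comm, ← map_mul, ← h5, hu] at h6
      have h7 : σ (cut ℓ ζ x) * σ (cut ℓ ζ (x + 1)) * e x = 1 := by
        have h8 : sym ℓ m * sym ℓ m = 1 := sym_sq hm
        have := congrArg (fun y => ntr (y * sym ℓ m)) h6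
        simp only [smul_mul_assoc] at this
        rwa [h8, ntr_smul_one, ntr_one] at this
      rw [h4, h7, one_smul]
  · obtain ⟨G, hG⟩ := hb.exists_gateFamily hα hm hms hζ h hv hw hvw htv htw
      (σ := fun _ => 1) (fun _ => Or.inl rfl) fun _ => Or.inl rfl
    refine ⟨G, _, _, hG, fun x hx => ?_⟩
    have h1 := (gateLayer_cell hG hα hζ (by omega) hx).2
    obtain ⟨hL, -, -⟩ := gateLayer_spec hG hζ (by omega)
    rw [one_smul, one_smul, hε2 ⟨x, hx⟩] at h1
    have h2 := congrArg ntr h1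
    rw [← ev_apply hL, ntr_aut, ntr_smul, ntr_aut] at h2
    have h3 : ntr (onSites (cell ℓ ζ x) m) ≠ 0 := by
      rw [ntr_onSites]
      exact pow_ne_zero _ (div_ne_zero hk (by exact_mod_cast Fintype.card_ne_zero))
    -- Conjugation by the layer and α both preserve the trace of the symmetry operator of the cell,
    -- which is nonzero if Tr m ≠ 0.
    have h4 : ε ⟨x, hx⟩ = 1 := mul_right_cancel₀ h3 (h2.symm.trans (one_mul _).symm)
    rw [h1, h4, one_smul]

end Gluing

/-! ### Balanced QCA are symmetric circuits -/

section Circuit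
variable {ℓ : ℕ} [NeZero ℓ] {ι : Type} [Fintype ι] [DecidableEq ι] [Nonempty ι] {ζ : ℕ} {m : Op ι}
  {μ : Z2 → Op ι} {W : Op (ZMod ℓ → ι)}

theorem isSymmetric_of_commute (hμ : IsRep μ) (h : Commute W (sym ℓ (μ gen))) : IsSymmetric μ W := by
  intro g
  rcases z2_cases g with rfl | rfl
  · rw [hμ.one, onSites_one]; exact Commute.one_right _
  · exact h

/-- A phase counts as a gate on an empty interval, which is disjoint from all others. -/
theorem isSymmetricLayer_smul {r : ℕ} (hW : IsSymmetricLayer μ r W) {c : ℂ} (hc : star c * c = 1) :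
    IsSymmetricLayer μ r (c • W) := by
  obtain ⟨n, a, w, G, hw, hd, hG, rfl⟩ := hW
  have he : ∀ a : ZMod ℓ, arc a 0 = ∅ := fun a => by simp [arc]
  refine ⟨n + 1, Fin.cons 0 a, Fin.cons 0 w, Fin.cons (c • 1) G, fun j => ?_, fun j j' => ?_,
    fun j => ?_, ?_⟩
  · refine Fin.cases ?_ (fun j => ?_) j
    · simp
    · simpa using hw j
  · refine Fin.cases ?_ (fun j => ?_) j
    · intro _; simp [he]
    · refine Fin.cases ?_ (fun j' => ?_) j'
      · intro _; simp [he]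
      · intro h
        simp only [Fin.cons_succ]
        exact hd j j' fun h' => h (by rw [h'])
  · refine Fin.cases ?_ (fun j => ?_) j
    · simp only [Fin.cons_zero]
      refine ⟨?_, ?_, fun g => ?_⟩
      · rw [Matrix.mem_unitaryGroup_iff', star_smul, star_one, smul_mul_smul_comm, hc, one_smul, one_mul]
      · rw [← mem_net_iff]
        exact StarSubalgebra.smul_mem _ (one_mem _) c
      · exact (Commute.one_left _).smul_left c
    · simpa only [Fin.cons_succ] using hG j
  · rw [List.ofFn_succ, List.prod_cons]
    simp

theorem Balanced.isSymmetricCircuit (hμ : IsRep μ) (hq : IsQCA ζ W) (hs : IsSymmetric μ W)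
    (hb : Balanced (μ gen) ζ (ev W hq.unitary)) (hζ : 1 ≤ ζ) (h : 8 * ζ ≤ ℓ) :
    IsSymmetricCircuit μ (4 * ζ) W := by
  have hu := (isSymmetric_iff hμ hq.unitary).1 hs
  obtain ⟨G, v, w, hG, hcell⟩ := hb.exists_layer hq.spreads hμ.sq hμ.star hu hζ h
  obtain ⟨hL, -, -⟩ := gateLayer_spec hG hζ (by omega)
  set L := gateLayer ζ G with hLdef
  have hLL : L * Lᴴ = 1 := Matrix.mem_unitaryGroup_iff.1 hL
  have hGU : ∀ c, (G c)ᴴ ∈ Matrix.unitaryGroup (ZMod ℓ → ι) ℂ := fun c =>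
    conjTranspose_mem_unitaryGroup (Matrix.mem_unitaryGroup_iff'.2 (hG.unitary c))
  have hL1 : IsSymmetricLayer μ (4 * ζ) L := by
    refine ⟨ℓ / (2 * ζ), fun j => cut ℓ ζ j - (ζ : ZMod ℓ), fun _ => 2 * ζ,
      fun j => (G (cut ℓ ζ j))ᴴ, fun _ => (by omega : 2 * ζ ≤ 4 * ζ), fun j j' hjj =>
      window_disjoint hζ j.2 j'.2 fun h => hjj (Fin.ext h), fun j => ⟨hGU _,
      mem_net_iff.1 (conjTranspose_mem (hG.mem _)), ?_⟩, rfl⟩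
    have := IsSymmetric.conjTranspose hμ (Matrix.mem_unitaryGroup_iff'.2 (hG.unitary (cut ℓ ζ j)))
      (isSymmetric_of_commute hμ (hG.comm _))
    exact this
  set T := W * Lᴴ with hT
  have hTU : T ∈ Matrix.unitaryGroup (ZMod ℓ → ι) ℂ :=
    mul_mem hq.unitary (conjTranspose_mem_unitaryGroup hL)
  have hT1 : Tᴴ * T = 1 := Matrix.mem_unitaryGroup_iff'.1 hTU
  have hTconj : ∀ y, T * y * Tᴴ = (ev W hq.unitary).symm (Lᴴ * y * L) := by
    intro y
    rw [ev_symm_apply, hT, Matrix.conjTranspose_mul, Matrix.conjTranspose_conjTranspose]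
    simp only [mul_assoc]
  -- The layer L and α send the algebra of a cell into the same image, so T = W L† preserves the
  -- algebra of every cell.
  have hTn : ∀ x : Fin (ℓ / (2 * ζ)), Norm T (net (cell ℓ ζ x)) := by
    intro x y hy
    rw [hTconj]
    exact (gateLayer_cell hG hq.spreads hζ (by omega) x.2).1 y hy
  have hTu : ∀ x : Fin (ℓ / (2 * ζ)),
      T * onSites (cell ℓ ζ x) (μ gen) * Tᴴ = onSites (cell ℓ ζ x) (μ gen) := by
    intro x
    rw [hTconj, hcell x x.2, StarAlgEquiv.symm_apply_apply]
  -- On each cell conjugation by T is inner. The gate H x implementing it commutes with the symmetry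
  -- operator of the cell because T fixes that operator.
  have hex : ∀ x : Fin (ℓ / (2 * ζ)), ∃ v ∈ net (cell ℓ ζ x), IsU v ∧
      ∀ r ∈ net (cell ℓ ζ x), v * r = T * r * Tᴴ * v := fun x =>
    (isFactor_net (cell ℓ ζ x)).exists_implements hT1 (hTn x)
  choose H hH hHU hHi using hex
  have hHU' : ∀ x, H x * (H x)ᴴ = 1 := fun x => mul_eq_one_comm.1 (hHU x)
  have hHm : ∀ x, H x ∈ Matrix.unitaryGroup (ZMod ℓ → ι) ℂ := fun x =>
    Matrix.mem_unitaryGroup_iff'.2 (hHU x)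
  have hHc : ∀ x : Fin (ℓ / (2 * ζ)), ∀ y ∈ net (cell ℓ ζ x), H x * y * (H x)ᴴ = T * y * Tᴴ := by
    intro x y hy
    rw [hHi x y hy, mul_assoc, hHU', mul_one]
  have hdisj : ∀ x y : Fin (ℓ / (2 * ζ)), x ≠ y → Disjoint (cell ℓ ζ x) (cell ℓ ζ y) := by
    have key : ∀ x y : Fin (ℓ / (2 * ζ)), x < y → Disjoint (cell ℓ ζ x) (cell ℓ ζ y) := by
      intro x y hxy
      have hxy' : (x : ℕ) + 1 ≤ y := hxy
      have h1 := (cutPos_succ hζ x.2).2.2.2.2 (lt_of_le_of_lt hxy' y.2)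
      have h2 := (cutPos_succ hζ x.2).1
      have h3 := (cutPos_succ hζ y.2).1
      have h4 := Nat.mul_le_mul_left (2 * ζ) hxy'
      rw [mul_add, mul_one] at h4
      exact iv_disjoint (by omega)
    intro x y hxy
    rcases lt_or_gt_of_ne hxy with h | h
    · exact key x y h
    · exact (key y x h).symm
  have hL2 : IsSymmetricLayer μ (4 * ζ) (List.ofFn H).prod := by
    have hc : ∀ x : Fin (ℓ / (2 * ζ)),
        arc (cut ℓ ζ x) (cutPos ℓ ζ (x + 1) - cutPos ℓ ζ x) = cell ℓ ζ x := by
      intro x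
      obtain ⟨h1, h2, h3, h4, -⟩ := cutPos_succ hζ x.2
      have := arc_eq_iv (0 : ZMod ℓ) (s := cutPos ℓ ζ x) (n := cutPos ℓ ζ (x + 1) - cutPos ℓ ζ x)
        (by omega)
      rw [zero_add] at this
      rw [this, cell]
      congr 1
      omega
    refine ⟨ℓ / (2 * ζ), fun x => cut ℓ ζ x, fun x => cutPos ℓ ζ (x + 1) - cutPos ℓ ζ x, H,
      fun x => ?_, fun x y hxy => ?_, fun x => ⟨hHm x, ?_, ?_⟩, rfl⟩
    · obtain ⟨h1, h2, h3, h4, -⟩ := cutPos_succ hζ x.2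
      simp only
      omega
    · rw [hc, hc]; exact hdisj x y hxy
    · rw [hc]; exact mem_net_iff.1 (hH x)
    · refine isSymmetric_of_commute hμ ?_
      have h1 : sym ℓ (μ gen) = onSites (cell ℓ ζ x) (μ gen) * onSites (cell ℓ ζ x)ᶜ (μ gen) :=
        onSites_union disjoint_compl_right (by simp) _
      have h2 : H x * onSites (cell ℓ ζ x) (μ gen) = onSites (cell ℓ ζ x) (μ gen) * H x := by
        rw [hHi x _ (onSites_mem _ _), hTu]
      change _ * _ = _ * _
      rw [h1, ← mul_assoc, h2, mul_assoc, mul_assoc,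
        net_comm disjoint_compl_right (hH x) (onSites_mem _ _)]
  have hPU := list_ofFn_prod_mem_unitaryGroup hHm
  set P := (List.ofFn H).prod with hP
  have hP1 : Pᴴ * P = 1 := Matrix.mem_unitaryGroup_iff'.1 hPU
  have hP2 : P * Pᴴ = 1 := Matrix.mem_unitaryGroup_iff.1 hPU
  -- P is the product of the H x. Conjugations by P and T agree on all cells, hence on all
  -- operators; so P†T is a phase, and W = T L consists of a layer on the cells after a layer on the
  -- windows.
  have hR : ∀ y ∈ net (Finset.univ : Finset (ZMod ℓ)), (Pᴴ * T) * y = y * (Pᴴ * T) := by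
    have key : net (Finset.univ : Finset (ZMod ℓ)) ≤ StarSubalgebra.centralizer ℂ {Pᴴ * T} := by
      refine net_biUnion_induction fun i _ y hy => ?_
      have key : ∀ y ∈ net {i}, (Pᴴ * T) * y = y * (Pᴴ * T) := by
        intro y hy
        obtain ⟨x, hx, hx1, hx2⟩ := exists_cutPos hζ (show 2 * ζ ≤ ℓ by omega) (ZMod.val_lt i)
        have hy' : y ∈ net (cell ℓ ζ x) := net_mono (by
          rw [Finset.singleton_subset_iff, mem_iv, sub_zero]; exact ⟨hx1, hx2⟩) hy
        have h1 := (list_prod_conj hHm hH hdisj ⟨x, hx⟩ hy').2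
        rw [hHc ⟨x, hx⟩ y hy', ← hP] at h1
        calc Pᴴ * T * y = Pᴴ * (T * y * Tᴴ) * T := by
              simp only [mul_assoc]; rw [hT1, mul_one]
          _ = (Pᴴ * P) * y * Pᴴ * T := by rw [← h1]; simp only [mul_assoc]
          _ = y * (Pᴴ * T) := by rw [hP1, one_mul, mul_assoc]
      rw [StarSubalgebra.mem_centralizer_iff]
      rintro _ rfl
      refine ⟨key y hy, ?_⟩
      have := congrArg star (key (star y) (star_mem hy))
      rw [star_mul (Pᴴ * T) (star y), star_mul (star y) (Pᴴ * T), star_star] at this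
      exact this.symm
    intro y hy
    exact ((StarSubalgebra.mem_centralizer_iff ℂ).1 (key hy) _ rfl).1
  obtain ⟨c, hc⟩ := isFactor_net (Finset.univ : Finset (ZMod ℓ)) (Pᴴ * T) (mem_net_univ _)
    fun y hy => (hR y hy).symm
  have hTc : T = c • P := by
    rw [← one_mul T, ← hP2, mul_assoc, hc, mul_smul_comm, mul_one]
  have hcc : star c * c = 1 := by
    rw [hTc, Matrix.conjTranspose_smul, smul_mul_smul_comm, hP1] at hT1
    have := congrArg ntr hT1
    rwa [ntr_smul_one, ntr_one] at this
  refine ⟨L, c • P, hL1, isSymmetricLayer_smul hL2 hcc, ?_⟩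
  rw [← hTc, hT, mul_assoc]
  have : Lᴴ * L = 1 := Matrix.mem_unitaryGroup_iff'.1 hL
  rw [this, mul_one]

end Circuit

/-! ### Completeness of the invariants -/

section Complete
variable {ℓ : ℕ} [NeZero ℓ] {ι : Type} [Fintype ι] [DecidableEq ι] [Nonempty ι]
  {κ : Type} [Fintype κ] [DecidableEq κ] [Nonempty κ]
  {α : Aut (ZMod ℓ → ι)} {α' : Aut (ZMod ℓ → ι × κ)} {ξ ζ : ℕ} {m : Op ι} {m' : Op κ}
  {μ : Z2 → Op ι} {U U' : Op (ZMod ℓ → ι)}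

theorem kap_eq (m : Op ι) : kap m = ((‖m.trace‖ ^ 2 : ℝ) : ℂ) := by
  rw [kap, Complex.ofReal_pow, ← Complex.mul_conj']; rfl

theorem kap_one : kap (1 : Op ι) = (Fintype.card ι : ℂ) ^ 2 := by
  rw [kap, Matrix.trace_one, star_natCast, sq]

theorem kap_kronecker : kap (m ⊗ₖ m') = kap m * kap m' := by
  rw [kap, kap, kap, Matrix.trace_kronecker, star_mul']; ring

/-- The twisted dimension is a nonnegative real, so it is recovered from the index. The value on Lf
then follows from the product of both, which is known. -/
theorem tw_eq_of_idx_eq_one (hα : Spreads ξ α) (h : 6 * ξ + 1 ≤ ℓ) (hm : m * m = 1) (hms : mᴴ = m)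
    (hu : α (sym ℓ m) = sym ℓ m) (hk : m.trace ≠ 0) (hi : idx m ξ α = 1) (c : ZMod ℓ) :
    tw (sym ℓ m) (Rt ξ α c) = kap m ^ ξ ∧ tw (sym ℓ m) (Lf ξ α c) = kap m ^ ξ := by
  have hR := isFactor_Rt hα (by omega) c
  have hus : (sym ℓ m)ᴴ = sym ℓ m := onSites_conjTranspose hms _
  have h1 : tw (sym ℓ m) (Rt ξ α c) = kap m ^ ξ := by
    rw [idx_eq hα h hm hms hu hk c, div_eq_one_iff_eq (pow_ne_zero _ (norm_ne_zero_iff.2 hk))] at hi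
    obtain ⟨v, hv⟩ := hR.exists_impl (sym_sq hm) hus (norm_Rt hm hms hu c)
    have h2 := hv.tw hR hus
    have h3 : (‖tw (sym ℓ m) (Rt ξ α c)‖ : ℂ) = tw (sym ℓ m) (Rt ξ α c) := by
      rw [h2, Complex.norm_real, Real.norm_of_nonneg (by positivity)]
    rw [← h3, ← Real.sq_sqrt (norm_nonneg (tw (sym ℓ m) (Rt ξ α c))), hi, kap_eq, ← pow_mul,
      mul_comm ξ, pow_mul]
    push_cast
    rfl
  refine ⟨h1, ?_⟩
  have h2 := tw_cut hα (by omega) hm hms hu c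
  rw [h1, two_mul, pow_add] at h2
  exact mul_left_cancel₀ (pow_ne_zero _ (kap_ne_zero hk)) h2

/-- In contrast to `Extends.idx` nothing is assumed about the traces, so that the statement also
serves the case χ = 0, where no index is attached to the symmetry. -/
theorem Extends.tw_cut (h : Extends α α') (hα : Spreads ξ α) (h6 : 6 * ξ + 1 ≤ ℓ) (hm : m * m = 1)
    (hms : mᴴ = m) (hm' : m' * m' = 1) (hms' : m'ᴴ = m') (hu : α (sym ℓ m) = sym ℓ m) (c : ZMod ℓ) :
    tw (sym ℓ (m ⊗ₖ m')) (Rt ξ α' c) = tw (sym ℓ m) (Rt ξ α c) * kap m' ^ ξ ∧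
    tw (sym ℓ (m ⊗ₖ m')) (Lf ξ α' c) = tw (sym ℓ m) (Lf ξ α c) * kap m' ^ ξ := by
  have hmm : (m ⊗ₖ m') * (m ⊗ₖ m') = 1 := by
    rw [← Matrix.mul_kronecker_mul, hm, hm', Matrix.one_kronecker_one]
  have hmms : (m ⊗ₖ m')ᴴ = m ⊗ₖ m' := by rw [Matrix.conjTranspose_kronecker, hms, hms']
  have hsym : sym ℓ (m ⊗ₖ m') = stack (sym ℓ m) (sym ℓ m') := (stack_onSites _ _ _).symm
  have hU : IsU (sym ℓ (m ⊗ₖ m')) := isU_onSites hmm hmms _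
  obtain ⟨s1, s2⟩ := h.splits_cut hα (c - ((3 * ξ : ℕ) : ZMod ℓ)) (s := 3 * ξ) le_rfl (by omega)
  rw [sub_add_cancel] at s1 s2
  have hw : sym ℓ m' * (sym ℓ m')ᴴ = 1 := mul_eq_one_comm.1 (isU_onSites hm' hms' _)
  have hw1 : sym ℓ m * (sym ℓ m)ᴴ = 1 := mul_eq_one_comm.1 (isU_onSites hm hms _)
  rw [hsym] at hU ⊢
  constructor
  · rw [s1.tw (s1.isFactor_left (isFactor_Rt (h.spreads hα) (by omega) _)) hU
      ((norm_Rt hm hms hu _).map_stackL hw) ((norm_net hm' hms' _).map_stackR hw1),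
      tw_map_stackL hw, tw_map_stackR hw1, tw_net hm' hms', card_iv _ (by omega),
      show 3 * ξ - (3 * ξ - ξ) = ξ by omega, kap]
  · rw [s2.tw (s2.isFactor_left (isFactor_Lf (h.spreads hα) (by omega) _)) hU
      ((norm_Lf hm hms hu _).map_stackL hw) ((norm_net hm' hms' _).map_stackR hw1),
      tw_map_stackL hw, tw_map_stackR hw1, tw_net hm' hms', card_iv _ (by omega),
      show 3 * ξ + ξ - 3 * ξ = ξ by omega, kap]

theorem idx_ne_zero (hα : Spreads ξ α) (h : 6 * ξ ≤ ℓ) (hm : m * m = 1) (hms : mᴴ = m)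
    (hu : α (sym ℓ m) = sym ℓ m) (hk : m.trace ≠ 0) : idx m ξ α ≠ 0 := by
  have h1 := tw_cut hα h hm hms hu 0
  have h2 : tw (sym ℓ m) (Rt ξ α 0) ≠ 0 :=
    left_ne_zero_of_mul (h1.trans_ne (pow_ne_zero _ (kap_ne_zero hk)))
  exact div_ne_zero (Real.sqrt_ne_zero'.2 (norm_pos_iff.2 h2))
    (pow_ne_zero _ (norm_ne_zero_iff.2 hk))

theorem isAdmissible_one : IsAdmissible μ (1 : Op ι) := ⟨Or.inl rfl, trace_one_ne_zero⟩

/-- With one ancilla per site, a QCA with trivial invariants is balanced. -/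
theorem balanced_ancilla (hμ : IsRep μ) (hq : IsQCA ζ U) (hs : IsSymmetric μ U) (hζ : 1 ≤ ζ)
    (h : 6 * ζ + 1 ≤ ℓ) (hi : ∀ m, IsAdmissible μ m → idx m ζ (ev U hq.unitary) = 1) :
    Balanced (ancillaRep μ 1 gen) ζ
      (ev (stackL (κ := Fin 1 → ι) U) (stackL_mem_unitaryGroup hq.unitary)) := by
  have key : ∀ m : Op ι, (m = 1 ∨ m = μ gen) → ∀ c,
      tw (sym ℓ (m ⊗ₖ tensorOp fun _ : Fin 1 => m)) (Rt ζ (ev (stackL (κ := Fin 1 → ι) U)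
        (stackL_mem_unitaryGroup hq.unitary)) c) = kap (m ⊗ₖ tensorOp fun _ : Fin 1 => m) ^ ζ ∧
      tw (sym ℓ (m ⊗ₖ tensorOp fun _ : Fin 1 => m)) (Lf ζ (ev (stackL (κ := Fin 1 → ι) U)
        (stackL_mem_unitaryGroup hq.unitary)) c) = kap (m ⊗ₖ tensorOp fun _ : Fin 1 => m) ^ ζ := by
    intro m hm c
    have hm1 : m * m = 1 := by rcases hm with rfl | rfl; exacts [mul_one _, hμ.sq]
    have hm2 : mᴴ = m := by rcases hm with rfl | rfl; exacts [Matrix.conjTranspose_one, hμ.star]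
    have hu : ev U hq.unitary (sym ℓ m) = sym ℓ m := by
      rcases hm with rfl | rfl
      · rw [sym_one, map_one]
      · exact (isSymmetric_iff hμ hq.unitary).1 hs
    obtain ⟨h1, h2⟩ := (extends_ev (κ := Fin 1 → ι) hq.unitary).tw_cut hq.spreads h hm1 hm2
      (m' := tensorOp fun _ : Fin 1 => m) (by rw [tensorOp_mul]; simp only [hm1]; exact tensorOp_one)
      (by rw [tensorOp_conjTranspose]; simp only [hm2]) hu c
    rw [h1, h2, kap_kronecker, mul_pow]
    -- If the trace of m vanishes, so does the contribution of the ancillas, as ζ ≥ 1, and both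
    -- weights are zero whatever the QCA does. This is the reason for the ancilla.
    by_cases hk : m.trace = 0
    · have : kap (tensorOp fun _ : Fin 1 => m) = 0 := by
        rw [kap, tensorOp_trace]; simp [hk]
      rw [this, zero_pow (by omega)]
      simp
    · obtain ⟨h3, h4⟩ := tw_eq_of_idx_eq_one hq.spreads h hm1 hm2 hu hk (hi m ⟨hm, hk⟩) c
      rw [h3, h4]
      exact ⟨rfl, rfl⟩
  have key1 := key 1 (Or.inl rfl)
  rw [tensorOp_one, Matrix.one_kronecker_one, kap_one, sym_one] at key1
  simp only [tw_one, ← pow_mul] at key1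
  exact ⟨fun c => by exact_mod_cast (key1 c).1, fun c => by exact_mod_cast (key1 c).2,
    fun c => (key _ (Or.inr rfl) c).1, fun c => (key _ (Or.inr rfl) c).2⟩

/-- Multiplicativity for (U'U†)U = U'; the index of an inverse need not be computed. -/
theorem IsAdmissible.idx_mul_conjTranspose (hμ : IsRep μ) (hm : IsAdmissible μ m) (hq : IsQCA ξ U)
    (hs : IsSymmetric μ U) (hq' : IsQCA ξ U') (hs' : IsSymmetric μ U') (hℓ : 24 * ξ + 1 ≤ ℓ) :
    idx m (2 * ξ) (ev (U' * Uᴴ) (hq'.mul hq.conjTranspose).unitary) * idx m ξ (ev U hq.unitary)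
      = idx m ξ (ev U' hq'.unitary) := by
  have qW := hq'.mul hq.conjTranspose
  have sW := hs'.mul (hs.conjTranspose hμ hq.unitary)
  have hUU : U' * Uᴴ * U = U' := by
    rw [mul_assoc, show Uᴴ * U = 1 from Matrix.mem_unitaryGroup_iff'.1 hq.unitary, mul_one]
  have q2 := hq.mono (ξ' := 2 * ξ) (by omega)
  have h1 := hm.idx_mul hμ qW sW q2 hs (by omega)
  have h2 := hm.idx_mono hμ hq hs (ξ' := 2 * ξ) (by omega) (by omega)
  have h3 := hm.idx_mono hμ hq' hs' (ξ' := 2 * (2 * ξ)) (by omega) (by omega)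
  have h4 : idx m (2 * (2 * ξ)) (ev (U' * Uᴴ * U) (mul_mem qW.unitary q2.unitary))
      = idx m (2 * (2 * ξ)) (ev U' hq'.unitary) := by congr 2
  rw [h4, h3, h2] at h1
  exact h1.symm

/-- The circuit is W = U'U† with one ancilla per site. W has spreading length 2ξ; one is added
because the gluing requires a positive spreading length. -/
theorem stronglyEquivalent_of_idx_eq (hμ : IsRep μ) (hq : IsQCA ξ U) (hs : IsSymmetric μ U)
    (hq' : IsQCA ξ U') (hs' : IsSymmetric μ U') (hℓ : 24 * (ξ + 1) ≤ ℓ)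
    (hi : ∀ m, IsAdmissible μ m → idx m ξ (ev U hq.unitary) = idx m ξ (ev U' hq'.unitary)) :
    StronglyEquivalent μ (4 * (2 * ξ + 1)) 1 U U' := by
  have qW := hq'.mul hq.conjTranspose
  have sW := hs'.mul (hs.conjTranspose hμ hq.unitary)
  have hUU : U' * Uᴴ * U = U' := by
    rw [mul_assoc, show Uᴴ * U = 1 from Matrix.mem_unitaryGroup_iff'.1 hq.unitary, mul_one]
  have hiW : ∀ m, IsAdmissible μ m → idx m (2 * ξ) (ev (U' * Uᴴ) qW.unitary) = 1 := by
    intro m hm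
    have h5 := idx_ne_zero hq'.spreads (by omega) (hm.sq hμ) (hm.star hμ) (hm.fixed hμ _ hs') hm.2
    have h1 := hm.idx_mul_conjTranspose hμ hq hs hq' hs' (by omega)
    rw [hi m hm] at h1
    exact mul_right_cancel₀ h5 (by rw [h1, one_mul])
  have qW1 := qW.mono (ξ' := 2 * ξ + 1) (by omega)
  have hb := balanced_ancilla hμ qW1 sW (by omega) (by omega) fun m hm => by
    rw [hm.idx_mono hμ qW sW (by omega) (by omega), hiW m hm]
  refine ⟨stackL (U' * Uᴴ), hb.isSymmetricCircuit hμ.ancillaRep (qW1.stackL _) sW.stackL (by omega)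
    (by omega), ?_⟩
  rw [withAncillas_eq, withAncillas_eq, ← map_mul, hUU]

end Complete

/-! ### Signatures and the system of equations -/

section Signature
variable {X : Type} [Fintype X] [DecidableEq X] [Nonempty X] {R : StarSubalgebra ℂ (Op X)} {u v : Op X}

theorem sum_signs {I : Type} [Fintype I] (s : I → ℤˣ) :
    ∃ a b : ℕ, Fintype.card I = a + b ∧ ∑ i, (s i : ℤ) = a - b := by
  classical
  refine ⟨(Finset.univ.filter fun i => s i = 1).card, (Finset.univ.filter fun i => ¬ s i = 1).card,
    (Finset.card_filter_add_card_filter_not _).symm, ?_⟩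
  rw [← Finset.sum_filter_add_sum_filter_not Finset.univ (fun i => s i = 1),
    Finset.sum_congr rfl (g := fun _ => (1 : ℤ)) (by simp +contextual),
    Finset.sum_congr (s₁ := Finset.univ.filter fun i => ¬ s i = 1) rfl (g := fun _ => (-1 : ℤ))
      (fun i hi => by
        rcases Int.units_eq_one_or (s i) with h | h
        · simp [h] at hi
        · simp [h])]
  simp [sub_eq_add_neg]

/-- The dimensions of the eigenspaces of an involution. -/
theorem IsFactor.exists_signature_of_mem (hR : IsFactor R) (hv : v ∈ R) (hvv : v * v = 1)
    (hvs : vᴴ = v) : ∃ a b : ℕ, rdim R = (a + b) ^ 2 ∧ (a + b : ℂ) * ntr v = a - b := by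
  obtain ⟨n, E, s, hE, rfl⟩ := hR.exists_diagonal hv hvv hvs
  obtain ⟨a, b, h1, h2⟩ := sum_signs s
  refine ⟨a, b, by rw [hE.card_sq, h1], ?_⟩
  have := hE.toIsMU.card_ne
  rw [hE.toIsMU.ntr_diagonal, h2]
  rw [h1] at this ⊢
  push_cast at this ⊢
  field_simp

/-- In R ≅ M_n the implementing involution has eigenvalues 1 and -1 with multiplicities a and b, so
n = a + b and its trace is a - b. -/
theorem IsFactor.exists_signature (hR : IsFactor R) (hu : u * u = 1) (hus : uᴴ = u)
    (hn : Norm u R) : ∃ a b : ℕ, rdim R = (a + b) ^ 2 ∧ ‖tw u R‖ = ((a : ℝ) - b) ^ 2 := by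
  obtain ⟨v, hv⟩ := hR.exists_impl hu hus hn
  obtain ⟨a, b, h1, h2⟩ := hR.exists_signature_of_mem hv.mem hv.sq hv.star
  refine ⟨a, b, h1, ?_⟩
  have h3 : ((a : ℝ) + b) * ‖ntr v‖ = |(a : ℝ) - b| := by
    have := congrArg norm h2
    rw [norm_mul] at this
    rw [← Real.norm_eq_abs, ← Complex.norm_real, ← Real.norm_of_nonneg (r := (a : ℝ) + b)
      (by positivity), ← Complex.norm_real]
    push_cast
    exact this
  rw [hv.tw hR hus, Complex.norm_real, Real.norm_of_nonneg (by positivity), h1,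
    ← sq_abs ((a : ℝ) - b), ← h3]
  push_cast
  ring

theorem exists_signature_rep {ι : Type} [Fintype ι] [DecidableEq ι] [Nonempty ι] {m : Op ι}
    (hm : m * m = 1) (hms : mᴴ = m) :
    ∃ a b : ℕ, Fintype.card ι = a + b ∧ m.trace = a - b := by
  obtain ⟨a, b, h1, h2⟩ := (isFactor_top (X := ι)).exists_signature_of_mem StarSubalgebra.mem_top
    hm hms
  have h3 : rdim (⊤ : StarSubalgebra ℂ (Op ι)) = Fintype.card ι ^ 2 := by
    rw [rdim, show sm (⊤ : StarSubalgebra ℂ (Op ι)) = ⊤ from rfl, finrank_top,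
      Module.finrank_matrix]
    simp [sq]
  have h4 : Fintype.card ι = a + b := Nat.pow_left_injective two_ne_zero (h3.symm.trans h1)
  refine ⟨a, b, h4, ?_⟩
  rw [← h2, ntr, h4]
  push_cast
  rw [mul_div_cancel₀]
  exact_mod_cast h4 ▸ Fintype.card_ne_zero

end Signature

section Value
variable {ℓ : ℕ} [NeZero ℓ] {ι : Type} [Fintype ι] [DecidableEq ι] [Nonempty ι]
  {ξ : ℕ} {α : Aut (ZMod ℓ → ι)} {m : Op ι}

theorem idx_nonneg : 0 ≤ idx m ξ α := div_nonneg (Real.sqrt_nonneg _) (by positivity)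

theorem idx_pos (hα : Spreads ξ α) (h : 6 * ξ ≤ ℓ) (hm : m * m = 1) (hms : mᴴ = m)
    (hu : α (sym ℓ m) = sym ℓ m) (hk : m.trace ≠ 0) : 0 < idx m ξ α :=
  idx_nonneg.lt_of_ne' (idx_ne_zero hα h hm hms hu hk)

/-- The invariants in terms of the dimensions of eigenspaces. -/
theorem exists_idx_eq (hα : Spreads ξ α) (h : 6 * ξ ≤ ℓ) (hm : m * m = 1) (hms : mᴴ = m)
    (hu : α (sym ℓ m) = sym ℓ m) : ∃ a b a' b' : ℕ,
    (Fintype.card ι : ℝ) ^ ξ * idx 1 ξ α = a + b ∧ (a + b) * (a' + b') = Fintype.card ι ^ (2 * ξ) ∧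
    (m.trace ≠ 0 → ‖m.trace‖ ^ ξ * idx m ξ α = |(a : ℝ) - b| ∧
      |(a : ℝ) - b| * |(a' : ℝ) - b'| = ‖m.trace‖ ^ (2 * ξ)) := by
  obtain ⟨a, b, h1, h2⟩ := (isFactor_Rt hα h 0).exists_signature (sym_sq hm)
    (onSites_conjTranspose hms _) (norm_Rt hm hms hu 0)
  obtain ⟨a', b', h3, h4⟩ := (isFactor_Lf hα h 0).exists_signature (sym_sq hm)
    (onSites_conjTranspose hms _) (norm_Lf hm hms hu 0)
  have key : ∀ {x y : ℝ} {n : ℕ}, 0 ≤ x → 0 ≤ y → x ^ 2 = y ^ (2 * n) → x = y ^ n := by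
    intro x y n hx hy h
    rw [mul_comm, pow_mul] at h
    exact (pow_left_inj₀ hx (by positivity) two_ne_zero).1 h
  refine ⟨a, b, a', b', ?_, ?_, fun hk => ⟨?_, ?_⟩⟩
  · rw [idx, sym_one, tw_one, Matrix.trace_one, h1]
    have : (Fintype.card ι : ℝ) ≠ 0 := by exact_mod_cast Fintype.card_ne_zero
    simp only [Complex.norm_natCast]
    push_cast
    rw [Real.sqrt_sq (by positivity), mul_div_cancel₀ _ (pow_ne_zero _ this)]
  · have h5 := (splits_cut' hα h 0).rdim (isFactor_Rt hα h 0)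
    rw [rdim_net, card_arc _ (by omega), h1, h3, ← mul_pow] at h5
    apply Nat.pow_left_injective two_ne_zero
    simp only [← h5, ← pow_mul]
    ring
  · rw [idx, h2, Real.sqrt_sq_eq_abs, mul_div_cancel₀ _ (pow_ne_zero _ (norm_ne_zero_iff.2 hk))]
  · apply key (by positivity) (norm_nonneg _)
    have h5 := congrArg norm (tw_cut hα h hm hms hu 0)
    rw [norm_mul, h2, h4, kap_eq, ← Complex.ofReal_pow, Complex.norm_real,
      Real.norm_of_nonneg (by positivity)] at h5
    rw [mul_pow, sq_abs, sq_abs, h5, ← pow_mul]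

end Value

section System
variable {d N : ℕ} {χ : ℤ} {x y : ℝ}

theorem exists_sub_eq_of_abs_eq {a b : ℕ} {t : ℝ} (h : |t| = |(a : ℝ) - b|) :
    ∃ a' b' : ℕ, a + b = a' + b' ∧ t = a' - b' := by
  rcases abs_eq_abs.1 h with h | h
  · exact ⟨a, b, rfl, h⟩
  · exact ⟨b, a, add_comm _ _, by rw [h, neg_sub]⟩

/-- Signs are immaterial: exchanging the two integers keeps their sum and changes the sign of their
difference. So a negative χ needs no separate treatment. -/
theorem solvesSystem_of_abs (hy : 0 < y) {a b a' b' : ℕ}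
    (h0 : (d : ℝ) ^ N * x = a + b) (h1 : |(χ : ℝ)| ^ N * y = |(a : ℝ) - b|)
    (h2 : (d : ℝ) ^ N / x = a' + b') (h3 : |(χ : ℝ)| ^ N / y = |(a' : ℝ) - b'|) :
    SolvesSystem d χ x y := by
  obtain ⟨α₀, α₁, h4, h5⟩ := exists_sub_eq_of_abs_eq (t := (χ : ℝ) ^ N * y)
    (by rw [abs_mul, abs_pow, abs_of_pos hy, h1])
  obtain ⟨β₀, β₁, h6, h7⟩ := exists_sub_eq_of_abs_eq (t := (χ : ℝ) ^ N / y)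
    (by rw [abs_div, abs_pow, abs_of_pos hy, h3])
  refine ⟨N, N, α₀, α₁, β₀, β₁, ?_, ?_, h5, h7⟩
  · rw [h0]; exact_mod_cast h4
  · rw [h2]; exact_mod_cast h6

end System

section Value
variable {ℓ : ℕ} [NeZero ℓ] {ι : Type} [Fintype ι] [DecidableEq ι] [Nonempty ι]
  {ξ : ℕ} {α : Aut (ZMod ℓ → ι)} {m : Op ι} {χ : ℤ}

theorem idx_mem_solutions (hα : Spreads ξ α) (h : 6 * ξ ≤ ℓ) (hm : m * m = 1) (hms : mᴴ = m)
    (hu : α (sym ℓ m) = sym ℓ m) (hχ : m.trace = χ) (h0 : χ ≠ 0) :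
    (idx 1 ξ α, idx m ξ α) ∈ solutions (Fintype.card ι) χ := by
  have hk : m.trace ≠ 0 := by rw [hχ]; exact_mod_cast h0
  have p1 : 0 < idx 1 ξ α := idx_pos hα h (mul_one _) Matrix.conjTranspose_one
    (by rw [sym_one, map_one]) trace_one_ne_zero
  have p2 := idx_pos hα h hm hms hu hk
  obtain ⟨a, b, a', b', h1, h2, h3⟩ := exists_idx_eq hα h hm hms hu
  obtain ⟨h3, h4⟩ := h3 hk
  have hn : ‖m.trace‖ = |(χ : ℝ)| := by rw [hχ, Complex.norm_intCast]
  have hd : (Fintype.card ι : ℝ) ≠ 0 := by exact_mod_cast Fintype.card_ne_zero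
  have hχ' : |(χ : ℝ)| ≠ 0 := abs_ne_zero.2 (by exact_mod_cast h0)
  rw [hn] at h3 h4
  refine ⟨p1, p2, solvesSystem_of_abs (N := ξ) (a' := a') (b' := b') p2 h1 h3 ?_ ?_⟩
  · have h2' : ((a : ℝ) + b) * (a' + b') = (Fintype.card ι : ℝ) ^ (2 * ξ) := by exact_mod_cast h2
    rw [div_eq_iff p1.ne']
    rw [← h1, two_mul, pow_add] at h2'
    apply mul_left_cancel₀ (pow_ne_zero ξ hd)
    linear_combination -h2'
  · rw [div_eq_iff p2.ne']
    rw [← h3, two_mul, pow_add] at h4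
    apply mul_left_cancel₀ (pow_ne_zero ξ hχ')
    linear_combination -h4

theorem idx_mem_solutionsGNVW (hα : Spreads ξ α) (h : 6 * ξ ≤ ℓ) (hm : m * m = 1) (hms : mᴴ = m)
    (hu : α (sym ℓ m) = sym ℓ m) (hχ : m.trace = 0) :
    idx 1 ξ α ∈ solutionsGNVW (Fintype.card ι) 0 := by
  have p1 : 0 < idx 1 ξ α := idx_pos hα h (mul_one _) Matrix.conjTranspose_one
    (by rw [sym_one, map_one]) trace_one_ne_zero
  obtain ⟨a, b, a', b', h1, h2, -⟩ := exists_idx_eq hα h hm hms hu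
  obtain ⟨e, e', he, he'⟩ := exists_signature_rep hm hms
  have he2 : e' = e := by
    rw [hχ] at he'
    exact_mod_cast (sub_eq_zero.1 he'.symm).symm
  subst he2
  have hd : (Fintype.card ι : ℝ) ≠ 0 := by exact_mod_cast Fintype.card_ne_zero
  have hd' : (Fintype.card ι : ℝ) = e' + e' := by exact_mod_cast he
  -- For χ = 0 the two eigenspaces of m have the same dimension d/2, so one additional factor d
  -- splits every number evenly and makes the differences vanish.
  refine ⟨p1, ξ + 1, ξ + 1, e' * (a + b), e' * (a + b), e' * (a' + b'), e' * (a' + b'),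
    ?_, ?_, by simp, by simp⟩
  · rw [pow_succ, mul_right_comm, h1, hd']; push_cast; ring
  · have h2' : ((a : ℝ) + b) * (a' + b') = (Fintype.card ι : ℝ) ^ (2 * ξ) := by exact_mod_cast h2
    rw [div_eq_iff p1.ne']
    rw [← h1, two_mul, pow_add] at h2'
    apply mul_left_cancel₀ (pow_ne_zero ξ hd)
    push_cast
    linear_combination -(Fintype.card ι : ℝ) * h2' +
      (Fintype.card ι : ℝ) ^ ξ * idx 1 ξ α * (a' + b') * hd'

end Value

/-! ### Swaps, tensor factors and products of swaps -/

section Swap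
variable {X : Type} [Fintype X] [DecidableEq X] {I J : Type} [Fintype I] [DecidableEq I]
  [Fintype J] [DecidableEq J] {E F : I → I → Op X} {R S : StarSubalgebra ℂ (Op X)}

/-- The operator exchanging two commuting systems of matrix units. -/
def swapOp (E F : I → I → Op X) : Op X := ∑ i, ∑ j, E i j * F j i

theorem IsMU.swapOp_mul (hE : IsMU E) (hF : IsMU F) (hc : ∀ i j k l, E i j * F k l = F k l * E i j)
    (k l : I) : swapOp E F * E k l = F k l * swapOp E F := by
  have h1 : swapOp E F * E k l = ∑ i, E i l * F k i := by
    simp only [swapOp, Finset.sum_mul]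
    refine Finset.sum_congr rfl fun i _ => ?_
    rw [Finset.sum_eq_single k]
    · rw [mul_assoc, ← hc, ← mul_assoc, hE.mul, if_pos rfl]
    · intro j _ hj
      rw [mul_assoc, ← hc, ← mul_assoc, hE.mul, if_neg hj, zero_mul]
    · simp
  have h2 : F k l * swapOp E F = ∑ i, E i l * F k i := by
    simp only [swapOp, Finset.mul_sum]
    refine Finset.sum_congr rfl fun i _ => ?_
    rw [Finset.sum_eq_single l]
    · rw [← mul_assoc, ← hc, mul_assoc, hF.mul, if_pos rfl]
    · intro j _ hj
      rw [← mul_assoc, ← hc, mul_assoc, hF.mul, if_neg hj.symm, mul_zero]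
    · simp
  rw [h1, h2]

theorem swapOp_comm (hc : ∀ i j k l, E i j * F k l = F k l * E i j) : swapOp E F = swapOp F E := by
  rw [swapOp, swapOp, Finset.sum_comm]
  exact Finset.sum_congr rfl fun i _ => Finset.sum_congr rfl fun j _ => hc _ _ _ _

theorem IsMU.swapOp_conjTranspose (hE : IsMU E) (hF : IsMU F)
    (hc : ∀ i j k l, E i j * F k l = F k l * E i j) : (swapOp E F)ᴴ = swapOp E F := by
  simp only [swapOp, Matrix.conjTranspose_sum, Matrix.conjTranspose_mul, hE.star, hF.star]
  rw [Finset.sum_comm]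
  exact Finset.sum_congr rfl fun i _ => Finset.sum_congr rfl fun j _ => (hc _ _ _ _).symm

theorem IsMU.swapOp_sq (hE : IsMU E) (hF : IsMU F) (hc : ∀ i j k l, E i j * F k l = F k l * E i j) :
    swapOp E F * swapOp E F = 1 := by
  have h : ∀ i j, E i j * F j i * swapOp E F = E i i * F j j := by
    intro i j
    have h1 : ∀ k l, E i j * F j i * (E k l * F l k)
        = if j = k ∧ i = l then E i i * F j j else 0 := by
      intro k l
      rw [mul_assoc, ← mul_assoc (F j i), ← hc, mul_assoc (E k l), ← mul_assoc, hE.mul, hF.mul]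
      split_ifs with h1 h2 h3 h3 h3 <;> simp_all
    simp only [swapOp, Finset.mul_sum, h1, ite_and]
    simp
  conv_lhs => enter [1]; rw [swapOp]
  simp only [Finset.sum_mul, h]
  simp only [← Finset.mul_sum, hF.one, mul_one, hE.one]

theorem commute_swapOp {y : Op X} (h1 : ∀ i j, E i j * y = y * E i j)
    (h2 : ∀ i j, F i j * y = y * F i j) : swapOp E F * y = y * swapOp E F := by
  simp only [swapOp, Finset.sum_mul, Finset.mul_sum]
  refine Finset.sum_congr rfl fun i _ => Finset.sum_congr rfl fun j _ => ?_
  rw [mul_assoc, h2, ← mul_assoc, h1, mul_assoc]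

end Swap

section Factorization
variable {X : Type} [Fintype X] [DecidableEq X] {I J : Type} [Fintype I] [DecidableEq I]
  [Fintype J] [DecidableEq J] {E : I × J → I × J → Op X} {R S : StarSubalgebra ℂ (Op X)}

/-- The matrix units of the first tensor factor. -/
def fstMU (E : I × J → I × J → Op X) (i i' : I) : Op X := ∑ j, E (i, j) (i', j)

/-- The matrix units of the second tensor factor. -/
def sndMU (E : I × J → I × J → Op X) (j j' : J) : Op X := ∑ i, E (i, j) (i, j')

theorem IsMU.fst (h : IsMU E) : IsMU (fstMU E) := by
  refine ⟨fun i j k l => ?_, fun i j => ?_, ?_⟩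
  · simp only [fstMU, Finset.sum_mul_sum, h.mul, Prod.mk.injEq, ite_and]
    simp
  · simp only [fstMU, Matrix.conjTranspose_sum, h.star]
  · rw [← h.one, Fintype.sum_prod_type]; rfl

theorem IsMU.snd (h : IsMU E) : IsMU (sndMU E) := by
  have := (h.reindex (Equiv.prodComm J I)).fst
  exact this

theorem IsMU.fst_mul_snd (h : IsMU E) (i i' : I) (j j' : J) :
    fstMU E i i' * sndMU E j j' = E (i, j) (i', j') := by
  simp only [fstMU, sndMU, Finset.sum_mul_sum, h.mul, Prod.mk.injEq, ite_and]
  simp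

theorem IsMU.snd_mul_fst (h : IsMU E) (i i' : I) (j j' : J) :
    sndMU E j j' * fstMU E i i' = E (i, j) (i', j') := by
  simp only [fstMU, sndMU, Finset.sum_mul_sum, h.mul, Prod.mk.injEq, ite_and]
  simp

theorem IsMUOf.fst_mem (h : IsMUOf R E) (i i' : I) : fstMU E i i' ∈ R := sum_mem fun _ _ => h.mem _ _

theorem IsMUOf.snd_mem (h : IsMUOf R E) (j j' : J) : sndMU E j j' ∈ R := sum_mem fun _ _ => h.mem _ _

theorem IsMUOf.le_iff {E : I → I → Op X} (h : IsMUOf R E) : R ≤ S ↔ ∀ i j, E i j ∈ S := by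
  refine ⟨fun hR i j => hR (h.mem i j), fun hE x hx => ?_⟩
  have : Submodule.span ℂ (Set.range fun p : I × I => E p.1 p.2) ≤ sm S := by
    rw [Submodule.span_le]
    rintro _ ⟨p, rfl⟩
    exact hE _ _
  rw [h.span_eq] at this
  exact this hx

theorem IsMUOf.le_of_fst_snd (h : IsMUOf R E) (h1 : ∀ i i', fstMU E i i' ∈ S)
    (h2 : ∀ j j', sndMU E j j' ∈ S) : R ≤ S :=
  h.le_iff.2 fun p q => by
    rw [← h.toIsMU.fst_mul_snd p.1 q.1 p.2 q.2]; exact mul_mem (h1 _ _) (h2 _ _)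

/-- The commutant of the first factor is spanned by the matrix units of the second factor. -/
theorem IsMUOf.snd_of_comm [Nonempty X] (h : IsMUOf R E) (hS : S ≤ R) (h2 : ∀ j j', sndMU E j j' ∈ S)
    (hc : ∀ x ∈ S, ∀ i i', fstMU E i i' * x = x * fstMU E i i') : IsMUOf S (sndMU E) := by
  refine ⟨h.toIsMU.snd, le_antisymm ?_ fun x hx => ?_⟩
  · rw [Submodule.span_le]
    rintro _ ⟨p, rfl⟩
    exact h2 _ _
  obtain ⟨o⟩ := h.toIsMU.fst.nonempty
  -- As x commutes with the first factor it equals its average over the units of this factor, and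
  -- averaging maps every product unit into the span of the units of the second factor.
  have h3 : x = ∑ i, fstMU E i o * x * fstMU E o i := by
    have : ∀ i, fstMU E i o * x * fstMU E o i = x * fstMU E i i := by
      intro i
      rw [hc x hx, mul_assoc, h.toIsMU.fst.mul, if_pos rfl]
    simp only [this, ← Finset.mul_sum, h.toIsMU.fst.one, mul_one]
  obtain ⟨M, hM⟩ := h.exists_toOp (hS hx)
  have h4 : ∀ p q, ∑ i, fstMU E i o * E p q * fstMU E o i ∈
      Submodule.span ℂ (Set.range fun p : J × J => sndMU E p.1 p.2) := by
    rintro ⟨k, j⟩ ⟨k', j'⟩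
    have h5 : ∀ i, fstMU E i o * E (k, j) (k', j') * fstMU E o i
        = if o = k ∧ k' = o then E (i, j) (i, j') else 0 := by
      intro i
      have h7 := (h.toIsMU.snd_mul_fst o i j j').trans (h.toIsMU.fst_mul_snd o i j j').symm
      rw [← h.toIsMU.fst_mul_snd, mul_assoc, mul_assoc, h7, ← mul_assoc, ← mul_assoc,
        h.toIsMU.fst.mul]
      split_ifs with h6 h8 h8
      · rw [h.toIsMU.fst.mul, if_pos h8.2, h.toIsMU.fst_mul_snd]
      · rw [h.toIsMU.fst.mul, if_neg (fun h9 => h8 ⟨h6, h9⟩), zero_mul]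
      · exact absurd h8.1 h6
      · rw [zero_mul, zero_mul]
    simp only [h5]
    by_cases h6 : o = k ∧ k' = o
    · simp only [h6, and_self, if_true]
      exact Submodule.subset_span ⟨(j, j'), rfl⟩
    · simp [h6]
  rw [h3, hM]
  simp only [toOp_apply, Finset.mul_sum, Finset.sum_mul, mul_smul_comm, smul_mul_assoc]
  rw [Finset.sum_comm]
  refine sum_mem fun p _ => ?_
  rw [Finset.sum_comm]
  refine sum_mem fun q _ => ?_
  rw [← Finset.smul_sum]
  exact Submodule.smul_mem _ _ (h4 p q)

variable {s : I → ℤˣ} {t : J → ℤˣ} {v : Op X}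

theorem diagonal_conj {I : Type} [Fintype I] [DecidableEq I] {E : I → I → Op X} (h : IsMU E)
    {s : I → ℤˣ} (hv : v = ∑ i, ((s i : ℤ) : ℂ) • E i i) (i j : I) :
    v * E i j * v = (((s i * s j : ℤˣ) : ℤ) : ℂ) • E i j := by
  have h1 : v * E i j = ((s i : ℤ) : ℂ) • E i j := by
    rw [hv, Finset.sum_mul, Finset.sum_eq_single i]
    · rw [smul_mul_assoc, h.mul, if_pos rfl]
    · intro k _ hk
      rw [smul_mul_assoc, h.mul, if_neg hk, smul_zero]
    · simp
  have h2 : E i j * v = ((s j : ℤ) : ℂ) • E i j := by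
    rw [hv, Finset.mul_sum, Finset.sum_eq_single j]
    · rw [mul_smul_comm, h.mul, if_pos rfl]
    · intro k _ hk
      rw [mul_smul_comm, h.mul, if_neg hk.symm, smul_zero]
    · simp
  rw [h1, smul_mul_assoc, h2, smul_smul]
  push_cast; rfl

theorem fstMU_conj (h : IsMU E) (hv : v = ∑ p, ((s p.1 * t p.2 : ℤˣ) : ℂ) • E p p) (i i' : I) :
    v * fstMU E i i' * v = (((s i * s i' : ℤˣ) : ℤ) : ℂ) • fstMU E i i' := by
  simp only [fstMU, Finset.mul_sum, Finset.sum_mul, diagonal_conj h (s := fun p => s p.1 * t p.2) hv,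
    Finset.smul_sum]
  refine Finset.sum_congr rfl fun j _ => ?_
  rw [mul_mul_mul_comm, Int.units_mul_self, mul_one]

theorem sndMU_conj (h : IsMU E) (hv : v = ∑ p, ((s p.1 * t p.2 : ℤˣ) : ℂ) • E p p) (j j' : J) :
    v * sndMU E j j' * v = (((t j * t j' : ℤˣ) : ℤ) : ℂ) • sndMU E j j' := by
  simp only [sndMU, Finset.mul_sum, Finset.sum_mul, diagonal_conj h (s := fun p => s p.1 * t p.2) hv,
    Finset.smul_sum]
  refine Finset.sum_congr rfl fun j _ => ?_
  rw [mul_mul_mul_comm, Int.units_mul_self, one_mul]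

/-- The twisted dimension of a factor on which `u` acts through a diagonal involution. -/
theorem IsMUOf.tw_eq [Nonempty X] {E : J → J → Op X} {u : Op X} (hR : IsFactor R) (h : IsMUOf R E)
    (hus : uᴴ = u) (hu : ∀ i j, u * E i j * u = (((t i * t j : ℤˣ) : ℤ) : ℂ) • E i j) :
    tw u R = (((∑ j, (t j : ℤ)) ^ 2 : ℤ) : ℂ) := by
  set w : Op X := ∑ j, ((t j : ℤ) : ℂ) • E j j with hw
  have hws : wᴴ = w := by
    simp [hw, Matrix.conjTranspose_sum, h.toIsMU.star]
  have hw2 : ∀ r ∈ R, w * r * w = u * r * u := by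
    intro r hr
    obtain ⟨M, rfl⟩ := h.exists_toOp hr
    simp only [toOp_apply, Finset.mul_sum, Finset.sum_mul, mul_smul_comm, smul_mul_assoc,
      diagonal_conj h.toIsMU hw, hu]
  have hwR : w ∈ R := sum_mem fun j _ => (R.toSubalgebra.smul_mem (h.mem j j) _)
  rw [hR.tw_of_implements hwR fun r hr => by rw [hus, hws, hw2 r hr], hw, h.toIsMU.ntr_diagonal,
    h.card_sq]
  have := h.toIsMU.card_ne
  simp
  field_simp

end Factorization

section ShiftOp
variable {X : Type} [Fintype X] [DecidableEq X] {I : Type} [Fintype I] [DecidableEq I]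
  {e : ℕ → I → I → Op X} {M : ℕ}

/-- The product of the swaps of neighbouring systems of matrix units. -/
def shiftOp (e : ℕ → I → I → Op X) : ℕ → Op X
  | 0 => 1
  | k + 1 => shiftOp e k * swapOp (e k) (e (k + 1))

theorem commute_shiftOp {y : Op X} {k : ℕ} (h : ∀ b ≤ k, ∀ i j, e b i j * y = y * e b i j) :
    shiftOp e k * y = y * shiftOp e k := by
  induction k with
  | zero => rw [shiftOp, one_mul, mul_one]
  | succ k ih =>
    rw [shiftOp, mul_assoc, commute_swapOp (h k (by omega)) (h (k + 1) le_rfl), ← mul_assoc,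
      ih fun b hb => h b (by omega), mul_assoc]

variable (he : ∀ b < M, IsMU (e b))
  (hc : ∀ b < M, ∀ b' < M, b ≠ b' → ∀ i j k l, e b i j * e b' k l = e b' k l * e b i j)
include he hc

theorem shiftOp_conjTranspose_mul {k : ℕ} (hk : k < M) : (shiftOp e k)ᴴ * shiftOp e k = 1 := by
  induction k with
  | zero => simp [shiftOp]
  | succ k ih =>
    have h1 := he k (by omega)
    have h2 := he (k + 1) hk
    have h3 := hc k (by omega) (k + 1) hk (by omega)
    rw [shiftOp, Matrix.conjTranspose_mul, mul_assoc, ← mul_assoc _ (shiftOp e k), ih (by omega),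
      one_mul, h1.swapOp_conjTranspose h2 h3, h1.swapOp_sq h2 h3]

theorem shiftOp_mul_last {k : ℕ} (hk : k < M) (i j : I) :
    shiftOp e k * e k i j = e 0 i j * shiftOp e k := by
  induction k with
  | zero => simp [shiftOp]
  | succ k ih =>
    have h3 := hc k (by omega) (k + 1) hk (by omega)
    rw [shiftOp, mul_assoc, swapOp_comm h3,
      (he (k + 1) hk).swapOp_mul (he k (by omega)) (fun _ _ _ _ => (h3 _ _ _ _).symm), ← mul_assoc,
      ih (by omega), mul_assoc]

/-- Each swap advances one system of units by one place, and all others pass through it. The last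
system is carried back to place 0 by the chain of swaps, as in `shiftOp_mul_last`; the result is a
cyclic shift. -/
theorem shiftOp_mul {k b : ℕ} (hk : k < M) (hb : b < k) (i j : I) :
    shiftOp e k * e b i j = e (b + 1) i j * shiftOp e k := by
  induction k with
  | zero => omega
  | succ k ih =>
    have h3 := hc k (by omega) (k + 1) hk (by omega)
    rw [shiftOp, mul_assoc]
    rcases (by omega : b < k ∨ b = k) with h | rfl
    · rw [commute_swapOp (fun i' j' => hc k (by omega) b (by omega) (by omega) _ _ _ _)
        (fun i' j' => hc (k + 1) hk b (by omega) (by omega) _ _ _ _), ← mul_assoc, ih (by omega) h,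
        mul_assoc]
    · rw [(he b (by omega)).swapOp_mul (he (b + 1) hk) h3, ← mul_assoc, ← mul_assoc,
        commute_shiftOp fun b' hb' i' j' => hc b' (by omega) (b + 1) hk (by omega) _ _ _ _]

end ShiftOp

/-! ### Partial shifts of blocks -/

section IsShift
variable {ℓ : ℕ} [NeZero ℓ] {ι : Type} [Fintype ι] [DecidableEq ι] [Nonempty ι]
  {I J : Type} [Fintype I] [DecidableEq I] [Fintype J] [DecidableEq J]
  {α : Aut (ZMod ℓ → ι)} {N : ℕ} {m : Op ι} {s : I → ℤˣ} {t : J → ℤˣ}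

/-- The multiplicities of the eigenvalues of the symmetry operator of T are determined by dimension
and trace. The products of the signs s and t have the same number and sum, so the diagonal units can
be labelled by I × J with these signs. -/
theorem exists_blockMU {Λ : Type} [Fintype Λ] [DecidableEq Λ] (hm : m * m = 1) (hms : mᴴ = m)
    (T : Finset Λ) (hc : Fintype.card I * Fintype.card J = Fintype.card ι ^ T.card)
    (hs : (((∑ i, (s i : ℤ)) * ∑ j, (t j : ℤ) : ℤ) : ℂ) = m.trace ^ T.card) :
    ∃ E : I × J → I × J → Op (Λ → ι), IsMUOf (net T) E ∧
      onSites T m = ∑ p, ((s p.1 * t p.2 : ℤˣ) : ℂ) • E p p := by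
  obtain ⟨n, F, r, hF, hr⟩ := (isFactor_net T).exists_diagonal (onSites_mem T m)
    (onSites_mul_self hm T) (onSites_conjTranspose hms T)
  have h1 : n = Fintype.card ι ^ T.card := by
    have := hF.card_sq
    rw [rdim_net, Fintype.card_fin, mul_comm 2, pow_mul] at this
    exact (Nat.pow_left_injective two_ne_zero this).symm
  have hd : (Fintype.card ι : ℂ) ≠ 0 := by exact_mod_cast Fintype.card_ne_zero
  have h2 : ((∑ i, (r i : ℤ) : ℤ) : ℂ) = m.trace ^ T.card := by
    have h3 := ntr_onSites T m
    rw [hr, hF.toIsMU.ntr_diagonal, Fintype.card_fin, div_pow,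
      show (n : ℂ) = (Fintype.card ι : ℂ) ^ T.card by rw [h1, Nat.cast_pow]] at h3
    exact (div_left_inj' (pow_ne_zero _ hd)).1 h3
  obtain ⟨e, he⟩ := exists_equiv_of_sum_eq (fun p : I × J => s p.1 * t p.2) r
    (by rw [Fintype.card_prod, hc, Fintype.card_fin, h1]) (by
      have : ((∑ i, (r i : ℤ) : ℤ) : ℂ) = (((∑ i, (s i : ℤ)) * ∑ j, (t j : ℤ) : ℤ) : ℂ) := by
        rw [h2, hs]
      rw [Int.cast_injective this, Finset.sum_mul_sum, Fintype.sum_prod_type]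
      simp)
  refine ⟨_, hF.reindex e, ?_⟩
  rw [hr, ← e.sum_comp]
  refine Finset.sum_congr rfl fun p _ => ?_
  rw [he]


/-- The sites of the `b`-th block of `N` sites. -/
def blk (ℓ : ℕ) [NeZero ℓ] (N b : ℕ) : Finset (ZMod ℓ) := iv 0 (b * N) ((b + 1) * N)

theorem blk_disjoint {b b' : ℕ} (h : b ≠ b') : Disjoint (blk ℓ N b) (blk ℓ N b') := by
  apply iv_disjoint
  rcases Nat.lt_or_gt_of_ne h with h | h
  · exact Or.inl (Nat.mul_le_mul_right _ h)
  · exact Or.inr (Nat.mul_le_mul_right _ h)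

/-- `α` shifts the first tensor factors of all blocks of `N` sites to the left by one block. -/
structure IsShift (N : ℕ) (E : ℕ → I × J → I × J → Op (ZMod ℓ → ι)) (α : Aut (ZMod ℓ → ι)) :
    Prop where
  mu : ∀ b < ℓ / N, IsMUOf (net (blk ℓ N b)) (E b)
  zero : ∀ i i', α (fstMU (E 0) i i') = fstMU (E (ℓ / N - 1)) i i'
  succ : ∀ b, b + 1 < ℓ / N → ∀ i i', α (fstMU (E (b + 1)) i i') = fstMU (E b) i i'
  fix : ∀ y, (∀ b < ℓ / N, ∀ i i', fstMU (E b) i i' * y = y * fstMU (E b) i i') → α y = y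

variable {E : ℕ → I × J → I × J → Op (ZMod ℓ → ι)}

theorem IsShift.snd (h : IsShift N E α) {b : ℕ} (hb : b < ℓ / N) (j j' : J) :
    α (sndMU (E b) j j') = sndMU (E b) j j' := by
  refine h.fix _ fun b' hb' i i' => ?_
  by_cases hbb : b' = b
  · subst hbb
    rw [(h.mu b' hb).toIsMU.fst_mul_snd, (h.mu b' hb).toIsMU.snd_mul_fst]
  · exact net_comm (blk_disjoint hbb) ((h.mu b' hb').fst_mem _ _) ((h.mu b hb).snd_mem _ _)

theorem IsShift.maps_symm (h : IsShift N E α) {b : ℕ} (hb : b + 1 < ℓ / N) {T : Finset (ZMod ℓ)}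
    (h1 : blk ℓ N b ⊆ T) (h2 : blk ℓ N (b + 1) ⊆ T) : Maps α.symm (blk ℓ N b) T := by
  have : net (blk ℓ N b) ≤ img α (net T) := by
    refine (h.mu b (by omega)).le_of_fst_snd (fun i i' => ?_) fun j j' => ?_
    · rw [← h.succ b hb]
      exact apply_mem_img (net_mono h2 ((h.mu _ hb).fst_mem _ _))
    · rw [← h.snd (by omega)]
      exact apply_mem_img (net_mono h1 ((h.mu _ (by omega)).snd_mem _ _))
  exact fun x hx => this hx

theorem IsShift.maps (h : IsShift N E α) {b : ℕ} (hb : b < ℓ / N) {T : Finset (ZMod ℓ)}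
    (h1 : blk ℓ N b ⊆ T) (h2 : b ≠ 0 → blk ℓ N (b - 1) ⊆ T) (h3 : b = 0 → blk ℓ N (ℓ / N - 1) ⊆ T) :
    Maps α (blk ℓ N b) T := by
  have : net (blk ℓ N b) ≤ img α.symm (net T) := by
    refine (h.mu b hb).le_of_fst_snd (fun i i' => ?_) fun j j' => ?_
    · rw [mem_img, StarAlgEquiv.symm_symm]
      rcases b with _ | b
      · rw [h.zero]
        exact net_mono (h3 rfl) ((h.mu _ (by omega)).fst_mem _ _)
      · rw [h.succ b hb]
        exact net_mono (h2 (by omega)) ((h.mu b (by omega)).fst_mem _ _)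
    · rw [mem_img, StarAlgEquiv.symm_symm, h.snd hb]
      exact net_mono h1 ((h.mu _ hb).snd_mem _ _)
  exact fun x hx => this hx

/-- Block 0 is sent to the last block across the fewer than N sites that belong to no block and are
not moved. This step stays within 3N sites; all others move by at most one block. -/
theorem IsShift.spreads (h : IsShift N E α) (hN : 0 < N) (hℓ : N ≤ ℓ) : Spreads (3 * N) α := by
  have hM := Nat.div_add_mod ℓ N
  have hr := Nat.mod_lt ℓ hN
  set M := ℓ / N with hMd
  have hM1 : 0 < M := Nat.div_pos hℓ hN
  have key : ∀ i x : ZMod ℓ, (∃ k : ℕ, k < 6 * N + 1 ∧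
      (x.val + 3 * N = i.val + k ∨ x.val + 3 * N = i.val + k + ℓ)) →
      x ∈ arc (i - ((3 * N : ℕ) : ZMod ℓ)) (2 * (3 * N) + 1) := by
    rintro i x ⟨k, hk, hx⟩
    rw [mem_arc]
    refine ⟨k, by omega, ?_⟩
    have h1 : ((x.val + 3 * N : ℕ) : ZMod ℓ) = ((i.val + k : ℕ) : ZMod ℓ) := by
      rcases hx with hx | hx
      · rw [hx]
      · rw [hx, Nat.cast_add _ ℓ, ZMod.natCast_self, add_zero]
    push_cast [ZMod.natCast_val, ZMod.cast_id] at h1 ⊢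
    linear_combination -h1
  intro i
  by_cases hi : i.val < M * N
  · have hb : i.val / N < M := (Nat.div_lt_iff_lt_mul hN).2 hi
    have hi1 := Nat.div_add_mod i.val N
    have hi2 := Nat.mod_lt i.val hN
    rw [mul_comm] at hi1 hM
    set b := i.val / N
    have hib : {i} ⊆ blk ℓ N b := by
      rw [Finset.singleton_subset_iff, blk, mem_iv, sub_zero, add_mul]
      omega
    refine (h.maps hb ?_ ?_ ?_).mono hib subset_rfl
    · intro x hx
      rw [blk, mem_iv, sub_zero, add_mul] at hx
      exact key i x ⟨x.val + 3 * N - i.val, by omega, by omega⟩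
    · intro hb0 x hx
      obtain ⟨c, hc⟩ := Nat.exists_eq_succ_of_ne_zero hb0
      rw [hc] at hx hi1
      rw [blk, mem_iv, sub_zero, Nat.succ_sub_one, add_mul] at hx
      rw [Nat.succ_mul] at hi1
      exact key i x ⟨x.val + 3 * N - i.val, by omega, by omega⟩
    · intro hb0 x hx
      obtain ⟨c, hc⟩ := Nat.exists_eq_succ_of_ne_zero hM1.ne'
      rw [← hMd, hc, blk, mem_iv, sub_zero, Nat.succ_sub_one, add_mul] at hx
      rw [hc, Nat.succ_mul] at hM
      rw [hb0, zero_mul] at hi1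
      by_cases hlt : x.val + 3 * N < i.val + ℓ
      · exact key i x ⟨x.val + 3 * N - i.val, by omega, by omega⟩
      · exact key i x ⟨x.val + 3 * N - i.val - ℓ, by omega, by omega⟩
  · intro x hx
    rw [h.fix x fun b hb i' j' => net_comm ?_ ((h.mu b hb).fst_mem _ _) hx]
    · refine net_mono ?_ hx
      rw [Finset.singleton_subset_iff]
      exact key i i ⟨3 * N, by omega, by omega⟩
    · rw [Finset.disjoint_singleton_right, blk, mem_iv, sub_zero]
      have := Nat.mul_le_mul_right N (show b + 1 ≤ M from hb)
      omega

end IsShift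

section ShiftIndex
variable {ℓ : ℕ} [NeZero ℓ] {ι : Type} [Fintype ι] [DecidableEq ι] [Nonempty ι]
  {I J : Type} [Fintype I] [DecidableEq I] [Fintype J] [DecidableEq J]
  {α : Aut (ZMod ℓ → ι)} {N : ℕ} {m : Op ι} {s : I → ℤˣ} {t : J → ℤˣ}
  {E : ℕ → I × J → I × J → Op (ZMod ℓ → ι)}

theorem Maps.union {Λ : Type} [Fintype Λ] [DecidableEq Λ] {α : Aut (Λ → ι)} {S S' T : Finset Λ}
    (hd : Disjoint S S') (h : Maps α S T) (h' : Maps α S' T) : Maps α (S ∪ S') T := by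
  intro x hx
  refine Submodule.mul_induction_on (mem_net_union hd hx) (fun r hr s hs => ?_) fun x y hx hy => ?_
  · rw [map_mul]
    exact mul_mem (h r hr) (h' s hs)
  · rw [map_add]
    exact add_mem hx hy

theorem IsShift.maps_symm_iv (h : IsShift N E α) {b k : ℕ} (hb : b + k < ℓ / N) :
    Maps α.symm (iv 0 (b * N) ((b + k) * N)) (iv 0 (b * N) ((b + k + 1) * N)) := by
  induction k with
  | zero =>
    intro x hx
    rw [show iv (0 : ZMod ℓ) (b * N) ((b + 0) * N) = ∅ from
      Finset.card_eq_zero.1 (by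
        rw [card_iv _ ((Nat.mul_le_mul_right N hb.le).trans (Nat.div_mul_le_self _ _))]; simp)] at hx
    obtain ⟨c, rfl⟩ := exists_smul_of_mem_net_empty hx
    rw [map_smul, map_one]
    exact (net _).toSubalgebra.smul_mem (one_mem _) c
  | succ k ih =>
    have e1 : ∀ j, b * N ≤ (b + j) * N := fun j => Nat.mul_le_mul_right _ (by omega)
    have e2 : ∀ j, (b + (j + 1)) * N = (b + j) * N + N := fun j => by ring
    have e3 := e1 k
    have e4 := e2 k
    have e5 := e2 (k + 1)
    rw [iv_union (e1 k) (by omega : (b + k) * N ≤ (b + (k + 1)) * N)]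
    refine Maps.union (iv_disjoint (Or.inl le_rfl)) ?_ ?_
    · exact (ih (by omega)).mono subset_rfl (iv_subset fun _ => ⟨le_rfl, Nat.mul_le_mul_right _ (by omega)⟩)
    · exact h.maps_symm (b := b + k) (by omega)
        (iv_subset fun _ => ⟨e1 k, Nat.mul_le_mul_right _ (by omega)⟩)
        (iv_subset fun _ => ⟨Nat.mul_le_mul_right _ (by omega), Nat.mul_le_mul_right _ (by omega)⟩)

/-- First factors move from each block to the block before. To the left of the cut 9N, the window of
radius 3N contains blocks 6, 7 and 8. The image of the left side contains blocks 6 and 7 entirely,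
but of block 8 only the second factor: its first factor is filled from block 9, on the other side of
the cut. -/
theorem IsShift.isMUOf (h : IsShift N E α) (hN : 0 < N) (hℓ : 24 * N ≤ ℓ) :
    Splits (Rt (3 * N) α ((9 * N : ℕ) : ZMod ℓ)) (net (iv 0 (6 * N) (8 * N)))
        (Rt (3 * N) α ((9 * N : ℕ) : ZMod ℓ) ⊓ net (blk ℓ N 8)) ∧
      IsMUOf (Rt (3 * N) α ((9 * N : ℕ) : ZMod ℓ) ⊓ net (blk ℓ N 8)) (sndMU (E 8)) := by
  have hM : 24 ≤ ℓ / N := (Nat.le_div_iff_mul_le hN).2 hℓ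
  have hα := h.spreads hN (by omega)
  have hR : Rt (3 * N) α ((9 * N : ℕ) : ZMod ℓ)
      = net (iv 0 (6 * N) (12 * N)) ⊓ img α (net (iv 0 (3 * N) (9 * N))) := by
    have := Rt_eq (ξ := 3 * N) (α := α) 0 (s := 9 * N) (by omega) (by omega)
    rw [zero_add] at this
    rw [this]
    congr 3 <;> congr 1 <;> omega
  have h1 : net (iv 0 (6 * N) (8 * N)) ≤ Rt (3 * N) α ((9 * N : ℕ) : ZMod ℓ) := by
    rw [hR]
    refine le_inf (net_mono (iv_subset fun _ => by omega)) ?_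
    have := (h.maps_symm_iv (b := 6) (k := 2) (by omega)).mono subset_rfl
      (T' := iv 0 (3 * N) (9 * N)) (iv_subset fun _ => by omega)
    exact this.le_img
  have h2 : Rt (3 * N) α ((9 * N : ℕ) : ZMod ℓ) ≤ net (iv 0 (6 * N) (9 * N)) := by
    have h3 := ((h.maps_symm_iv (b := 9) (k := 3) (by omega)).symm).mono
      (S' := iv 0 (3 * N) (9 * N)) ?_ subset_rfl
    · have h4 := inf_le_inf_left (net (iv 0 (6 * N) (12 * N))) h3.img_le
      rw [hR]
      refine h4.trans ?_
      rw [net_inf]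
      refine net_mono fun x hx => ?_
      simp only [Finset.mem_inter, Finset.mem_compl, mem_iv] at hx ⊢
      omega
    · rw [Finset.subset_compl_iff_disjoint_left]
      exact iv_disjoint (Or.inr le_rfl)
  have hs := (splits_net (ι := ι) (S := iv (0 : ZMod ℓ) (6 * N) (8 * N)) (T := blk ℓ N 8)
    (iv_disjoint (Or.inl le_rfl)) (iv_union (by omega) (by omega))).of_le (isFactor_net _) h1 h2
  refine ⟨hs, (h.mu 8 (by omega)).snd_of_comm inf_le_right (fun j j' => ⟨?_, ?_⟩)
    fun x hx i i' => ?_⟩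
  · rw [hR]
    have hf := (h.mu 8 (by omega)).snd_mem j j'
    refine ⟨net_mono (iv_subset fun _ => by omega) hf, ?_⟩
    rw [← h.snd (by omega)]
    exact apply_mem_img (net_mono (iv_subset fun _ => by omega) hf)
  · exact (h.mu 8 (by omega)).snd_mem j j'
  · have hx' := hx.1
    rw [hR] at hx'
    obtain ⟨y, hy, rfl⟩ := exists_of_mem_img hx'.2
    rw [← h.succ 8 (by omega), ← map_mul, ← map_mul]
    congr 1
    exact net_comm (iv_disjoint (Or.inr le_rfl)) ((h.mu 9 (by omega)).fst_mem _ _) hy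

theorem IsShift.idx_eq (h : IsShift N E α) (hN : 0 < N) (hℓ : 24 * N ≤ ℓ) (hm : m * m = 1)
    (hms : mᴴ = m) (hu : α (sym ℓ m) = sym ℓ m) (hk : m.trace ≠ 0)
    (ht : ∀ j j', sym ℓ m * sndMU (E 8) j j' * sym ℓ m
      = (((t j * t j' : ℤˣ) : ℤ) : ℂ) • sndMU (E 8) j j') :
    ‖m.trace‖ ^ N * idx m (3 * N) α = |((∑ j, (t j : ℤ) : ℤ) : ℝ)| := by
  obtain ⟨h1, h2⟩ := h.isMUOf hN hℓ
  have hα := h.spreads hN (by omega)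
  have hF := isFactor_Rt hα (by omega) ((9 * N : ℕ) : ZMod ℓ)
  have hus : (sym ℓ m)ᴴ = sym ℓ m := onSites_conjTranspose hms _
  have h3 := h1.tw (isFactor_net _) (isU_onSites hm hms Finset.univ) (norm_net hm hms _)
    ((norm_Rt hm hms hu _).inf (norm_net hm hms _))
  rw [tw_net hm hms, card_iv _ (by omega), h2.tw_eq (h1.isFactor_right hF) hus ht] at h3
  have h4 : ‖tw (sym ℓ m) (Rt (3 * N) α ((9 * N : ℕ) : ZMod ℓ))‖
      = (‖m.trace‖ ^ (2 * N) * |((∑ j, (t j : ℤ) : ℤ) : ℝ)|) ^ 2 := by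
    rw [h3, norm_mul, norm_pow, norm_mul, norm_star, Complex.norm_intCast, mul_pow,
      show 8 * N - 6 * N = 2 * N by omega, ← pow_two, Int.cast_pow, abs_pow, ← mul_pow]
  have hn : ‖m.trace‖ ≠ 0 := norm_ne_zero_iff.2 hk
  rw [SymQCA.idx_eq hα (by omega) hm hms hu hk ((9 * N : ℕ) : ZMod ℓ), h4,
    Real.sqrt_sq (by positivity), ← mul_div_assoc,
    div_eq_iff (pow_ne_zero _ hn)]
  ring

end ShiftIndex

/-! ### Realization of the solutions of the system -/

section Realize
variable {ℓ : ℕ} [NeZero ℓ] {ι : Type} [Fintype ι] [DecidableEq ι] [Nonempty ι]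
  {I J : Type} [Fintype I] [DecidableEq I] [Fintype J] [DecidableEq J]
  {N : ℕ} {m : Op ι} {s : I → ℤˣ} {t : J → ℤˣ} {μ : Z2 → Op ι}

/-- The partial shift with prescribed dimensions of eigenspaces. -/
theorem exists_shift (hμ : IsRep μ) (hN : 0 < N) (hℓ : 24 * N ≤ ℓ)
    (hc : Fintype.card I * Fintype.card J = Fintype.card ι ^ N)
    (hs : (((∑ i, (s i : ℤ)) * ∑ j, (t j : ℤ) : ℤ) : ℂ) = (μ gen).trace ^ N) :
    ∃ (U : Op (ZMod ℓ → ι)) (hq : IsQCA (3 * N) U), IsSymmetric μ U ∧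
      (Fintype.card ι : ℝ) ^ N * idx 1 (3 * N) (ev U hq.unitary) = Fintype.card J ∧
      ((μ gen).trace ≠ 0 → ‖(μ gen).trace‖ ^ N * idx (μ gen) (3 * N) (ev U hq.unitary)
        = |((∑ j, (t j : ℤ) : ℤ) : ℝ)|) := by
  have hM : 24 ≤ ℓ / N := (Nat.le_div_iff_mul_le hN).2 hℓ
  have hcard : ∀ b < ℓ / N, (blk ℓ N b).card = N := by
    intro b hb
    rw [blk, card_iv _ ((Nat.mul_le_mul_right N hb).trans (Nat.div_mul_le_self _ _)), Nat.succ_mul]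
    omega
  have hE : ∀ b : ℕ, ∃ E : I × J → I × J → Op (ZMod ℓ → ι), b < ℓ / N → IsMUOf (net (blk ℓ N b)) E ∧
      onSites (blk ℓ N b) (μ gen) = ∑ p, ((s p.1 * t p.2 : ℤˣ) : ℂ) • E p p := by
    intro b
    by_cases hb : b < ℓ / N
    · obtain ⟨E, h1⟩ := exists_blockMU (I := I) (J := J) (s := s) (t := t) hμ.sq hμ.star (blk ℓ N b)
        (by rw [hcard b hb, hc]) (by rw [hcard b hb, hs])
      exact ⟨E, fun _ => h1⟩
    · exact ⟨0, fun h => absurd h hb⟩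
  choose E hE using hE
  have he : ∀ b < ℓ / N, IsMU (fstMU (E b)) := fun b hb => (hE b hb).1.toIsMU.fst
  have hcomm : ∀ b < ℓ / N, ∀ b' < ℓ / N, b ≠ b' → ∀ i j k l,
      fstMU (E b) i j * fstMU (E b') k l = fstMU (E b') k l * fstMU (E b) i j :=
    fun b hb b' hb' hbb i j k l => net_comm (blk_disjoint hbb) ((hE b hb).1.fst_mem _ _)
      ((hE b' hb').1.fst_mem _ _)
  have hk : ℓ / N - 1 < ℓ / N := by omega
  set U := shiftOp (fun b => fstMU (E b)) (ℓ / N - 1) with hUdef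
  have hUU : Uᴴ * U = 1 := shiftOp_conjTranspose_mul he hcomm hk
  have hU : U ∈ Matrix.unitaryGroup (ZMod ℓ → ι) ℂ := Matrix.mem_unitaryGroup_iff'.2 hUU
  have hev : ∀ x y, U * x = y * U → ev U hU y = x := by
    intro x y h
    rw [ev_apply, mul_assoc, ← h, ← mul_assoc, hUU, one_mul]
  have hS : IsShift N E (ev U hU) := by
    refine ⟨fun b hb => (hE b hb).1, fun i i' => hev _ _ (shiftOp_mul_last he hcomm hk i i'),
      fun b hb i i' => hev _ _ (shiftOp_mul he hcomm hk (by omega) i i'), fun y hy => hev _ _ ?_⟩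
    exact commute_shiftOp fun b hb i j => hy b (by omega) i j
  have hu2 := sym_sq (ℓ := ℓ) hμ.sq
  have hsym : Commute U (sym ℓ (μ gen)) := by
    -- In a swap every unit E i j occurs with F j i, and the symmetry multiplies both by the same
    -- sign s i * s j.
    have hsw : ∀ b, b + 1 < ℓ / N → swapOp (fstMU (E b)) (fstMU (E (b + 1))) * sym ℓ (μ gen)
        = sym ℓ (μ gen) * swapOp (fstMU (E b)) (fstMU (E (b + 1))) := by
      intro b hb
      have h1 : ∀ b < ℓ / N, ∀ i i', sym ℓ (μ gen) * fstMU (E b) i i'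
          = (((s i * s i' : ℤˣ) : ℤ) : ℂ) • (fstMU (E b) i i' * sym ℓ (μ gen)) := by
        intro b hb i i'
        rw [← smul_mul_assoc, ← fstMU_conj (hE b hb).1.toIsMU (hE b hb).2,
          ← onSites_conj hμ.sq _ ((hE b hb).1.fst_mem _ _), mul_assoc _ _ (sym ℓ (μ gen)), hu2,
          mul_one]
      simp only [swapOp, Finset.sum_mul, Finset.mul_sum]
      refine Finset.sum_congr rfl fun i _ => Finset.sum_congr rfl fun j _ => ?_
      rw [← mul_assoc (sym ℓ (μ gen)), h1 b (by omega), smul_mul_assoc, mul_assoc _ (sym ℓ (μ gen)),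
        h1 (b + 1) hb, mul_smul_comm, smul_smul, mul_assoc]
      rcases Int.units_eq_one_or (s i) with h2 | h2 <;>
        rcases Int.units_eq_one_or (s j) with h3 | h3 <;> simp [h2, h3]
    have : ∀ k < ℓ / N, shiftOp (fun b => fstMU (E b)) k * sym ℓ (μ gen)
        = sym ℓ (μ gen) * shiftOp (fun b => fstMU (E b)) k := by
      intro k hk
      induction k with
      | zero => rw [shiftOp, one_mul, mul_one]
      | succ k ih => rw [shiftOp, mul_assoc, hsw k hk, ← mul_assoc, ih (by omega), mul_assoc]
    exact this _ hk
  have hq : IsQCA (3 * N) U := (isQCA_iff hU).2 (hS.spreads hN (by omega))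
  refine ⟨U, hq, isSymmetric_of_commute hμ hsym, ?_, fun h0 => ?_⟩
  · have := hS.idx_eq (m := 1) (t := fun _ => 1) hN hℓ (mul_one _) Matrix.conjTranspose_one
      (by rw [sym_one, map_one]) trace_one_ne_zero (fun j j' => by simp [sym_one])
    simpa [Matrix.trace_one] using this
  · refine hS.idx_eq hN hℓ hμ.sq hμ.star ((ev_eq_self_iff hU).2 hsym) h0 fun j j' => ?_
    rw [onSites_conj hμ.sq _ ((hE 8 (by omega)).1.snd_mem _ _)]
    exact sndMU_conj (hE 8 (by omega)).1.toIsMU (hE 8 (by omega)).2 j j'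

end Realize

section Signs

/-- `a` signs `1` and `b` signs `-1`. -/
def signs (a b : ℕ) : Fin a ⊕ Fin b → ℤˣ := Sum.elim (fun _ => 1) fun _ => -1

theorem sum_signs_eq (a b : ℕ) : ∑ i, (signs a b i : ℤ) = a - b := by
  simp [signs, sub_eq_add_neg]

theorem exists_pow_signature {d : ℕ} {χ : ℤ} {a b : ℕ} (hd : d = a + b) (hχ : χ = a - b) (N : ℕ) :
    ∃ a' b' : ℕ, d ^ N = a' + b' ∧ χ ^ N = a' - b' := by
  induction N with
  | zero => exact ⟨1, 0, by simp, by simp⟩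
  | succ N ih =>
    obtain ⟨a', b', h1, h2⟩ := ih
    refine ⟨a' * a + b' * b, a' * b + b' * a, ?_, ?_⟩
    · rw [pow_succ, h1, hd]; ring
    · rw [pow_succ, h2, hχ]; push_cast; ring

/-- Multiplying the first and third equations by d and χ makes N₁ positive, so that the blocks are
nonempty. The product equations say that the two factors fill a block of N₁ + N₂ sites, in dimension
and in trace. -/
theorem SolvesSystem.exists_pos {d : ℕ} {χ : ℤ} {a b : ℕ} (hd : d = a + b) (hχ : χ = a - b)
    {x y : ℝ} (hx : 0 < x) (hy : 0 < y) (hd0 : 0 < d) (h : SolvesSystem d χ x y) :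
    ∃ N₁ N₂ α₀ α₁ β₀ β₁ : ℕ, 0 < N₁ ∧ (d : ℝ) ^ N₁ * x = α₀ + α₁ ∧
      (χ : ℝ) ^ N₁ * y = (α₀ : ℝ) - α₁ ∧ (β₀ + β₁) * (α₀ + α₁) = d ^ (N₁ + N₂) ∧
      ((β₀ : ℤ) - β₁) * (α₀ - α₁) = χ ^ (N₁ + N₂) := by
  obtain ⟨N₁, N₂, α₀, α₁, β₀, β₁, h1, h2, h3, h4⟩ := h
  have hd' : (d : ℝ) = a + b := by exact_mod_cast hd
  have hχ' : (χ : ℝ) = a - b := by exact_mod_cast hχ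
  have h5 : ((β₀ : ℝ) + β₁) * (α₀ + α₁) = d ^ (N₁ + N₂) := by
    rw [← h1, ← h2, pow_add]; field_simp
  have h6 : ((β₀ : ℝ) - β₁) * (α₀ - α₁) = χ ^ (N₁ + N₂) := by
    rw [← h3, ← h4, pow_add]; field_simp
  refine ⟨N₁ + 1, N₂, α₀ * a + α₁ * b, α₀ * b + α₁ * a, β₀, β₁, Nat.succ_pos _, ?_, ?_, ?_, ?_⟩
  · rw [pow_succ, mul_right_comm, h1, hd']; push_cast; ring
  · rw [pow_succ, mul_right_comm, h3, hχ']; push_cast; ring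
  · have : (β₀ + β₁) * (α₀ + α₁) = d ^ (N₁ + N₂) := by exact_mod_cast h5
    rw [add_right_comm N₁, pow_succ, ← this, hd]; ring
  · have : ((β₀ : ℤ) - β₁) * (α₀ - α₁) = χ ^ (N₁ + N₂) := by exact_mod_cast h6
    rw [add_right_comm N₁, pow_succ, ← this, hχ]; push_cast; ring

end Signs

section Realize
variable {ι : Type} [Fintype ι] [DecidableEq ι] [Nonempty ι] {μ : Z2 → Op ι} {χ : ℤ} {x y : ℝ}

theorem exists_realization (hμ : IsRep μ) (hχ : (μ gen).trace = χ) (hx : 0 < x) (hy : 0 < y)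
    (h : SolvesSystem (Fintype.card ι) χ x y) : ∃ ξ : ℕ, ∀ (ℓ : ℕ) [NeZero ℓ], 8 * ξ ≤ ℓ →
      ∃ (U : Op (ZMod ℓ → ι)) (hq : IsQCA ξ U), IsSymmetric μ U ∧ idx 1 ξ (ev U hq.unitary) = x ∧
        (χ ≠ 0 → idx (μ gen) ξ (ev U hq.unitary) = y) := by
  obtain ⟨a, b, hd, hab⟩ := exists_signature_rep hμ.sq hμ.star
  have hχab : χ = a - b := by rw [hχ] at hab; exact_mod_cast hab
  have hd0 : 0 < Fintype.card ι := Fintype.card_pos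
  obtain ⟨N₁, N₂, α₀, α₁, β₀, β₁, hN, h1, h2, h3, h4⟩ := h.exists_pos hd hχab hx hy hd0
  obtain ⟨γ₀, γ₁, h5, h6⟩ := exists_pow_signature hd hχab N₁
  obtain ⟨δ₀, δ₁, h7, h8⟩ := exists_pow_signature hd hχab N₂
  -- The QCA below has spreading length 6(N₁ + N₂). The larger value guarantees, through 8ξ ≤ ℓ, the
  -- length of the chain that multiplicativity requires for two shifts of spreading length 3(N₁ +
  -- N₂).
  refine ⟨10 * (N₁ + N₂), fun ℓ _ hℓ => ?_⟩
  obtain ⟨U, hq, hs, hU1, hU2⟩ := exists_shift (ℓ := ℓ) (N := N₁ + N₂) (I := Fin β₀ ⊕ Fin β₁)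
    (J := Fin α₀ ⊕ Fin α₁) (s := signs β₀ β₁) (t := signs α₀ α₁) hμ (by omega) (by omega)
    (by simp [h3]) (by rw [sum_signs_eq, sum_signs_eq, h4, hχ]; push_cast; rfl)
  -- The shift U leaves factors of dimension d^N₁ π₀ in place and therefore has index π₀ / d^N₂. The
  -- shift V, whose fixed factors have the dimension d^N₁ and trace χ^N₁ of N₁ sites, has index 1 /
  -- d^N₂ and serves to divide this out; the same holds for the symmetry up to absolute values.
  obtain ⟨V, hq', hs', hV1, hV2⟩ := exists_shift (ℓ := ℓ) (N := N₁ + N₂) (I := Fin δ₀ ⊕ Fin δ₁)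
    (J := Fin γ₀ ⊕ Fin γ₁) (s := signs δ₀ δ₁) (t := signs γ₀ γ₁) hμ (by omega) (by omega)
    (by simp [← h5, ← h7, pow_add, mul_comm])
    (by rw [sum_signs_eq, sum_signs_eq, ← h6, ← h8, hχ, add_comm, pow_add]; push_cast; rfl)
  have qW := hq.mul hq'.conjTranspose
  have sW := hs.mul (hs'.conjTranspose hμ hq'.unitary)
  have key : ∀ m, IsAdmissible μ m → idx m (10 * (N₁ + N₂))
      (ev (U * Vᴴ) (qW.mono (ξ' := 10 * (N₁ + N₂)) (by omega)).unitary)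
        * idx m (3 * (N₁ + N₂)) (ev V hq'.unitary) = idx m (3 * (N₁ + N₂)) (ev U hq.unitary) := by
    intro m hm
    rw [hm.idx_mono hμ qW sW (by omega) (by omega)]
    exact hm.idx_mul_conjTranspose hμ hq' hs' hq hs (by omega)
  refine ⟨U * Vᴴ, qW.mono (by omega), sW, ?_, fun h0 => ?_⟩
  · have hk := key 1 isAdmissible_one
    have hdr : (Fintype.card ι : ℝ) ≠ 0 := by exact_mod_cast hd0.ne'
    have hV : (Fintype.card ι : ℝ) ^ (N₁ + N₂) * idx 1 (3 * (N₁ + N₂)) (ev V hq'.unitary)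
        = (Fintype.card ι : ℝ) ^ N₁ := by
      rw [hV1]; simp only [Fintype.card_sum, Fintype.card_fin, ← h5]; push_cast; rfl
    have hU : (Fintype.card ι : ℝ) ^ (N₁ + N₂) * idx 1 (3 * (N₁ + N₂)) (ev U hq.unitary)
        = (Fintype.card ι : ℝ) ^ N₁ * x := by
      rw [hU1, h1]; simp
    rw [← hk, mul_left_comm, hV, mul_comm] at hU
    exact mul_left_cancel₀ (pow_ne_zero _ hdr) hU
  · have htr : (μ gen).trace ≠ 0 := by rw [hχ]; exact_mod_cast h0
    have hk := key (μ gen) ⟨Or.inr rfl, htr⟩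
    have hn : ‖(μ gen).trace‖ = |(χ : ℝ)| := by rw [hχ, Complex.norm_intCast]
    have hdr : |(χ : ℝ)| ≠ 0 := abs_ne_zero.2 (by exact_mod_cast h0)
    have hV := hV2 htr
    have hU := hU2 htr
    rw [sum_signs_eq, hn] at hV hU
    rw [← h6, Int.cast_pow, abs_pow] at hV
    push_cast at hU
    rw [← h2, abs_mul, abs_pow, abs_of_pos hy, ← hk, mul_left_comm, hV, mul_comm] at hU
    exact mul_left_cancel₀ (pow_ne_zero _ hdr) hU

end Realize

/-! ### Multiplicative groups generated by prime factors -/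

section Arithmetic

theorem isFreeAbelianOfRank_card {Γ : Type} [Monoid Γ] {S : Set Γ} {κ : Type} [Fintype κ]
    (Φ : Multiplicative (κ → ℤ) →* Γ) (hi : Function.Injective Φ) (hr : Set.range Φ = S) {n : ℕ}
    (hn : Fintype.card κ = n) : IsFreeAbelianOfRank S n := by
  subst hn
  let e : Multiplicative (Fin (Fintype.card κ) → ℤ) ≃* Multiplicative (κ → ℤ) :=
    AddEquiv.toMultiplicative
      (LinearEquiv.funCongrLeft ℤ ℤ (Fintype.equivFin κ)).toAddEquiv
  refine ⟨Φ.comp e.toMonoidHom, hi.comp e.injective, ?_⟩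
  rw [← hr]
  exact e.surjective.range_comp Φ

/-- The product of the prime factors of `n` with prescribed integer exponents. -/
def primePow (n : ℕ) : Multiplicative (n.primeFactors → ℤ) →* ℝ where
  toFun e := ∏ p : n.primeFactors, ((p : ℕ) : ℝ) ^ (Multiplicative.toAdd e p)
  map_one' := by simp
  map_mul' e f := by
    rw [← Finset.prod_mul_distrib]
    refine Finset.prod_congr rfl fun p _ => ?_
    rw [toAdd_mul, Pi.add_apply, zpow_add₀]
    exact_mod_cast (Nat.prime_of_mem_primeFactors p.2).ne_zero

theorem primePow_apply (n : ℕ) (e) :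
    primePow n e = ∏ p : n.primeFactors, ((p : ℕ) : ℝ) ^ (Multiplicative.toAdd e p) := rfl

/-- If the product is one, moving the primes with negative exponents to the other side gives two
equal natural numbers, and unique factorization applies. -/
theorem primePow_injective (n : ℕ) : Function.Injective (primePow n) := by
  rw [injective_iff_map_eq_one]
  intro e he
  set k : n.primeFactors → ℤ := Multiplicative.toAdd e with hk
  have hpos : ∀ p : n.primeFactors, ((p : ℕ) : ℝ) ≠ 0 := fun p => by
    exact_mod_cast (Nat.prime_of_mem_primeFactors p.2).ne_zero
  have h1 : ∏ p : n.primeFactors, (p : ℕ) ^ (k p).toNat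
      = ∏ p : n.primeFactors, (p : ℕ) ^ (-k p).toNat := by
    have h2 : (∏ p : n.primeFactors, ((p : ℕ) : ℝ) ^ (k p).toNat)
        = (∏ p : n.primeFactors, ((p : ℕ) : ℝ) ^ (-k p).toNat) := by
      have h3 : (∏ p : n.primeFactors, ((p : ℕ) : ℝ) ^ (k p).toNat)
          = (∏ p : n.primeFactors, ((p : ℕ) : ℝ) ^ k p)
            * ∏ p : n.primeFactors, ((p : ℕ) : ℝ) ^ (-k p).toNat := by
        rw [← Finset.prod_mul_distrib]
        refine Finset.prod_congr rfl fun p _ => ?_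
        rw [← zpow_natCast, ← zpow_natCast, ← zpow_add₀ (hpos p)]
        congr 1
        omega
      rw [h3, show (∏ p : n.primeFactors, ((p : ℕ) : ℝ) ^ k p) = 1 from he, one_mul]
    exact_mod_cast h2
  have hf : ∀ (l : n.primeFactors → ℕ) (q : n.primeFactors),
      (∏ p : n.primeFactors, (p : ℕ) ^ l p).factorization q = l q := by
    intro l q
    rw [Nat.factorization_prod_apply fun p _ => pow_ne_zero _
      (Nat.prime_of_mem_primeFactors p.2).ne_zero, Finset.sum_eq_single q]
    · rw [(Nat.prime_of_mem_primeFactors q.2).factorization_pow, Finsupp.single_eq_same]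
    · intro p _ hp
      rw [(Nat.prime_of_mem_primeFactors p.2).factorization_pow, Finsupp.single_eq_of_ne]
      exact fun h => hp (Subtype.ext h.symm)
    · simp
  have : k = 0 := by
    funext q
    have h4 := (hf (fun p => (k p).toNat) q).symm.trans ((congrArg (fun x => x.factorization q) h1).trans
      (hf (fun p => (-k p).toNat) q))
    change k q = 0
    omega
  exact this

/-- The positive reals that become natural numbers, together with their inverses, after
multiplication with a power of `n`. -/
def radicalSet (n : ℕ) : Set ℝ :=
  {x | 0 < x ∧ ∃ N A B : ℕ, (n : ℝ) ^ N * x = A ∧ (n : ℝ) ^ N / x = B}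

variable {n d : ℕ} {x y : ℝ}

theorem mem_radicalSet (hx : 0 < x) {N N' A B : ℕ} (h1 : (n : ℝ) ^ N * x = A)
    (h2 : (n : ℝ) ^ N' / x = B) : x ∈ radicalSet n := by
  refine ⟨hx, N + N', n ^ N' * A, n ^ N * B, ?_, ?_⟩
  · push_cast; rw [← h1, pow_add]; ring
  · push_cast; rw [← h2, pow_add]; ring

theorem one_mem_radicalSet : (1 : ℝ) ∈ radicalSet n := ⟨one_pos, 0, 1, 1, by simp, by simp⟩

theorem mul_mem_radicalSet (hx : x ∈ radicalSet n) (hy : y ∈ radicalSet n) :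
    x * y ∈ radicalSet n := by
  obtain ⟨hx, N, A, B, h1, h2⟩ := hx
  obtain ⟨hy, N', A', B', h3, h4⟩ := hy
  refine ⟨mul_pos hx hy, N + N', A * A', B * B', ?_, ?_⟩
  · push_cast; rw [← h1, ← h3, pow_add]; ring
  · push_cast; rw [← h2, ← h4, pow_add]; field_simp

theorem inv_mem_radicalSet (hx : x ∈ radicalSet n) : x⁻¹ ∈ radicalSet n := by
  obtain ⟨hx, N, A, B, h1, h2⟩ := hx
  exact ⟨inv_pos.2 hx, N, B, A, by rw [← h2]; rfl, by rw [← h1, div_inv_eq_mul]⟩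

theorem pow_mem_radicalSet (hx : x ∈ radicalSet n) (k : ℕ) : x ^ k ∈ radicalSet n := by
  induction k with
  | zero => rw [pow_zero]; exact one_mem_radicalSet
  | succ k ih => rw [pow_succ]; exact mul_mem_radicalSet ih hx

theorem zpow_mem_radicalSet (hx : x ∈ radicalSet n) (k : ℤ) : x ^ k ∈ radicalSet n := by
  obtain ⟨k, rfl | rfl⟩ := k.eq_nat_or_neg
  · rw [zpow_natCast]; exact pow_mem_radicalSet hx k
  · rw [zpow_neg, zpow_natCast]; exact inv_mem_radicalSet (pow_mem_radicalSet hx k)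

theorem prime_mem_radicalSet {p : ℕ} (hp : p ∈ n.primeFactors) : (p : ℝ) ∈ radicalSet n := by
  have h0 : (p : ℝ) ≠ 0 := by exact_mod_cast (Nat.prime_of_mem_primeFactors hp).ne_zero
  obtain ⟨c, hc⟩ := Nat.dvd_of_mem_primeFactors hp
  refine ⟨lt_of_le_of_ne (Nat.cast_nonneg _) h0.symm, 1, n * p, c, by push_cast; ring, ?_⟩
  rw [hc]; push_cast; field_simp

theorem cast_eq_prod_factorization {A k : ℕ} (hn : n ≠ 0) (hA : A ∣ n ^ k) :
    (A : ℝ) = ∏ p : n.primeFactors, ((p : ℕ) : ℝ) ^ ((A.factorization p : ℕ) : ℤ) := by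
  have hA0 : A ≠ 0 := ne_zero_of_dvd_ne_zero (pow_ne_zero _ hn) hA
  have h1 : A.primeFactors ⊆ n.primeFactors := by
    intro p hp
    have hp' := Nat.prime_of_mem_primeFactors hp
    exact Nat.mem_primeFactors.2 ⟨hp', hp'.dvd_of_dvd_pow ((Nat.dvd_of_mem_primeFactors hp).trans hA), hn⟩
  have h2 := Nat.prod_factorization_pow_eq_self hA0
  rw [Finsupp.prod_of_support_subset _ (s := n.primeFactors) h1 _ (by simp)] at h2
  conv_lhs => rw [← h2]
  push_cast
  rw [← Finset.prod_coe_sort]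
  simp

/-- If n^N x = A and n^N / x = B are natural numbers, then A B = n^(2N). So A divides a power of n
and has no primes other than those of n. -/
theorem range_primePow (hn : n ≠ 0) : Set.range (primePow n) = radicalSet n := by
  apply Set.Subset.antisymm
  · rintro _ ⟨e, rfl⟩
    rw [primePow_apply]
    exact Finset.prod_induction _ (· ∈ radicalSet n) (fun _ _ => mul_mem_radicalSet)
      one_mem_radicalSet fun p _ => zpow_mem_radicalSet (prime_mem_radicalSet p.2) _
  · rintro x ⟨hx, N, A, B, h1, h2⟩
    have hnr : (n : ℝ) ≠ 0 := by exact_mod_cast hn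
    have hAB : A * B = n ^ (2 * N) := by
      have : (A : ℝ) * B = (n : ℝ) ^ (2 * N) := by
        rw [← h1, ← h2, two_mul, pow_add]; field_simp
      exact_mod_cast this
    have h3 := cast_eq_prod_factorization hn (Dvd.intro _ hAB)
    have h4 := cast_eq_prod_factorization (A := n ^ N) hn dvd_rfl
    refine ⟨Multiplicative.ofAdd fun p : n.primeFactors =>
      ((A.factorization p : ℕ) : ℤ) - (((n ^ N).factorization p : ℕ) : ℤ), ?_⟩
    have h5 : x = A / ((n ^ N : ℕ) : ℝ) := by
      rw [eq_div_iff (by exact_mod_cast pow_ne_zero _ hn), ← h1]; push_cast; ring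
    rw [h5, h3, h4, ← Finset.prod_div_distrib, primePow_apply]
    refine Finset.prod_congr rfl fun p _ => ?_
    rw [toAdd_ofAdd, zpow_sub₀]
    exact_mod_cast (Nat.prime_of_mem_primeFactors p.2).ne_zero

theorem isFreeAbelianOfRank_radicalSet (hn : n ≠ 0) :
    IsFreeAbelianOfRank (radicalSet n) n.primeFactors.card :=
  isFreeAbelianOfRank_card (primePow n) (primePow_injective n) (range_primePow hn)
    (Fintype.card_coe _)

end Arithmetic

/-! ### The group of solutions -/

section Solutions
variable {d : ℕ} {χ : ℤ} {a b : ℕ} {x y : ℝ}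

theorem SolvesSystem.mem_radicalSet (hx : 0 < x) (h : SolvesSystem d χ x y) : x ∈ radicalSet d := by
  obtain ⟨N₁, N₂, α₀, α₁, β₀, β₁, h1, h2, -, -⟩ := h
  exact SymQCA.mem_radicalSet hx (A := α₀ + α₁) (B := β₀ + β₁) (by rw [h1]; push_cast; rfl)
    (by rw [h2]; push_cast; rfl)

theorem SolvesSystem.snd_mem_radicalSet (hy : 0 < y) (h : SolvesSystem d χ x y) :
    y ∈ radicalSet χ.natAbs := by
  obtain ⟨N₁, N₂, α₀, α₁, β₀, β₁, -, -, h1, h2⟩ := h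
  have hX : ((χ.natAbs : ℕ) : ℝ) = |(χ : ℝ)| := by rw [Nat.cast_natAbs, Int.cast_abs]
  refine SymQCA.mem_radicalSet hy (N := N₁) (N' := N₂) (A := ((α₀ : ℤ) - α₁).natAbs)
    (B := ((β₀ : ℤ) - β₁).natAbs) ?_ ?_
  · rw [hX, Nat.cast_natAbs, Int.cast_abs]
    push_cast
    rw [← h1, abs_mul, abs_pow, abs_of_pos hy]
  · rw [hX, Nat.cast_natAbs, Int.cast_abs]
    push_cast
    rw [← h2, abs_div, abs_pow, abs_of_pos hy]

theorem exists_half {A C : ℕ} (h : C ≤ A) (hp : A % 2 = C % 2) :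
    ∃ a b : ℕ, (A : ℝ) = a + b ∧ (C : ℝ) = |(a : ℝ) - b| := by
  refine ⟨(A + C) / 2, (A - C) / 2, ?_, ?_⟩
  · have : A = (A + C) / 2 + (A - C) / 2 := by omega
    exact_mod_cast this
  · have : (A + C) / 2 = (A - C) / 2 + C := by omega
    rw [this]
    push_cast
    rw [add_sub_cancel_left, Nat.abs_cast]

/-- Two natural numbers P and Q are the sum and the absolute difference of natural numbers as soon
as Q ≤ P and both have the same parity. Here P = d^K x and Q = |χ|^K y, and likewise for the
inverses. For large K the inequalities hold since |χ| < d, and the parities agree since d = a + b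
and χ = a - b. -/
theorem solvesSystem_of_mem_radicalSet (hd : d = a + b) (hab : χ = a - b) (h0 : χ ≠ 0)
    (hlt : χ.natAbs < d) (hx : x ∈ radicalSet d) (hy : y ∈ radicalSet χ.natAbs) :
    SolvesSystem d χ x y := by
  obtain ⟨hx0, N, A, B, h1, h2⟩ := hx
  obtain ⟨hy0, N', C, D, h3, h4⟩ := hy
  set X := χ.natAbs with hXdef
  have hX : (X : ℝ) = |(χ : ℝ)| := by rw [hXdef, Nat.cast_natAbs, Int.cast_abs]
  have hX0 : 0 < X := Int.natAbs_pos.2 h0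
  have hXr : (0 : ℝ) < X := by exact_mod_cast hX0
  have hdr : (0 : ℝ) < d := by exact_mod_cast (hX0.trans hlt)
  have hpar : d % 2 = X % 2 := by omega
  have hratio : 1 < (d : ℝ) / X := (one_lt_div hXr).2 (by exact_mod_cast hlt)
  have ht := tendsto_pow_atTop_atTop_of_one_lt hratio
  obtain ⟨K, hK1, hK2, hKN, hKN'⟩ := ((ht.eventually_ge_atTop (y / x)).and
    ((ht.eventually_ge_atTop (x / y)).and
      ((Filter.eventually_gt_atTop N).and (Filter.eventually_gt_atTop N')))).exists
  have hpow : ∀ {e M : ℕ} {z : ℝ} {F : ℕ}, M < K → (e : ℝ) ^ M * z = F →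
      (e : ℝ) ^ K * z = ((e ^ (K - M) * F : ℕ) : ℝ) := by
    intro e M z F hM h
    push_cast
    rw [← h, ← mul_assoc, ← pow_add, Nat.sub_add_cancel hM.le]
  have hprod : ∀ {e : ℕ} {z : ℝ} {F G : ℕ}, 0 < z → (e : ℝ) ^ K * z = F → (e : ℝ) ^ K * z⁻¹ = G →
      F * G = e ^ (2 * K) := by
    intro e z F G hz h h'
    have : (F : ℝ) * G = (e : ℝ) ^ (2 * K) := by
      rw [← h, ← h', two_mul, pow_add]; field_simp
    exact_mod_cast this
  -- If e is even, the surplus power of e makes the number even, for which K > M is needed; if e is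
  -- odd, the number divides an odd number.
  have hparity : ∀ {e M F G : ℕ}, M < K → e ^ (K - M) * F * G = e ^ (2 * K) →
      (e ^ (K - M) * F) % 2 = e % 2 := by
    intro e M F G hM h
    rcases Nat.mod_two_eq_zero_or_one e with he | he
    · rw [he, Nat.mul_mod, Nat.pow_mod, he, zero_pow (by omega)]
      simp
    · rw [he]
      have h5 : Odd (e ^ (K - M) * F * G) := by
        rw [h]; exact (Nat.odd_iff.2 he).pow
      exact Nat.odd_iff.1 (Nat.odd_mul.1 h5).1
  rw [div_eq_mul_inv] at h2 h4
  have h1' := hpow hKN h1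
  have h2' := hpow hKN h2
  have h3' := hpow hKN' h3
  have h4' := hpow hKN' h4
  have q1 := hprod hx0 h1' h2'
  have q2 := hprod hy0 h3' h4'
  have hle1 : X ^ (K - N') * C ≤ d ^ (K - N) * A := by
    have : (X : ℝ) ^ K * y ≤ (d : ℝ) ^ K * x := by
      rw [div_pow, div_le_div_iff₀ hx0 (by positivity)] at hK1
      linarith
    rw [h1', h3'] at this
    exact_mod_cast this
  have hle2 : X ^ (K - N') * D ≤ d ^ (K - N) * B := by
    have : (X : ℝ) ^ K * y⁻¹ ≤ (d : ℝ) ^ K * x⁻¹ := by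
      rw [div_pow, div_le_div_iff₀ hy0 (by positivity)] at hK2
      rw [← div_eq_mul_inv, ← div_eq_mul_inv, div_le_div_iff₀ hy0 hx0]
      linarith
    rw [h2', h4'] at this
    exact_mod_cast this
  obtain ⟨α₀, α₁, e1, e2⟩ := exists_half hle1 (by rw [hparity hKN q1, hparity hKN' q2, hpar])
  obtain ⟨β₀, β₁, e3, e4⟩ := exists_half hle2 (by
    rw [hparity hKN ((mul_comm _ _).trans q1), hparity hKN' ((mul_comm _ _).trans q2), hpar])
  exact solvesSystem_of_abs (N := K) (a' := β₀) (b' := β₁) hy0 (h1'.trans e1) (by rw [← hX, h3', e2])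
    (by rw [div_eq_mul_inv, h2', e3]) (by rw [← hX, div_eq_mul_inv, h4', e4])

theorem isFreeAbelianOfRank_solutions (hd : d = a + b) (hab : χ = a - b) (h0 : χ ≠ 0)
    (hlt : χ.natAbs < d) : IsFreeAbelianOfRank (solutions d χ)
      (d.primeFactors.card + χ.natAbs.primeFactors.card) := by
  let inl : Multiplicative (d.primeFactors ⊕ χ.natAbs.primeFactors → ℤ) →*
      Multiplicative (d.primeFactors → ℤ) :=
    AddMonoidHom.toMultiplicative (LinearMap.funLeft ℤ ℤ Sum.inl).toAddMonoidHom
  let inr : Multiplicative (d.primeFactors ⊕ χ.natAbs.primeFactors → ℤ) →*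
      Multiplicative (χ.natAbs.primeFactors → ℤ) :=
    AddMonoidHom.toMultiplicative (LinearMap.funLeft ℤ ℤ Sum.inr).toAddMonoidHom
  refine isFreeAbelianOfRank_card (((primePow d).comp inl).prod ((primePow χ.natAbs).comp inr))
    ?_ ?_ (by rw [Fintype.card_sum, Fintype.card_coe, Fintype.card_coe])
  · intro e f h
    have h1 : inl e = inl f := primePow_injective _ (congrArg Prod.fst h :)
    have h2 : inr e = inr f := primePow_injective _ (congrArg Prod.snd h :)
    funext p
    rcases p with p | p
    · exact congrFun h1 p
    · exact congrFun h2 p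
  · ext ⟨x, y⟩
    have hsol : (x, y) ∈ solutions d χ ↔ x ∈ radicalSet d ∧ y ∈ radicalSet χ.natAbs :=
      ⟨fun h => ⟨h.2.2.mem_radicalSet h.1, h.2.2.snd_mem_radicalSet h.2.1⟩,
        fun h => ⟨h.1.1, h.2.1, solvesSystem_of_mem_radicalSet hd hab h0 hlt h.1 h.2⟩⟩
    rw [hsol, ← range_primePow (by omega), ← range_primePow (by omega)]
    constructor
    · rintro ⟨e, he⟩
      exact ⟨⟨_, congrArg Prod.fst he⟩, ⟨_, congrArg Prod.snd he⟩⟩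
    · rintro ⟨⟨e, rfl⟩, ⟨f, rfl⟩⟩
      exact ⟨Multiplicative.ofAdd (Sum.elim (Multiplicative.toAdd e) (Multiplicative.toAdd f)), rfl⟩

/-- A difference of natural numbers is bounded by their sum. If |χ| = d, this says π₁ ≤ π₀ for the
first pair of integers and 1/π₁ ≤ 1/π₀ for the second. -/
theorem snd_eq_fst_of_mem_solutions (h0 : χ ≠ 0) (heq : χ.natAbs = d) {x : ℝ × ℝ}
    (hx : x ∈ solutions d χ) : x.2 = x.1 := by
  obtain ⟨hx1, hx2, N₁, N₂, α₀, α₁, β₀, β₁, h1, h2, h3, h4⟩ := hx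
  have hX : (d : ℝ) = |(χ : ℝ)| := by rw [← heq, Nat.cast_natAbs, Int.cast_abs]
  have hd : (0 : ℝ) < d := by rw [hX]; exact abs_pos.2 (by exact_mod_cast h0)
  have habs : ∀ a b : ℕ, |(a : ℝ) - b| ≤ a + b := fun a b => by
    rw [abs_le]
    have h1 : (0 : ℝ) ≤ a := Nat.cast_nonneg _
    have h2 : (0 : ℝ) ≤ b := Nat.cast_nonneg _
    constructor <;> linarith
  have h5 := habs α₀ α₁
  have h6 := habs β₀ β₁
  rw [← h1, ← h3, abs_mul, abs_pow, abs_of_pos hx2, ← hX] at h5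
  rw [← h2, ← h4, abs_div, abs_pow, abs_of_pos hx2, ← hX] at h6
  exact le_antisymm (le_of_mul_le_mul_left h5 (by positivity))
    ((div_le_div_iff_of_pos_left (by positivity) hx2 hx1).1 h6)

theorem isFreeAbelianOfRank_solutions_of_natAbs_eq (h0 : χ ≠ 0) (heq : χ.natAbs = d) :
    IsFreeAbelianOfRank (solutions d χ) d.primeFactors.card := by
  have hX : (d : ℝ) = |(χ : ℝ)| := by rw [← heq, Nat.cast_natAbs, Int.cast_abs]
  refine isFreeAbelianOfRank_card ((primePow d).prod (primePow d))
    (fun e f h => primePow_injective _ (congrArg Prod.fst h)) ?_ (Fintype.card_coe _)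
  have hr := range_primePow (n := d) (by omega)
  ext x
  constructor
  · rintro ⟨e, rfl⟩
    obtain ⟨hx, N, A, B, h1, h2⟩ : primePow d e ∈ radicalSet d := hr ▸ ⟨e, rfl⟩
    have h3 : SolvesSystem d χ (primePow d e) (primePow d e) :=
      solvesSystem_of_abs (N := N) (a := A) (b := 0) (a' := B) (b' := 0) hx
        (by simpa using h1) (by rw [← hX, h1]; simp) (by simpa using h2) (by rw [← hX, h2]; simp)
    exact ⟨hx, hx, h3⟩
  · intro hx
    have h1 := hx.2.2.mem_radicalSet hx.1
    rw [← hr] at h1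
    obtain ⟨e, he⟩ := h1
    exact ⟨e, Prod.ext he (he.trans (snd_eq_fst_of_mem_solutions h0 heq hx).symm)⟩

theorem isFreeAbelianOfRank_solutionsGNVW (hd : d = a + a) (hd0 : d ≠ 0) :
    IsFreeAbelianOfRank (solutionsGNVW d 0) d.primeFactors.card := by
  have : solutionsGNVW d 0 = radicalSet d := by
    ext x
    refine ⟨fun h => h.2.mem_radicalSet h.1, ?_⟩
    rintro ⟨hx, N, A, B, h1, h2⟩
    have hdr : (d : ℝ) = a + a := by exact_mod_cast hd
    -- Since d = 2a, one more factor d doubles the integers, and the halves can be taken equal; the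
    -- differences are zero, as required by 0^(N+1) = 0.
    refine ⟨hx, N + 1, N + 1, a * A, a * A, a * B, a * B, ?_, ?_, by simp, by simp⟩
    · rw [pow_succ, mul_right_comm, h1, hdr]; push_cast; ring
    · rw [pow_succ, mul_div_right_comm, h2, hdr]; push_cast; ring
  rw [this]
  exact isFreeAbelianOfRank_radicalSet hd0

end Solutions

/-! ### Assembly of the classification -/

section Classification
variable {ι : Type} [Fintype ι] [DecidableEq ι] [Nonempty ι] {μ : Z2 → Op ι} {χ : ℤ}

theorem isRep_coe {d : ℕ} (μ : Z2 →* Matrix.unitaryGroup (Fin d) ℂ) :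
    IsRep fun g => (μ g : Op (Fin d)) := by
  have h1 : (μ gen : Op (Fin d)) * μ gen = 1 := by
    rw [← Submonoid.coe_mul, ← map_mul, show gen * gen = (1 : Z2) by decide, map_one]
    rfl
  refine ⟨by simp, h1, ?_⟩
  have h2 : (μ gen : Op (Fin d))ᴴ * μ gen = 1 := Matrix.mem_unitaryGroup_iff'.1 (μ gen).2
  calc (μ gen : Op (Fin d))ᴴ = (μ gen : Op (Fin d))ᴴ * (μ gen * μ gen) := by rw [h1, mul_one]
    _ = μ gen := by rw [← mul_assoc, h2, one_mul]

theorem hasInvariants_iff {ℓ : ℕ} [NeZero ℓ] {ξ : ℕ} {U : Op (ZMod ℓ → ι)} (hμ : IsRep μ)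
    (h0 : (μ gen).trace ≠ 0) (h8 : 8 * ξ ≤ ℓ) (hq : IsQCA ξ U) (hs : IsSymmetric μ U) (y : ℝ × ℝ) :
    (HasGNVWIndex ξ U y.1 ∧ HasSPI μ ξ U y.1 y.2) ↔
      y = (idx 1 ξ (ev U hq.unitary), idx (μ gen) ξ (ev U hq.unitary)) := by
  obtain ⟨y₁, y₂⟩ := y
  rw [hasGNVWIndex_iff hq.unitary hq.spreads h8, Prod.mk.injEq]
  refine and_congr_right fun h => ?_
  subst h
  exact hasSPI_iff hμ hq.unitary hq.spreads ((isSymmetric_iff hμ hq.unitary).1 hs) h0 h8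

theorem classifies_pair (hμ : IsRep μ) (hχ : (μ gen).trace = χ) (h0 : χ ≠ 0) :
    Classifies μ (fun _ _ ξ U (x : ℝ × ℝ) => HasGNVWIndex ξ U x.1 ∧ HasSPI μ ξ U x.1 x.2)
      (solutions (Fintype.card ι) χ) := by
  have htr : (μ gen).trace ≠ 0 := by rw [hχ]; exact_mod_cast h0
  have hg : IsAdmissible μ (μ gen) := ⟨Or.inr rfl, htr⟩
  refine ⟨fun ξ ℓ _ h8 U hq hs => ?_, fun x hx => ?_, fun ξ r => ⟨12 * (ξ + 2 * r) + 1, ?_⟩,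
    fun ξ => ⟨4 * (2 * ξ + 1), 1, 24 * (ξ + 1), ?_⟩, ?_⟩
  · exact ⟨_, idx_mem_solutions hq.spreads (by omega) hμ.sq hμ.star
      ((isSymmetric_iff hμ hq.unitary).1 hs) hχ h0, hasInvariants_iff hμ htr h8 hq hs⟩
  · obtain ⟨ξ, hξ⟩ := exists_realization hμ hχ hx.1 hx.2.1 hx.2.2
    refine ⟨ξ, fun ℓ _ h8 => ?_⟩
    obtain ⟨U, hq, hs, h1, h2⟩ := hξ ℓ h8
    refine ⟨U, hq, hs, (hasInvariants_iff hμ htr h8 hq hs x).2 ?_⟩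
    rw [h1, h2 h0]
  · intro ℓ _ hℓ k U U' hq hs hq' hs' h x
    rw [hasInvariants_iff hμ htr (by omega) hq hs, hasInvariants_iff hμ htr (by omega) hq' hs',
      h.idx_eq hμ isAdmissible_one hq hs hq' hs' hℓ, h.idx_eq hμ hg hq hs hq' hs' hℓ]
  · rintro ℓ _ hℓ U U' hq hs hq' hs' ⟨x, h1, h2⟩
    rw [hasInvariants_iff hμ htr (by omega) hq hs] at h1
    rw [hasInvariants_iff hμ htr (by omega) hq' hs', h1, Prod.mk.injEq] at h2
    refine stronglyEquivalent_of_idx_eq hμ hq hs hq' hs' hℓ fun m hm => ?_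
    rcases hm.1 with rfl | rfl
    · exact h2.1
    · exact h2.2
  · intro ξ ℓ _ h16 U V hq hs hq' hs' x y hx hy
    have hℓ := NeZero.pos ℓ
    refine ⟨hq.mul hq', hs.mul hs', ?_⟩
    rw [hasInvariants_iff hμ htr (by omega) hq hs] at hx
    rw [hasInvariants_iff hμ htr (by omega) hq' hs'] at hy
    rw [hasInvariants_iff hμ htr (by omega) (hq.mul hq') (hs.mul hs'), hx, hy,
      isAdmissible_one.idx_mul hμ hq hs hq' hs' (by omega), hg.idx_mul hμ hq hs hq' hs' (by omega)]
    rfl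

theorem classifies_gnvw (hμ : IsRep μ) (hχ : (μ gen).trace = 0) :
    Classifies μ (fun _ _ ξ U (x : ℝ) => HasGNVWIndex ξ U x) (solutionsGNVW (Fintype.card ι) 0) := by
  have key : ∀ {ℓ : ℕ} [NeZero ℓ] {ξ : ℕ} {U : Op (ZMod ℓ → ι)} (hq : IsQCA ξ U) (y : ℝ),
      8 * ξ ≤ ℓ → (HasGNVWIndex ξ U y ↔ y = idx 1 ξ (ev U hq.unitary)) :=
    fun hq _ h8 => hasGNVWIndex_iff hq.unitary hq.spreads h8
  refine ⟨fun ξ ℓ _ h8 U hq hs => ?_, fun x hx => ?_, fun ξ r => ⟨12 * (ξ + 2 * r) + 1, ?_⟩,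
    fun ξ => ⟨4 * (2 * ξ + 1), 1, 24 * (ξ + 1), ?_⟩, ?_⟩
  · exact ⟨_, idx_mem_solutionsGNVW hq.spreads (by omega) hμ.sq hμ.star
      ((isSymmetric_iff hμ hq.unitary).1 hs) hχ, fun y => key hq y h8⟩
  · obtain ⟨ξ, hξ⟩ := exists_realization hμ (by rw [hχ, Int.cast_zero]) hx.1 one_pos hx.2
    refine ⟨ξ, fun ℓ _ h8 => ?_⟩
    obtain ⟨U, hq, hs, h1, -⟩ := hξ ℓ h8
    exact ⟨U, hq, hs, (key hq x h8).2 h1.symm⟩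
  · intro ℓ _ hℓ k U U' hq hs hq' hs' h x
    rw [key hq x (by omega), key hq' x (by omega), h.idx_eq hμ isAdmissible_one hq hs hq' hs' hℓ]
  · rintro ℓ _ hℓ U U' hq hs hq' hs' ⟨x, h1, h2⟩
    rw [key hq x (by omega)] at h1
    rw [key hq' x (by omega), h1] at h2
    refine stronglyEquivalent_of_idx_eq hμ hq hs hq' hs' hℓ fun m hm => ?_
    rcases hm with ⟨rfl | rfl, h⟩
    · exact h2
    · exact absurd hχ h
  · intro ξ ℓ _ h16 U V hq hs hq' hs' x y hx hy
    have hℓ := NeZero.pos ℓ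
    refine ⟨hq.mul hq', hs.mul hs', ?_⟩
    rw [key hq x (by omega)] at hx
    rw [key hq' y (by omega)] at hy
    rw [key (hq.mul hq') _ (by omega), hx, hy,
      isAdmissible_one.idx_mul hμ hq hs hq' hs' (by omega)]

end Classification

end SymQCA

end

theorem mainTheorem3 (d : ℕ) (hd : 0 < d)
    (μ : SymQCA.Z2 →* Matrix.unitaryGroup (Fin d) ℂ) (χ : ℤ)
    (hχ : (μ SymQCA.gen : Matrix (Fin d) (Fin d) ℂ).trace = (χ : ℂ)) :
    (χ ≠ 0 →
      SymQCA.Classifies (fun g => (μ g : Matrix (Fin d) (Fin d) ℂ))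
        (fun ℓ _ ξ U (x : ℝ × ℝ) => SymQCA.HasGNVWIndex ξ U x.1 ∧
          SymQCA.HasSPI (fun g => (μ g : Matrix (Fin d) (Fin d) ℂ)) ξ U x.1 x.2)
        (SymQCA.solutions d χ) ∧
      (χ.natAbs < d → SymQCA.IsFreeAbelianOfRank (SymQCA.solutions d χ)
        (d.primeFactors.card + χ.natAbs.primeFactors.card)) ∧
      (χ.natAbs = d → (∀ x ∈ SymQCA.solutions d χ, x.2 = x.1) ∧
        SymQCA.IsFreeAbelianOfRank (SymQCA.solutions d χ) d.primeFactors.card)) ∧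
    (χ = 0 →
      SymQCA.Classifies (fun g => (μ g : Matrix (Fin d) (Fin d) ℂ))
        (fun ℓ _ ξ U (x : ℝ) => SymQCA.HasGNVWIndex ξ U x)
        (SymQCA.solutionsGNVW d χ) ∧
      SymQCA.IsFreeAbelianOfRank (SymQCA.solutionsGNVW d χ) d.primeFactors.card) := by
  have : Nonempty (Fin d) := ⟨⟨0, hd⟩⟩
  have hμ := SymQCA.isRep_coe μ
  -- The multiplicities a and b of the eigenvalues of μ₁ give d = a + b and χ = a - b. In particular
  -- d and χ have the same parity, and d is even if χ = 0.
  obtain ⟨a, b, hab, htr⟩ := SymQCA.exists_signature_rep hμ.sq hμ.star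
  rw [Fintype.card_fin] at hab
  have hχab : χ = a - b := by
    rw [hχ] at htr
    exact_mod_cast htr
  refine ⟨fun h0 => ⟨?_, SymQCA.isFreeAbelianOfRank_solutions hab hχab h0, fun h =>
    ⟨fun x hx => SymQCA.snd_eq_fst_of_mem_solutions h0 h hx,
      SymQCA.isFreeAbelianOfRank_solutions_of_natAbs_eq h0 h⟩⟩, ?_⟩
  · have h := SymQCA.classifies_pair hμ hχ h0
    rwa [Fintype.card_fin] at h
  · rintro rfl
    have h := SymQCA.classifies_gnvw hμ (by rw [hχ, Int.cast_zero])
    rw [Fintype.card_fin] at h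
    exact ⟨h, SymQCA.isFreeAbelianOfRank_solutionsGNVW (a := a) (by omega) hd.ne'⟩
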